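/- **Setting.** Let $V$ be a smooth manifold of dimension $2n$ with a smooth pseudo-Riemannian metric $\mathbf g$ (of any signature) given in Lagrange–Finsler variables. This means that $V$ carries a splitting $TV=hV\oplus vV$ and an almost complex structure $\mathbf J$, and that around each point there are coordinates $u=(x^i,y^{a})$, $i=1,\dots,n$, $a=n+i$, and a smooth real function $\mathcal L(x,y)$ with $\det(h_{ij})\neq0$, where $h_{ij}=\frac12\frac{\partial^2\mathcal L}{\partial y^i\partial y^j}$ and $y^i=y^{n+i}$, with the following property. Put (identifying an index $a=n+i$ with $i$ where needed, and $(h^{ab})$ being the inverse of $(h_{ij})$) $$G^a=\tfrac14h^{ab}\Big(\frac{\partial^2\mathcal L}{\partial y^b\partial x^k}y^k-\frac{\partial\mathcal L}{\partial x^b}\Big),\quad N^a_i=\frac{\partial G^a}{\partial y^i},\quad e^i=dx^i,\ e^{a}=dy^a+N^a_idx^i,\quad e_i=\frac{\partial}{\partial x^i}-N_i^a\frac{\partial}{\partial y^a},\ e_a=\frac{\partial}{\partial y^a}.$$ Then $\mathbf g=h_{ij}\,e^i\otimes e^j+h_{ij}\,e^{n+i}\otimes e^{n+j}$, $hV=\mathrm{span}(e_i)$,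 $vV=\mathrm{span}(e_a)$, $\mathbf J e_i=-e_{n+i}$ and $\mathbf Je_{n+i}=e_i$. Greek indices run over all $2n$ values. Let $\theta(X,Y)=\mathbf g(\mathbf JX,Y)$, $\theta^{\alpha\beta}=g^{\alpha\mu}g^{\beta\nu}\theta_{\mu\nu}$, $\Lambda^{\alpha\beta}=\theta^{\alpha\beta}-i\,g^{\alpha\beta}$. The normal d-connection $\widehat{\mathbf D}$, with $\widehat{\mathbf D}_{e_\alpha}e_\beta=\Gamma^\tau_{\beta\alpha}e_\tau$, has the coefficients $\Gamma^i_{jk}=\Gamma^{n+i}_{n+j\,k}=\frac12h^{im}(e_kh_{jm}+e_jh_{mk}-e_mh_{jk})$ and $\Gamma^i_{j\,n+k}=\Gamma^{n+i}_{n+j\,n+k}=\frac12h^{im}\big(\frac{\partial h_{jm}}{\partial y^k}+\frac{\partial h_{mk}}{\partial y^j}-\frac{\partial h_{jk}}{\partial y^m}\big)$, all others being zero. Its torsion $T(X,Y)=\widehat{\mathbf D}_XY-\widehat{\mathbf D}_YX-[X,Y]$ and curvature $R(X,Y)=[\widehat{\mathbf D}_X,\widehat{\mathbf D}_Y]-\widehat{\mathbf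 D}_{[X,Y]}$ have components defined by $T(e_\beta,e_\alpha)=T^\tau_{\alpha\beta}e_\tau$, $R(e_\beta,e_\alpha)e_\varphi=R^\tau_{\varphi\alpha\beta}e_\tau$. Let $\mathcal W\otimes\Lambda$ be the sheaf of smooth sections $a=\sum a_{r,m,S}(u)\,v^r z^m e^S$ ($r\ge0$, $m$ a multi-index, $S$ a set of indices, complex coefficients), formal series in $v$ and in the fibre coordinates $z^\alpha$ of $TV$ with values in differential forms. It has the gradings $\deg_s(z^\alpha)=1$, $\deg_v(v)=1$, $\deg_a(e^\alpha)=1$, $Deg=2\deg_v+\deg_s$, and the product $$a\circ b=\exp\Big(\tfrac{iv}2\Lambda^{\alpha\beta}\frac{\partial^2}{\partial z^\alpha\partial z_1^\beta}\Big)a(z)\,b(z_1)\Big|_{z_1=z}$$ combined with the exterior product; $\mathrm{ad}_{Wick}(a)$ is the $\deg_a$-graded commutator with $a$ for $\circ$. Graded commutators, and $r\circ r$ for $\deg_a r=1$, are divisible by $v$. Put $\check\delta a=e^\alpha\wedge\frac{\partial a}{\partial z^\alpha}$; $\check\delta^{-1}a=\frac1{p+q}z^\alpha\,\iota_{e_\alpha}a$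 if $\deg_sa=p$, $\deg_aa=q$, $p+q>0$, and $\check\delta^{-1}a=0$ if $p=q=0$; and $$\widehat{\mathbf D}(a\otimes\lambda)=\Big(e_\alpha(a)-z^\beta\Gamma^\gamma_{\beta\alpha}\frac{\partial a}{\partial z^\gamma}\Big)\otimes(e^\alpha\wedge\lambda)+a\otimes d\lambda,$$ $$\widehat{\mathcal T}=\tfrac12z^\gamma\theta_{\gamma\tau}T^\tau_{\alpha\beta}\,e^\alpha\wedge e^\beta,\qquad \widehat{\mathcal R}=\tfrac14z^\gamma z^\varphi\theta_{\gamma\tau}R^\tau_{\varphi\alpha\beta}\,e^\alpha\wedge e^\beta .$$ Write $a^{(k)}$ for the $Deg$-homogeneous component of $a$ of degree $k$. **Theorem.** There is a unique global smooth section $r$ of $\mathcal W\otimes\Lambda$ with $\deg_a r=1$, $\check\delta^{-1}r=0$, $r^{(0)}=r^{(1)}=0$ and $$\check\delta r=\widehat{\mathcal T}+\widehat{\mathcal R}+\widehat{\mathbf D}r-\frac iv\,r\circ r .$$ It is given recursively by $r^{(0)}=r^{(1)}=0$, $r^{(2)}=\check\delta^{-1}\widehat{\mathcal T}$, $r^{(3)}=\check\delta^{-1}\big(\widehat{\mathcal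 R}+\widehat{\mathbf D}r^{(2)}-\frac iv r^{(2)}\circ r^{(2)}\big)$ and, for $k\ge1$, $$r^{(k+3)}=\check\delta^{-1}\Big(\widehat{\mathbf D}r^{(k+2)}-\frac iv\sum_{l=0}^kr^{(l+2)}\circ r^{(k-l+2)}\Big).$$ The operator $\widehat{\mathcal D}=-\check\delta+\widehat{\mathbf D}-\frac iv\,\mathrm{ad}_{Wick}(r)$ maps global smooth sections of $\mathcal W\otimes\Lambda$ to global smooth sections and is flat: $\widehat{\mathcal D}^2=0$ on smooth sections over every open subset of each of the above coordinate domains. -/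

import Mathlib

open scoped ContDiff Manifold Matrix

noncomputable section

namespace LagrangeFedosov

/-! ### Local coordinates, generating function and canonical Lagrange geometry

`Sum.inl i` is the horizontal index `i`, `Sum.inr i` is the vertical index `n + i`; a point of
`Coord n` is `u = (x, y)` with `x i = u (Sum.inl i)` and `y i = u (Sum.inr i)`. -/

abbrev Idx (n : ℕ) : Type := Fin n ⊕ Fin n

abbrev Coord (n : ℕ) : Type := Idx n → ℝ

/-- The coordinate derivative `∂f/∂u^α`. -/
def pd {n : ℕ} {F : Type*} [NormedAddCommGroup F] [NormedSpace ℝ F]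
    (α : Idx n) (f : Coord n → F) (u : Coord n) : F :=
  fderiv ℝ f u (Pi.single α 1)

/-- `h_ij = (1/2) ∂²L/∂y^i∂y^j`. -/
def hess {n : ℕ} (L : Coord n → ℝ) (u : Coord n) : Matrix (Fin n) (Fin n) ℝ :=
  Matrix.of fun i j => (1 / 2) * pd (Sum.inr i) (pd (Sum.inr j) L) u

/-- The semispray coefficients,
`2 G^a = (1/2) h^{ab} (∂²L/∂y^b∂x^k y^k - ∂L/∂x^b)`. -/
def spray {n : ℕ} (L : Coord n → ℝ) (a : Fin n) (u : Coord n) : ℝ :=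
  (1 / 4) * ∑ b, (hess L u)⁻¹ a b *
    ((∑ k, pd (Sum.inr b) (pd (Sum.inl k) L) u * u (Sum.inr k)) - pd (Sum.inl b) L u)

/-- The canonical N-connection `N^a_i = ∂G^a/∂y^i`. -/
def ncon {n : ℕ} (L : Coord n → ℝ) (a i : Fin n) (u : Coord n) : ℝ :=
  pd (Sum.inr i) (spray L a) u

/-- The N-adapted frame `e_i = ∂/∂x^i - N^a_i ∂/∂y^a`, `e_a = ∂/∂y^a`. -/
def frame {n : ℕ} (L : Coord n → ℝ) : Idx n → Coord n → Coord n
  | Sum.inl i => fun u => Pi.single (Sum.inl i) 1 - ∑ a, ncon L a i u • Pi.single (Sum.inr a) 1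
  | Sum.inr a => fun _ => Pi.single (Sum.inr a) 1

/-- The dual coframe `e^i = dx^i`, `e^a = dy^a + N^a_i dx^i` at `u`, evaluated on `w`. -/
def coframe {n : ℕ} (L : Coord n → ℝ) (u w : Coord n) : Idx n → ℝ
  | Sum.inl i => w (Sum.inl i)
  | Sum.inr a => w (Sum.inr a) + ∑ i, ncon L a i u * w (Sum.inl i)

/-- The action `e_α(f)` of a frame vector on a function. -/
def fd {n : ℕ} {F : Type*} [NormedAddCommGroup F] [NormedSpace ℝ F]
    (L : Coord n → ℝ) (α : Idx n) (f : Coord n → F) (u : Coord n) : F :=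
  fderiv ℝ f u (frame L α u)

/-- Anholonomy coefficients: `[e_α, e_β] = W^τ_{αβ} e_τ`. -/
def anhol {n : ℕ} (L : Coord n → ℝ) (τ α β : Idx n) (u : Coord n) : ℝ :=
  coframe L u (VectorField.lieBracket ℝ (frame L α) (frame L β) u) τ

/-- The metric in the N-adapted frame, `g = h_ij e^i ⊗ e^j + h_ab e^a ⊗ e^b`. -/
def gMat {n : ℕ} (L : Coord n → ℝ) (u : Coord n) : Matrix (Idx n) (Idx n) ℝ :=
  Matrix.fromBlocks (hess L u) 0 0 (hess L u)

/-- The matrix `J^γ_α` (row `γ`, column `α`) of `J(e_i) = -e_{n+i}`, `J(e_{n+i}) = e_i`. -/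
def jMat (n : ℕ) : Matrix (Idx n) (Idx n) ℝ :=
  Matrix.fromBlocks 0 1 (-1) 0

/-- `θ(X, Y) = g(JX, Y)`, that is `θ_{αβ} = J^γ_α g_{γβ}`. -/
def thetaLow {n : ℕ} (L : Coord n → ℝ) (u : Coord n) : Matrix (Idx n) (Idx n) ℝ :=
  (jMat n)ᵀ * gMat L u

/-- `θ^{αβ} = g^{αμ} g^{βν} θ_{μν}`. -/
def thetaUp {n : ℕ} (L : Coord n → ℝ) (u : Coord n) : Matrix (Idx n) (Idx n) ℝ :=
  (gMat L u)⁻¹ * thetaLow L u * ((gMat L u)⁻¹)ᵀ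

/-- `Λ^{αβ} = θ^{αβ} - i g^{αβ}`. -/
def lam {n : ℕ} (L : Coord n → ℝ) (u : Coord n) : Matrix (Idx n) (Idx n) ℂ :=
  Matrix.of fun α β => (thetaUp L u α β : ℂ) - Complex.I * ((gMat L u)⁻¹ α β : ℂ)

/-- `L^i_{jk}`, horizontal coefficients of the normal d-connection. -/
def lhat {n : ℕ} (L : Coord n → ℝ) (i j k : Fin n) (u : Coord n) : ℝ :=
  (1 / 2) * ∑ m, (hess L u)⁻¹ i m *
    (fd L (Sum.inl k) (fun w => hess L w j m) u + fd L (Sum.inl j) (fun w => hess L w m k) u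
      - fd L (Sum.inl m) (fun w => hess L w j k) u)

/-- `C^i_{jk}`, vertical coefficients of the normal d-connection. -/
def chat {n : ℕ} (L : Coord n → ℝ) (i j k : Fin n) (u : Coord n) : ℝ :=
  (1 / 2) * ∑ m, (hess L u)⁻¹ i m *
    (fd L (Sum.inr k) (fun w => hess L w j m) u + fd L (Sum.inr j) (fun w => hess L w m k) u
      - fd L (Sum.inr m) (fun w => hess L w j k) u)

/-- The normal d-connection: `D_{e_α} e_β = Γ^τ_{βα} e_τ`, with the arguments in the order
`τ β α`, so that the last index is the direction of differentiation. -/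
def gam {n : ℕ} (L : Coord n → ℝ) : Idx n → Idx n → Idx n → Coord n → ℝ
  | Sum.inl i, Sum.inl j, Sum.inl k => lhat L i j k
  | Sum.inr i, Sum.inr j, Sum.inl k => lhat L i j k
  | Sum.inl i, Sum.inl j, Sum.inr k => chat L i j k
  | Sum.inr i, Sum.inr j, Sum.inr k => chat L i j k
  | Sum.inl _, Sum.inr _, _ => fun _ => 0
  | Sum.inr _, Sum.inl _, _ => fun _ => 0

/-- Torsion `T(X, Y) = D_X Y - D_Y X - [X, Y]`, with `T(e_β, e_α) = T^τ_{αβ} e_τ`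
(arguments in the order `τ α β`). -/
def tors {n : ℕ} (L : Coord n → ℝ) (τ α β : Idx n) (u : Coord n) : ℝ :=
  gam L τ α β u - gam L τ β α u - anhol L τ β α u

/-- Curvature `R(X, Y) Z = D_X D_Y Z - D_Y D_X Z - D_{[X, Y]} Z`, with
`R(e_β, e_α) e_φ = R^τ_{φαβ} e_τ` (arguments in the order `τ φ α β`). -/
def curv {n : ℕ} (L : Coord n → ℝ) (τ φ α β : Idx n) (u : Coord n) : ℝ :=
  fd L β (gam L τ φ α) u - fd L α (gam L τ φ β) u
    + ∑ μ, (gam L μ φ α u * gam L τ μ β u - gam L μ φ β u * gam L τ μ α u)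
    - ∑ μ, anhol L μ β α u * gam L τ φ μ u

/-! ### The fibre of `W ⊗ Λ`

In a fixed coframe an element of the fibre is a formal series
`∑ a_{r,m,S} v^r z^m e^S`, where `e^S` is the exterior product of the `e^α`, `α ∈ S`, in
increasing order (horizontal indices first); it is given by its coefficients. -/

abbrev Fiber (n : ℕ) : Type := ℕ → (Idx n →₀ ℕ) → Finset (Idx n) → ℂ

/-- A (local) section in a fixed coframe. -/
abbrev LocSec (n : ℕ) : Type := Coord n → Fiber n

/-- `e^S ∧ e^T = wsign S T • e^(S ∪ T)` for disjoint `S` and `T`. -/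
def wsign {n : ℕ} (S T : Finset (Idx n)) : ℂ :=
  (-1) ^ ((S ×ˢ T).filter fun q => finSumFinEquiv q.2 < finSumFinEquiv q.1).card

/-- The unit `1`. -/
def wOne (n : ℕ) : Fiber n := fun r m S => if r = 0 ∧ m = 0 ∧ S = ∅ then 1 else 0

/-- The undeformed product: commutative product of series times exterior product of forms. -/
def wMul {n : ℕ} (a b : Fiber n) : Fiber n := fun r m S =>
  ∑ x ∈ Finset.HasAntidiagonal.antidiagonal r, ∑ y ∈ Finset.HasAntidiagonal.antidiagonal m, ∑ T ∈ S.powerset,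
    wsign T (S \ T) * (a x.1 y.1 T * b x.2 y.2 (S \ T))

/-- Exterior multiplication `a ↦ e^α ∧ a`. -/
def extMul {n : ℕ} (α : Idx n) (a : Fiber n) : Fiber n := fun r m S =>
  if α ∈ S then wsign {α} (S.erase α) * a r m (S.erase α) else 0

/-- Interior product of `a` with the frame vector `e_α`. -/
def intProd {n : ℕ} (α : Idx n) (a : Fiber n) : Fiber n := fun r m S =>
  if α ∈ S then 0 else wsign {α} S * a r m (insert α S)

/-- Multiplication by `z^α`. -/
def zmul {n : ℕ} (α : Idx n) (a : Fiber n) : Fiber n := fun r m S =>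
  if m α = 0 then 0 else a r (m - Finsupp.single α 1) S

/-- The derivative `∂/∂z^α`. -/
def zd {n : ℕ} (α : Idx n) (a : Fiber n) : Fiber n := fun r m S =>
  ((m α : ℂ) + 1) * a r (m + Finsupp.single α 1) S

/-- The operator `δ(a) = e^α ∧ ∂a/∂z^α`. -/
def delta {n : ℕ} (a : Fiber n) : Fiber n := ∑ α, extMul α (zd α a)

/-- The operator `δ⁻¹`, equal to `(p + q)⁻¹ z^α i(e_α)` on elements with `deg_s = p` and
`deg_a = q`, `p + q > 0`, and to zero for `p = q = 0`.  The operator `z^α i(e_α)` preserves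
`deg_s + deg_a`, so that `p + q` may be read off from the coefficient of the result. -/
def deltaInv {n : ℕ} (a : Fiber n) : Fiber n := fun r m S =>
  if m.degree + S.card = 0 then 0
  else (∑ α, zmul α (intProd α a)) r m S / ((m.degree + S.card : ℕ) : ℂ)

/-- `(Λ^{αβ} ∂/∂z^α ⊗ ∂/∂z^β)^k` applied to `a ⊗ b`, followed by multiplication. -/
def wickTerm {n : ℕ} (Λ : Matrix (Idx n) (Idx n) ℂ) : ℕ → Fiber n → Fiber n → Fiber n
  | 0, a, b => wMul a b
  | k + 1, a, b => ∑ α, ∑ β, Λ α β • wickTerm Λ k (zd α a) (zd β b)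

/-- The formal Wick product
`a ∘ b = exp ((i v / 2) Λ^{αβ} ∂²/∂z^α∂z₁^β) a(z) b(z₁)` at `z₁ = z`. -/
def wick {n : ℕ} (Λ : Matrix (Idx n) (Idx n) ℂ) (a b : Fiber n) : Fiber n := fun r m S =>
  ∑ k ∈ Finset.range (r + 1),
    (Complex.I / 2) ^ k / (k.factorial : ℂ) * wickTerm Λ k a b (r - k) m S

/-- The part of `a` of antisymmetric degree `deg_a = q`. -/
def degA {n : ℕ} (q : ℕ) (a : Fiber n) : Fiber n := fun r m S =>
  if S.card = q then a r m S else 0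

/-- The part of `a` of total degree `Deg = 2 deg_v + deg_s = k`. -/
def degTot {n : ℕ} (k : ℕ) (a : Fiber n) : Fiber n := fun r m S =>
  if 2 * r + m.degree = k then a r m S else 0

/-- `ad_Wick(a)(b)`, the `deg_a`-graded commutator of `a` and `b` for the Wick product. -/
def adWick {n : ℕ} (Λ : Matrix (Idx n) (Idx n) ℂ) (a b : Fiber n) : Fiber n :=
  ∑ p ∈ Finset.range (2 * n + 1), ∑ q ∈ Finset.range (2 * n + 1),
    (wick Λ (degA p a) (degA q b) - (-1 : ℂ) ^ (p * q) • wick Λ (degA q b) (degA p a))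

/-- Division by `v` of a series without constant term in `v`. -/
def vdiv {n : ℕ} (a : Fiber n) : Fiber n := fun r m S => a (r + 1) m S

theorem wsign_swap {n : ℕ} (S T : Finset (Idx n)) (h : Disjoint S T) :
    wsign S T = (-1) ^ (S.card * T.card) * wsign T S := by
  unfold wsign
  set c1 := ((S ×ˢ T).filter fun q => finSumFinEquiv q.2 < finSumFinEquiv q.1).card with h1
  set c2 := ((T ×ˢ S).filter fun q => finSumFinEquiv q.2 < finSumFinEquiv q.1).card with h2
  have h3 : ((S ×ˢ T).filter fun q => ¬ finSumFinEquiv q.2 < finSumFinEquiv q.1).card = c2 := by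
    rw [h2]
    apply Finset.card_bij (fun q _ => (q.2, q.1))
    · rintro ⟨s, t⟩ hq
      simp only [Finset.mem_filter, Finset.mem_product, not_lt] at hq ⊢
      refine ⟨⟨hq.1.2, hq.1.1⟩, lt_of_le_of_ne hq.2 fun heq => ?_⟩
      have hst : s = t := finSumFinEquiv.injective heq
      subst hst
      exact (Finset.disjoint_left.mp h) hq.1.1 hq.1.2
    · rintro ⟨s, t⟩ _ ⟨s', t'⟩ _ heq
      simp only [Prod.mk.injEq] at heq ⊢
      exact ⟨heq.2, heq.1⟩
    · rintro ⟨t, s⟩ hq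
      simp only [Finset.mem_filter, Finset.mem_product] at hq
      refine ⟨(s, t), ?_, rfl⟩
      simp only [Finset.mem_filter, Finset.mem_product, not_lt]
      exact ⟨⟨hq.1.2, hq.1.1⟩, hq.2.le⟩
  have h4 : S.card * T.card = c1 + c2 := by
    rw [← Finset.card_product, ← h3, h1, Finset.card_filter_add_card_filter_not]
  rw [h4, pow_add, mul_assoc, ← pow_add, ← two_mul, pow_mul]
  simp

theorem wMul_swap {n : ℕ} (p q : ℕ) (a b : Fiber n) :
    wMul (degA p a) (degA q b) = (-1 : ℂ) ^ (p * q) • wMul (degA q b) (degA p a) := by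
  funext r m S
  simp only [wMul, Pi.smul_apply, smul_eq_mul, Finset.mul_sum]
  rw [← Finset.Nat.sum_antidiagonal_swap]
  refine Finset.sum_congr rfl fun x _ => ?_
  refine Finset.sum_equiv (Equiv.prodComm _ _) (fun y => by simp [add_comm]) fun y _ => ?_
  refine Finset.sum_bij (fun T _ => S \ T) ?_ ?_ ?_ ?_
  · intro T _
    simp
  · intro T hT T' hT' heq
    rw [Finset.mem_powerset] at hT hT'
    rw [← Finset.sdiff_sdiff_eq_self hT, heq, Finset.sdiff_sdiff_eq_self hT']
  · intro T hT
    rw [Finset.mem_powerset] at hT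
    exact ⟨S \ T, by simp, Finset.sdiff_sdiff_eq_self hT⟩
  · intro T hT
    rw [Finset.mem_powerset] at hT
    rw [Finset.sdiff_sdiff_eq_self hT]
    simp only [degA, Prod.fst_swap, Prod.snd_swap, Equiv.prodComm_apply]
    by_cases hp : T.card = p
    · by_cases hq : (S \ T).card = q
      · rw [if_pos hp, if_pos hq, wsign_swap _ _ Finset.disjoint_sdiff, hp, hq]
        ring
      · simp [hq]
    · simp [hp]

theorem wick_zero {n : ℕ} (Λ : Matrix (Idx n) (Idx n) ℂ) (a b : Fiber n) :
    wick Λ a b 0 = wMul a b 0 := by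
  funext m S
  simp [wick, wickTerm]

/-- Graded commutators are divisible by `v`, so that `v⁻¹ ad_Wick(a)` takes values in series
without negative powers of `v`. -/
theorem adWick_zero {n : ℕ} (Λ : Matrix (Idx n) (Idx n) ℂ) (a b : Fiber n) :
    adWick Λ a b 0 = 0 := by
  simp only [adWick, Finset.sum_apply]
  refine Finset.sum_eq_zero fun p _ => Finset.sum_eq_zero fun q _ => ?_
  rw [Pi.sub_apply, Pi.smul_apply, wick_zero, wick_zero, wMul_swap p q, Pi.smul_apply, sub_self]

/-- The Wick square of an element with `deg_a = 1` is divisible by `v`. -/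
theorem wick_self_zero {n : ℕ} (Λ : Matrix (Idx n) (Idx n) ℂ) (a : Fiber n)
    (h : degA 1 a = a) : wick Λ a a 0 = 0 := by
  have h1 := congrFun (wMul_swap 1 1 a a) 0
  rw [h, Pi.smul_apply] at h1
  rw [wick_zero]
  funext m S
  have h2 := congrFun (congrFun h1 m) S
  simp only [Pi.smul_apply, smul_eq_mul, mul_one, pow_one] at h2
  rw [Pi.zero_apply, Pi.zero_apply]
  linear_combination h2 / 2

/-! ### Differential operators on local sections -/

/-- The extension of the normal d-connection to `W ⊗ Λ`,
`D (a ⊗ λ) = (e_α(a) - z^β Γ^γ_{βα} ∂a/∂z^γ) ⊗ (e^α ∧ λ) + a ⊗ dλ`, where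
`d` on the coframe is `d e^τ = -(1/2) W^τ_{αβ} e^α ∧ e^β`, that is,
`a ⊗ dλ = -(1/2) W^τ_{αβ} e^α ∧ e^β ∧ i(e_τ)(a ⊗ λ)` for `λ = e^S`. -/
def dConn {n : ℕ} (L : Coord n → ℝ) (a : LocSec n) : LocSec n := fun u =>
  (∑ α, extMul α ((fun r m S => fd L α (fun w => a w r m S) u)
      - ∑ β, ∑ γ, (gam L γ β α u : ℂ) • zmul β (zd γ (a u))))
    - (1 / 2 : ℂ) • ∑ τ, ∑ α, ∑ β, (anhol L τ α β u : ℂ) • extMul α (extMul β (intProd τ (a u)))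

/-- The torsion element `(1/2) z^γ θ_{γτ} T^τ_{αβ} e^α ∧ e^β`. -/
def torsElt {n : ℕ} (L : Coord n → ℝ) : LocSec n := fun u =>
  ∑ γ, ∑ τ, ∑ α, ∑ β, ((1 / 2 * thetaLow L u γ τ * tors L τ α β u : ℝ) : ℂ) •
    zmul γ (extMul α (extMul β (wOne n)))

/-- The curvature element `(1/4) z^γ z^φ θ_{γτ} R^τ_{φαβ} e^α ∧ e^β`. -/
def curvElt {n : ℕ} (L : Coord n → ℝ) : LocSec n := fun u =>
  ∑ γ, ∑ φ, ∑ τ, ∑ α, ∑ β, ((1 / 4 * thetaLow L u γ τ * curv L τ φ α β u : ℝ) : ℂ) •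
    zmul γ (zmul φ (extMul α (extMul β (wOne n))))

/-- The operator `-δ + D - (i/v) ad_Wick(r)`. -/
def fedosovD {n : ℕ} (L : Coord n → ℝ) (r a : LocSec n) : LocSec n := fun u =>
  -delta (a u) + dConn L a u - Complex.I • vdiv (adWick (lam L u) (r u) (a u))

/-- Smoothness of a local section: all its coefficients are smooth. -/
def SmoothOn {n : ℕ} (a : LocSec n) (U : Set (Coord n)) : Prop :=
  ∀ r m S, ContDiffOn ℝ ∞ (fun u => a u r m S) U

/-! ### Change of coframe -/

/-- The `k`-th element of `S`, in increasing order. -/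
def nth {n : ℕ} (S : Finset (Idx n)) (k : Fin S.card) : Idx n :=
  finSumFinEquiv.symm
    ((S.map finSumFinEquiv.toEmbedding).orderEmbOfFin (Finset.card_map _) k)

/-- The minor of `A` with rows `S` and columns `T`: the coefficient of `e^T` in the exterior
product of the forms `A^α_β e^β`, `α ∈ S`. -/
def minor {n : ℕ} (A : Matrix (Idx n) (Idx n) ℝ) (S T : Finset (Idx n)) : ℝ :=
  if h : S.card = T.card then
    (A.submatrix (nth S) fun k : Fin S.card => nth T (Fin.cast h k)).det
  else 0

/-- The linear substitution `z^α ↦ A^α_β z^β`, `e^α ↦ A^α_β e^β` in a series. -/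
def pull {n : ℕ} (A : Matrix (Idx n) (Idx n) ℝ) (b : Fiber n) : Fiber n := fun r m S =>
  ∑ m' ∈ Finset.finsuppAntidiag (Finset.univ : Finset (Idx n)) m.degree,
    ∑ S' : Finset (Idx n),
      ((MvPolynomial.coeff m
          (∏ α, (∑ β, MvPolynomial.C (A α β) * MvPolynomial.X β) ^ m' α) *
        minor A S' S : ℝ) : ℂ) * b r m' S'

/-! ### Pseudo-Riemannian metrics in Lagrange-Finsler variables -/

/-- A smooth pseudo-Riemannian metric, of any signature, on a manifold of dimension `2n`. -/
structure PseudoRiemMetric (n : ℕ) (V : Type*) [TopologicalSpace V] [ChartedSpace (Coord n) V] where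
  val : ∀ p : V, TangentSpace 𝓘(ℝ, Coord n) p →ₗ[ℝ] TangentSpace 𝓘(ℝ, Coord n) p →ₗ[ℝ] ℝ
  symm : ∀ p X Y, val p X Y = val p Y X
  nondegenerate : ∀ p X, (∀ Y, val p X Y = 0) → X = 0
  /-- `g = g_{αβ} du^α ⊗ du^β` with smooth `g_{αβ}` in every chart. -/
  smooth : ∀ e ∈ atlas (Coord n) V, ∃ c : Idx n → Idx n → Coord n → ℝ,
    (∀ α β, ContDiffOn ℝ ∞ (c α β) e.target) ∧
    ∀ p ∈ e.source, ∀ X Y : TangentSpace 𝓘(ℝ, Coord n) p,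
      val p X Y = ∑ α, ∑ β, c α β (e p) *
        ((mfderiv 𝓘(ℝ, Coord n) 𝓘(ℝ, Coord n) e p X : Coord n) α *
          (mfderiv 𝓘(ℝ, Coord n) 𝓘(ℝ, Coord n) e p Y : Coord n) β)

/-- The coframe defined by a chart `e = (x, y)` and a function `L (x, y)`, on `T_p V`. -/
def chartCoframe {n : ℕ} {V : Type*} [TopologicalSpace V] [ChartedSpace (Coord n) V]
    (e : OpenPartialHomeomorph V (Coord n)) (L : Coord n → ℝ) (p : V)
    (X : TangentSpace 𝓘(ℝ, Coord n) p) : Idx n → ℝ :=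
  coframe L (e p) (mfderiv 𝓘(ℝ, Coord n) 𝓘(ℝ, Coord n) e p X)

/-- A representation of the metric `g` in Lagrange-Finsler variables: a Whitney sum
`TV = hV ⊕ vV`, an almost complex structure `J`, and around every point coordinates `(x, y)`
with a regular generating function `L (x, y)` such that, in the coframe
`e^i = dx^i`, `e^{n+i} = dy^i + N^i_j dx^j` of the canonical N-connection of `L`,
* `g = h_ij e^i ⊗ e^j + h_ij e^{n+i} ⊗ e^{n+j}` with `h_ij = (1/2) ∂²L/∂y^i∂y^j`,
* `hV` and `vV` are the kernels of the `e^{n+i}` and of the `e^i`,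
* `J = -e_{n+i} ⊗ e^i + e_i ⊗ e^{n+i}`. -/
structure LagrangeVariables {n : ℕ} {V : Type*} [TopologicalSpace V]
    [ChartedSpace (Coord n) V] [IsManifold 𝓘(ℝ, Coord n) ∞ V] (g : PseudoRiemMetric n V) where
  hor : ∀ p : V, Submodule ℝ (TangentSpace 𝓘(ℝ, Coord n) p)
  ver : ∀ p : V, Submodule ℝ (TangentSpace 𝓘(ℝ, Coord n) p)
  J : ∀ p : V, TangentSpace 𝓘(ℝ, Coord n) p →ₗ[ℝ] TangentSpace 𝓘(ℝ, Coord n) p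
  charts : Set (OpenPartialHomeomorph V (Coord n))
  charts_subset : charts ⊆ IsManifold.maximalAtlas 𝓘(ℝ, Coord n) ∞ V
  cover : ∀ p : V, ∃ e ∈ charts, p ∈ e.source
  /-- The generating function in each of the charts. -/
  L : charts → Coord n → ℝ
  smooth : ∀ e, ContDiffOn ℝ ∞ (L e) e.1.target
  regular : ∀ e, ∀ u ∈ e.1.target, (hess (L e) u).det ≠ 0
  metric_eq : ∀ e, ∀ p ∈ e.1.source, ∀ X Y, g.val p X Y =
    ∑ α, ∑ β, gMat (L e) (e.1 p) α β *
      (chartCoframe e.1 (L e) p X α * chartCoframe e.1 (L e) p Y β)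
  hor_eq : ∀ e, ∀ p ∈ e.1.source, ∀ X,
    X ∈ hor p ↔ ∀ i, chartCoframe e.1 (L e) p X (Sum.inr i) = 0
  ver_eq : ∀ e, ∀ p ∈ e.1.source, ∀ X,
    X ∈ ver p ↔ ∀ i, chartCoframe e.1 (L e) p X (Sum.inl i) = 0
  J_eq : ∀ e, ∀ p ∈ e.1.source, ∀ X,
    chartCoframe e.1 (L e) p (J p X) = jMat n *ᵥ chartCoframe e.1 (L e) p X

namespace LagrangeVariables

variable {n : ℕ} {V : Type*} [TopologicalSpace V] [ChartedSpace (Coord n) V]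
  [IsManifold 𝓘(ℝ, Coord n) ∞ V] {g : PseudoRiemMetric n V}

/-- A global smooth section of `W ⊗ Λ`, given by its components `a e` with respect to the
coframes of all the charts `e` (values outside of the target of `e` are irrelevant): the
components are smooth, and on overlaps they are related by the change of coframe. -/
def IsSection (X : LagrangeVariables g) (a : X.charts → LocSec n) : Prop :=
  (∀ e, SmoothOn (a e) e.1.target) ∧
  ∀ e e' : X.charts, ∀ p ∈ e.1.source ∩ e'.1.source, ∀ A : Matrix (Idx n) (Idx n) ℝ,
    (∀ Y, chartCoframe e'.1 (X.L e') p Y = A *ᵥ chartCoframe e.1 (X.L e) p Y) →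
    a e (e.1 p) = pull A (a e' (e'.1 p))

/-- `r` is a section of `W ⊗ Λ` with `deg_a r = 1`, `δ⁻¹ r = 0` and no components of total
degree `0` and `1`, that solves `δ r = T + R + D r - (i/v) r ∘ r`. -/
def IsFedosovElement (X : LagrangeVariables g) (r : X.charts → LocSec n) : Prop :=
  X.IsSection r ∧ ∀ e : X.charts, ∀ u ∈ e.1.target,
    degA 1 (r e u) = r e u ∧
    deltaInv (r e u) = 0 ∧
    degTot 0 (r e u) = 0 ∧ degTot 1 (r e u) = 0 ∧
    delta (r e u) = torsElt (X.L e) u + curvElt (X.L e) u + dConn (X.L e) (r e) u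
      - Complex.I • vdiv (wick (lam (X.L e) u) (r e u) (r e u))

end LagrangeVariables

end LagrangeFedosov

end

open LagrangeFedosov

/-!
Fedosov's argument is purely algebraic once the ring of functions and its frame of derivations are
given, and it is carried out here over an arbitrary commutative `ℂ`-algebra `C` of coefficients
(`Fib n C` is the fibre of `W ⊗ Λ` over `C`, `FedosovData n C` collects the frame, the connection,
the Wick tensor `Λ` and the two-form `θ`).

The facts about the fibre are: the Wick product is associative (`Fib.star_assoc`), because the
three operators `Λ^{αβ} ∂_α ⊗ ∂_β` on pairs of factors commute; `δ` is an odd derivation of square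
zero, and `δ δ⁻¹ + δ⁻¹ δ` is the identity away from the elements of bidegree zero
(`Fib.del_delInv`); the total degree is additive for the product (`Fib.deg_star`); and, since the
antisymmetric part of `Λ` is invertible, an element without `z`-constant part that commutes with
all fibre coordinates is zero (`Fib.eq_zero_of_commute`).

The connection `D` is an odd derivation because `Λ` is parallel. Both `δ D + D δ` and `D²` are inner
derivations, given by the torsion and the curvature element (`FedosovData.vMul_del_conn`,
`FedosovData.vMul_conn_conn`). Comparing triple compositions of `δ` and `D`, and using
that the relevant elements have no `z`-constant part, gives the Bianchi identities `D T = δ R` and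
`D R = 0`; and `δ T = 0` because `θ` is closed. The map `r ↦ δ⁻¹ (T + R + D r - (i/v) r ∘ r)`
raises the total degree up to which two elements agree, so it has exactly one fixed point `sol`.
Every solution of Fedosov's equation is a fixed point, which gives uniqueness and the recursion.
Conversely the defect `Ω` of the fixed point satisfies `δ⁻¹ Ω = 0` and, by the Bianchi
identities, a homogeneous equation; the Hodge identity and induction on the degree give `Ω = 0`
(`FedosovData.del_sol`). Flatness (`FedosovData.fed_fed`) follows from the equation for `r`.

A regular generating function `ℓ` provides such data (`LagrangeData.fedosov`). The form `θ` is the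
exterior derivative of `p_i dx^i` with `p_i = (1/2) ∂ℓ/∂y^i`; the one identity that is not formal is
the symmetry of `e_k p_i` (`LagrangeData.X_p_symm`), which encodes the choice of the semispray.
The normal d-connection preserves `h_ij`, hence `Λ` (`LagrangeData.K_parallel`).

For the global statement, a transition map respects the metric, the splitting and the complex
structure, so its matrix in the adapted coframes consists of two equal diagonal blocks
(`exists_block`). Such a change of coframe intertwines all the operations (`LagrangeChange`,
`FrameChange`); torsion and curvature elements are preserved because they are
determined by their commutators, and the solution is preserved because it is unique
(`FrameChange.Φ_sol`). Sections in the sense of the statement are compared with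
elements over the rings of smooth functions through the evaluation maps
(`smoothRing.ev`, `Rep`, `RepSec`).
-/

noncomputable section

namespace LagrangeFedosov

set_option linter.unusedSectionVars false

/-! ### The fibre over a commutative ring of coefficients -/

/-- The fibre of `W ⊗ Λ` with coefficients in a commutative ring `C`. For `C = ℂ` this is `Fiber n`;
for `C` a ring of smooth functions its elements are the smooth local sections. -/
abbrev Fib (n : ℕ) (C : Type*) : Type _ := ℕ → (Idx n →₀ ℕ) → Finset (Idx n) → C

/-- The number of inversions when the increasing list of `T` is appended to that of `S`. -/
def inversions {n : ℕ} (S T : Finset (Idx n)) : ℕ :=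
  ((S ×ˢ T).filter fun q => finSumFinEquiv q.2 < finSumFinEquiv q.1).card

/-- The sign `wsign` in a commutative ring `C`. -/
def sgn {n : ℕ} (C : Type*) [CommRing C] (S T : Finset (Idx n)) : C := (-1) ^ inversions S T

section Form

variable {n : ℕ} {C : Type*} [CommRing C]

theorem inversions_union_left {S S' T : Finset (Idx n)} (h : Disjoint S S') :
    inversions (S ∪ S') T = inversions S T + inversions S' T := by
  unfold inversions
  rw [Finset.union_product, Finset.filter_union, Finset.card_union_of_disjoint]
  exact Finset.disjoint_filter_filter (Finset.disjoint_product.2 (Or.inl h))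

theorem inversions_union_right {S T T' : Finset (Idx n)} (h : Disjoint T T') :
    inversions S (T ∪ T') = inversions S T + inversions S T' := by
  unfold inversions
  rw [Finset.product_union, Finset.filter_union, Finset.card_union_of_disjoint]
  exact Finset.disjoint_filter_filter (Finset.disjoint_product.2 (Or.inr h))

theorem sgn_insert_left {α : Idx n} {S T : Finset (Idx n)} (h : α ∉ S) :
    sgn C (insert α S) T = sgn C {α} T * sgn C S T := by
  rw [Finset.insert_eq, sgn, inversions_union_left (by simpa using h), pow_add]; rfl

theorem sgn_insert_right {α : Idx n} {S T : Finset (Idx n)} (h : α ∉ T) :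
    sgn C S (insert α T) = sgn C S {α} * sgn C S T := by
  rw [Finset.insert_eq, sgn, inversions_union_right (by simpa using h), pow_add]; rfl

theorem sgn_union_right {S T T' : Finset (Idx n)} (h : Disjoint T T') :
    sgn C S (T ∪ T') = sgn C S T * sgn C S T' := by
  rw [sgn, inversions_union_right h, pow_add]; rfl

theorem sgn_mul_self (S T : Finset (Idx n)) : sgn C S T * sgn C S T = 1 := by
  rw [sgn, ← mul_pow]; simp

@[simp] theorem sgn_empty_left (T : Finset (Idx n)) : sgn C ∅ T = 1 := by simp [sgn, inversions]

theorem sgn_singleton_swap {α β : Idx n} (h : α ≠ β) : sgn C {α} {β} = -sgn C {β} {α} := by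
  have h' : finSumFinEquiv α ≠ finSumFinEquiv β := fun e => h (finSumFinEquiv.injective e)
  rcases lt_or_gt_of_ne h' with h1 | h1 <;>
  · simp [sgn, inversions, Finset.filter_singleton, h1, not_lt.2 h1.le]

namespace Fib

/-- Exterior multiplication by the coframe element `e^α`. -/
def wedge (α : Idx n) : Fib n C →ₗ[C] Fib n C where
  toFun a r m S := if α ∈ S then sgn C {α} (S.erase α) * a r m (S.erase α) else 0
  map_add' a b := by
    funext r m S; by_cases h : α ∈ S <;> simp [h, mul_add]
  map_smul' c a := by
    funext r m S; by_cases h : α ∈ S <;> simp [h, mul_left_comm]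

/-- Interior product with the frame vector `e_α`. -/
def contr (α : Idx n) : Fib n C →ₗ[C] Fib n C where
  toFun a r m S := if α ∈ S then 0 else sgn C {α} S * a r m (insert α S)
  map_add' a b := by
    funext r m S; by_cases h : α ∈ S <;> simp [h, mul_add]
  map_smul' c a := by
    funext r m S; by_cases h : α ∈ S <;> simp [h, mul_left_comm]

/-- Multiplication by the fibre coordinate `z^α`. -/
def zMul (α : Idx n) : Fib n C →ₗ[C] Fib n C where
  toFun a r m S := if m α = 0 then 0 else a r (m - Finsupp.single α 1) S
  map_add' a b := by
    funext r m S; by_cases h : m α = 0 <;> simp [h]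
  map_smul' c a := by
    funext r m S; by_cases h : m α = 0 <;> simp [h]

/-- The derivative `∂/∂z^α`. -/
def zDer (α : Idx n) : Fib n C →ₗ[C] Fib n C where
  toFun a r m S := ((m α : C) + 1) * a r (m + Finsupp.single α 1) S
  map_add' a b := by funext r m S; simp [mul_add]
  map_smul' c a := by funext r m S; simp [mul_left_comm]

/-- Multiplication by the formal parameter `v`. -/
def vMul : Fib n C →ₗ[C] Fib n C where
  toFun a r := match r with
    | 0 => 0
    | r + 1 => a r
  map_add' a b := by funext r; cases r <;> simp
  map_smul' c a := by funext r; cases r <;> simp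

/-- The parity involution, `(-1)^q` on forms of degree `q`. -/
def parity : Fib n C →ₗ[C] Fib n C where
  toFun a r m S := (-1) ^ S.card * a r m S
  map_add' a b := by funext r m S; simp [mul_add]
  map_smul' c a := by funext r m S; simp [mul_left_comm]

/-- The unit. -/
def one : Fib n C := fun r m S => if r = 0 ∧ m = 0 ∧ S = ∅ then 1 else 0

/-- The undeformed product of `W ⊗ Λ`. -/
def mul : Fib n C →ₗ[C] Fib n C →ₗ[C] Fib n C :=
  LinearMap.mk₂ C (fun a b r m S =>
    ∑ x ∈ Finset.HasAntidiagonal.antidiagonal r, ∑ y ∈ Finset.HasAntidiagonal.antidiagonal m,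
      ∑ T ∈ S.powerset, sgn C T (S \ T) * (a x.1 y.1 T * b x.2 y.2 (S \ T)))
    (fun a a' b => by
      funext r m S; simp only [Pi.add_apply, add_mul, mul_add, Finset.sum_add_distrib])
    (fun c a b => by
      funext r m S
      simp only [Pi.smul_apply, smul_eq_mul, Finset.mul_sum, mul_assoc, mul_left_comm c])
    (fun a b b' => by
      funext r m S; simp only [Pi.add_apply, mul_add, Finset.sum_add_distrib])
    (fun c a b => by
      funext r m S
      simp only [Pi.smul_apply, smul_eq_mul, Finset.mul_sum, mul_left_comm c])

theorem wedge_apply (α : Idx n) (a : Fib n C) (r m S) :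
    wedge α a r m S = if α ∈ S then sgn C {α} (S.erase α) * a r m (S.erase α) else 0 := rfl
theorem contr_apply (α : Idx n) (a : Fib n C) (r m S) :
    contr α a r m S = if α ∈ S then 0 else sgn C {α} S * a r m (insert α S) := rfl
theorem zMul_apply (α : Idx n) (a : Fib n C) (r m S) :
    zMul α a r m S = if m α = 0 then 0 else a r (m - Finsupp.single α 1) S := rfl
theorem zDer_apply (α : Idx n) (a : Fib n C) (r m S) :
    zDer α a r m S = ((m α : C) + 1) * a r (m + Finsupp.single α 1) S := rfl
theorem vMul_succ (a : Fib n C) (r) : vMul a (r + 1) = a r := rfl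
@[simp] theorem vMul_zero (a : Fib n C) : vMul a 0 = 0 := rfl
theorem parity_apply (a : Fib n C) (r m S) : parity a r m S = (-1) ^ S.card * a r m S := rfl
theorem mul_apply (a b : Fib n C) (r m S) : mul a b r m S =
    ∑ x ∈ Finset.HasAntidiagonal.antidiagonal r, ∑ y ∈ Finset.HasAntidiagonal.antidiagonal m,
      ∑ T ∈ S.powerset, sgn C T (S \ T) * (a x.1 y.1 T * b x.2 y.2 (S \ T)) := rfl

/-! ### Commutation of the elementary operators -/

theorem wedge_wedge (α β : Idx n) (a : Fib n C) : wedge α (wedge β a) = -wedge β (wedge α a) := by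
  funext r m S
  simp only [wedge_apply, Pi.neg_apply, Finset.mem_erase]
  by_cases hab : α = β
  · subst hab; simp
  by_cases ha : α ∈ S <;> by_cases hb : β ∈ S <;> simp only [ha, hb, if_true, if_false, and_true,
    and_false, neg_zero, mul_zero, ne_eq, hab, Ne.symm hab, not_false_eq_true]
  have h1 : S.erase α = insert β ((S.erase α).erase β) :=
    (Finset.insert_erase (Finset.mem_erase.2 ⟨Ne.symm hab, hb⟩)).symm
  have h2 : S.erase β = insert α ((S.erase α).erase β) := by
    rw [Finset.erase_right_comm]
    exact (Finset.insert_erase (Finset.mem_erase.2 ⟨hab, ha⟩)).symm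
  rw [Finset.erase_right_comm (s := S) (a := β)]
  generalize hU : (S.erase α).erase β = U at *
  have hbU : β ∉ U := by simp [← hU]
  have haU : α ∉ U := by simp [← hU]
  rw [h1, h2, sgn_insert_right hbU, sgn_insert_right haU, sgn_singleton_swap hab]
  ring

theorem wedge_self (α : Idx n) (a : Fib n C) : wedge α (wedge α a) = 0 := by
  funext r m S
  simp [wedge_apply]

theorem contr_contr (α β : Idx n) (a : Fib n C) : contr α (contr β a) = -contr β (contr α a) := by
  funext r m S
  simp only [contr_apply, Pi.neg_apply, Finset.mem_insert]
  by_cases hab : α = β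
  · subst hab; simp
  by_cases ha : α ∈ S <;> by_cases hb : β ∈ S <;> simp only [ha, hb, if_true, if_false, or_true,
    or_false, neg_zero, mul_zero, hab, Ne.symm hab]
  rw [Finset.insert_comm, sgn_insert_right ha, sgn_insert_right hb, sgn_singleton_swap hab]
  ring

theorem contr_wedge (α β : Idx n) (a : Fib n C) :
    contr α (wedge β a) = (if α = β then a else 0) - wedge β (contr α a) := by
  funext r m S
  simp only [contr_apply, wedge_apply, Pi.sub_apply, Finset.mem_insert]
  by_cases hab : α = β
  · subst hab
    by_cases ha : α ∈ S
    · simp [ha, ← mul_assoc, sgn_mul_self]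
    · simp [ha, ← mul_assoc, sgn_mul_self]
  by_cases ha : α ∈ S <;> by_cases hb : β ∈ S <;> simp [ha, hb, hab, Ne.symm hab]
  obtain ⟨U, hU, rfl⟩ : ∃ U, β ∉ U ∧ S = insert β U := ⟨S.erase β, by simp,
    (Finset.insert_erase hb).symm⟩
  have haU : α ∉ U := fun h => ha (Finset.mem_insert_of_mem h)
  rw [Finset.erase_insert hU, Finset.insert_comm, Finset.erase_insert (by simp [hU, Ne.symm hab]),
    sgn_insert_right hU, sgn_insert_right haU, sgn_singleton_swap hab]
  linear_combination (-sgn C {α} U * sgn C {β} U * a r m (insert α U)) *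
    sgn_mul_self (C := C) {β} {α}

theorem zDer_zMul (α β : Idx n) (a : Fib n C) :
    zDer α (zMul β a) = (if α = β then a else 0) + zMul β (zDer α a) := by
  funext r m S
  simp only [zDer_apply, zMul_apply, Pi.add_apply]
  by_cases hab : α = β
  · subst hab
    simp only [Finsupp.add_apply, Finsupp.single_eq_same, Nat.add_one_ne_zero, if_false, if_true,
      add_tsub_cancel_right]
    by_cases h0 : m α = 0
    · simp [h0]
    · rw [if_neg h0]
      have h1 : m - Finsupp.single α 1 + Finsupp.single α 1 = m := by
        ext i; by_cases hi : i = α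
        · subst hi; simp; omega
        · simp [hi]
      rw [h1]
      have h2 : (m α : C) = (m α - 1 : ℕ) + 1 := by
        rw [← Nat.cast_add_one, Nat.sub_add_cancel (Nat.pos_of_ne_zero h0)]
      simp [h2]; ring
  · simp only [hab, if_false, Finsupp.add_apply, Finsupp.single_apply, Pi.zero_apply, zero_add,
      add_zero]
    by_cases h0 : m β = 0
    · simp [h0]
    · rw [if_neg h0, if_neg h0]
      have h1 : m + Finsupp.single α 1 - Finsupp.single β 1
          = m - Finsupp.single β 1 + Finsupp.single α 1 := by
        ext i
        by_cases hi : i = β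
        · subst hi; simp [hab]
        · simp [Finsupp.single_apply, Ne.symm hi]
      rw [h1]
      simp [Ne.symm hab]

theorem zDer_comm (α β : Idx n) (a : Fib n C) : zDer α (zDer β a) = zDer β (zDer α a) := by
  funext r m S
  simp only [zDer_apply, Finsupp.add_apply]
  by_cases hab : α = β
  · subst hab; rfl
  · rw [add_right_comm m]
    simp only [Finsupp.single_apply, hab, Ne.symm hab, if_false, add_zero]
    ring

theorem zMul_comm (α β : Idx n) (a : Fib n C) : zMul α (zMul β a) = zMul β (zMul α a) := by
  funext r m S
  simp only [zMul_apply, Finsupp.tsub_apply]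
  by_cases hab : α = β
  · subst hab; rfl
  · rw [tsub_right_comm]
    simp only [Finsupp.single_apply, hab, Ne.symm hab, if_false, tsub_zero]
    split_ifs <;> rfl

theorem wedge_zMul (α β : Idx n) (a : Fib n C) : wedge α (zMul β a) = zMul β (wedge α a) := by
  funext r m S
  simp only [wedge_apply, zMul_apply]
  split_ifs <;> simp

theorem wedge_zDer (α β : Idx n) (a : Fib n C) : wedge α (zDer β a) = zDer β (wedge α a) := by
  funext r m S
  simp only [wedge_apply, zDer_apply]
  split_ifs
  · ring
  · simp

theorem contr_zMul (α β : Idx n) (a : Fib n C) : contr α (zMul β a) = zMul β (contr α a) := by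
  funext r m S
  simp only [contr_apply, zMul_apply]
  split_ifs <;> simp

theorem contr_zDer (α β : Idx n) (a : Fib n C) : contr α (zDer β a) = zDer β (contr α a) := by
  funext r m S
  simp only [contr_apply, zDer_apply]
  split_ifs
  · simp
  · ring

theorem vMul_wedge (α : Idx n) (a : Fib n C) : vMul (wedge α a) = wedge α (vMul a) := by
  funext r m S
  cases r <;> simp [wedge_apply, vMul_succ]

theorem vMul_contr (α : Idx n) (a : Fib n C) : vMul (contr α a) = contr α (vMul a) := by
  funext r m S
  cases r <;> simp [contr_apply, vMul_succ]

theorem vMul_zMul (α : Idx n) (a : Fib n C) : vMul (zMul α a) = zMul α (vMul a) := by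
  funext r m S
  cases r <;> simp [zMul_apply, vMul_succ]

theorem vMul_zDer (α : Idx n) (a : Fib n C) : vMul (zDer α a) = zDer α (vMul a) := by
  funext r m S
  cases r <;> simp [zDer_apply, vMul_succ]

theorem vMul_parity (a : Fib n C) : vMul (parity a) = parity (vMul a) := by
  funext r m S
  cases r <;> simp [parity_apply, vMul_succ]

theorem vMul_injective : Function.Injective (vMul : Fib n C → Fib n C) := fun a b h => by
  funext r
  exact congrFun h (r + 1)

theorem parity_wedge (α : Idx n) (a : Fib n C) : parity (wedge α a) = -wedge α (parity a) := by
  funext r m S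
  simp only [parity_apply, wedge_apply, Pi.neg_apply]
  split_ifs with h
  · rw [← Finset.card_erase_add_one h, pow_succ]; ring
  · simp

theorem parity_contr (α : Idx n) (a : Fib n C) : parity (contr α a) = -contr α (parity a) := by
  funext r m S
  simp only [parity_apply, contr_apply, Pi.neg_apply]
  split_ifs with h
  · simp
  · rw [Finset.card_insert_of_notMem h, pow_succ]; ring

theorem parity_zMul (α : Idx n) (a : Fib n C) : parity (zMul α a) = zMul α (parity a) := by
  funext r m S
  simp only [parity_apply, zMul_apply]
  split_ifs <;> simp

theorem parity_zDer (α : Idx n) (a : Fib n C) : parity (zDer α a) = zDer α (parity a) := by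
  funext r m S
  simp only [parity_apply, zDer_apply]; ring

theorem parity_parity (a : Fib n C) : parity (parity a) = a := by
  funext r m S
  simp only [parity_apply, ← mul_assoc, ← mul_pow]; simp

/-! ### Induction on the form part -/

/-- A form of degree zero. -/
def IsZeroForm (a : Fib n C) : Prop := ∀ r m S, S ≠ ∅ → a r m S = 0

/-- Every element is a sum of exterior products of coframe elements with forms of degree zero. -/
theorem form_induction {P : Fib n C → Prop} (h0 : ∀ a, IsZeroForm a → P a)
    (hadd : ∀ a b, P a → P b → P (a + b)) (hw : ∀ α a, P a → P (wedge α a)) (a : Fib n C) :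
    P a := by
  have key : ∀ (S : Finset (Idx n)) (a : Fib n C), (∀ r m T, T ≠ S → a r m T = 0) → P a := by
    intro S
    induction S using Finset.induction_on with
    | empty => exact fun a ha => h0 a ha
    | insert α S hα ih =>
      intro a ha
      have : a = wedge α (fun r m T => if T = S then sgn C {α} S * a r m (insert α S) else 0) := by
        funext r m T
        rw [wedge_apply]
        by_cases hT : T = insert α S
        · subst hT
          simp [Finset.erase_insert hα, ← mul_assoc, sgn_mul_self]
        · rw [ha r m T hT]
          split_ifs with h1 h2
          · exact absurd (by rw [← h2, Finset.insert_erase h1]) hT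
          · simp
          · rfl
      rw [this]
      exact hw α _ (ih _ fun r m T hT => if_neg hT)
  have hsum : ∀ s : Finset (Finset (Idx n)),
      P (∑ S ∈ s, fun r m T => if T = S then a r m T else 0) := by
    intro s
    induction s using Finset.induction_on with
    | empty => rw [Finset.sum_empty]; exact h0 _ fun _ _ _ _ => rfl
    | insert S s hS ih =>
      rw [Finset.sum_insert hS]
      exact hadd _ _ (key S _ fun r m T hT => if_neg hT) ih
  convert hsum Finset.univ using 1
  funext r m T
  simp [Finset.sum_apply]

theorem parity_of_isZeroForm {a : Fib n C} (ha : IsZeroForm a) : parity a = a := by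
  funext r m S
  rw [parity_apply]
  by_cases hS : S = ∅
  · simp [hS]
  · simp [ha r m S hS]

theorem mul_zeroForm_apply {a : Fib n C} (ha : IsZeroForm a) (b : Fib n C) (r m S) :
    mul a b r m S = ∑ x ∈ Finset.HasAntidiagonal.antidiagonal r,
      ∑ y ∈ Finset.HasAntidiagonal.antidiagonal m, a x.1 y.1 ∅ * b x.2 y.2 S := by
  rw [mul_apply]
  refine Finset.sum_congr rfl fun x _ => Finset.sum_congr rfl fun y _ => ?_
  rw [Finset.sum_eq_single ∅]
  · simp
  · intro T _ hT
    simp [ha _ _ T hT]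
  · simp

theorem mul_wedge_left (α : Idx n) (a b : Fib n C) : mul (wedge α a) b = wedge α (mul a b) := by
  funext r m S
  rw [wedge_apply]
  split_ifs with h
  · obtain ⟨U, hU, rfl⟩ : ∃ U, α ∉ U ∧ S = insert α U := ⟨S.erase α, by simp,
      (Finset.insert_erase h).symm⟩
    rw [Finset.erase_insert hU]
    simp only [mul_apply, Finset.mul_sum]
    refine Finset.sum_congr rfl fun x _ => Finset.sum_congr rfl fun y _ => ?_
    rw [Finset.sum_powerset_insert hU]
    rw [Finset.sum_eq_zero, zero_add]
    · refine Finset.sum_congr rfl fun T hT => ?_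
      rw [Finset.mem_powerset] at hT
      have hαT : α ∉ T := fun h => hU (hT h)
      rw [wedge_apply, if_pos (Finset.mem_insert_self _ _), Finset.erase_insert hαT]
      have e1 : insert α U \ insert α T = U \ T := by
        rw [Finset.insert_sdiff_of_mem _ (Finset.mem_insert_self _ _),
          Finset.sdiff_insert_of_notMem hU]
      have e2 : sgn C {α} U = sgn C {α} T * sgn C {α} (U \ T) := by
        rw [← sgn_union_right Finset.disjoint_sdiff, Finset.union_sdiff_of_subset hT]
      rw [e1, sgn_insert_left hαT, e2]
      ring
    · intro T hT
      rw [Finset.mem_powerset] at hT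
      have hαT : α ∉ T := fun h => hU (hT h)
      simp [wedge_apply, hαT]
  · rw [mul_apply]
    refine Finset.sum_eq_zero fun x _ => Finset.sum_eq_zero fun y _ =>
        Finset.sum_eq_zero fun T hT => ?_
    rw [Finset.mem_powerset] at hT
    rw [wedge_apply, if_neg fun h' => h (hT h'), zero_mul, mul_zero]

theorem mul_parity_wedge (α : Idx n) (a b : Fib n C) :
    mul (parity a) (wedge α b) = wedge α (mul a b) := by
  induction a using form_induction generalizing b with
  | h0 a ha =>
    rw [parity_of_isZeroForm ha]
    funext r m S
    simp only [mul_zeroForm_apply ha, wedge_apply]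
    split_ifs with h
    · simp only [Finset.mul_sum, mul_left_comm]
    · simp
  | hadd a a' h h' => simp only [map_add, LinearMap.add_apply, h, h']
  | hw β a h =>
    rw [parity_wedge, map_neg, LinearMap.neg_apply, mul_wedge_left, h, mul_wedge_left, wedge_wedge,
      neg_neg]

theorem mul_wedge_right (α : Idx n) (a b : Fib n C) :
    mul a (wedge α b) = wedge α (mul (parity a) b) := by
  rw [← mul_parity_wedge, parity_parity]

theorem contr_of_isZeroForm {a : Fib n C} (ha : IsZeroForm a) (α : Idx n) : contr α a = 0 := by
  funext r m S
  simp [contr_apply, ha r m (insert α S) (by simp)]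

theorem contr_mul (α : Idx n) (a b : Fib n C) :
    contr α (mul a b) = mul (contr α a) b + mul (parity a) (contr α b) := by
  induction a using form_induction generalizing b with
  | h0 a ha =>
    rw [contr_of_isZeroForm ha, parity_of_isZeroForm ha]
    funext r m S
    simp only [mul_zeroForm_apply ha, contr_apply, map_zero, LinearMap.zero_apply, zero_add]
    split_ifs with h
    · simp
    · simp only [Finset.mul_sum, mul_left_comm]
  | hadd a a' h h' =>
    simp only [map_add, LinearMap.add_apply, h, h']; abel
  | hw β a h =>
    rw [mul_wedge_left, contr_wedge, h, contr_wedge, parity_wedge]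
    simp only [map_add, map_sub, map_neg, LinearMap.sub_apply, LinearMap.neg_apply, mul_wedge_left]
    split_ifs
    · abel
    · simp; abel

theorem parity_mul (a b : Fib n C) : parity (mul a b) = mul (parity a) (parity b) := by
  induction a using form_induction generalizing b with
  | h0 a ha =>
    rw [parity_of_isZeroForm ha]
    funext r m S
    simp only [mul_zeroForm_apply ha, parity_apply, Finset.mul_sum, mul_left_comm]
  | hadd a a' h h' => simp only [map_add, LinearMap.add_apply, h, h']
  | hw β a h =>
    rw [mul_wedge_left, parity_wedge, h, parity_wedge, map_neg, LinearMap.neg_apply, mul_wedge_left]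

/-! ### The undeformed product -/

theorem sum_antidiagonal_single (α : Idx n) (m : Idx n →₀ ℕ) (F : (Idx n →₀ ℕ) × (Idx n →₀ ℕ) → C)
    (hF : ∀ y, y.1 α = 0 → F y = 0) :
    ∑ y ∈ Finset.HasAntidiagonal.antidiagonal (m + Finsupp.single α 1), F y =
      ∑ y ∈ Finset.HasAntidiagonal.antidiagonal m, F (y.1 + Finsupp.single α 1, y.2) := by
  symm
  refine Finset.sum_bij_ne_zero (fun y _ _ => (y.1 + Finsupp.single α 1, y.2)) ?_ ?_ ?_ ?_
  · intro y hy _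
    simp only [Finset.HasAntidiagonal.mem_antidiagonal] at hy ⊢
    rw [← hy]; abel
  · intro y _ _ y' _ _ h
    simp only [Prod.mk.injEq, add_left_inj] at h
    exact Prod.ext h.1 h.2
  · intro y hy hne
    have h1 : y.1 α ≠ 0 := fun h => hne (hF y h)
    have h2 : y.1 - Finsupp.single α 1 + Finsupp.single α 1 = y.1 := by
      ext i; by_cases hi : i = α
      · subst hi; simp; omega
      · simp [hi]
    refine ⟨(y.1 - Finsupp.single α 1, y.2), ?_, ?_, ?_⟩
    · simp only [Finset.HasAntidiagonal.mem_antidiagonal] at hy ⊢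
      apply add_right_cancel (b := Finsupp.single α 1)
      rw [← hy, add_right_comm, h2]
    · rw [h2]; exact hne
    · simp [h2]
  · intros; rfl

/-- The Leibniz rule for `∂/∂z^α`, on the coefficients of a product of power series. -/
theorem conv_leibniz (α : Idx n) (m : Idx n →₀ ℕ) (f g : (Idx n →₀ ℕ) → C) :
    ((m α : C) + 1) *
      ∑ y ∈ Finset.HasAntidiagonal.antidiagonal (m + Finsupp.single α 1), f y.1 * g y.2 =
    ∑ y ∈ Finset.HasAntidiagonal.antidiagonal m,
      ((((y.1 α : C) + 1) * f (y.1 + Finsupp.single α 1)) * g y.2 +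
        f y.1 * (((y.2 α : C) + 1) * g (y.2 + Finsupp.single α 1))) := by
  have h1 : ((m α : C) + 1) *
      ∑ y ∈ Finset.HasAntidiagonal.antidiagonal (m + Finsupp.single α 1), f y.1 * g y.2 =
      ∑ y ∈ Finset.HasAntidiagonal.antidiagonal (m + Finsupp.single α 1),
        (((y.1 : Idx n →₀ ℕ) α : C) * (f y.1 * g y.2)) +
      ∑ y ∈ Finset.HasAntidiagonal.antidiagonal (m + Finsupp.single α 1),
        (((y.2 : Idx n →₀ ℕ) α : C) * (f y.1 * g y.2)) := by
    rw [Finset.mul_sum, ← Finset.sum_add_distrib]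
    refine Finset.sum_congr rfl fun y hy => ?_
    rw [← add_mul]
    congr 1
    have := DFunLike.congr_fun (Finset.HasAntidiagonal.mem_antidiagonal.1 hy) α
    simp only [Finsupp.add_apply, Finsupp.single_eq_same] at this
    rw [← Nat.cast_add, this]; push_cast; rfl
  rw [h1, Finset.sum_add_distrib]
  congr 1
  · rw [sum_antidiagonal_single α m _ (fun y hy => by simp [hy])]
    refine Finset.sum_congr rfl fun y _ => ?_
    simp; ring
  · have hsw : ∀ (k : Idx n →₀ ℕ) (F : (Idx n →₀ ℕ) × (Idx n →₀ ℕ) → C),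
        ∑ y ∈ Finset.HasAntidiagonal.antidiagonal k, F y =
        ∑ y ∈ Finset.HasAntidiagonal.antidiagonal k, F y.swap := fun k F =>
      Finset.sum_equiv (Equiv.prodComm _ _) (fun y => by simp [add_comm]) fun y _ => by simp
    rw [hsw, sum_antidiagonal_single α m _ (fun y hy => by simp [hy]), hsw m]
    refine Finset.sum_congr rfl fun y _ => ?_
    simp; ring

theorem zDer_mul (α : Idx n) (a b : Fib n C) :
    zDer α (mul a b) = mul (zDer α a) b + mul a (zDer α b) := by
  funext r m S
  simp only [zDer_apply, mul_apply, Pi.add_apply]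
  rw [Finset.mul_sum, ← Finset.sum_add_distrib]
  refine Finset.sum_congr rfl fun x _ => ?_
  rw [Finset.sum_comm, Finset.mul_sum, ← Finset.sum_add_distrib,
    ← Finset.sum_congr rfl fun y _ => Finset.sum_add_distrib, Finset.sum_comm]
  refine Finset.sum_congr rfl fun T _ => ?_
  simp only [← mul_add, ← Finset.mul_sum]
  rw [mul_left_comm, conv_leibniz α m (fun y => a x.1 y T) (fun y => b x.2 y (S \ T))]

theorem mul_vMul_left (a b : Fib n C) : mul (vMul a) b = vMul (mul a b) := by
  funext r m S
  cases r with
  | zero => simp [mul_apply]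
  | succ r =>
    rw [vMul_succ, mul_apply, Finset.Nat.sum_antidiagonal_succ]
    simp [vMul_succ, mul_apply]

theorem mul_vMul_right (a b : Fib n C) : mul a (vMul b) = vMul (mul a b) := by
  funext r m S
  cases r with
  | zero => simp [mul_apply]
  | succ r =>
    rw [vMul_succ, mul_apply, Finset.Nat.sum_antidiagonal_succ']
    simp [vMul_succ, mul_apply]

theorem sum_antidiagonal_assoc {M : Type*} [AddCommMonoid M] [Finset.HasAntidiagonal M]
    (r : M) (F : M → M → M → C) :
    ∑ x ∈ Finset.HasAntidiagonal.antidiagonal r, ∑ y ∈ Finset.HasAntidiagonal.antidiagonal x.1,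
      F y.1 y.2 x.2 =
    ∑ x ∈ Finset.HasAntidiagonal.antidiagonal r, ∑ y ∈ Finset.HasAntidiagonal.antidiagonal x.2,
      F x.1 y.1 y.2 := by
  rw [Finset.sum_sigma', Finset.sum_sigma']
  refine Finset.sum_nbij' (fun p => ⟨(p.2.1, p.2.2 + p.1.2), (p.2.2, p.1.2)⟩)
    (fun p => ⟨(p.1.1 + p.2.1, p.2.2), (p.1.1, p.2.1)⟩) ?_ ?_ ?_ ?_ ?_
  · rintro ⟨⟨x, y⟩, ⟨z, w⟩⟩ h
    simp only [Finset.mem_sigma, Finset.HasAntidiagonal.mem_antidiagonal] at h ⊢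
    exact ⟨by rw [← h.1, ← h.2, add_assoc], trivial⟩
  · rintro ⟨⟨x, y⟩, ⟨z, w⟩⟩ h
    simp only [Finset.mem_sigma, Finset.HasAntidiagonal.mem_antidiagonal] at h ⊢
    exact ⟨by rw [← h.1, ← h.2, add_assoc], trivial⟩
  · rintro ⟨⟨x, y⟩, ⟨z, w⟩⟩ h
    simp only [Finset.mem_sigma, Finset.HasAntidiagonal.mem_antidiagonal] at h ⊢
    obtain ⟨_, rfl⟩ := h; rfl
  · rintro ⟨⟨x, y⟩, ⟨z, w⟩⟩ h
    simp only [Finset.mem_sigma, Finset.HasAntidiagonal.mem_antidiagonal] at h ⊢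
    obtain ⟨_, rfl⟩ := h; rfl
  · intros; rfl

theorem isZeroForm_mul {a b : Fib n C} (ha : IsZeroForm a) (hb : IsZeroForm b) :
    IsZeroForm (mul a b) := fun r m S hS => by
  rw [mul_zeroForm_apply ha]
  exact Finset.sum_eq_zero fun x _ => Finset.sum_eq_zero fun y _ => by rw [hb _ _ S hS, mul_zero]

theorem mul_assoc (a b c : Fib n C) : mul (mul a b) c = mul a (mul b c) := by
  induction a using form_induction generalizing b with
  | hadd a a' h h' => simp only [map_add, LinearMap.add_apply, h, h']
  | hw β a h => simp only [mul_wedge_left, h]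
  | h0 a ha =>
    induction b using form_induction with
    | hadd b b' h h' => simp only [map_add, LinearMap.add_apply, h, h']
    | hw β b h =>
      simp only [mul_wedge_left, mul_wedge_right, parity_of_isZeroForm ha, h]
    | h0 b hb =>
      funext r m S
      simp only [mul_zeroForm_apply (isZeroForm_mul ha hb), mul_zeroForm_apply ha,
        mul_zeroForm_apply hb, Finset.sum_mul, Finset.mul_sum]
      rw [← Finset.sum_congr rfl fun x _ => Finset.sum_comm]
      rw [sum_antidiagonal_assoc r (fun x1 x2 x3 =>
        ∑ y ∈ Finset.HasAntidiagonal.antidiagonal m,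
          ∑ y' ∈ Finset.HasAntidiagonal.antidiagonal y.1,
            a x1 y'.1 ∅ * b x2 y'.2 ∅ * c x3 y.2 S)]
      refine Finset.sum_congr rfl fun x _ => ?_
      rw [Finset.sum_comm (s := Finset.HasAntidiagonal.antidiagonal m)]
      refine Finset.sum_congr rfl fun x' _ => ?_
      rw [sum_antidiagonal_assoc m (fun y1 y2 y3 => a x.1 y1 ∅ * b x'.1 y2 ∅ * c x'.2 y3 S)]
      simp only [_root_.mul_assoc]

theorem isZeroForm_one : IsZeroForm (one : Fib n C) := fun r m S hS => by simp [one, hS]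

theorem one_mul (a : Fib n C) : mul one a = a := by
  funext r m S
  rw [mul_zeroForm_apply isZeroForm_one, Finset.sum_eq_single (0, r)]
  · rw [Finset.sum_eq_single (0, m)]
    · simp [one]
    · intro y hy hne
      have : y.1 ≠ 0 := fun h => hne (by
        rw [Finset.HasAntidiagonal.mem_antidiagonal, h, zero_add] at hy
        exact Prod.ext h hy)
      simp [one, this]
    · intro h; simp at h
  · intro x hx hne
    have : x.1 ≠ 0 := fun h => hne (by
      rw [Finset.HasAntidiagonal.mem_antidiagonal, h, zero_add] at hx
      exact Prod.ext h hx)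
    simp [one, this]
  · intro h; simp at h

theorem mul_one (a : Fib n C) : mul a one = a := by
  induction a using form_induction with
  | hadd a a' h h' => simp only [map_add, LinearMap.add_apply, h, h']
  | hw β a h => simp only [mul_wedge_left, h]
  | h0 a ha =>
  funext r m S
  by_cases hS : S = ∅
  swap
  · rw [isZeroForm_mul ha isZeroForm_one r m S hS, ha r m S hS]
  subst hS
  rw [mul_zeroForm_apply ha, Finset.sum_eq_single (r, 0)]
  · rw [Finset.sum_eq_single (m, 0)]
    · simp [one]
    · intro y hy hne
      have : y.2 ≠ 0 := fun h => hne (by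
        rw [Finset.HasAntidiagonal.mem_antidiagonal, h, add_zero] at hy
        exact Prod.ext hy h)
      simp [one, this]
    · intro h; simp at h
  · intro x hx hne
    have : x.2 ≠ 0 := fun h => hne (by
      rw [Finset.HasAntidiagonal.mem_antidiagonal, h, add_zero] at hx
      exact Prod.ext hx h)
    simp [one, this]
  · intro h; simp at h

theorem mul_zMul_left (γ : Idx n) (a b : Fib n C) : mul (zMul γ a) b = zMul γ (mul a b) := by
  funext r m S
  simp only [zMul_apply, mul_apply]
  split_ifs with h
  · refine Finset.sum_eq_zero fun x _ => Finset.sum_eq_zero fun y hy =>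
      Finset.sum_eq_zero fun T _ => ?_
    have := DFunLike.congr_fun (Finset.HasAntidiagonal.mem_antidiagonal.1 hy) γ
    simp only [Finsupp.add_apply, h] at this
    rw [if_pos (by omega)]; simp
  · have h2 : m = m - Finsupp.single γ 1 + Finsupp.single γ 1 := by
      ext i; by_cases hi : i = γ
      · subst hi; simp; omega
      · simp [hi]
    generalize m - Finsupp.single γ 1 = k at h2
    subst h2
    refine Finset.sum_congr rfl fun x _ => ?_
    rw [sum_antidiagonal_single γ k _ (fun y hy => by simp [hy])]
    simp

theorem mul_zMul_right (γ : Idx n) (a b : Fib n C) : mul a (zMul γ b) = zMul γ (mul a b) := by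
  have h : zMul γ b = mul (zMul γ one) b := by rw [mul_zMul_left, one_mul]
  have h2 : mul a (zMul γ one) = zMul γ a := by
    induction a using form_induction with
    | hadd a a' h h' => simp only [map_add, LinearMap.add_apply, h, h']
    | hw β a h => simp only [mul_wedge_left, h, wedge_zMul]
    | h0 a ha =>
      funext r m S
      have h1 : IsZeroForm (zMul γ (one : Fib n C)) := fun r m S hS => by
        rw [zMul_apply, isZeroForm_one _ _ S hS, ite_self]
      have hsymm : mul a (zMul γ one) = mul (zMul γ one) a := by
        funext r m S
        by_cases hS : S = ∅
        · subst hS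
          rw [mul_zeroForm_apply ha, mul_zeroForm_apply h1, ← Finset.Nat.sum_antidiagonal_swap]
          refine Finset.sum_congr rfl fun x _ => ?_
          refine Finset.sum_equiv (Equiv.prodComm _ _) (fun y => by simp [add_comm]) fun y _ => ?_
          simp [mul_comm]
        · rw [isZeroForm_mul ha h1 r m S hS, isZeroForm_mul h1 ha r m S hS]
      rw [hsymm, mul_zMul_left, one_mul]
  rw [h, ← mul_assoc, h2, mul_zMul_left]

end Fib

end Form

/-! ### The formal Wick product -/

namespace Fib

variable {n : ℕ} {C : Type*} [CommRing C] [Algebra ℂ C]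

/-- The coefficient `(i/2)^k / k!` of the exponential series. -/
def expCoeff (k : ℕ) : ℂ := (Complex.I / 2) ^ k / (k.factorial : ℂ)

theorem expCoeff_zero : expCoeff 0 = 1 := by simp [expCoeff]

theorem expCoeff_succ (k : ℕ) :
    expCoeff (k + 1) * ((k + 1 : ℕ) : ℂ) = Complex.I / 2 * expCoeff k := by
  have h : (k.factorial : ℂ) ≠ 0 := by exact_mod_cast k.factorial_ne_zero
  have h' : (((k + 1 : ℕ)) : ℂ) ≠ 0 := by exact_mod_cast k.succ_ne_zero
  rw [expCoeff, expCoeff, Nat.factorial_succ, Nat.cast_mul, pow_succ]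
  field_simp

/-- The formal series `∑ (i v / 2)^k / k! F_k`; only the terms with `k ≤ r` contribute to the
coefficient of `v^r`. -/
def expSum : (ℕ → Fib n C) →ₗ[C] Fib n C where
  toFun F r := ∑ k ∈ Finset.range (r + 1), expCoeff k • F k (r - k)
  map_add' F G := by
    funext r; simp only [Pi.add_apply, smul_add, Finset.sum_add_distrib]
  map_smul' c F := by
    funext r
    simp only [Pi.smul_apply, Finset.smul_sum, RingHom.id_apply]
    exact Finset.sum_congr rfl fun k _ => smul_comm _ _ _

theorem expSum_apply (F : ℕ → Fib n C) (r : ℕ) :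
    expSum F r = ∑ k ∈ Finset.range (r + 1), expCoeff k • F k (r - k) := rfl

/-- The bidifferential operators `(Λ^{αβ} ∂/∂z^α ⊗ ∂/∂z^β)^k`, followed by multiplication. -/
def biDer (Λ : Matrix (Idx n) (Idx n) C) : ℕ → Fib n C →ₗ[C] Fib n C →ₗ[C] Fib n C
  | 0 => mul
  | k + 1 => ∑ α, ∑ β, Λ α β • (biDer Λ k).compl₁₂ (zDer α) (zDer β)

theorem biDer_zero (Λ : Matrix (Idx n) (Idx n) C) (a b : Fib n C) : biDer Λ 0 a b = mul a b := rfl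

theorem biDer_succ (Λ : Matrix (Idx n) (Idx n) C) (k : ℕ) (a b : Fib n C) :
    biDer Λ (k + 1) a b = ∑ α, ∑ β, Λ α β • biDer Λ k (zDer α a) (zDer β b) := by
  simp [biDer, LinearMap.sum_apply]

/-- The formal Wick product. -/
def star (Λ : Matrix (Idx n) (Idx n) C) : Fib n C →ₗ[C] Fib n C →ₗ[C] Fib n C :=
  LinearMap.mk₂ C (fun a b => expSum fun k => biDer Λ k a b)
    (fun a a' b => by simp only [map_add, LinearMap.add_apply]; exact map_add expSum _ _)
    (fun c a b => by simp only [map_smul, LinearMap.smul_apply]; exact map_smul expSum c _)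
    (fun a b b' => by simp only [map_add]; exact map_add expSum _ _)
    (fun c a b => by simp only [map_smul]; exact map_smul expSum c _)

theorem star_eq (Λ : Matrix (Idx n) (Idx n) C) (a b : Fib n C) :
    star Λ a b = expSum fun k => biDer Λ k a b := rfl

/-- An operator is slicewise if it acts on the coefficients of the powers of `v` separately and
in the same way. -/
def IsSlicewise (O : Fib n C →ₗ[ℂ] Fib n C) : Prop := ∀ a r, O a r = O (fun _ => a r) 0

theorem expSum_map {O : Fib n C →ₗ[ℂ] Fib n C} (h : IsSlicewise O) (F : ℕ → Fib n C) :
    O (expSum F) = expSum fun k => O (F k) := by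
  funext r
  have e : (fun _ : ℕ => expSum F r) =
      ∑ k ∈ Finset.range (r + 1), expCoeff k • (fun _ : ℕ => F k (r - k)) := by
    funext i; simp [expSum_apply, Finset.sum_apply]
  rw [h, e, map_sum, expSum_apply, Finset.sum_apply]
  refine Finset.sum_congr rfl fun k _ => ?_
  rw [map_smul, Pi.smul_apply, h (F k)]

theorem expSum_zDer (α : Idx n) (F : ℕ → Fib n C) :
    zDer α (expSum F) = expSum fun k => zDer α (F k) :=
  expSum_map (O := (zDer α).restrictScalars ℂ) (fun _ _ => rfl) F

theorem expSum_zMul (α : Idx n) (F : ℕ → Fib n C) :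
    zMul α (expSum F) = expSum fun k => zMul α (F k) :=
  expSum_map (O := (zMul α).restrictScalars ℂ) (fun _ _ => rfl) F

theorem expSum_wedge (α : Idx n) (F : ℕ → Fib n C) :
    wedge α (expSum F) = expSum fun k => wedge α (F k) :=
  expSum_map (O := (wedge α).restrictScalars ℂ) (fun _ _ => rfl) F

theorem expSum_contr (α : Idx n) (F : ℕ → Fib n C) :
    contr α (expSum F) = expSum fun k => contr α (F k) :=
  expSum_map (O := (contr α).restrictScalars ℂ) (fun _ _ => rfl) F

theorem expSum_parity (F : ℕ → Fib n C) :
    parity (expSum F) = expSum fun k => parity (F k) :=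
  expSum_map (O := parity.restrictScalars ℂ) (fun _ _ => rfl) F

theorem expSum_vMul (F : ℕ → Fib n C) : expSum (fun k => vMul (F k)) = vMul (expSum F) := by
  funext r
  cases r with
  | zero => simp [expSum_apply]
  | succ r =>
    rw [vMul_succ, expSum_apply, expSum_apply, Finset.sum_range_succ, Nat.sub_self, vMul_zero,
      smul_zero, add_zero]
    refine Finset.sum_congr rfl fun k hk => ?_
    rw [Nat.sub_add_comm (Nat.lt_succ_iff.1 (Finset.mem_range.1 hk)), vMul_succ]

/-- The exponential series reproduces itself when its terms are multiplied by `k` and shifted. -/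
theorem expSum_shift (F : ℕ → Fib n C) :
    expSum (fun k => (k : ℂ) • F (k - 1)) = (Complex.I / 2) • vMul (expSum F) := by
  funext r
  cases r with
  | zero => simp [expSum_apply]
  | succ r =>
    rw [Pi.smul_apply, vMul_succ, expSum_apply, expSum_apply, Finset.sum_range_succ']
    simp only [Nat.cast_zero, zero_smul, smul_zero, add_zero, Finset.smul_sum,
      Nat.add_sub_cancel, Nat.add_sub_add_right, Pi.smul_apply, smul_smul, expCoeff_succ]

theorem iterate_vMul_apply (k r : ℕ) (a : Fib n C) :
    (vMul ^ k : Module.End C (Fib n C)) a r = if k ≤ r then a (r - k) else 0 := by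
  induction k generalizing r with
  | zero => simp
  | succ k ih =>
    rw [pow_succ', Module.End.mul_apply]
    cases r with
    | zero => simp
    | succ r => rw [vMul_succ, ih]; simp

/-- Up to a given order in `v` the series `expSum F` is a finite sum. -/
theorem expSum_trunc (F : ℕ → Fib n C) {r N : ℕ} (h : r ≤ N) :
    expSum F r =
      (∑ k ∈ Finset.range (N + 1), expCoeff k • (vMul ^ k : Module.End C (Fib n C)) (F k)) r := by
  rw [expSum_apply, Finset.sum_apply]
  have hsub : Finset.range (r + 1) ⊆ Finset.range (N + 1) := by
    intro x; simp only [Finset.mem_range]; omega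
  rw [← Finset.sum_subset hsub]
  · refine Finset.sum_congr rfl fun k hk => ?_
    rw [Pi.smul_apply, iterate_vMul_apply, if_pos (Nat.lt_succ_iff.1 (Finset.mem_range.1 hk))]
  · intro k _ hk
    rw [Pi.smul_apply, iterate_vMul_apply, if_neg (by simpa using hk), smul_zero]

theorem mul_congr_left {a a' : Fib n C} (b : Fib n C) {r : ℕ} (h : ∀ x ≤ r, a x = a' x) :
    mul a b r = mul a' b r := by
  funext m S
  simp only [mul_apply]
  refine Finset.sum_congr rfl fun x hx => ?_
  rw [h x.1 (by rw [← Finset.HasAntidiagonal.mem_antidiagonal.1 hx]; omega)]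

theorem mul_congr_right (a : Fib n C) {b b' : Fib n C} {r : ℕ} (h : ∀ x ≤ r, b x = b' x) :
    mul a b r = mul a b' r := by
  funext m S
  simp only [mul_apply]
  refine Finset.sum_congr rfl fun x hx => ?_
  rw [h x.2 (by rw [← Finset.HasAntidiagonal.mem_antidiagonal.1 hx]; omega)]

theorem mul_iterate_vMul_left (k : ℕ) (a b : Fib n C) :
    mul ((vMul ^ k : Module.End C (Fib n C)) a) b =
      (vMul ^ k : Module.End C (Fib n C)) (mul a b) := by
  induction k with
  | zero => rfl
  | succ k ih => rw [pow_succ', Module.End.mul_apply, Module.End.mul_apply, mul_vMul_left, ih]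

theorem mul_iterate_vMul_right (k : ℕ) (a b : Fib n C) :
    mul a ((vMul ^ k : Module.End C (Fib n C)) b) =
      (vMul ^ k : Module.End C (Fib n C)) (mul a b) := by
  induction k with
  | zero => rfl
  | succ k ih => rw [pow_succ', Module.End.mul_apply, Module.End.mul_apply, mul_vMul_right, ih]

theorem mul_expSum_left (F : ℕ → Fib n C) (b : Fib n C) :
    mul (expSum F) b = expSum fun k => mul (F k) b := by
  funext r
  rw [mul_congr_left b fun x hx => expSum_trunc F hx, expSum_trunc _ le_rfl]
  simp only [map_sum, LinearMap.sum_apply, LinearMap.map_smul_of_tower, LinearMap.smul_apply,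
    mul_iterate_vMul_left]

theorem mul_expSum_right (a : Fib n C) (F : ℕ → Fib n C) :
    mul a (expSum F) = expSum fun k => mul a (F k) := by
  funext r
  rw [mul_congr_right a fun x hx => expSum_trunc F hx, expSum_trunc _ le_rfl]
  simp only [map_sum, LinearMap.map_smul_of_tower, mul_iterate_vMul_right]

variable (Λ : Matrix (Idx n) (Idx n) C)

theorem expSum_sum_smul (F : Idx n → Idx n → ℕ → Fib n C) :
    ∑ α, ∑ β, Λ α β • expSum (F α β) = expSum fun k => ∑ α, ∑ β, Λ α β • F α β k := by
  have : (fun k => ∑ α, ∑ β, Λ α β • F α β k) = ∑ α, ∑ β, Λ α β • F α β := by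
    funext k; simp only [Finset.sum_apply, Pi.smul_apply]
  rw [this]
  simp only [map_sum, map_smul]

theorem biDer_expSum_left (k : ℕ) (F : ℕ → Fib n C) (b : Fib n C) :
    biDer Λ k (expSum F) b = expSum fun l => biDer Λ k (F l) b := by
  induction k generalizing F b with
  | zero => exact mul_expSum_left F b
  | succ k ih => simp only [biDer_succ, expSum_zDer, ih, expSum_sum_smul]

theorem biDer_expSum_right (k : ℕ) (a : Fib n C) (F : ℕ → Fib n C) :
    biDer Λ k a (expSum F) = expSum fun l => biDer Λ k a (F l) := by
  induction k generalizing F a with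
  | zero => exact mul_expSum_right a F
  | succ k ih => simp only [biDer_succ, expSum_zDer, ih, expSum_sum_smul]

theorem zDer_biDer (γ : Idx n) (k : ℕ) (a b : Fib n C) :
    zDer γ (biDer Λ k a b) = biDer Λ k (zDer γ a) b + biDer Λ k a (zDer γ b) := by
  induction k generalizing a b with
  | zero => exact zDer_mul γ a b
  | succ k ih =>
    simp only [biDer_succ, map_sum, map_smul, ih, smul_add, Finset.sum_add_distrib,
      zDer_comm _ γ]

/-! ### Associativity of the Wick product -/

/-- The operator `Λ^{αβ} ∂_α ⊗ ∂_β ⊗ 1` on functions of three arguments. -/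
def pair₁₂ : Module.End C (Fib n C → Fib n C → Fib n C → Fib n C) where
  toFun F a b c := ∑ α, ∑ β, Λ α β • F (zDer α a) (zDer β b) c
  map_add' F G := by
    funext a b c; simp only [Pi.add_apply, smul_add, Finset.sum_add_distrib]
  map_smul' t F := by
    funext a b c; simp only [Pi.smul_apply, Finset.smul_sum, smul_comm t, RingHom.id_apply]

/-- The operator `Λ^{αβ} ∂_α ⊗ 1 ⊗ ∂_β` on functions of three arguments. -/
def pair₁₃ : Module.End C (Fib n C → Fib n C → Fib n C → Fib n C) where
  toFun F a b c := ∑ α, ∑ β, Λ α β • F (zDer α a) b (zDer β c)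
  map_add' F G := by
    funext a b c; simp only [Pi.add_apply, smul_add, Finset.sum_add_distrib]
  map_smul' t F := by
    funext a b c; simp only [Pi.smul_apply, Finset.smul_sum, smul_comm t, RingHom.id_apply]

/-- The operator `Λ^{αβ} 1 ⊗ ∂_α ⊗ ∂_β` on functions of three arguments. -/
def pair₂₃ : Module.End C (Fib n C → Fib n C → Fib n C → Fib n C) where
  toFun F a b c := ∑ α, ∑ β, Λ α β • F a (zDer α b) (zDer β c)
  map_add' F G := by
    funext a b c; simp only [Pi.add_apply, smul_add, Finset.sum_add_distrib]
  map_smul' t F := by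
    funext a b c; simp only [Pi.smul_apply, Finset.smul_sum, smul_comm t, RingHom.id_apply]

theorem sum_pair_comm (G : Idx n → Idx n → Idx n → Idx n → Fib n C) :
    ∑ α, ∑ β, Λ α β • ∑ γ, ∑ δ, Λ γ δ • G α β γ δ =
      ∑ γ, ∑ δ, Λ γ δ • ∑ α, ∑ β, Λ α β • G α β γ δ := by
  simp only [Finset.smul_sum]
  rw [Finset.sum_congr rfl fun α _ => Finset.sum_comm, Finset.sum_comm]
  refine Finset.sum_congr rfl fun γ _ => ?_
  rw [Finset.sum_congr rfl fun α _ => Finset.sum_comm, Finset.sum_comm]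
  refine Finset.sum_congr rfl fun δ _ => Finset.sum_congr rfl fun α _ =>
    Finset.sum_congr rfl fun β _ => smul_comm _ _ _

theorem commute_pair₁₂_pair₁₃ : Commute (pair₁₂ Λ) (pair₁₃ Λ) := by
  refine LinearMap.ext fun F => ?_
  funext a b c
  change ∑ α, ∑ β, Λ α β • ∑ γ, ∑ δ, Λ γ δ • F (zDer γ (zDer α a)) (zDer β b) (zDer δ c) =
    ∑ γ, ∑ δ, Λ γ δ • ∑ α, ∑ β, Λ α β • F (zDer α (zDer γ a)) (zDer β b) (zDer δ c)
  rw [sum_pair_comm]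
  simp only [zDer_comm]

theorem commute_pair₁₂_pair₂₃ : Commute (pair₁₂ Λ) (pair₂₃ Λ) := by
  refine LinearMap.ext fun F => ?_
  funext a b c
  change ∑ α, ∑ β, Λ α β • ∑ γ, ∑ δ, Λ γ δ • F (zDer α a) (zDer γ (zDer β b)) (zDer δ c) =
    ∑ γ, ∑ δ, Λ γ δ • ∑ α, ∑ β, Λ α β • F (zDer α a) (zDer β (zDer γ b)) (zDer δ c)
  rw [sum_pair_comm]
  simp only [zDer_comm]

theorem commute_pair₁₃_pair₂₃ : Commute (pair₁₃ Λ) (pair₂₃ Λ) := by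
  refine LinearMap.ext fun F => ?_
  funext a b c
  change ∑ α, ∑ β, Λ α β • ∑ γ, ∑ δ, Λ γ δ • F (zDer α a) (zDer γ b) (zDer δ (zDer β c)) =
    ∑ γ, ∑ δ, Λ γ δ • ∑ α, ∑ β, Λ α β • F (zDer α a) (zDer γ b) (zDer β (zDer δ c))
  rw [sum_pair_comm]
  simp only [zDer_comm]

/-- The undeformed product of three factors. -/
def mul₃ : Fib n C → Fib n C → Fib n C → Fib n C := fun a b c => mul (mul a b) c

/-- On `(a b) c`, a derivative of the product `a b` falls on `a` or on `b`. -/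
theorem biDer_biDer_left (k l : ℕ) (a b c : Fib n C) :
    biDer Λ k (biDer Λ l a b) c =
      ((pair₁₃ Λ + pair₂₃ Λ) ^ k * pair₁₂ Λ ^ l) mul₃ a b c := by
  have h1 : ∀ (l : ℕ) (a b c : Fib n C), mul (biDer Λ l a b) c = (pair₁₂ Λ ^ l) mul₃ a b c := by
    intro l
    induction l with
    | zero => intro a b c; rfl
    | succ l ih =>
      intro a b c
      rw [pow_succ', Module.End.mul_apply, biDer_succ]
      simp only [map_sum, map_smul, LinearMap.sum_apply, LinearMap.smul_apply, ih]
      rfl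
  rw [Module.End.mul_apply]
  induction k generalizing a b c with
  | zero => exact h1 l a b c
  | succ k ih =>
    rw [pow_succ', Module.End.mul_apply, biDer_succ]
    simp only [zDer_biDer, map_add, LinearMap.add_apply, ih, smul_add, Finset.sum_add_distrib]
    rfl

/-- On `a (b c)`, a derivative of the product `b c` falls on `b` or on `c`. -/
theorem biDer_biDer_right (k l : ℕ) (a b c : Fib n C) :
    biDer Λ k a (biDer Λ l b c) =
      ((pair₁₂ Λ + pair₁₃ Λ) ^ k * pair₂₃ Λ ^ l) mul₃ a b c := by
  have h1 : ∀ (l : ℕ) (a b c : Fib n C), mul a (biDer Λ l b c) = (pair₂₃ Λ ^ l) mul₃ a b c := by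
    intro l
    induction l with
    | zero => intro a b c; exact (mul_assoc a b c).symm
    | succ l ih =>
      intro a b c
      rw [pow_succ', Module.End.mul_apply, biDer_succ]
      simp only [map_sum, map_smul, ih]
      rfl
  rw [Module.End.mul_apply]
  induction k generalizing a b c with
  | zero => exact h1 l a b c
  | succ k ih =>
    rw [pow_succ', Module.End.mul_apply, biDer_succ]
    simp only [zDer_biDer, map_add, ih, smul_add, Finset.sum_add_distrib]
    rfl

/-- Product of two exponential series: the terms of a given order in `v` combine to binomial
sums. -/
theorem expSum_expSum (M : ℕ → ℕ → Fib n C) (r : ℕ) :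
    expSum (fun k => expSum (M k)) r = ∑ N ∈ Finset.range (r + 1),
      expCoeff N •
        (∑ p ∈ Finset.HasAntidiagonal.antidiagonal N, N.choose p.1 • M p.1 p.2) (r - N) := by
  have h1 : expSum (fun k => expSum (M k)) r =
      ∑ k ∈ Finset.range (r + 1), ∑ l ∈ Finset.range (r - k + 1),
        (expCoeff k * expCoeff l) • M k l (r - k - l) := by
    simp only [expSum_apply, Finset.smul_sum, smul_smul]
  rw [h1, Finset.range_eq_Ico, Finset.sum_sigma']
  simp only [Finset.sum_apply, Finset.smul_sum]
  rw [← Finset.range_eq_Ico, Finset.sum_sigma']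
  refine Finset.sum_nbij' (fun p => ⟨p.1 + p.2, (p.1, p.2)⟩) (fun p => ⟨p.2.1, p.2.2⟩)
    ?_ ?_ ?_ ?_ ?_
  · rintro ⟨k, l⟩ h
    simp only [Finset.mem_sigma, Finset.mem_range, Finset.HasAntidiagonal.mem_antidiagonal,
      and_true] at h ⊢
    omega
  · rintro ⟨N, k, l⟩ h
    simp only [Finset.mem_sigma, Finset.mem_range, Finset.HasAntidiagonal.mem_antidiagonal] at h ⊢
    obtain ⟨h, rfl⟩ := h
    omega
  · rintro ⟨k, l⟩ _; rfl
  · rintro ⟨N, k, l⟩ h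
    simp only [Finset.mem_sigma, Finset.mem_range, Finset.HasAntidiagonal.mem_antidiagonal] at h
    obtain ⟨_, rfl⟩ := h; rfl
  · rintro ⟨k, l⟩ _
    simp only [Pi.smul_apply]
    rw [← Nat.cast_smul_eq_nsmul ℂ, smul_smul, Nat.sub_sub]
    congr 1
    have hk : (k.factorial : ℂ) ≠ 0 := by exact_mod_cast k.factorial_ne_zero
    have hl : (l.factorial : ℂ) ≠ 0 := by exact_mod_cast l.factorial_ne_zero
    have hkl : ((k + l).factorial : ℂ) ≠ 0 := by exact_mod_cast (k + l).factorial_ne_zero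
    have := Nat.choose_mul_factorial_mul_factorial (Nat.le_add_right k l)
    rw [Nat.add_sub_cancel_left] at this
    have h2 : ((k + l).choose k : ℂ) * k.factorial * l.factorial = (k + l).factorial := by
      exact_mod_cast this
    simp only [expCoeff, pow_add]
    rw [← h2] at hkl ⊢
    have hc : ((k + l).choose k : ℂ) ≠ 0 := fun h => hkl (by rw [h]; ring)
    field_simp

/-- Associativity of the Wick product: by the binomial theorem for commuting operators, both
sides are obtained by applying the exponential of `pair₁₂ + pair₁₃ + pair₂₃` to the product of the
three factors. -/
theorem star_assoc (a b c : Fib n C) : star Λ (star Λ a b) c = star Λ a (star Λ b c) := by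
  have e1 : star Λ (star Λ a b) c = expSum fun k => expSum fun l =>
      ((pair₁₃ Λ + pair₂₃ Λ) ^ k * pair₁₂ Λ ^ l) mul₃ a b c := by
    simp only [star_eq, biDer_expSum_left, biDer_biDer_left]
  have e2 : star Λ a (star Λ b c) = expSum fun k => expSum fun l =>
      ((pair₁₂ Λ + pair₁₃ Λ) ^ k * pair₂₃ Λ ^ l) mul₃ a b c := by
    simp only [star_eq, biDer_expSum_right, biDer_biDer_right]
  have e3 : ∀ (x y : Module.End C (Fib n C → Fib n C → Fib n C → Fib n C))
      (_ : Commute x y) (N : ℕ),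
      ∑ p ∈ Finset.HasAntidiagonal.antidiagonal N, N.choose p.1 • ((x ^ p.1 * y ^ p.2) mul₃ a b c) =
        ((x + y) ^ N) mul₃ a b c := by
    intro x y h N
    rw [h.add_pow']
    simp only [LinearMap.sum_apply, Finset.sum_apply, LinearMap.smul_apply, Pi.smul_apply]
  rw [e1, e2]
  funext r
  rw [expSum_expSum, expSum_expSum]
  refine Finset.sum_congr rfl fun N _ => ?_
  rw [e3 _ _ ((commute_pair₁₂_pair₁₃ Λ).symm.add_left (commute_pair₁₂_pair₂₃ Λ).symm),
    e3 _ _ ((commute_pair₁₂_pair₂₃ Λ).add_left (commute_pair₁₃_pair₂₃ Λ))]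
  rw [add_comm (pair₁₃ Λ + pair₂₃ Λ), ← add_assoc]

/-! ### Wick products with elementary factors -/

theorem biDer_wedge_left (k : ℕ) (α : Idx n) (a b : Fib n C) :
    biDer Λ k (wedge α a) b = wedge α (biDer Λ k a b) := by
  induction k generalizing a b with
  | zero => exact mul_wedge_left α a b
  | succ k ih => simp only [biDer_succ, ← wedge_zDer, ih, map_sum, map_smul]

theorem biDer_wedge_right (k : ℕ) (α : Idx n) (a b : Fib n C) :
    biDer Λ k a (wedge α b) = wedge α (biDer Λ k (parity a) b) := by
  induction k generalizing a b with
  | zero => exact mul_wedge_right α a b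
  | succ k ih => simp only [biDer_succ, ← wedge_zDer, ih, map_sum, map_smul, parity_zDer]

theorem contr_biDer (k : ℕ) (α : Idx n) (a b : Fib n C) :
    contr α (biDer Λ k a b) = biDer Λ k (contr α a) b + biDer Λ k (parity a) (contr α b) := by
  induction k generalizing a b with
  | zero => exact contr_mul α a b
  | succ k ih =>
    simp only [biDer_succ, map_sum, map_smul, ih, contr_zDer, parity_zDer, smul_add,
      Finset.sum_add_distrib]

theorem parity_biDer (k : ℕ) (a b : Fib n C) :
    parity (biDer Λ k a b) = biDer Λ k (parity a) (parity b) := by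
  induction k generalizing a b with
  | zero => exact parity_mul a b
  | succ k ih => simp only [biDer_succ, map_sum, map_smul, ih, parity_zDer]

theorem biDer_vMul_left (k : ℕ) (a b : Fib n C) : biDer Λ k (vMul a) b = vMul (biDer Λ k a b) := by
  induction k generalizing a b with
  | zero => exact mul_vMul_left a b
  | succ k ih => simp only [biDer_succ, map_sum, map_smul, ih, ← vMul_zDer]

theorem biDer_vMul_right (k : ℕ) (a b : Fib n C) : biDer Λ k a (vMul b) = vMul (biDer Λ k a b) := by
  induction k generalizing a b with
  | zero => exact mul_vMul_right a b
  | succ k ih => simp only [biDer_succ, map_sum, map_smul, ih, ← vMul_zDer]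

theorem star_wedge_left (α : Idx n) (a b : Fib n C) :
    star Λ (wedge α a) b = wedge α (star Λ a b) := by
  simp only [star_eq, biDer_wedge_left, expSum_wedge]

theorem star_wedge_right (α : Idx n) (a b : Fib n C) :
    star Λ a (wedge α b) = wedge α (star Λ (parity a) b) := by
  simp only [star_eq, biDer_wedge_right, expSum_wedge]

theorem contr_star (α : Idx n) (a b : Fib n C) :
    contr α (star Λ a b) = star Λ (contr α a) b + star Λ (parity a) (contr α b) := by
  simp only [star_eq, expSum_contr, contr_biDer]
  exact map_add expSum _ _

theorem parity_star (a b : Fib n C) : parity (star Λ a b) = star Λ (parity a) (parity b) := by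
  simp only [star_eq, expSum_parity, parity_biDer]

theorem star_vMul_left (a b : Fib n C) : star Λ (vMul a) b = vMul (star Λ a b) := by
  simp only [star_eq, ← expSum_vMul, biDer_vMul_left]

theorem star_vMul_right (a b : Fib n C) : star Λ a (vMul b) = vMul (star Λ a b) := by
  simp only [star_eq, ← expSum_vMul, biDer_vMul_right]

theorem zDer_star (γ : Idx n) (a b : Fib n C) :
    zDer γ (star Λ a b) = star Λ (zDer γ a) b + star Λ a (zDer γ b) := by
  simp only [star_eq, expSum_zDer, zDer_biDer]
  exact map_add expSum _ _

theorem zDer_one (γ : Idx n) : zDer γ (one : Fib n C) = 0 := by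
  funext r m S
  have : m + Finsupp.single γ 1 ≠ 0 := fun h => by
    have := DFunLike.congr_fun h γ
    simp at this
  simp [zDer_apply, one, this]

theorem expSum_of_zero {F : ℕ → Fib n C} (h : ∀ k, k ≠ 0 → F k = 0) : expSum F = F 0 := by
  funext r
  rw [expSum_apply, Finset.sum_eq_single 0]
  · simp [expCoeff_zero]
  · intro k _ hk; simp [h k hk]
  · simp

theorem one_star (a : Fib n C) : star Λ one a = a := by
  rw [star_eq, expSum_of_zero, biDer_zero, one_mul]
  intro k hk
  obtain ⟨k, rfl⟩ := Nat.exists_eq_succ_of_ne_zero hk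
  simp [biDer_succ, zDer_one]

theorem star_one (a : Fib n C) : star Λ a one = a := by
  rw [star_eq, expSum_of_zero, biDer_zero, mul_one]
  intro k hk
  obtain ⟨k, rfl⟩ := Nat.exists_eq_succ_of_ne_zero hk
  simp [biDer_succ, zDer_one]

/-- The factor `z^γ` is either left alone or absorbs exactly one of the `k` derivatives. -/
theorem biDer_zMul_left (k : ℕ) (γ : Idx n) (a b : Fib n C) :
    biDer Λ k (zMul γ a) b = zMul γ (biDer Λ k a b) +
      (k : ℂ) • ∑ β, Λ γ β • biDer Λ (k - 1) a (zDer β b) := by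
  induction k generalizing a b with
  | zero => simp [biDer_zero, mul_zMul_left]
  | succ k ih =>
    simp only [biDer_succ, zDer_zMul, map_add, LinearMap.add_apply, smul_add,
      Finset.sum_add_distrib, ih, map_sum, map_smul, Nat.add_sub_cancel]
    have h1 : ∑ α, ∑ β, Λ α β • biDer Λ k (if α = γ then a else 0) (zDer β b) =
        ∑ β, Λ γ β • biDer Λ k a (zDer β b) := by
      rw [Finset.sum_eq_single γ]
      · simp
      · intro α _ h; simp [h]
      · simp
    have h2 : ∑ α, ∑ β, Λ α β •
        ((k : ℂ) • ∑ μ, Λ γ μ • biDer Λ (k - 1) (zDer α a) (zDer μ (zDer β b))) =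
        (k : ℂ) • ∑ β, Λ γ β • biDer Λ k a (zDer β b) := by
      cases k with
      | zero => simp
      | succ k =>
        simp only [biDer_succ, Nat.add_sub_cancel, Finset.smul_sum]
        simp only [smul_comm _ (((k + 1 : ℕ)) : ℂ)]
        conv_rhs => rw [Finset.sum_comm]
        refine Finset.sum_congr rfl fun x _ => ?_
        conv_rhs => rw [Finset.sum_comm]
        refine Finset.sum_congr rfl fun y _ => Finset.sum_congr rfl fun z _ => ?_
        rw [smul_comm (Λ x y), zDer_comm y z]
    rw [h1, h2, Nat.cast_add, Nat.cast_one, add_smul, one_smul]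
    abel

theorem biDer_zMul_right (k : ℕ) (γ : Idx n) (a b : Fib n C) :
    biDer Λ k a (zMul γ b) = zMul γ (biDer Λ k a b) +
      (k : ℂ) • ∑ α, Λ α γ • biDer Λ (k - 1) (zDer α a) b := by
  induction k generalizing a b with
  | zero => simp [biDer_zero, mul_zMul_right]
  | succ k ih =>
    simp only [biDer_succ, zDer_zMul, map_add, smul_add,
      Finset.sum_add_distrib, ih, map_sum, map_smul, Nat.add_sub_cancel]
    have h1 : ∑ α, ∑ β, Λ α β • biDer Λ k (zDer α a) (if β = γ then b else 0) =
        ∑ α, Λ α γ • biDer Λ k (zDer α a) b := by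
      refine Finset.sum_congr rfl fun α _ => ?_
      rw [Finset.sum_eq_single γ]
      · simp
      · intro β _ h; simp [h]
      · simp
    have h2 : ∑ α, ∑ β, Λ α β •
        ((k : ℂ) • ∑ μ, Λ μ γ • biDer Λ (k - 1) (zDer μ (zDer α a)) (zDer β b)) =
        (k : ℂ) • ∑ α, Λ α γ • biDer Λ k (zDer α a) b := by
      cases k with
      | zero => simp
      | succ k =>
        simp only [biDer_succ, Nat.add_sub_cancel, Finset.smul_sum]
        simp only [smul_comm _ (((k + 1 : ℕ)) : ℂ)]
        conv_rhs => rw [Finset.sum_comm]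
        refine Finset.sum_congr rfl fun x _ => ?_
        conv_rhs => rw [Finset.sum_comm]
        refine Finset.sum_congr rfl fun y _ => Finset.sum_congr rfl fun z _ => ?_
        rw [smul_comm (Λ x y), zDer_comm x z]
    rw [h1, h2, Nat.cast_add, Nat.cast_one, add_smul, one_smul]
    abel

theorem star_zMul_left (γ : Idx n) (a b : Fib n C) :
    star Λ (zMul γ a) b = zMul γ (star Λ a b) +
      (Complex.I / 2) • vMul (∑ β, Λ γ β • star Λ a (zDer β b)) := by
  have h : ∑ β, Λ γ β • star Λ a (zDer β b) =
      expSum fun k => ∑ β, Λ γ β • biDer Λ k a (zDer β b) := by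
    have : (fun k => ∑ β, Λ γ β • biDer Λ k a (zDer β b)) =
        ∑ β, Λ γ β • fun k => biDer Λ k a (zDer β b) := by
      funext k; simp only [Finset.sum_apply, Pi.smul_apply]
    rw [this]
    simp only [map_sum, map_smul, star_eq]
  rw [h, ← expSum_shift, star_eq, star_eq, expSum_zMul, ← map_add]
  congr 1
  funext k
  exact biDer_zMul_left Λ k γ a b

theorem star_zMul_right (γ : Idx n) (a b : Fib n C) :
    star Λ a (zMul γ b) = zMul γ (star Λ a b) +
      (Complex.I / 2) • vMul (∑ α, Λ α γ • star Λ (zDer α a) b) := by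
  have h : ∑ α, Λ α γ • star Λ (zDer α a) b =
      expSum fun k => ∑ α, Λ α γ • biDer Λ k (zDer α a) b := by
    have : (fun k => ∑ α, Λ α γ • biDer Λ k (zDer α a) b) =
        ∑ α, Λ α γ • fun k => biDer Λ k (zDer α a) b := by
      funext k; simp only [Finset.sum_apply, Pi.smul_apply]
    rw [this]
    simp only [map_sum, map_smul, star_eq]
  rw [h, ← expSum_shift, star_eq, star_eq, expSum_zMul, ← map_add]
  congr 1
  funext k
  exact biDer_zMul_right Λ k γ a b

end Fib

/-! ### The operators `δ` and `δ⁻¹` -/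

theorem sum_sum_eq_zero_of_antisymm {ι M : Type*} [Fintype ι] [AddCommGroup M] [Module ℂ M]
    (F : ι → ι → M) (h : ∀ α β, F α β = -F β α) : ∑ α, ∑ β, F α β = 0 := by
  have h1 : ∑ α, ∑ β, F α β = -∑ α, ∑ β, F α β := by
    conv_lhs => rw [Finset.sum_comm]
    simp only [← Finset.sum_neg_distrib]
    exact Finset.sum_congr rfl fun _ _ => Finset.sum_congr rfl fun _ _ => h _ _
  have h2 : (2 : ℂ) • ∑ α, ∑ β, F α β = 0 := by
    rw [two_smul]; nth_rewrite 1 [h1]; exact neg_add_cancel _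
  exact (smul_eq_zero_iff_right two_ne_zero).1 h2

namespace Fib

variable {n : ℕ} {C : Type*} [CommRing C] [Algebra ℂ C]

/-- The operator `δ = e^α ∧ ∂/∂z^α`. -/
def del : Fib n C →ₗ[C] Fib n C := ∑ α, (wedge α).comp (zDer α)

/-- The operator `z^α ι(e_α)`. -/
def delAdj : Fib n C →ₗ[C] Fib n C := ∑ α, (zMul α).comp (contr α)

theorem del_apply (a : Fib n C) : del a = ∑ α, wedge α (zDer α a) := by
  simp [del, LinearMap.sum_apply]

theorem delAdj_apply (a : Fib n C) : delAdj a = ∑ α, zMul α (contr α a) := by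
  simp [delAdj, LinearMap.sum_apply]

/-- Multiplication by `f (deg_s + deg_a)`. -/
def weight (f : ℕ → ℂ) : Fib n C →ₗ[C] Fib n C where
  toFun a r m S := f (m.degree + S.card) • a r m S
  map_add' a b := by funext r m S; simp
  map_smul' c a := by funext r m S; simp

theorem weight_apply (f : ℕ → ℂ) (a : Fib n C) (r m S) :
    weight f a r m S = f (m.degree + S.card) • a r m S := rfl

/-- The operator `δ⁻¹`. Since `0⁻¹ = 0`, it vanishes on the part with `deg_s + deg_a = 0`. -/
def delInv : Fib n C →ₗ[C] Fib n C := (weight fun k => (k : ℂ)⁻¹).comp delAdj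

theorem delInv_apply (a : Fib n C) : delInv a = weight (fun k => (k : ℂ)⁻¹) (delAdj a) := rfl

theorem weight_wedge_zDer (f : ℕ → ℂ) (α : Idx n) (a : Fib n C) :
    weight f (wedge α (zDer α a)) = wedge α (zDer α (weight f a)) := by
  funext r m S
  simp only [weight_apply, wedge_apply, zDer_apply]
  split_ifs with h
  · have e : (m + Finsupp.single α 1).degree + (S.erase α).card = m.degree + S.card := by
      rw [map_add, Finsupp.degree_single, Finset.card_erase_of_mem h]
      have := Finset.card_pos.2 ⟨α, h⟩
      omega
    rw [e]
    simp only [mul_smul_comm]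
  · simp

theorem weight_zMul_contr (f : ℕ → ℂ) (α : Idx n) (a : Fib n C) :
    weight f (zMul α (contr α a)) = zMul α (contr α (weight f a)) := by
  funext r m S
  simp only [weight_apply, contr_apply, zMul_apply]
  split_ifs with h h'
  · simp
  · simp
  · have e : (m - Finsupp.single α 1).degree + (insert α S).card = m.degree + S.card := by
      have h2 : m - Finsupp.single α 1 + Finsupp.single α 1 = m := by
        ext i; by_cases hi : i = α
        · subst hi; simp; omega
        · simp [hi]
      rw [Finset.card_insert_of_notMem h']
      conv_rhs => rw [← h2, map_add, Finsupp.degree_single]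
      omega
    rw [e]
    simp only [mul_smul_comm]

theorem weight_del (f : ℕ → ℂ) (a : Fib n C) : weight f (del a) = del (weight f a) := by
  simp only [del_apply, map_sum, weight_wedge_zDer]

theorem weight_delAdj (f : ℕ → ℂ) (a : Fib n C) : weight f (delAdj a) = delAdj (weight f a) := by
  simp only [delAdj_apply, map_sum, weight_zMul_contr]

theorem weight_weight (f g : ℕ → ℂ) (a : Fib n C) : weight f (weight g a) = weight (f * g) a := by
  funext r m S
  simp only [weight_apply, smul_smul, Pi.mul_apply]

theorem del_del (a : Fib n C) : del (del a) = 0 := by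
  simp only [del_apply, map_sum, ← wedge_zDer]
  exact sum_sum_eq_zero_of_antisymm _ fun α β => by rw [wedge_wedge, zDer_comm]

theorem delAdj_delAdj (a : Fib n C) : delAdj (delAdj a) = 0 := by
  simp only [delAdj_apply, map_sum, contr_zMul]
  exact sum_sum_eq_zero_of_antisymm _ fun α β => by rw [contr_contr, map_neg, map_neg, zMul_comm]

theorem delInv_delInv (a : Fib n C) : delInv (delInv a) = 0 := by
  rw [delInv_apply, delInv_apply, ← weight_delAdj, delAdj_delAdj, map_zero, map_zero]

theorem sum_zMul_zDer_apply (a : Fib n C) (r m S) :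
    (∑ α, zMul α (zDer α a)) r m S = (m.degree : C) * a r m S := by
  simp only [Finset.sum_apply]
  have : ∀ α, zMul α (zDer α a) r m S = (m α : C) * a r m S := by
    intro α
    simp only [zMul_apply, zDer_apply]
    split_ifs with h
    · simp [h]
    · have h2 : m - Finsupp.single α 1 + Finsupp.single α 1 = m := by
        ext i; by_cases hi : i = α
        · subst hi; simp; omega
        · simp [hi]
      rw [h2]
      have h3 : (m α : C) = (m α - 1 : ℕ) + 1 := by
        rw [← Nat.cast_add_one, Nat.sub_add_cancel (Nat.pos_of_ne_zero h)]
      simp [h3]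
  rw [Finset.sum_congr rfl fun α _ => this α, ← Finset.sum_mul, Finsupp.degree_eq_sum, Nat.cast_sum]

theorem sum_wedge_contr_apply (a : Fib n C) (r m S) :
    (∑ α, wedge α (contr α a)) r m S = (S.card : C) * a r m S := by
  simp only [Finset.sum_apply]
  have : ∀ α, wedge α (contr α a) r m S = if α ∈ S then a r m S else 0 := by
    intro α
    simp only [wedge_apply, contr_apply]
    split_ifs with h h'
    · simp at h'
    · rw [← _root_.mul_assoc, sgn_mul_self, Finset.insert_erase h, _root_.one_mul]
    · rfl
  simp [this]

/-- The Hodge-type identity for `δ` and `z^α ι(e_α)`. -/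
theorem del_delAdj (a : Fib n C) :
    del (delAdj a) + delAdj (del a) = weight (fun k => (k : ℂ)) a := by
  have h : del (delAdj a) + delAdj (del a) =
      (∑ α, wedge α (contr α a)) + ∑ α, zMul α (zDer α a) := by
    simp only [del_apply, delAdj_apply, map_sum, zDer_zMul, contr_wedge, map_add, map_sub,
      Finset.sum_add_distrib, Finset.sum_sub_distrib]
    have h1 : ∑ β : Idx n, ∑ α, wedge α (if α = β then contr β a else 0) =
        ∑ α, wedge α (contr α a) := by
      refine Finset.sum_congr rfl fun β _ => ?_
      rw [Finset.sum_eq_single β]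
      · simp
      · intro α _ h; simp [h]
      · simp
    have h2 : ∑ β : Idx n, ∑ α, zMul α (if α = β then zDer β a else 0) =
        ∑ α, zMul α (zDer α a) := by
      refine Finset.sum_congr rfl fun β _ => ?_
      rw [Finset.sum_eq_single β]
      · simp
      · intro α _ h; simp [h]
      · simp
    have h3 : ∑ β : Idx n, ∑ α, wedge α (zMul β (zDer α (contr β a))) =
        ∑ β : Idx n, ∑ α, zMul α (wedge β (contr α (zDer β a))) := by
      rw [Finset.sum_comm]
      simp only [wedge_zMul, contr_zDer]
    rw [h1, h2, h3]
    abel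
  rw [h]
  funext r m S
  rw [Pi.add_apply, Pi.add_apply, Pi.add_apply, sum_zMul_zDer_apply, sum_wedge_contr_apply,
    weight_apply, ← add_mul, add_comm (S.card : C), ← Nat.cast_add, Nat.cast_smul_eq_nsmul,
    nsmul_eq_mul]

/-- The Hodge identity, normalized by the sum of the two degrees. -/
theorem del_delInv (a : Fib n C) (h : ∀ r, a r 0 ∅ = 0) :
    del (delInv a) + delInv (del a) = a := by
  rw [delInv_apply, delInv_apply, ← weight_del, ← map_add, del_delAdj, weight_weight]
  funext r m S
  rw [weight_apply, Pi.mul_apply]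
  by_cases h0 : m.degree + S.card = 0
  · obtain ⟨h1, h2⟩ := Nat.add_eq_zero_iff.1 h0
    rw [Finsupp.degree_eq_zero_iff] at h1
    rw [Finset.card_eq_zero] at h2
    subst h1 h2
    rw [h, smul_zero]
  · rw [inv_mul_cancel₀ (by exact_mod_cast h0), one_smul]

variable (Λ : Matrix (Idx n) (Idx n) C)

theorem del_star (a b : Fib n C) :
    del (star Λ a b) = star Λ (del a) b + star Λ (parity a) (del b) := by
  simp only [del_apply, zDer_star, map_add, map_sum, LinearMap.sum_apply, Finset.sum_add_distrib,
    star_wedge_left, star_wedge_right, parity_parity]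

theorem parity_del (a : Fib n C) : parity (del a) = -del (parity a) := by
  simp only [del_apply, map_sum, parity_wedge, parity_zDer, Finset.sum_neg_distrib]

theorem del_vMul (a : Fib n C) : del (vMul a) = vMul (del a) := by
  simp only [del_apply, map_sum, vMul_wedge, vMul_zDer]

theorem eq_zero_of_zDer {x : Fib n C} (h0 : ∀ r S, x r 0 S = 0) (h : ∀ α, zDer α x = 0) :
    x = 0 := by
  funext r m S
  by_cases hm : m = 0
  · rw [hm, h0]; rfl
  · obtain ⟨α, hα⟩ : ∃ α, m α ≠ 0 := by
      by_contra hc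
      push Not at hc
      exact hm (Finsupp.ext hc)
    have h1 := congrFun (congrFun (congrFun (h α) r) (m - Finsupp.single α 1)) S
    have h2 : m - Finsupp.single α 1 + Finsupp.single α 1 = m := by
      ext i; by_cases hi : i = α
      · subst hi; simp; omega
      · simp [hi]
    rw [zDer_apply, h2] at h1
    have h3 : (((m - Finsupp.single α 1 : Idx n →₀ ℕ) α : C) + 1) = algebraMap ℂ C (m α) := by
      rw [map_natCast, ← Nat.cast_add_one, ← DFunLike.congr_fun h2 α]
      simp
    rw [h3, ← Algebra.smul_def] at h1
    exact (smul_eq_zero_iff_right (by exact_mod_cast hα)).1 h1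

theorem star_zOne_sub (x : Fib n C) (β : Idx n) :
    star Λ x (zMul β one) - star Λ (zMul β one) x =
      (Complex.I / 2) • vMul (∑ α, (Λ α β - Λ β α) • zDer α x) := by
  rw [star_zMul_left, star_zMul_right]
  simp only [star_one, one_star, sub_smul, Finset.sum_sub_distrib, map_sub, smul_sub]
  abel

/-- If the antisymmetric part of `Λ` is invertible, an element without `z`-constant part that
commutes with all fibre coordinates vanishes. -/
theorem eq_zero_of_commute {θ : Matrix (Idx n) (Idx n) C}
    (hθ : ∀ τ β, ∑ γ, (Λ β γ - Λ γ β) * θ γ τ = if β = τ then 2 else 0) {x : Fib n C}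
    (h0 : ∀ r S, x r 0 S = 0) (h : ∀ β, star Λ x (zMul β one) = star Λ (zMul β one) x) : x = 0 := by
  refine eq_zero_of_zDer h0 fun τ => ?_
  have h1 : ∀ β, ∑ α, (Λ α β - Λ β α) • zDer α x = 0 := fun β => by
    have h2 := star_zOne_sub Λ x β
    rw [h β, sub_self, ← LinearMap.map_smul_of_tower] at h2
    have h3 := vMul_injective (h2.symm.trans (map_zero _).symm)
    exact (smul_eq_zero_iff_right (by simp)).1 h3
  have h2 : ∑ β, θ β τ • ∑ α, (Λ α β - Λ β α) • zDer α x = 0 := by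
    simp only [h1, smul_zero, Finset.sum_const_zero]
  simp only [Finset.smul_sum, smul_smul] at h2
  rw [Finset.sum_comm] at h2
  simp only [← Finset.sum_smul, mul_comm (θ _ _), hθ, ite_smul, zero_smul, Finset.sum_ite_eq',
    Finset.mem_univ, if_true] at h2
  have h3 : (2 : ℂ) • zDer τ x = 0 := by
    rw [two_smul, ← two_smul C]; exact h2
  exact (smul_eq_zero_iff_right two_ne_zero).1 h3

/-! ### Derivations of the coefficients -/

/-- A derivation of the coefficient ring, applied coefficientwise. -/
def coeffDer (X : Derivation ℂ C C) : Fib n C →ₗ[ℂ] Fib n C where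
  toFun a r m S := X (a r m S)
  map_add' a b := by funext r m S; simp
  map_smul' c a := by funext r m S; simp

theorem coeffDer_apply (X : Derivation ℂ C C) (a : Fib n C) (r m S) :
    coeffDer X a r m S = X (a r m S) := rfl

theorem derivation_neg_one_pow (X : Derivation ℂ C C) (k : ℕ) : X ((-1 : C) ^ k) = 0 := by
  rcases neg_one_pow_eq_or C k with h | h <;> rw [h] <;> simp

theorem derivation_neg_one_pow_mul (X : Derivation ℂ C C) (k : ℕ) (c : C) :
    X ((-1 : C) ^ k * c) = (-1) ^ k * X c := by
  rw [Derivation.leibniz, derivation_neg_one_pow]; simp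

theorem coeffDer_smul (X : Derivation ℂ C C) (c : C) (a : Fib n C) :
    coeffDer X (c • a) = X c • a + c • coeffDer X a := by
  funext r m S
  simp only [coeffDer_apply, Pi.smul_apply, Pi.add_apply, smul_eq_mul, Derivation.leibniz]
  ring

theorem coeffDer_wedge (X : Derivation ℂ C C) (α : Idx n) (a : Fib n C) :
    coeffDer X (wedge α a) = wedge α (coeffDer X a) := by
  funext r m S
  simp only [coeffDer_apply, wedge_apply]
  split_ifs
  · exact derivation_neg_one_pow_mul X _ _
  · simp

theorem coeffDer_contr (X : Derivation ℂ C C) (α : Idx n) (a : Fib n C) :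
    coeffDer X (contr α a) = contr α (coeffDer X a) := by
  funext r m S
  simp only [coeffDer_apply, contr_apply]
  split_ifs
  · simp
  · exact derivation_neg_one_pow_mul X _ _

theorem coeffDer_parity (X : Derivation ℂ C C) (a : Fib n C) :
    coeffDer X (parity a) = parity (coeffDer X a) := by
  funext r m S
  exact derivation_neg_one_pow_mul X _ _

theorem coeffDer_zMul (X : Derivation ℂ C C) (α : Idx n) (a : Fib n C) :
    coeffDer X (zMul α a) = zMul α (coeffDer X a) := by
  funext r m S
  simp only [coeffDer_apply, zMul_apply]
  split_ifs <;> simp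

theorem coeffDer_zDer (X : Derivation ℂ C C) (α : Idx n) (a : Fib n C) :
    coeffDer X (zDer α a) = zDer α (coeffDer X a) := by
  funext r m S
  simp only [coeffDer_apply, zDer_apply, ← Nat.cast_add_one]
  rw [Derivation.leibniz]; simp

theorem coeffDer_vMul (X : Derivation ℂ C C) (a : Fib n C) :
    coeffDer X (vMul a) = vMul (coeffDer X a) := by
  funext r m S
  cases r with
  | zero => simp [coeffDer_apply]
  | succ r => rfl

theorem coeffDer_mul (X : Derivation ℂ C C) (a b : Fib n C) :
    coeffDer X (mul a b) = mul (coeffDer X a) b + mul a (coeffDer X b) := by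
  funext r m S
  simp only [coeffDer_apply, mul_apply, Pi.add_apply, map_sum, ← Finset.sum_add_distrib]
  refine Finset.sum_congr rfl fun x _ => Finset.sum_congr rfl fun y _ =>
    Finset.sum_congr rfl fun T _ => ?_
  rw [sgn, derivation_neg_one_pow_mul, Derivation.leibniz]
  simp only [smul_eq_mul]
  ring

end Fib

/-! ### Linear vector fields on the fibre and multiplication by forms -/

namespace Fib

variable {n : ℕ} {C : Type*} [CommRing C] [Algebra ℂ C]

/-- The linear vector field `M^γ_β z^β ∂/∂z^γ` on the fibre. -/
def lin (M : Matrix (Idx n) (Idx n) C) : Fib n C →ₗ[C] Fib n C :=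
  ∑ γ, ∑ β, M γ β • (zMul β).comp (zDer γ)

theorem lin_apply (M : Matrix (Idx n) (Idx n) C) (a : Fib n C) :
    lin M a = ∑ γ, ∑ β, M γ β • zMul β (zDer γ a) := by
  simp [lin, LinearMap.sum_apply]

theorem lin_add (M N : Matrix (Idx n) (Idx n) C) (a : Fib n C) :
    lin (M + N) a = lin M a + lin N a := by
  simp only [lin_apply, Matrix.add_apply, add_smul, Finset.sum_add_distrib]

theorem lin_neg (M : Matrix (Idx n) (Idx n) C) (a : Fib n C) : lin (-M) a = -lin M a := by
  simp only [lin_apply, Matrix.neg_apply, neg_smul, Finset.sum_neg_distrib]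

theorem lin_sub (M N : Matrix (Idx n) (Idx n) C) (a : Fib n C) :
    lin (M - N) a = lin M a - lin N a := by
  rw [sub_eq_add_neg, lin_add, lin_neg, ← sub_eq_add_neg]

theorem lin_smul (c : C) (M : Matrix (Idx n) (Idx n) C) (a : Fib n C) :
    lin (c • M) a = c • lin M a := by
  simp only [lin_apply, Matrix.smul_apply, smul_eq_mul, mul_smul, Finset.smul_sum]

theorem lin_sum {ι : Type*} (s : Finset ι) (M : ι → Matrix (Idx n) (Idx n) C) (a : Fib n C) :
    lin (∑ i ∈ s, M i) a = ∑ i ∈ s, lin (M i) a := by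
  classical
  induction s using Finset.induction_on with
  | empty => simp [lin_apply]
  | insert i s hi ih => rw [Finset.sum_insert hi, Finset.sum_insert hi, lin_add, ih]

theorem lin_wedge (M : Matrix (Idx n) (Idx n) C) (α : Idx n) (a : Fib n C) :
    lin M (wedge α a) = wedge α (lin M a) := by
  simp only [lin_apply, map_sum, map_smul, ← wedge_zDer, ← wedge_zMul]

theorem lin_contr (M : Matrix (Idx n) (Idx n) C) (α : Idx n) (a : Fib n C) :
    lin M (contr α a) = contr α (lin M a) := by
  simp only [lin_apply, map_sum, map_smul, ← contr_zDer, ← contr_zMul]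

theorem lin_parity (M : Matrix (Idx n) (Idx n) C) (a : Fib n C) :
    lin M (parity a) = parity (lin M a) := by
  simp only [lin_apply, map_sum, map_smul, parity_zDer, parity_zMul]

theorem lin_vMul (M : Matrix (Idx n) (Idx n) C) (a : Fib n C) :
    lin M (vMul a) = vMul (lin M a) := by
  simp only [lin_apply, map_sum, map_smul, vMul_zDer, vMul_zMul]

theorem zDer_lin (M : Matrix (Idx n) (Idx n) C) (μ : Idx n) (a : Fib n C) :
    zDer μ (lin M a) = lin M (zDer μ a) + ∑ γ, M γ μ • zDer γ a := by
  simp only [lin_apply, map_sum, map_smul, zDer_zMul, smul_add, Finset.sum_add_distrib]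
  rw [add_comm]
  congr 1
  · refine Finset.sum_congr rfl fun γ _ => Finset.sum_congr rfl fun β _ => ?_
    rw [zDer_comm]
  · refine Finset.sum_congr rfl fun γ _ => ?_
    rw [Finset.sum_eq_single μ]
    · simp
    · intro β _ h; simp [Ne.symm h]
    · simp

theorem lin_mul (M : Matrix (Idx n) (Idx n) C) (a b : Fib n C) :
    lin M (mul a b) = mul (lin M a) b + mul a (lin M b) := by
  simp only [lin_apply, map_sum, map_smul, zDer_mul, map_add, smul_add, Finset.sum_add_distrib,
    LinearMap.sum_apply, LinearMap.smul_apply, mul_zMul_left, mul_zMul_right]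

theorem lin_lin (M N : Matrix (Idx n) (Idx n) C) (a : Fib n C) :
    lin M (lin N a) - lin N (lin M a) = lin (N * M - M * N) a := by
  have h : ∀ M N : Matrix (Idx n) (Idx n) C, lin M (lin N a) =
      (∑ γ, ∑ β, ∑ δ, ∑ ε, (M γ β * N δ ε) • zMul β (zMul ε (zDer γ (zDer δ a)))) +
        lin (N * M) a := by
    intro M N
    rw [lin_apply]
    simp only [zDer_lin, map_add, map_sum, map_smul, smul_add, Finset.sum_add_distrib,
      Finset.smul_sum, smul_smul]
    congr 1
    · refine Finset.sum_congr rfl fun γ _ => Finset.sum_congr rfl fun β _ => ?_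
      rw [lin_apply]
      simp only [map_sum, map_smul, Finset.smul_sum, smul_smul, zDer_comm γ]
    · rw [lin_apply]
      simp only [Matrix.mul_apply, Finset.sum_smul]
      rw [Finset.sum_congr rfl fun γ _ => Finset.sum_comm]
      rw [Finset.sum_comm]
      refine Finset.sum_congr rfl fun δ _ => ?_
      rw [Finset.sum_comm]
      refine Finset.sum_congr rfl fun β _ => Finset.sum_congr rfl fun γ _ => ?_
      rw [mul_comm]
  have hs : (∑ γ, ∑ β, ∑ δ, ∑ ε, (M γ β * N δ ε) • zMul β (zMul ε (zDer γ (zDer δ a)))) =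
      ∑ γ, ∑ β, ∑ δ, ∑ ε, (N γ β * M δ ε) • zMul β (zMul ε (zDer γ (zDer δ a))) := by
    rw [Finset.sum_congr rfl fun γ _ => Finset.sum_comm, Finset.sum_comm]
    refine Finset.sum_congr rfl fun δ _ => ?_
    rw [Finset.sum_congr rfl fun γ _ => Finset.sum_congr rfl fun β _ => rfl,
      Finset.sum_congr rfl fun γ _ => Finset.sum_comm, Finset.sum_comm]
    refine Finset.sum_congr rfl fun ε _ => Finset.sum_congr rfl fun γ _ =>
      Finset.sum_congr rfl fun β _ => ?_
    rw [zMul_comm, zDer_comm, mul_comm]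
  rw [h M N, h N M, hs, lin_sub]
  abel

/-- Exterior multiplication by the two-form `F_{αβ} e^α ∧ e^β`. -/
def wedge₂ (F : Idx n → Idx n → C) : Fib n C →ₗ[C] Fib n C :=
  ∑ α, ∑ β, F α β • (wedge α).comp (wedge β)

theorem wedge₂_apply (F : Idx n → Idx n → C) (a : Fib n C) :
    wedge₂ F a = ∑ α, ∑ β, F α β • wedge α (wedge β a) := by
  simp [wedge₂, LinearMap.sum_apply]

theorem wedge₂_wedge (F : Idx n → Idx n → C) (μ : Idx n) (a : Fib n C) :
    wedge₂ F (wedge μ a) = wedge μ (wedge₂ F a) := by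
  simp only [wedge₂_apply, map_sum, map_smul]
  refine Finset.sum_congr rfl fun α _ => Finset.sum_congr rfl fun β _ => ?_
  rw [wedge_wedge β μ, map_neg, wedge_wedge α μ, neg_neg]

theorem wedge₂_comm (F G : Idx n → Idx n → C) (a : Fib n C) :
    wedge₂ F (wedge₂ G a) = wedge₂ G (wedge₂ F a) := by
  rw [wedge₂_apply F, wedge₂_apply F]
  simp only [map_sum, map_smul, wedge₂_wedge]

theorem wedge₂_zMul (F : Idx n → Idx n → C) (μ : Idx n) (a : Fib n C) :
    wedge₂ F (zMul μ a) = zMul μ (wedge₂ F a) := by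
  simp only [wedge₂_apply, map_sum, map_smul, wedge_zMul]

theorem wedge₂_zDer (F : Idx n → Idx n → C) (μ : Idx n) (a : Fib n C) :
    wedge₂ F (zDer μ a) = zDer μ (wedge₂ F a) := by
  simp only [wedge₂_apply, map_sum, map_smul, wedge_zDer]

theorem wedge₂_vMul (F : Idx n → Idx n → C) (a : Fib n C) :
    wedge₂ F (vMul a) = vMul (wedge₂ F a) := by
  simp only [wedge₂_apply, map_sum, map_smul, vMul_wedge]

theorem parity_wedge₂ (F : Idx n → Idx n → C) (a : Fib n C) :
    parity (wedge₂ F a) = wedge₂ F (parity a) := by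
  simp only [wedge₂_apply, map_sum, map_smul, parity_wedge, map_neg, neg_neg]

theorem contr_wedge₂ (F : Idx n → Idx n → C) (hF : ∀ α β, F α β = -F β α) (τ : Idx n)
    (a : Fib n C) :
    contr τ (wedge₂ F a) = wedge₂ F (contr τ a) + (2 : ℂ) • ∑ ν, F τ ν • wedge ν a := by
  have h1 : ∑ α : Idx n, ∑ β, F α β • (if τ = α then wedge β a else 0) =
      ∑ ν, F τ ν • wedge ν a := by
    rw [Finset.sum_eq_single τ]
    · simp
    · intro α _ h; simp [Ne.symm h]
    · simp
  have h2 : ∑ α : Idx n, ∑ β, F α β • wedge α (if τ = β then a else 0) =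
      -∑ ν, F τ ν • wedge ν a := by
    rw [← Finset.sum_neg_distrib]
    refine Finset.sum_congr rfl fun α _ => ?_
    rw [Finset.sum_eq_single τ]
    · simp [hF α τ]
    · intro β _ h; simp [Ne.symm h]
    · simp
  simp only [wedge₂_apply, map_sum, map_smul, contr_wedge, map_sub, smul_sub,
    Finset.sum_sub_distrib]
  rw [h1, h2, two_smul]
  abel

theorem star_wedge₂_left (Λ : Matrix (Idx n) (Idx n) C) (F : Idx n → Idx n → C) (a b : Fib n C) :
    star Λ (wedge₂ F a) b = wedge₂ F (star Λ a b) := by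
  simp only [wedge₂_apply, map_sum, map_smul, LinearMap.sum_apply, LinearMap.smul_apply,
    star_wedge_left]

theorem star_wedge₂_right (Λ : Matrix (Idx n) (Idx n) C) (F : Idx n → Idx n → C) (a b : Fib n C) :
    star Λ a (wedge₂ F b) = wedge₂ F (star Λ a b) := by
  simp only [wedge₂_apply, map_sum, map_smul, star_wedge_right, parity_parity]

theorem coeffDer_wedge₂ (X : Derivation ℂ C C) (F : Idx n → Idx n → C) (a : Fib n C) :
    coeffDer X (wedge₂ F a) = wedge₂ (fun α β => X (F α β)) a + wedge₂ F (coeffDer X a) := by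
  simp only [wedge₂_apply, map_sum, coeffDer_smul, coeffDer_wedge, Finset.sum_add_distrib]

/-- A three-form with coefficients whose cyclic sums vanish is zero. -/
theorem sum_wedge_wedge_wedge {c : Idx n → Idx n → Idx n → C}
    (h : ∀ α β γ, c α β γ + c β γ α + c γ α β = 0) (a : Fib n C) :
    ∑ α, ∑ β, ∑ γ, c α β γ • wedge α (wedge β (wedge γ a)) = 0 := by
  set s := ∑ α, ∑ β, ∑ γ, c α β γ • wedge α (wedge β (wedge γ a)) with hs
  have hrot : ∀ α β γ, wedge γ (wedge α (wedge β a)) = wedge α (wedge β (wedge γ a)) := by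
    intro α β γ
    rw [wedge_wedge γ α, wedge_wedge γ β, map_neg, neg_neg]
  have h1 : s = ∑ α, ∑ β, ∑ γ, c β γ α • wedge α (wedge β (wedge γ a)) := by
    rw [hs, Finset.sum_congr rfl fun α _ => Finset.sum_comm, Finset.sum_comm]
    refine Finset.sum_congr rfl fun γ _ => Finset.sum_congr rfl fun α _ =>
      Finset.sum_congr rfl fun β _ => ?_
    rw [hrot, hrot]
  have h2 : s = ∑ α, ∑ β, ∑ γ, c γ α β • wedge α (wedge β (wedge γ a)) := by
    rw [hs, Finset.sum_comm]
    refine Finset.sum_congr rfl fun β _ => ?_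
    rw [Finset.sum_comm]
    refine Finset.sum_congr rfl fun γ _ => Finset.sum_congr rfl fun α _ => ?_
    rw [← hrot, ← hrot]
  have h3 : s + s + s = 0 := by
    have : s + s + s = s + (∑ α, ∑ β, ∑ γ, c β γ α • wedge α (wedge β (wedge γ a))) +
        ∑ α, ∑ β, ∑ γ, c γ α β • wedge α (wedge β (wedge γ a)) := by rw [← h1, ← h2]
    rw [this, hs]
    simp only [← Finset.sum_add_distrib, ← add_smul, h, zero_smul, Finset.sum_const_zero]
  have h4 : (3 : ℂ) • s = 0 := by
    rw [← h3, show (3 : ℂ) = 1 + 1 + 1 by norm_num, add_smul, add_smul, one_smul]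
  exact (smul_eq_zero_iff_right three_ne_zero).1 h4

end Fib

/-! ### Fedosov data -/

/-- The algebraic data of Fedosov's construction over a ring of functions `C`: a frame `X_α` with
structure functions `W^τ_{αβ}`, a connection with the matrices `(Γ_α)^τ_β = Γ^τ_{βα}`, a parallel
bivector `Λ^{αβ}` whose antisymmetric part is invertible, with inverse determined by the closed
two-form `θ`. -/
structure FedosovData (n : ℕ) (C : Type*) [CommRing C] [Algebra ℂ C] where
  X : Idx n → Derivation ℂ C C
  W : Idx n → Idx n → Idx n → C
  Γ : Idx n → Matrix (Idx n) (Idx n) C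
  Λ : Matrix (Idx n) (Idx n) C
  θ : Matrix (Idx n) (Idx n) C
  commutator : ∀ α β f, X α (X β f) - X β (X α f) = ∑ τ, W τ α β * X τ f
  W_antisymm : ∀ τ α β, W τ α β = -W τ β α
  jacobi : ∀ σ α μ ν, (X α (W σ μ ν) + ∑ τ, W τ μ ν * W σ α τ) +
    (X μ (W σ ν α) + ∑ τ, W τ ν α * W σ μ τ) + (X ν (W σ α μ) + ∑ τ, W τ α μ * W σ ν τ) = 0
  Λ_parallel : ∀ α, Λ.map (X α) + Γ α * Λ + Λ * (Γ α)ᵀ = 0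
  Λ_θ : (Λ - Λᵀ) * θ = (-2 : C) • (1 : Matrix (Idx n) (Idx n) C)
  θ_closed : ∀ α β γ, X α (θ β γ) + X β (θ γ α) + X γ (θ α β) =
    ∑ τ, (W τ α β * θ τ γ + W τ β γ * θ τ α + W τ γ α * θ τ β)

namespace FedosovData

open Fib

variable {n : ℕ} {C : Type*} [CommRing C] [Algebra ℂ C] (D : FedosovData n C)

/-- The covariant derivative along the frame vector `e_α`. -/
def nabla (α : Idx n) : Fib n C →ₗ[ℂ] Fib n C :=
  coeffDer (D.X α) - (lin (D.Γ α)).restrictScalars ℂ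

theorem nabla_apply (α : Idx n) (a : Fib n C) :
    D.nabla α a = coeffDer (D.X α) a - lin (D.Γ α) a := rfl

theorem nabla_smul (α : Idx n) (c : C) (a : Fib n C) :
    D.nabla α (c • a) = D.X α c • a + c • D.nabla α a := by
  rw [nabla_apply, nabla_apply, coeffDer_smul, map_smul, smul_sub]; abel

theorem nabla_wedge (α β : Idx n) (a : Fib n C) :
    D.nabla α (wedge β a) = wedge β (D.nabla α a) := by
  rw [nabla_apply, nabla_apply, coeffDer_wedge, lin_wedge, map_sub]

theorem nabla_contr (α β : Idx n) (a : Fib n C) :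
    D.nabla α (contr β a) = contr β (D.nabla α a) := by
  rw [nabla_apply, nabla_apply, coeffDer_contr, lin_contr, map_sub]

theorem nabla_parity (α : Idx n) (a : Fib n C) :
    D.nabla α (parity a) = parity (D.nabla α a) := by
  rw [nabla_apply, nabla_apply, coeffDer_parity, lin_parity, map_sub]

theorem nabla_vMul (α : Idx n) (a : Fib n C) :
    D.nabla α (vMul a) = vMul (D.nabla α a) := by
  rw [nabla_apply, nabla_apply, coeffDer_vMul, lin_vMul, map_sub]

theorem nabla_zDer (α μ : Idx n) (a : Fib n C) :
    D.nabla α (zDer μ a) = zDer μ (D.nabla α a) + ∑ γ, D.Γ α γ μ • zDer γ a := by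
  rw [nabla_apply, nabla_apply, coeffDer_zDer, map_sub, zDer_lin]; abel

theorem nabla_wedge₂ (α : Idx n) (F : Idx n → Idx n → C) (a : Fib n C) :
    D.nabla α (wedge₂ F a) = wedge₂ (fun μ ν => D.X α (F μ ν)) a + wedge₂ F (D.nabla α a) := by
  have : lin (D.Γ α) (wedge₂ F a) = wedge₂ F (lin (D.Γ α) a) := by
    simp only [wedge₂_apply, map_sum, map_smul, lin_wedge]
  rw [nabla_apply, nabla_apply, coeffDer_wedge₂, map_sub, this]; abel

theorem nabla_mul (α : Idx n) (a b : Fib n C) :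
    D.nabla α (mul a b) = mul (D.nabla α a) b + mul a (D.nabla α b) := by
  simp only [nabla_apply, coeffDer_mul, lin_mul, map_sub, LinearMap.sub_apply]; abel

/-- The covariant derivative is a derivation of the bidifferential operators: the terms with `Γ` and
with the derivative of `Λ` cancel because `Λ` is parallel. -/
theorem nabla_biDer (α : Idx n) (k : ℕ) (a b : Fib n C) :
    D.nabla α (biDer D.Λ k a b) = biDer D.Λ k (D.nabla α a) b + biDer D.Λ k a (D.nabla α b) := by
  induction k generalizing a b with
  | zero => exact D.nabla_mul α a b
  | succ k ih =>
    -- the terms in which the connection acts on the index of `∂/∂z` of the first factor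
    have h1 : ∑ μ, ∑ ν, D.Λ μ ν • biDer D.Λ k (D.nabla α (zDer μ a)) (zDer ν b) =
        biDer D.Λ (k + 1) (D.nabla α a) b +
          ∑ μ, ∑ ν, (D.Γ α * D.Λ) μ ν • biDer D.Λ k (zDer μ a) (zDer ν b) := by
      simp only [nabla_zDer, map_add, LinearMap.add_apply, smul_add, Finset.sum_add_distrib,
        biDer_succ, map_sum, map_smul, LinearMap.sum_apply, LinearMap.smul_apply,
        Matrix.mul_apply, Finset.sum_smul, Finset.smul_sum, smul_smul]
      congr 1
      rw [Finset.sum_congr rfl fun μ _ => Finset.sum_comm, Finset.sum_comm]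
      refine Finset.sum_congr rfl fun μ _ => ?_
      rw [Finset.sum_comm]
      refine Finset.sum_congr rfl fun ν _ => Finset.sum_congr rfl fun γ _ => ?_
      rw [mul_comm]
    -- the same for the second factor
    have h2 : ∑ μ, ∑ ν, D.Λ μ ν • biDer D.Λ k (zDer μ a) (D.nabla α (zDer ν b)) =
        biDer D.Λ (k + 1) a (D.nabla α b) +
          ∑ μ, ∑ ν, (D.Λ * (D.Γ α)ᵀ) μ ν • biDer D.Λ k (zDer μ a) (zDer ν b) := by
      simp only [nabla_zDer, map_add, smul_add, Finset.sum_add_distrib,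
        biDer_succ, map_sum, map_smul, Matrix.transpose_apply,
        Matrix.mul_apply, Finset.sum_smul, Finset.smul_sum, smul_smul]
      congr 1
      refine Finset.sum_congr rfl fun μ _ => ?_
      rw [Finset.sum_comm]
    -- the three corrections cancel
    have h3 : ∑ μ, ∑ ν, D.X α (D.Λ μ ν) • biDer D.Λ k (zDer μ a) (zDer ν b) +
        ∑ μ, ∑ ν, (D.Γ α * D.Λ) μ ν • biDer D.Λ k (zDer μ a) (zDer ν b) +
        ∑ μ, ∑ ν, (D.Λ * (D.Γ α)ᵀ) μ ν • biDer D.Λ k (zDer μ a) (zDer ν b) = 0 := by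
      simp only [← Finset.sum_add_distrib, ← add_smul]
      refine Finset.sum_eq_zero fun μ _ => Finset.sum_eq_zero fun ν _ => ?_
      have := congrFun (congrFun (D.Λ_parallel α) μ) ν
      simp only [Matrix.add_apply, Matrix.map_apply, Matrix.zero_apply] at this
      rw [this, zero_smul]
    rw [biDer_succ]
    simp only [map_sum, nabla_smul, ih, smul_add, Finset.sum_add_distrib]
    rw [h1, h2, ← sub_eq_zero, ← h3]
    abel

theorem isSlicewise_nabla (α : Idx n) : IsSlicewise (D.nabla α) := fun a r => by
  funext m S
  simp only [nabla_apply, lin_apply, Pi.sub_apply, Finset.sum_apply]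
  rfl

theorem nabla_star (α : Idx n) (a b : Fib n C) :
    D.nabla α (star D.Λ a b) = star D.Λ (D.nabla α a) b + star D.Λ a (D.nabla α b) := by
  simp only [star_eq, expSum_map (D.isSlicewise_nabla α), nabla_biDer]
  exact map_add expSum _ _

/-- The exterior derivative on the coframe, `-(1/2) W^τ_{αβ} e^α ∧ e^β ∧ ι(e_τ)`. -/
def frameD (a : Fib n C) : Fib n C := -(1 / 2 : ℂ) • ∑ τ, wedge₂ (D.W τ) (contr τ a)

/-- The extension of the connection to `W ⊗ Λ`. -/
def conn : Fib n C →ₗ[ℂ] Fib n C where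
  toFun a := ∑ α, wedge α (D.nabla α a) + D.frameD a
  map_add' a b := by
    simp only [frameD, map_add, Finset.sum_add_distrib, smul_add]; abel
  map_smul' c a := by
    simp only [frameD, map_smul, LinearMap.map_smul_of_tower, Finset.smul_sum, smul_add,
      RingHom.id_apply, smul_comm c]

theorem conn_apply (a : Fib n C) : D.conn a = ∑ α, wedge α (D.nabla α a) + D.frameD a := rfl

theorem frameD_star (a b : Fib n C) :
    D.frameD (star D.Λ a b) = star D.Λ (D.frameD a) b + star D.Λ (parity a) (D.frameD b) := by
  simp only [frameD, contr_star, map_add, Finset.sum_add_distrib, smul_add, map_sum,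
    LinearMap.map_smul_of_tower, LinearMap.smul_apply, LinearMap.sum_apply, star_wedge₂_left,
    star_wedge₂_right]

theorem conn_star (a b : Fib n C) :
    D.conn (star D.Λ a b) = star D.Λ (D.conn a) b + star D.Λ (parity a) (D.conn b) := by
  simp only [conn_apply, frameD_star, nabla_star, map_add, map_sum, LinearMap.add_apply,
    LinearMap.sum_apply, Finset.sum_add_distrib, star_wedge_left, star_wedge_right, parity_parity]
  abel

theorem frameD_vMul (a : Fib n C) : D.frameD (vMul a) = vMul (D.frameD a) := by
  simp only [frameD, ← vMul_contr, wedge₂_vMul, map_sum, LinearMap.map_smul_of_tower]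

theorem conn_vMul (a : Fib n C) : D.conn (vMul a) = vMul (D.conn a) := by
  simp only [conn_apply, frameD_vMul, nabla_vMul, map_add, map_sum, vMul_wedge]

theorem frameD_parity (a : Fib n C) : parity (D.frameD a) = -D.frameD (parity a) := by
  simp only [frameD, LinearMap.map_smul_of_tower, map_sum, parity_wedge₂, parity_contr, map_neg,
    Finset.sum_neg_distrib, smul_neg]

theorem conn_parity (a : Fib n C) : parity (D.conn a) = -D.conn (parity a) := by
  simp only [conn_apply, map_add, frameD_parity, map_sum, parity_wedge, nabla_parity,
    Finset.sum_neg_distrib]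
  abel

/-! ### Torsion and curvature -/

/-- The torsion coefficients, with `T(e_β, e_α) = T^τ_{αβ} e_τ`. -/
def torsion (τ α β : Idx n) : C := D.Γ β τ α - D.Γ α τ β - D.W τ β α

/-- The curvature endomorphism `R(e_α, e_β)`. -/
def curvature (α β : Idx n) : Matrix (Idx n) (Idx n) C :=
  (D.Γ β).map (D.X α) - (D.Γ α).map (D.X β) + D.Γ α * D.Γ β - D.Γ β * D.Γ α
    - ∑ μ, D.W μ α β • D.Γ μ

theorem frameD_wedge (β : Idx n) (a : Fib n C) :
    D.frameD (wedge β a) = -(1 / 2 : ℂ) • wedge₂ (D.W β) a - wedge β (D.frameD a) := by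
  simp only [frameD, contr_wedge, map_sub, Finset.sum_sub_distrib, smul_sub, wedge₂_wedge,
    LinearMap.map_smul_of_tower, map_sum]
  congr 2
  rw [Finset.sum_eq_single β]
  · simp
  · intro τ _ h; simp [h]
  · simp

theorem frameD_zDer (β : Idx n) (a : Fib n C) : D.frameD (zDer β a) = zDer β (D.frameD a) := by
  simp only [frameD, contr_zDer, wedge₂_zDer, LinearMap.map_smul_of_tower, map_sum]

/-- The graded commutator of `δ` and the connection is the torsion. -/
theorem del_conn_add_conn_del (a : Fib n C) :
    del (D.conn a) + D.conn (del a) =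
      -(1 / 2 : ℂ) • ∑ γ, wedge₂ (D.torsion γ) (zDer γ a) := by
  have h1 : D.conn (del a) = ∑ α, ∑ β, wedge α (wedge β (zDer β (D.nabla α a))) +
      ∑ α, ∑ β, ∑ γ, D.Γ α γ β • wedge α (wedge β (zDer γ a)) +
      (-(1 / 2 : ℂ) • ∑ γ, wedge₂ (D.W γ) (zDer γ a) - ∑ β, wedge β (zDer β (D.frameD a))) := by
    have hf : D.frameD (del a) = -(1 / 2 : ℂ) • ∑ γ, wedge₂ (D.W γ) (zDer γ a)
        - ∑ β, wedge β (zDer β (D.frameD a)) := by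
      have : ∀ s : Finset (Idx n), D.frameD (∑ β ∈ s, wedge β (zDer β a)) =
          ∑ β ∈ s, D.frameD (wedge β (zDer β a)) := by
        intro s
        simp only [frameD, map_sum, ← Finset.smul_sum]
        congr 1
        rw [Finset.sum_comm]
      rw [del_apply, this]
      simp only [frameD_wedge, Finset.sum_sub_distrib, frameD_zDer, Finset.smul_sum]
    rw [conn_apply, hf, del_apply]
    congr 1
    simp only [map_sum, nabla_wedge, nabla_zDer, map_add, map_smul, Finset.sum_add_distrib]
  have h2 : del (D.conn a) = ∑ α, ∑ β, wedge β (wedge α (zDer β (D.nabla α a))) +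
      ∑ β, wedge β (zDer β (D.frameD a)) := by
    rw [conn_apply, map_add, del_apply (D.frameD a)]
    congr 1
    rw [map_sum]
    simp only [del_apply, wedge_zDer]
  -- the second derivatives cancel, and what remains is antisymmetrized in `α, β`
  have h3 : ∑ α, ∑ β, wedge β (wedge α (zDer β (D.nabla α a))) =
      -∑ α, ∑ β, wedge α (wedge β (zDer β (D.nabla α a))) := by
    simp only [← Finset.sum_neg_distrib]
    exact Finset.sum_congr rfl fun α _ => Finset.sum_congr rfl fun β _ => wedge_wedge _ _ _
  have h4 : (1 / 2 : ℂ) • ∑ γ, ∑ α, ∑ β, (D.Γ α γ β - D.Γ β γ α) • wedge α (wedge β (zDer γ a)) =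
      ∑ α, ∑ β, ∑ γ, D.Γ α γ β • wedge α (wedge β (zDer γ a)) := by
    have h5 : ∑ γ, ∑ α, ∑ β, D.Γ β γ α • wedge α (wedge β (zDer γ a)) =
        -∑ γ, ∑ α, ∑ β, D.Γ α γ β • wedge α (wedge β (zDer γ a)) := by
      simp only [← Finset.sum_neg_distrib]
      refine Finset.sum_congr rfl fun γ _ => ?_
      rw [Finset.sum_comm]
      refine Finset.sum_congr rfl fun α _ => Finset.sum_congr rfl fun β _ => ?_
      rw [wedge_wedge, smul_neg]
    simp only [sub_smul, Finset.sum_sub_distrib]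
    rw [h5, sub_neg_eq_add, ← two_smul ℂ, smul_smul, one_div, inv_mul_cancel₀ two_ne_zero, one_smul,
      Finset.sum_comm]
    exact Finset.sum_congr rfl fun α _ => Finset.sum_comm
  have h6 : -(1 / 2 : ℂ) • ∑ γ, wedge₂ (D.torsion γ) (zDer γ a) =
      (1 / 2 : ℂ) • ∑ γ, ∑ α, ∑ β, (D.Γ α γ β - D.Γ β γ α) • wedge α (wedge β (zDer γ a)) +
      -(1 / 2 : ℂ) • ∑ γ, wedge₂ (D.W γ) (zDer γ a) := by
    rw [neg_smul, neg_smul, ← smul_neg, ← smul_neg, ← smul_add]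
    congr 1
    simp only [wedge₂_apply, ← Finset.sum_neg_distrib, ← Finset.sum_add_distrib, ← neg_smul,
      ← add_smul, torsion]
    refine Finset.sum_congr rfl fun γ _ => Finset.sum_congr rfl fun α _ =>
      Finset.sum_congr rfl fun β _ => ?_
    rw [D.W_antisymm γ β α]
    congr 1
    ring
  rw [h1, h2, h3, h6, h4]
  abel

/-- The exterior derivative of the coframe has square zero: this is the Jacobi identity of the
frame. -/
theorem frameD_frameD (a : Fib n C) :
    ∑ α, wedge α ((-(1 / 2 : ℂ)) • ∑ τ, wedge₂ (fun μ ν => D.X α (D.W τ μ ν)) (contr τ a)) +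
      D.frameD (D.frameD a) = 0 := by
  have h1 : D.frameD (D.frameD a) =
      (1 / 4 : ℂ) • ∑ τ, ∑ σ, wedge₂ (D.W τ) (contr τ (wedge₂ (D.W σ) (contr σ a))) := by
    simp only [frameD, map_sum, LinearMap.map_smul_of_tower, ← Finset.smul_sum, smul_smul]
    norm_num
  -- two contractions anticommute, while two-forms commute
  have h2 : ∑ τ, ∑ σ, wedge₂ (D.W τ) (wedge₂ (D.W σ) (contr τ (contr σ a))) = 0 :=
    sum_sum_eq_zero_of_antisymm _ fun τ σ => by
      rw [wedge₂_comm, contr_contr, map_neg, map_neg]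
  have h3 : ∑ τ, ∑ σ, wedge₂ (D.W τ) (contr τ (wedge₂ (D.W σ) (contr σ a))) =
      (2 : ℂ) • ∑ σ, ∑ α, ∑ μ, ∑ ν, (∑ τ, D.W τ α μ * D.W σ τ ν) •
        wedge α (wedge μ (wedge ν (contr σ a))) := by
    simp only [contr_wedge₂ _ (D.W_antisymm _), map_add, Finset.sum_add_distrib, h2, zero_add,
      LinearMap.map_smul_of_tower, ← Finset.smul_sum]
    congr 1
    rw [Finset.sum_comm]
    refine Finset.sum_congr rfl fun σ _ => ?_
    simp only [map_sum, map_smul, wedge₂_apply, Finset.sum_smul, Finset.smul_sum, smul_smul]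
    rw [Finset.sum_congr rfl fun τ _ => Finset.sum_comm, Finset.sum_comm]
    refine Finset.sum_congr rfl fun α _ => ?_
    rw [Finset.sum_congr rfl fun τ _ => Finset.sum_comm, Finset.sum_comm]
    refine Finset.sum_congr rfl fun μ _ => ?_
    rw [Finset.sum_comm]
    refine Finset.sum_congr rfl fun ν _ => Finset.sum_congr rfl fun τ _ => ?_
    rw [mul_comm]
  have h4 : ∑ α, wedge α ((-(1 / 2 : ℂ)) • ∑ τ, wedge₂ (fun μ ν => D.X α (D.W τ μ ν)) (contr τ a)) =
      -(1 / 2 : ℂ) • ∑ σ, ∑ α, ∑ μ, ∑ ν, D.X α (D.W σ μ ν) •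
        wedge α (wedge μ (wedge ν (contr σ a))) := by
    simp only [LinearMap.map_smul_of_tower, ← Finset.smul_sum, map_sum, wedge₂_apply, map_smul]
    rw [Finset.sum_comm]
  -- antisymmetrization in `α, μ, ν` turns the difference into the Jacobi identity
  have h5 : ∀ σ, ∑ α, ∑ μ, ∑ ν, (∑ τ, D.W τ α μ * D.W σ τ ν) •
        wedge α (wedge μ (wedge ν (contr σ a))) -
      ∑ α, ∑ μ, ∑ ν, D.X α (D.W σ μ ν) • wedge α (wedge μ (wedge ν (contr σ a))) = 0 := by
    intro σ
    simp only [← Finset.sum_sub_distrib, ← sub_smul]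
    refine sum_wedge_wedge_wedge (fun α μ ν => ?_) _
    have hW : ∀ x y z, ∑ τ, D.W τ x y * D.W σ z τ = -∑ τ, D.W τ x y * D.W σ τ z := by
      intro x y z
      rw [← Finset.sum_neg_distrib]
      exact Finset.sum_congr rfl fun τ _ => by rw [D.W_antisymm σ z τ, mul_neg]
    have hj := D.jacobi σ α μ ν
    rw [hW, hW, hW] at hj
    linear_combination -hj
  rw [h1, h3, h4, smul_smul, neg_smul, neg_add_eq_sub,
    show (1 / 4 * 2 : ℂ) = 1 / 2 by norm_num, ← smul_sub, ← Finset.sum_sub_distrib]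
  simp only [h5, Finset.sum_const_zero, smul_zero]

/-- The commutator of covariant derivatives. -/
theorem nabla_nabla_sub (α β : Idx n) (a : Fib n C) :
    D.nabla α (D.nabla β a) - D.nabla β (D.nabla α a) - ∑ τ, D.W τ α β • D.nabla τ a =
      -lin (D.curvature α β) a := by
  have h1 : ∀ (X : Derivation ℂ C C) (M : Matrix (Idx n) (Idx n) C),
      coeffDer X (lin M a) = lin (M.map X) a + lin M (coeffDer X a) := by
    intro X M
    simp only [lin_apply, map_sum, coeffDer_smul, coeffDer_zMul, coeffDer_zDer,
      Finset.sum_add_distrib, Matrix.map_apply]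
  have h2 : coeffDer (D.X α) (coeffDer (D.X β) a) - coeffDer (D.X β) (coeffDer (D.X α) a) =
      ∑ τ, D.W τ α β • coeffDer (D.X τ) a := by
    funext r m S
    simp only [Pi.sub_apply, coeffDer_apply, D.commutator, Finset.sum_apply, Pi.smul_apply,
      smul_eq_mul]
  have h3 := lin_lin (D.Γ α) (D.Γ β) a
  simp only [nabla_apply, map_sub, h1, smul_sub, Finset.sum_sub_distrib, ← h2, curvature, lin_sub,
    lin_add, lin_sum, lin_smul]
  rw [lin_sub] at h3
  rw [← sub_eq_zero] at h3 ⊢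
  rw [← h3]
  abel

/-- The square of the connection is the curvature. -/
theorem conn_conn (a : Fib n C) :
    D.conn (D.conn a) =
      (1 / 2 : ℂ) • ∑ α, ∑ β, wedge α (wedge β (lin (D.curvature β α) a)) := by
  have hadd : ∀ x y, D.frameD (x + y) = D.frameD x + D.frameD y := fun x y => by
    simp only [frameD, map_add, Finset.sum_add_distrib, smul_add]
  have hsum : ∀ f : Idx n → Fib n C, D.frameD (∑ β, f β) = ∑ β, D.frameD (f β) := by
    intro f
    simp only [frameD, map_sum, ← Finset.smul_sum]
    congr 1
    rw [Finset.sum_comm]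
  have h1 : ∀ α, D.nabla α (D.frameD a) =
      (-(1 / 2 : ℂ)) • ∑ τ, wedge₂ (fun μ ν => D.X α (D.W τ μ ν)) (contr τ a) +
        D.frameD (D.nabla α a) := by
    intro α
    simp only [frameD, map_smul, map_sum, nabla_wedge₂, nabla_contr, Finset.sum_add_distrib,
      smul_add]
  have h2 : D.conn (D.conn a) =
      ∑ α, ∑ β, wedge α (wedge β (D.nabla α (D.nabla β a))) +
      -(1 / 2 : ℂ) • ∑ τ, wedge₂ (D.W τ) (D.nabla τ a) := by
    have h3 : D.conn (D.conn a) = ∑ α, ∑ β, wedge α (wedge β (D.nabla α (D.nabla β a))) +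
        ∑ α, wedge α (D.nabla α (D.frameD a)) + (∑ β, D.frameD (wedge β (D.nabla β a)) +
        D.frameD (D.frameD a)) := by
      rw [conn_apply, conn_apply, hadd, hsum]
      simp only [map_add, map_sum, Finset.sum_add_distrib, nabla_wedge]
    have h4 := D.frameD_frameD a
    rw [h3]
    simp only [h1, frameD_wedge, map_add, Finset.sum_add_distrib, Finset.sum_sub_distrib,
      Finset.smul_sum] at h4 ⊢
    rw [← sub_eq_zero] at h4 ⊢
    rw [← h4]
    abel
  -- antisymmetrization of the second covariant derivatives
  have h5 : ∑ α, ∑ β, wedge α (wedge β (D.nabla α (D.nabla β a))) =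
      (1 / 2 : ℂ) • ∑ α, ∑ β,
        wedge α (wedge β (D.nabla α (D.nabla β a) - D.nabla β (D.nabla α a))) := by
    have h6 : ∑ α, ∑ β, wedge α (wedge β (D.nabla β (D.nabla α a))) =
        -∑ α, ∑ β, wedge α (wedge β (D.nabla α (D.nabla β a))) := by
      rw [Finset.sum_comm]
      simp only [← Finset.sum_neg_distrib]
      exact Finset.sum_congr rfl fun α _ => Finset.sum_congr rfl fun β _ => wedge_wedge _ _ _
    simp only [map_sub, Finset.sum_sub_distrib]
    rw [h6, sub_neg_eq_add, ← two_smul ℂ, smul_smul, one_div, inv_mul_cancel₀ two_ne_zero, one_smul]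
  have h7 : ∑ τ, wedge₂ (D.W τ) (D.nabla τ a) =
      ∑ α, ∑ β, wedge α (wedge β (∑ τ, D.W τ α β • D.nabla τ a)) := by
    simp only [wedge₂_apply, map_sum, map_smul]
    rw [Finset.sum_comm]
    exact Finset.sum_congr rfl fun α _ => Finset.sum_comm
  rw [h2, h5, h7, neg_smul, ← sub_eq_add_neg, ← smul_sub]
  congr 1
  have h8 : ∀ α β, lin (D.curvature β α) a = -lin (D.curvature α β) a := by
    intro α β
    rw [← lin_neg]
    congr 2
    simp only [curvature, D.W_antisymm _ β α, neg_smul, Finset.sum_neg_distrib]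
    abel
  simp only [← Finset.sum_sub_distrib, ← map_sub, nabla_nabla_sub]
  exact Finset.sum_congr rfl fun α _ => Finset.sum_congr rfl fun β _ => by rw [h8 α β]

end FedosovData

namespace FedosovData

open Fib

variable {n : ℕ} {C : Type*} [CommRing C] [Algebra ℂ C] (D : FedosovData n C)

/-! ### Torsion and curvature as inner derivations -/

/-- The element `(1/2) z^γ θ_{γτ} T^τ_{αβ} e^α ∧ e^β`. -/
def torsionElt : Fib n C :=
  (1 / 2 : ℂ) • ∑ γ, ∑ τ, D.θ γ τ • zMul γ (wedge₂ (D.torsion τ) one)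

/-- The element `(1/4) z^γ z^φ θ_{γτ} R^τ_{φαβ} e^α ∧ e^β`. -/
def curvatureElt : Fib n C :=
  (1 / 4 : ℂ) • ∑ α, ∑ β, ∑ γ, ∑ φ, (D.θ * D.curvature β α) γ φ •
    zMul γ (zMul φ (wedge α (wedge β one)))

theorem θ_Λ : D.θ * (D.Λ - D.Λᵀ) = (-2 : C) • (1 : Matrix (Idx n) (Idx n) C) := by
  have h2 : algebraMap ℂ C (-1 / 2) * (-2) = 1 := by
    rw [show (-2 : C) = algebraMap ℂ C (-2) by rw [map_neg, map_ofNat], ← map_mul]; norm_num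
  have h : (D.Λ - D.Λᵀ) * (algebraMap ℂ C (-1 / 2) • D.θ) = 1 := by
    rw [Matrix.mul_smul, D.Λ_θ, smul_smul, h2, one_smul]
  have h' := mul_eq_one_comm.1 h
  rw [Matrix.smul_mul] at h'
  calc D.θ * (D.Λ - D.Λᵀ) = (algebraMap ℂ C (-1 / 2) * (-2)) • (D.θ * (D.Λ - D.Λᵀ)) := by
        rw [h2, one_smul]
    _ = (-2 : C) • (algebraMap ℂ C (-1 / 2) • (D.θ * (D.Λ - D.Λᵀ))) := by rw [smul_smul, mul_comm]
    _ = _ := by rw [h']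

theorem two_smul_injective {M N : Matrix (Idx n) (Idx n) C} (h : (2 : C) • M = (2 : C) • N) :
    M = N := by
  have h2 : algebraMap ℂ C (1 / 2) * 2 = 1 := by
    rw [show (2 : C) = algebraMap ℂ C 2 by rw [map_ofNat], ← map_mul]; norm_num
  have := congrArg (fun M => algebraMap ℂ C (1 / 2) • M) h
  simpa only [smul_smul, h2, one_smul] using this

theorem θ_transpose : D.θᵀ = -D.θ := by
  have h1 := congrArg Matrix.transpose D.Λ_θ
  rw [Matrix.transpose_mul, Matrix.transpose_sub, Matrix.transpose_transpose, Matrix.transpose_smul,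
    Matrix.transpose_one] at h1
  have h2 : D.θᵀ * (D.Λᵀ - D.Λ) * D.θ = (-2 : C) • D.θ := by
    rw [h1, Matrix.smul_mul, Matrix.one_mul]
  have h3 : (D.Λᵀ - D.Λ) * D.θ = (2 : C) • 1 := by
    rw [← neg_sub, Matrix.neg_mul, D.Λ_θ, ← neg_smul, neg_neg]
  rw [Matrix.mul_assoc, h3, Matrix.mul_smul, Matrix.mul_one, neg_smul, ← smul_neg] at h2
  exact two_smul_injective h2

theorem map_mul_derivation (X : Derivation ℂ C C) {l m k : Type*} [Fintype m]
    (M : Matrix l m C) (N : Matrix m k C) :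
    (M * N).map X = M.map X * N + M * N.map X := by
  ext i j
  simp only [Matrix.map_apply, Matrix.mul_apply, Matrix.add_apply, map_sum, Derivation.leibniz,
    smul_eq_mul, ← Finset.sum_add_distrib]
  exact Finset.sum_congr rfl fun k _ => by ring

theorem map_add_derivation (X : Derivation ℂ C C) (M N : Matrix (Idx n) (Idx n) C) :
    (M + N).map X = M.map X + N.map X := by
  ext i j; simp

theorem map_sub_derivation (X : Derivation ℂ C C) (M N : Matrix (Idx n) (Idx n) C) :
    (M - N).map X = M.map X - N.map X := by
  ext i j; simp

theorem map_neg_derivation (X : Derivation ℂ C C) (M : Matrix (Idx n) (Idx n) C) :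
    (-M).map X = -M.map X := by
  ext i j; simp

theorem map_transpose_derivation (X : Derivation ℂ C C) (M : Matrix (Idx n) (Idx n) C) :
    Mᵀ.map X = (M.map X)ᵀ := rfl

theorem Λ_map (α : Idx n) : D.Λ.map (D.X α) = -(D.Γ α * D.Λ + D.Λ * (D.Γ α)ᵀ) := by
  rw [eq_neg_iff_add_eq_zero, ← add_assoc]; exact D.Λ_parallel α

/-- The curvature preserves the bivector `Λ`. -/
theorem curvature_mul_Λ (α β : Idx n) :
    D.curvature α β * D.Λ + D.Λ * (D.curvature α β)ᵀ = 0 := by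
  -- differentiate the equation `∇Λ = 0` once more and antisymmetrize
  have h1 : ∀ α β, (D.Λ.map (D.X β)).map (D.X α) =
      -((D.Γ β).map (D.X α) * D.Λ - D.Γ β * (D.Γ α * D.Λ + D.Λ * (D.Γ α)ᵀ)
        - (D.Γ α * D.Λ + D.Λ * (D.Γ α)ᵀ) * (D.Γ β)ᵀ + D.Λ * ((D.Γ β).map (D.X α))ᵀ) := by
    intro α β
    rw [Λ_map, map_neg_derivation, map_add_derivation, map_mul_derivation, map_mul_derivation,
      Λ_map, map_transpose_derivation]
    congr 1
    noncomm_ring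
  have h2 : (D.Λ.map (D.X β)).map (D.X α) - (D.Λ.map (D.X α)).map (D.X β) =
      ∑ μ, D.W μ α β • D.Λ.map (D.X μ) := by
    ext i j
    simp only [Matrix.sub_apply, Matrix.map_apply, D.commutator, Matrix.sum_apply,
      Matrix.smul_apply, smul_eq_mul]
  have h3 : ∑ μ, D.W μ α β • D.Λ.map (D.X μ) =
      -((∑ μ, D.W μ α β • D.Γ μ) * D.Λ + D.Λ * (∑ μ, D.W μ α β • D.Γ μ)ᵀ) := by
    simp only [Λ_map, Matrix.sum_mul, Matrix.transpose_sum, Matrix.mul_sum, Matrix.transpose_smul,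
      Matrix.smul_mul, Matrix.mul_smul, smul_neg, Finset.sum_neg_distrib, smul_add,
      Finset.sum_add_distrib]
  rw [h1, h1, h3] at h2
  rw [curvature]
  simp only [Matrix.transpose_sub, Matrix.transpose_add, Matrix.transpose_mul]
  rw [← sub_eq_zero] at h2
  rw [← neg_eq_zero, ← h2]
  noncomm_ring

theorem curvature_mul_Θ (α β : Idx n) :
    D.curvature α β * (D.Λ - D.Λᵀ) + (D.Λ - D.Λᵀ) * (D.curvature α β)ᵀ = 0 := by
  have h1 := D.curvature_mul_Λ α β
  have h2 := congrArg Matrix.transpose h1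
  simp only [Matrix.transpose_add, Matrix.transpose_mul, Matrix.transpose_transpose,
    Matrix.transpose_zero] at h2
  have h3 : D.curvature α β * (D.Λ - D.Λᵀ) + (D.Λ - D.Λᵀ) * (D.curvature α β)ᵀ =
      (D.curvature α β * D.Λ + D.Λ * (D.curvature α β)ᵀ) -
      (D.Λᵀ * (D.curvature α β)ᵀ + D.curvature α β * D.Λᵀ) := by noncomm_ring
  rw [h3, h1, h2, sub_zero]

/-- If the endomorphism `M` satisfies `M Θ + Θ Mᵀ = N`, then `θ M + Mᵀ θ` is determined by `N`. -/
theorem θ_sandwich (M N : Matrix (Idx n) (Idx n) C)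
    (h : M * (D.Λ - D.Λᵀ) + (D.Λ - D.Λᵀ) * Mᵀ = N) :
    (2 : C) • (D.θ * M + Mᵀ * D.θ) = -(D.θ * N * D.θ) := by
  have h1 : D.θ * N * D.θ = D.θ * M * ((D.Λ - D.Λᵀ) * D.θ) + (D.θ * (D.Λ - D.Λᵀ)) * Mᵀ * D.θ := by
    rw [← h]; noncomm_ring
  rw [h1, D.Λ_θ, D.θ_Λ]
  simp only [Matrix.mul_smul, Matrix.smul_mul, Matrix.mul_one, Matrix.one_mul, neg_smul, smul_add,
    Matrix.mul_neg, Matrix.neg_mul]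
  abel

theorem θ_mul_curvature (α β : Idx n) :
    D.θ * D.curvature α β + (D.curvature α β)ᵀ * D.θ = 0 := by
  have h := D.θ_sandwich _ _ (D.curvature_mul_Θ α β)
  rw [Matrix.mul_zero, Matrix.zero_mul, neg_zero] at h
  exact two_smul_injective (h.trans (smul_zero _).symm)

/-- The two-form `θ` is parallel. -/
theorem θ_map (α : Idx n) : D.θ.map (D.X α) = D.θ * D.Γ α + (D.Γ α)ᵀ * D.θ := by
  have h0 : D.Γ α * (D.Λ - D.Λᵀ) + (D.Λ - D.Λᵀ) * (D.Γ α)ᵀ = -(D.Λ - D.Λᵀ).map (D.X α) := by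
    have h1 := D.Λ_map α
    have h2 := congrArg Matrix.transpose h1
    simp only [Matrix.transpose_neg, Matrix.transpose_add, Matrix.transpose_mul,
      Matrix.transpose_transpose] at h2
    rw [map_sub_derivation, map_transpose_derivation, h1]
    simp only [Matrix.transpose_neg, Matrix.transpose_add, Matrix.transpose_mul,
      Matrix.transpose_transpose]
    noncomm_ring
  have h1 := D.θ_sandwich _ _ h0
  have h2 := map_mul_derivation (D.X α) (D.Λ - D.Λᵀ) D.θ
  have h3 : ((-2 : C) • (1 : Matrix (Idx n) (Idx n) C)).map (D.X α) = 0 := by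
    ext i j
    have h4 : D.X α (-2 : C) = 0 := by
      rw [show (-2 : C) = algebraMap ℂ C (-2) by rw [map_neg, map_ofNat], Derivation.map_algebraMap]
    simp only [Matrix.map_apply, Matrix.smul_apply, Matrix.one_apply, smul_eq_mul,
      Matrix.zero_apply]
    split_ifs <;> simp [h4]
  rw [D.Λ_θ, h3] at h2
  have h4 : D.θ * (D.Λ - D.Λᵀ).map (D.X α) * D.θ = (2 : C) • D.θ.map (D.X α) := by
    have h5 : (D.Λ - D.Λᵀ).map (D.X α) * D.θ = -((D.Λ - D.Λᵀ) * D.θ.map (D.X α)) :=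
      eq_neg_of_add_eq_zero_left h2.symm
    rw [Matrix.mul_assoc, h5, Matrix.mul_neg, ← Matrix.mul_assoc, D.θ_Λ, Matrix.smul_mul,
      Matrix.one_mul, neg_smul, neg_neg]
  rw [Matrix.mul_neg, Matrix.neg_mul, neg_neg, h4] at h1
  exact (two_smul_injective h1).symm

/-- The torsion element is `δ`-closed: this is the closedness of `θ`. -/
theorem del_torsionElt : del D.torsionElt = 0 := by
  -- differentiating `θ` produces the connection coefficients, since `θ` is parallel
  have hpar : ∀ α β γ, D.X α (D.θ β γ) = ∑ τ, (D.θ β τ * D.Γ α τ γ + D.Γ α τ β * D.θ τ γ) := by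
    intro α β γ
    have := congrFun (congrFun (D.θ_map α) β) γ
    simpa only [Matrix.map_apply, Matrix.add_apply, Matrix.mul_apply, Matrix.transpose_apply,
      ← Finset.sum_add_distrib] using this
  have hθ : ∀ β γ, D.θ β γ = -D.θ γ β := fun β γ => congrFun (congrFun D.θ_transpose γ) β
  have h1 : del D.torsionElt = (1 / 2 : ℂ) • ∑ γ, ∑ α, ∑ β, (∑ τ, D.θ γ τ * D.torsion τ α β) •
      wedge γ (wedge α (wedge β one)) := by
    have hd : ∀ γ (F : Idx n → Idx n → C), del (zMul γ (wedge₂ F one)) =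
        wedge γ (wedge₂ F one) := by
      intro γ F
      rw [del_apply, Finset.sum_eq_single γ]
      · rw [zDer_zMul, if_pos rfl, ← wedge₂_zDer, zDer_one, map_zero, map_zero, add_zero]
      · intro β _ h
        rw [zDer_zMul, if_neg h, ← wedge₂_zDer, zDer_one, map_zero, map_zero, add_zero, map_zero]
      · simp
    simp only [torsionElt, LinearMap.map_smul_of_tower, map_sum, map_smul, hd]
    congr 1
    simp only [wedge₂_apply, map_sum, map_smul, Finset.smul_sum, Finset.sum_smul, smul_smul]
    refine Finset.sum_congr rfl fun γ _ => ?_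
    rw [Finset.sum_comm]
    refine Finset.sum_congr rfl fun α _ => ?_
    rw [Finset.sum_comm]
  rw [h1, sum_wedge_wedge_wedge, smul_zero]
  intro γ α β
  have hc := D.θ_closed γ α β
  rw [hpar, hpar, hpar] at hc
  simp only [← Finset.sum_add_distrib, torsion] at hc ⊢
  rw [← sub_eq_zero, ← Finset.sum_sub_distrib] at hc
  rw [← hc]
  refine Finset.sum_congr rfl fun τ _ => ?_
  rw [D.W_antisymm τ β α, D.W_antisymm τ γ β, D.W_antisymm τ α γ, hθ γ τ, hθ α τ, hθ β τ]
  ring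

theorem Θ_θ_apply (τ β : Idx n) :
    ∑ γ, (D.Λ β γ - D.Λ γ β) * D.θ γ τ = if β = τ then -2 else 0 := by
  have := congrFun (congrFun D.Λ_θ β) τ
  simpa only [Matrix.mul_apply, Matrix.sub_apply, Matrix.transpose_apply, Matrix.smul_apply,
    Matrix.one_apply, smul_eq_mul, mul_ite, _root_.mul_one, mul_zero] using this

theorem eq_zero_of_commute {x : Fib n C} (h0 : ∀ r S, x r 0 S = 0)
    (h : ∀ β, star D.Λ x (zMul β one) = star D.Λ (zMul β one) x) : x = 0 := by
  refine Fib.eq_zero_of_commute D.Λ (θ := -D.θ) (fun τ β => ?_) h0 h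
  simp only [Matrix.neg_apply, mul_neg, Finset.sum_neg_distrib, D.Θ_θ_apply]
  split_ifs <;> simp

theorem star_wedge₂_one_left (F : Idx n → Idx n → C) (b : Fib n C) :
    star D.Λ (wedge₂ F one) b = wedge₂ F b := by rw [star_wedge₂_left, one_star]

theorem star_wedge₂_one_right (F : Idx n → Idx n → C) (b : Fib n C) :
    star D.Λ b (wedge₂ F one) = wedge₂ F b := by rw [star_wedge₂_right, Fib.star_one]

/-- The commutator with the torsion element. -/
theorem commutator_torsionElt (b : Fib n C) :
    star D.Λ D.torsionElt b - star D.Λ b D.torsionElt =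
      (Complex.I / 2) • vMul (∑ τ, wedge₂ (D.torsion τ) (zDer τ b)) := by
  have h1 : ∀ (γ : Idx n) (F : Idx n → Idx n → C),
      star D.Λ (zMul γ (wedge₂ F one)) b - star D.Λ b (zMul γ (wedge₂ F one)) =
      (Complex.I / 2) • vMul (∑ μ, (D.Λ γ μ - D.Λ μ γ) • wedge₂ F (zDer μ b)) := by
    intro γ F
    rw [star_zMul_left, star_zMul_right]
    simp only [star_wedge₂_one_left, star_wedge₂_one_right, sub_smul, Finset.sum_sub_distrib,
      map_sub, smul_sub]
    abel
  have h2 : star D.Λ D.torsionElt b - star D.Λ b D.torsionElt =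
      (1 / 2 : ℂ) • ∑ γ, ∑ τ, D.θ γ τ •
        (star D.Λ (zMul γ (wedge₂ (D.torsion τ) one)) b -
          star D.Λ b (zMul γ (wedge₂ (D.torsion τ) one))) := by
    simp only [torsionElt, LinearMap.map_smul_of_tower, map_sum, map_smul, LinearMap.smul_apply,
      LinearMap.sum_apply, smul_sub, Finset.sum_sub_distrib]
  have h3 : ∑ γ, ∑ τ, D.θ γ τ • ∑ μ, (D.Λ γ μ - D.Λ μ γ) • wedge₂ (D.torsion τ) (zDer μ b) =
      (2 : ℂ) • ∑ τ, wedge₂ (D.torsion τ) (zDer τ b) := by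
    rw [Finset.sum_comm, Finset.smul_sum]
    refine Finset.sum_congr rfl fun τ _ => ?_
    simp only [Finset.smul_sum, smul_smul]
    rw [Finset.sum_comm]
    simp only [← Finset.sum_smul]
    have h4 : ∀ μ, ∑ γ, D.θ γ τ * (D.Λ γ μ - D.Λ μ γ) = if μ = τ then 2 else 0 := by
      intro μ
      have := D.Θ_θ_apply τ μ
      rw [Finset.sum_congr rfl fun γ _ => show D.θ γ τ * (D.Λ γ μ - D.Λ μ γ) =
        -((D.Λ μ γ - D.Λ γ μ) * D.θ γ τ) by ring, Finset.sum_neg_distrib, this]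
      split_ifs <;> simp
    simp only [h4, ite_smul, zero_smul, Finset.sum_ite_eq', Finset.mem_univ, if_true]
    rw [two_smul, two_smul]
  have h5 : ∀ f : Idx n → Idx n → Fib n C, ∑ γ, ∑ τ, D.θ γ τ • (Complex.I / 2) • vMul (f γ τ) =
      (Complex.I / 2) • vMul (∑ γ, ∑ τ, D.θ γ τ • f γ τ) := by
    intro f
    simp only [map_sum, map_smul, Finset.smul_sum, smul_comm (D.θ _ _) (Complex.I / 2)]
  rw [h2]
  simp only [h1]
  rw [h5, h3, LinearMap.map_smul_of_tower, smul_smul, smul_smul]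
  congr 1
  ring

/-- The graded commutator `δ D + D δ` is the inner derivation of the torsion element. -/
theorem vMul_del_conn (b : Fib n C) :
    vMul (del (D.conn b) + D.conn (del b)) =
      Complex.I • (star D.Λ D.torsionElt b - star D.Λ b D.torsionElt) := by
  rw [D.del_conn_add_conn_del, D.commutator_torsionElt, smul_smul, LinearMap.map_smul_of_tower]
  congr 1
  linear_combination (-1 / 2 : ℂ) * Complex.I_mul_I

theorem wedge₂_single (α β : Idx n) (x : Fib n C) :
    wedge₂ (fun μ ν => if μ = α ∧ ν = β then 1 else 0) x = wedge α (wedge β x) := by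
  rw [wedge₂_apply, Finset.sum_eq_single α, Finset.sum_eq_single β]
  · simp
  · intro ν _ h; simp [h]
  · simp
  · intro μ _ h; simp [h]
  · simp

/-- The commutator with a quadratic form. The condition on `Λ` removes the second-order terms of the
Wick product, so that only a linear vector field remains. -/
theorem commutator_quadratic (S : Matrix (Idx n) (Idx n) C) (hS : Sᵀ = S)
    (hΛ : D.Λᵀ * S * D.Λ = D.Λ * S * D.Λᵀ) (F : Idx n → Idx n → C) (b : Fib n C) :
    star D.Λ (∑ γ, ∑ φ, S γ φ • zMul γ (zMul φ (wedge₂ F one))) b -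
      star D.Λ b (∑ γ, ∑ φ, S γ φ • zMul γ (zMul φ (wedge₂ F one))) =
    -Complex.I • vMul (wedge₂ F (lin ((D.Λ - D.Λᵀ) * S) b)) := by
  have h1 : ∀ γ φ : Idx n,
      star D.Λ (zMul γ (zMul φ (wedge₂ F one))) b - star D.Λ b (zMul γ (zMul φ (wedge₂ F one))) =
      (Complex.I / 2) • vMul (wedge₂ F (∑ μ, (D.Λ - D.Λᵀ) φ μ • zMul γ (zDer μ b)) +
        wedge₂ F (∑ ν, (D.Λ - D.Λᵀ) γ ν • zMul φ (zDer ν b))) +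
      (Complex.I / 2) • (Complex.I / 2) • vMul (vMul (wedge₂ F
        (∑ ν, ∑ μ, (D.Λ γ ν * D.Λ φ μ - D.Λ ν γ * D.Λ μ φ) • zDer μ (zDer ν b)))) := by
    intro γ φ
    rw [star_zMul_left, star_zMul_right]
    simp only [star_zMul_left, star_zMul_right, star_wedge₂_one_left, star_wedge₂_one_right,
      smul_add, map_add, Finset.sum_add_distrib, Matrix.sub_apply, Matrix.transpose_apply,
      sub_smul, Finset.sum_sub_distrib, map_sub, smul_sub, map_sum, map_smul, mul_smul,
      LinearMap.map_smul_of_tower, wedge₂_zMul, vMul_zMul, Finset.smul_sum,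
      smul_comm (D.Λ _ _) (Complex.I / 2)]
    abel
  have h2 : star D.Λ (∑ γ, ∑ φ, S γ φ • zMul γ (zMul φ (wedge₂ F one))) b -
      star D.Λ b (∑ γ, ∑ φ, S γ φ • zMul γ (zMul φ (wedge₂ F one))) =
      ∑ γ, ∑ φ, S γ φ • (star D.Λ (zMul γ (zMul φ (wedge₂ F one))) b -
        star D.Λ b (zMul γ (zMul φ (wedge₂ F one)))) := by
    simp only [map_sum, map_smul, LinearMap.smul_apply, LinearMap.sum_apply, smul_sub,
      Finset.sum_sub_distrib]
  -- the terms with one derivative: both factors `z` contribute equally, by the symmetry of `S`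
  have h3 : ∑ γ, ∑ φ, S γ φ • ∑ μ, (D.Λ - D.Λᵀ) φ μ • zMul γ (zDer μ b) =
      -lin ((D.Λ - D.Λᵀ) * S) b := by
    have e : (S * (D.Λ - D.Λᵀ))ᵀ = -((D.Λ - D.Λᵀ) * S) := by
      rw [Matrix.transpose_mul, hS, Matrix.transpose_sub, Matrix.transpose_transpose,
        ← neg_sub, Matrix.neg_mul]
    rw [← lin_neg, ← e, lin_apply]
    simp only [Matrix.transpose_apply, Matrix.mul_apply, Finset.sum_smul, Finset.smul_sum,
      smul_smul]
    rw [Finset.sum_comm' (t' := Finset.univ) (s' := fun _ => Finset.univ) (by simp)]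
    rw [Finset.sum_congr rfl fun φ _ => Finset.sum_comm, Finset.sum_comm]
    refine Finset.sum_congr rfl fun μ _ => ?_
    rw [Finset.sum_comm]
  have h4 : ∑ γ, ∑ φ, S γ φ • ∑ ν, (D.Λ - D.Λᵀ) γ ν • zMul φ (zDer ν b) =
      -lin ((D.Λ - D.Λᵀ) * S) b := by
    have e : (D.Λ - D.Λᵀ)ᵀ * S = -((D.Λ - D.Λᵀ) * S) := by
      rw [Matrix.transpose_sub, Matrix.transpose_transpose, ← neg_sub, Matrix.neg_mul]
    rw [← lin_neg, ← e, lin_apply]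
    simp only [Matrix.transpose_apply, Matrix.mul_apply, Finset.sum_smul, Finset.smul_sum,
      smul_smul]
    rw [Finset.sum_congr rfl fun φ _ => Finset.sum_comm, Finset.sum_comm]
    refine Finset.sum_congr rfl fun μ _ => ?_
    rw [Finset.sum_comm]
    refine Finset.sum_congr rfl fun φ _ => Finset.sum_congr rfl fun γ _ => ?_
    rw [mul_comm]
  -- the terms with two derivatives cancel by the condition on `Λ`
  have h5 : ∑ γ, ∑ φ, S γ φ • ∑ ν, ∑ μ, (D.Λ γ ν * D.Λ φ μ - D.Λ ν γ * D.Λ μ φ) •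
      zDer μ (zDer ν b) = 0 := by
    have e : ∀ ν μ, ∑ γ, ∑ φ, S γ φ * (D.Λ γ ν * D.Λ φ μ - D.Λ ν γ * D.Λ μ φ) = 0 := by
      intro ν μ
      have := congrFun (congrFun hΛ ν) μ
      simp only [Matrix.mul_apply, Matrix.transpose_apply, Finset.sum_mul] at this
      rw [← sub_eq_zero, ← Finset.sum_sub_distrib] at this
      rw [Finset.sum_comm, ← this]
      refine Finset.sum_congr rfl fun φ _ => ?_
      rw [← Finset.sum_sub_distrib]
      exact Finset.sum_congr rfl fun γ _ => by ring
    simp only [Finset.smul_sum, smul_smul]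
    rw [Finset.sum_congr rfl fun γ _ => Finset.sum_comm, Finset.sum_comm]
    refine Finset.sum_eq_zero fun ν _ => ?_
    rw [Finset.sum_congr rfl fun γ _ => Finset.sum_comm, Finset.sum_comm]
    refine Finset.sum_eq_zero fun μ _ => ?_
    simp only [← Finset.sum_smul, e, zero_smul]
  have h6 : ∀ f : Idx n → Idx n → Fib n C,
      ∑ γ, ∑ φ, S γ φ • (Complex.I / 2) • vMul (wedge₂ F (f γ φ)) =
      (Complex.I / 2) • vMul (wedge₂ F (∑ γ, ∑ φ, S γ φ • f γ φ)) := by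
    intro f
    simp only [map_sum, map_smul, Finset.smul_sum, smul_comm (S _ _) (Complex.I / 2)]
  have h7 : ∀ f : Idx n → Idx n → Fib n C,
      ∑ γ, ∑ φ, S γ φ • (Complex.I / 2) • (Complex.I / 2) • vMul (vMul (wedge₂ F (f γ φ))) =
      (Complex.I / 2) • (Complex.I / 2) • vMul (vMul (wedge₂ F (∑ γ, ∑ φ, S γ φ • f γ φ))) := by
    intro f
    simp only [map_sum, map_smul, Finset.smul_sum, smul_comm (S _ _) (Complex.I / 2)]
  rw [h2]
  simp only [h1, smul_add, Finset.sum_add_distrib, map_add]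
  rw [h6, h6, h7, h3, h4, h5]
  simp only [map_zero, smul_zero, add_zero, map_neg]
  rw [← two_smul ℂ, smul_smul, smul_neg, neg_smul]
  congr 2
  ring

/-- The commutator with the curvature element. -/
theorem commutator_curvatureElt (b : Fib n C) :
    star D.Λ D.curvatureElt b - star D.Λ b D.curvatureElt =
      (Complex.I / 2) • vMul (∑ α, ∑ β, wedge α (wedge β (lin (D.curvature β α) b))) := by
  -- the lowered curvature endomorphism is symmetric
  have hS : ∀ α β, (D.θ * D.curvature β α)ᵀ = D.θ * D.curvature β α := by
    intro α β
    rw [Matrix.transpose_mul, D.θ_transpose, Matrix.mul_neg]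
    exact neg_eq_of_add_eq_zero_left (D.θ_mul_curvature β α)
  -- `R Λ = - Λ Rᵀ` moves the curvature past `Λ`, and `Λᵀ θ Λ` is symmetric in `Λ, Λᵀ` since the
  -- inverse of `θ` is a multiple of `Λ - Λᵀ`
  have hΛ : ∀ α β, D.Λᵀ * (D.θ * D.curvature β α) * D.Λ =
      D.Λ * (D.θ * D.curvature β α) * D.Λᵀ := by
    intro α β
    set R := D.curvature β α
    have e1 : R * D.Λ = -(D.Λ * Rᵀ) := eq_neg_of_add_eq_zero_left (D.curvature_mul_Λ β α)
    have e2 : R * D.Λᵀ = -(D.Λᵀ * Rᵀ) := by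
      have := congrArg Matrix.transpose e1
      rw [Matrix.transpose_mul, Matrix.transpose_neg, Matrix.transpose_mul,
        Matrix.transpose_transpose] at this
      rw [this, neg_neg]
    have e3 : D.Λᵀ * D.θ * D.Λ = D.Λ * D.θ * D.Λᵀ := by
      have f1 : D.Λᵀ * D.θ * D.Λ = D.Λ * D.θ * D.Λ - (D.Λ - D.Λᵀ) * D.θ * D.Λ := by noncomm_ring
      have f2 : D.Λ * D.θ * D.Λᵀ = D.Λ * D.θ * D.Λ - D.Λ * (D.θ * (D.Λ - D.Λᵀ)) := by noncomm_ring
      rw [f1, f2, D.Λ_θ, D.θ_Λ]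
      simp
    calc D.Λᵀ * (D.θ * R) * D.Λ = D.Λᵀ * D.θ * (R * D.Λ) := by noncomm_ring
      _ = -(D.Λᵀ * D.θ * D.Λ * Rᵀ) := by rw [e1]; noncomm_ring
      _ = -(D.Λ * D.θ * D.Λᵀ * Rᵀ) := by rw [e3]
      _ = D.Λ * D.θ * (R * D.Λᵀ) := by rw [e2]; noncomm_ring
      _ = _ := by noncomm_ring
  have h2 : star D.Λ D.curvatureElt b - star D.Λ b D.curvatureElt = (1 / 4 : ℂ) • ∑ α, ∑ β,
      (star D.Λ (∑ γ, ∑ φ, (D.θ * D.curvature β α) γ φ • zMul γ (zMul φ (wedge α (wedge β one)))) b -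
        star D.Λ b (∑ γ, ∑ φ, (D.θ * D.curvature β α) γ φ •
          zMul γ (zMul φ (wedge α (wedge β one))))) := by
    simp only [curvatureElt, LinearMap.map_smul_of_tower, map_sum, LinearMap.smul_apply,
      LinearMap.sum_apply, smul_sub, Finset.sum_sub_distrib]
  have h3 : ∀ α β, star D.Λ (∑ γ, ∑ φ, (D.θ * D.curvature β α) γ φ •
      zMul γ (zMul φ (wedge α (wedge β one)))) b -
        star D.Λ b (∑ γ, ∑ φ, (D.θ * D.curvature β α) γ φ •
          zMul γ (zMul φ (wedge α (wedge β one)))) =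
      (2 * Complex.I) • vMul (wedge α (wedge β (lin (D.curvature β α) b))) := by
    intro α β
    have h4 := D.commutator_quadratic _ (hS α β) (hΛ α β)
      (fun μ ν => if μ = α ∧ ν = β then 1 else 0) b
    rw [← Matrix.mul_assoc, D.Λ_θ, Matrix.smul_mul, Matrix.one_mul, lin_smul, map_smul, map_smul,
      smul_comm] at h4
    simp only [wedge₂_single] at h4
    rw [h4, neg_smul, neg_smul, smul_neg, neg_neg, two_mul, two_smul, add_smul]
  rw [h2]
  simp only [h3]
  simp only [map_sum, Finset.smul_sum, smul_smul]
  refine Finset.sum_congr rfl fun α _ => Finset.sum_congr rfl fun β _ => ?_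
  congr 1
  ring

/-- The square `D²` is the inner derivation of the curvature element. -/
theorem vMul_conn_conn (b : Fib n C) :
    vMul (D.conn (D.conn b)) =
      -Complex.I • (star D.Λ D.curvatureElt b - star D.Λ b D.curvatureElt) := by
  rw [D.conn_conn, D.commutator_curvatureElt, smul_smul, LinearMap.map_smul_of_tower]
  congr 1
  linear_combination (1 / 2 : ℂ) * Complex.I_mul_I

end FedosovData

/-! ### Gradings of the fibre -/

namespace Fib

variable {n : ℕ} {C : Type*} [CommRing C] [Algebra ℂ C]

/-- The elements without terms of degree zero in the fibre coordinates. -/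
def zPos (n : ℕ) (C : Type*) [CommRing C] : Submodule C (Fib n C) where
  carrier := {a | ∀ r S, a r 0 S = 0}
  add_mem' ha hb r S := by simp [ha r S, hb r S]
  zero_mem' _ _ := rfl
  smul_mem' c a ha r S := by simp [ha r S]

theorem zMul_mem_zPos (α : Idx n) (a : Fib n C) : zMul α a ∈ zPos n C := fun r S => by
  simp [zMul_apply]

theorem wedge_mem_zPos (α : Idx n) {a : Fib n C} (ha : a ∈ zPos n C) : wedge α a ∈ zPos n C :=
  fun r S => by simp [wedge_apply, ha r]

theorem contr_mem_zPos (α : Idx n) {a : Fib n C} (ha : a ∈ zPos n C) : contr α a ∈ zPos n C :=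
  fun r S => by simp [contr_apply, ha r]

theorem wedge₂_mem_zPos (F : Idx n → Idx n → C) {a : Fib n C} (ha : a ∈ zPos n C) :
    wedge₂ F a ∈ zPos n C := by
  rw [wedge₂_apply]
  exact sum_mem fun α _ => sum_mem fun β _ =>
    Submodule.smul_mem _ _ (wedge_mem_zPos α (wedge_mem_zPos β ha))

theorem coeffDer_mem_zPos (X : Derivation ℂ C C) {a : Fib n C} (ha : a ∈ zPos n C) :
    coeffDer X a ∈ zPos n C := fun r S => by rw [coeffDer_apply, ha r S, map_zero]

theorem lin_mem_zPos (M : Matrix (Idx n) (Idx n) C) (a : Fib n C) : lin M a ∈ zPos n C := by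
  rw [lin_apply]
  exact sum_mem fun γ _ => sum_mem fun β _ => Submodule.smul_mem _ _ (zMul_mem_zPos _ _)

/-- The forms of degree `q`. -/
def forms (n : ℕ) (C : Type*) [CommRing C] (q : ℕ) : Submodule C (Fib n C) where
  carrier := {a | ∀ r m S, S.card ≠ q → a r m S = 0}
  add_mem' ha hb r m S h := by simp [ha r m S h, hb r m S h]
  zero_mem' _ _ _ _ := rfl
  smul_mem' c a ha r m S h := by simp [ha r m S h]

theorem one_mem_forms : (one : Fib n C) ∈ forms n C 0 := fun r m S h => by
  rw [Finset.card_ne_zero, Finset.nonempty_iff_ne_empty] at h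
  simp [one, h]

theorem wedge_mem_forms {q : ℕ} (α : Idx n) {a : Fib n C} (ha : a ∈ forms n C q) :
    wedge α a ∈ forms n C (q + 1) := fun r m S h => by
  rw [wedge_apply]
  split_ifs with hα
  · rw [ha, mul_zero]
    intro h'
    rw [← Finset.card_erase_add_one hα, h'] at h
    exact h rfl
  · rfl

theorem contr_mem_forms {q : ℕ} (α : Idx n) {a : Fib n C} (ha : a ∈ forms n C (q + 1)) :
    contr α a ∈ forms n C q := fun r m S h => by
  rw [contr_apply]
  split_ifs with hα
  · rfl
  · rw [ha, mul_zero]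
    rw [Finset.card_insert_of_notMem hα]
    omega

theorem contr_of_mem_forms_zero (α : Idx n) {a : Fib n C} (ha : a ∈ forms n C 0) :
    contr α a = 0 := by
  funext r m S
  rw [contr_apply]
  split_ifs with hα
  · rfl
  · rw [ha, mul_zero]; rfl
    simp

theorem zMul_mem_forms {q : ℕ} (α : Idx n) {a : Fib n C} (ha : a ∈ forms n C q) :
    zMul α a ∈ forms n C q := fun r m S h => by
  rw [zMul_apply, ha _ _ _ h, ite_self]

theorem zDer_mem_forms {q : ℕ} (α : Idx n) {a : Fib n C} (ha : a ∈ forms n C q) :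
    zDer α a ∈ forms n C q := fun r m S h => by
  rw [zDer_apply, ha _ _ _ h, mul_zero]

theorem coeffDer_mem_forms {q : ℕ} (X : Derivation ℂ C C) {a : Fib n C} (ha : a ∈ forms n C q) :
    coeffDer X a ∈ forms n C q := fun r m S h => by
  rw [coeffDer_apply, ha _ _ _ h, map_zero]

theorem lin_mem_forms {q : ℕ} (M : Matrix (Idx n) (Idx n) C) {a : Fib n C} (ha : a ∈ forms n C q) :
    lin M a ∈ forms n C q := by
  rw [lin_apply]
  exact sum_mem fun γ _ => sum_mem fun β _ =>
    Submodule.smul_mem _ _ (zMul_mem_forms _ (zDer_mem_forms _ ha))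

theorem wedge₂_mem_forms {q : ℕ} (F : Idx n → Idx n → C) {a : Fib n C} (ha : a ∈ forms n C q) :
    wedge₂ F a ∈ forms n C (q + 2) := by
  rw [wedge₂_apply]
  exact sum_mem fun α _ => sum_mem fun β _ =>
    Submodule.smul_mem _ _ (wedge_mem_forms α (wedge_mem_forms β ha))

theorem del_mem_forms {q : ℕ} {a : Fib n C} (ha : a ∈ forms n C q) : del a ∈ forms n C (q + 1) := by
  rw [del_apply]
  exact sum_mem fun α _ => wedge_mem_forms α (zDer_mem_forms α ha)

theorem delInv_mem_forms {q : ℕ} {a : Fib n C} (ha : a ∈ forms n C (q + 1)) :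
    delInv a ∈ forms n C q := by
  have : delAdj a ∈ forms n C q := by
    rw [delAdj_apply]
    exact sum_mem fun α _ => zMul_mem_forms α (contr_mem_forms α ha)
  intro r m S h
  rw [delInv_apply, weight_apply, this r m S h, smul_zero]

theorem mul_mem_forms {p q : ℕ} {a b : Fib n C} (ha : a ∈ forms n C p) (hb : b ∈ forms n C q) :
    mul a b ∈ forms n C (p + q) := fun r m S h => by
  rw [mul_apply]
  refine Finset.sum_eq_zero fun x _ => Finset.sum_eq_zero fun y _ =>
    Finset.sum_eq_zero fun T hT => ?_
  by_cases h1 : T.card = p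
  · rw [hb _ _ _ (fun h2 => h ?_), mul_zero, mul_zero]
    rw [← h1, ← h2, add_comm, Finset.card_sdiff_add_card_eq_card (Finset.mem_powerset.1 hT)]
  · rw [ha _ _ _ h1, zero_mul, mul_zero]

theorem biDer_mem_forms {p q : ℕ} (Λ : Matrix (Idx n) (Idx n) C) (k : ℕ) {a b : Fib n C}
    (ha : a ∈ forms n C p) (hb : b ∈ forms n C q) : biDer Λ k a b ∈ forms n C (p + q) := by
  induction k generalizing a b with
  | zero => exact mul_mem_forms ha hb
  | succ k ih =>
    rw [biDer_succ]
    exact sum_mem fun μ _ => sum_mem fun ν _ =>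
      Submodule.smul_mem _ _ (ih (zDer_mem_forms μ ha) (zDer_mem_forms ν hb))

theorem star_mem_forms {p q : ℕ} (Λ : Matrix (Idx n) (Idx n) C) {a b : Fib n C}
    (ha : a ∈ forms n C p) (hb : b ∈ forms n C q) : star Λ a b ∈ forms n C (p + q) := by
  intro r m S h
  rw [star_eq, expSum_apply, Finset.sum_apply, Finset.sum_apply]
  refine Finset.sum_eq_zero fun k _ => ?_
  rw [Pi.smul_apply, Pi.smul_apply, biDer_mem_forms Λ k ha hb _ _ _ h, smul_zero]

theorem parity_of_mem_forms {q : ℕ} {a : Fib n C} (ha : a ∈ forms n C q) :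
    parity a = (-1 : C) ^ q • a := by
  funext r m S
  rw [parity_apply, Pi.smul_apply, Pi.smul_apply, Pi.smul_apply, smul_eq_mul]
  by_cases h : S.card = q
  · rw [h]
  · rw [ha _ _ _ h, mul_zero, mul_zero]

/-! ### Division by the formal parameter -/

/-- Division by `v` of a series without constant term in `v`. -/
def vDiv : Fib n C →ₗ[C] Fib n C where
  toFun a r := a (r + 1)
  map_add' _ _ := rfl
  map_smul' _ _ := rfl

theorem vDiv_apply (a : Fib n C) (r : ℕ) : vDiv a r = a (r + 1) := rfl

theorem vMul_vDiv {a : Fib n C} (h : a 0 = 0) : vMul (vDiv a) = a := by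
  funext r
  cases r with
  | zero => rw [vMul_zero, h]
  | succ r => rfl

theorem vDiv_mem_forms {q : ℕ} {a : Fib n C} (ha : a ∈ forms n C q) : vDiv a ∈ forms n C q :=
  fun _ _ _ h => ha _ _ _ h

theorem mul_comm_of_isZeroForm {a : Fib n C} (ha : IsZeroForm a) (b : Fib n C) :
    mul a b = mul b a := by
  induction b using form_induction with
  | h0 b hb =>
    funext r m S
    by_cases hS : S = ∅
    · subst hS
      rw [mul_zeroForm_apply ha, mul_zeroForm_apply hb, ← Finset.Nat.sum_antidiagonal_swap]
      refine Finset.sum_congr rfl fun x _ => ?_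
      refine Finset.sum_equiv (Equiv.prodComm _ _) (fun y => by simp [add_comm]) fun y _ => ?_
      rw [mul_comm]; rfl
    · rw [mul_zeroForm_apply ha, mul_zeroForm_apply hb]
      refine Finset.sum_congr rfl fun x _ => ?_
      rw [Finset.sum_eq_zero fun y _ => by rw [hb _ _ _ hS, mul_zero],
        Finset.sum_eq_zero fun y _ => by rw [ha _ _ _ hS, mul_zero]]
  | hadd b c hb hc => rw [map_add, hb, hc, map_add, LinearMap.add_apply]
  | hw α b hb =>
    rw [mul_wedge_left, ← hb]
    conv_lhs => rw [← parity_of_isZeroForm ha]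
    exact mul_parity_wedge α a b

/-- The undeformed product is graded commutative. -/
theorem mul_parity_comm (a b : Fib n C) :
    mul (a + parity a) b = mul b (a + parity a) ∧
      mul (a - parity a) b = mul (parity b) (a - parity a) := by
  induction a using form_induction generalizing b with
  | h0 a ha =>
    rw [parity_of_isZeroForm ha, sub_self, map_zero, map_zero, LinearMap.zero_apply, map_add,
      LinearMap.add_apply, map_add, mul_comm_of_isZeroForm ha]
    exact ⟨rfl, rfl⟩
  | hadd a c ha hc =>
    have e1 : a + c + parity (a + c) = (a + parity a) + (c + parity c) := by rw [map_add]; abel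
    have e2 : a + c - parity (a + c) = (a - parity a) + (c - parity c) := by rw [map_add]; abel
    rw [e1, e2]
    rw [map_add mul, LinearMap.add_apply, (ha b).1, (hc b).1, map_add mul, LinearMap.add_apply,
      (ha b).2, (hc b).2, ← map_add (mul b), ← map_add (mul (parity b))]
    exact ⟨rfl, rfl⟩
  | hw α a ha =>
    rw [parity_wedge, ← sub_eq_add_neg, sub_neg_eq_add, ← map_sub, ← map_add, mul_wedge_left,
      mul_wedge_left, (ha b).1, (ha b).2, mul_parity_wedge]
    refine ⟨?_, rfl⟩
    have := mul_parity_wedge α (parity b) (a - parity a)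
    rwa [parity_parity, eq_comm] at this

theorem star_apply_zero (Λ : Matrix (Idx n) (Idx n) C) (a b : Fib n C) :
    star Λ a b 0 = mul a b 0 := by
  rw [star_eq, expSum_apply]
  simp [expCoeff_zero, biDer_zero]

theorem eq_of_two_smul {a b : Fib n C} (h : (2 : ℂ) • a = (2 : ℂ) • b) : a = b := by
  have := congrArg (fun x => (1 / 2 : ℂ) • x) h
  simpa only [smul_smul, one_div, inv_mul_cancel₀ (two_ne_zero : (2 : ℂ) ≠ 0), one_smul] using this

/-- The graded commutator with an odd element is divisible by `v`. -/
theorem star_sub_star_apply_zero (Λ : Matrix (Idx n) (Idx n) C) {a : Fib n C} (ha : parity a = -a)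
    (b : Fib n C) : (star Λ a b - star Λ (parity b) a) 0 = 0 := by
  have h := (mul_parity_comm a b).2
  rw [ha, sub_neg_eq_add, ← two_smul ℂ, LinearMap.map_smul_of_tower, LinearMap.map_smul_of_tower,
    LinearMap.smul_apply] at h
  rw [Pi.sub_apply, star_apply_zero, star_apply_zero, eq_of_two_smul h, sub_self]

/-- At `v = 0` the product is graded commutative, so the square of an odd element is divisible
by `v`. -/
theorem star_self_apply_zero (Λ : Matrix (Idx n) (Idx n) C) {a : Fib n C} (ha : parity a = -a) :
    star Λ a a 0 = 0 := by
  have h := star_sub_star_apply_zero Λ ha a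
  have e : star Λ a a - star Λ (parity a) a = (2 : ℂ) • star Λ a a := by
    rw [ha, map_neg, LinearMap.neg_apply, sub_neg_eq_add, two_smul]
  rw [e, Pi.smul_apply] at h
  exact (smul_eq_zero_iff_right two_ne_zero).1 h

/-! ### The total degree -/

/-- The part of total degree `2 deg_v + deg_s = k`. -/
def deg (k : ℕ) : Fib n C →ₗ[C] Fib n C where
  toFun a r m S := if 2 * r + m.degree = k then a r m S else 0
  map_add' a b := by funext r m S; simp only [Pi.add_apply]; split_ifs <;> simp
  map_smul' c a := by funext r m S; simp

theorem deg_apply (k : ℕ) (a : Fib n C) (r m S) :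
    deg k a r m S = if 2 * r + m.degree = k then a r m S else 0 := rfl

theorem deg_ext {a b : Fib n C} (h : ∀ k, deg k a = deg k b) : a = b := by
  funext r m S
  simpa [deg_apply] using congrFun (congrFun (congrFun (h (2 * r + m.degree)) r) m) S

theorem deg_wedge (k : ℕ) (α : Idx n) (a : Fib n C) : deg k (wedge α a) = wedge α (deg k a) := by
  funext r m S
  simp only [deg_apply, wedge_apply]
  split_ifs <;> simp

theorem deg_contr (k : ℕ) (α : Idx n) (a : Fib n C) : deg k (contr α a) = contr α (deg k a) := by
  funext r m S
  simp only [deg_apply, contr_apply]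
  split_ifs <;> simp

theorem deg_coeffDer (k : ℕ) (X : Derivation ℂ C C) (a : Fib n C) :
    deg k (coeffDer X a) = coeffDer X (deg k a) := by
  funext r m S
  simp only [deg_apply, coeffDer_apply]
  split_ifs <;> simp

theorem degree_add_single (m : Idx n →₀ ℕ) (α : Idx n) :
    (m + Finsupp.single α 1).degree = m.degree + 1 := by
  rw [map_add, Finsupp.degree_single]

theorem degree_sub_single {m : Idx n →₀ ℕ} {α : Idx n} (h : m α ≠ 0) :
    (m - Finsupp.single α 1).degree + 1 = m.degree := by
  have h2 : m - Finsupp.single α 1 + Finsupp.single α 1 = m := by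
    ext i; by_cases hi : i = α
    · subst hi; simp; omega
    · simp [hi]
  rw [← degree_add_single, h2]

theorem deg_succ_zMul (k : ℕ) (α : Idx n) (a : Fib n C) :
    deg (k + 1) (zMul α a) = zMul α (deg k a) := by
  funext r m S
  simp only [deg_apply, zMul_apply]
  by_cases h : m α = 0
  · simp [h]
  · have := degree_sub_single h
    simp only [h, if_false]
    congr 1
    simp only [eq_iff_iff]
    omega

theorem deg_zero_zMul (α : Idx n) (a : Fib n C) : deg 0 (zMul α a) = 0 := by
  funext r m S
  simp only [deg_apply, zMul_apply]
  by_cases h : m α = 0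
  · simp [h]
  · have := degree_sub_single h
    rw [if_neg (by omega)]; rfl

theorem deg_zDer (k : ℕ) (α : Idx n) (a : Fib n C) :
    deg k (zDer α a) = zDer α (deg (k + 1) a) := by
  funext r m S
  simp only [deg_apply, zDer_apply, degree_add_single]
  by_cases h : 2 * r + m.degree = k
  · rw [if_pos h, if_pos (by omega)]
  · rw [if_neg h, if_neg (by omega), mul_zero]

theorem zDer_deg_zero (α : Idx n) (a : Fib n C) : zDer α (deg 0 a) = 0 := by
  funext r m S
  rw [zDer_apply, deg_apply, degree_add_single, if_neg (by omega), mul_zero]; rfl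

theorem deg_lin (k : ℕ) (M : Matrix (Idx n) (Idx n) C) (a : Fib n C) :
    deg k (lin M a) = lin M (deg k a) := by
  rw [lin_apply, lin_apply]
  simp only [map_sum, map_smul]
  refine Finset.sum_congr rfl fun γ _ => Finset.sum_congr rfl fun β _ => ?_
  cases k with
  | zero => rw [deg_zero_zMul, zDer_deg_zero, map_zero]
  | succ k => rw [deg_succ_zMul, deg_zDer]

theorem deg_wedge₂ (k : ℕ) (F : Idx n → Idx n → C) (a : Fib n C) :
    deg k (wedge₂ F a) = wedge₂ F (deg k a) := by
  simp only [wedge₂_apply, map_sum, map_smul, deg_wedge]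

theorem deg_vMul (k : ℕ) (a : Fib n C) : deg (k + 2) (vMul a) = vMul (deg k a) := by
  funext r m S
  cases r with
  | zero => rw [deg_apply, vMul_zero, vMul_zero]; simp
  | succ r =>
    rw [deg_apply, vMul_succ, vMul_succ, deg_apply]
    congr 1
    simp only [eq_iff_iff]
    omega

theorem deg_vDiv (k : ℕ) (a : Fib n C) : deg k (vDiv a) = vDiv (deg (k + 2) a) := by
  funext r m S
  rw [deg_apply, vDiv_apply, vDiv_apply, deg_apply]
  congr 1
  simp only [eq_iff_iff]
  omega

theorem deg_weight (k : ℕ) (f : ℕ → ℂ) (a : Fib n C) : deg k (weight f a) = weight f (deg k a) := by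
  funext r m S
  simp only [deg_apply, weight_apply]
  split_ifs <;> simp

theorem deg_succ_delInv (k : ℕ) (a : Fib n C) : deg (k + 1) (delInv a) = delInv (deg k a) := by
  simp only [delInv_apply, deg_weight, delAdj_apply, map_sum, deg_succ_zMul, deg_contr]

theorem deg_zero_delInv (a : Fib n C) : deg 0 (delInv a) = 0 := by
  simp only [delInv_apply, deg_weight, delAdj_apply, map_sum, deg_zero_zMul,
    Finset.sum_const_zero, map_zero]

theorem deg_one (k : ℕ) : deg k (one : Fib n C) = if k = 0 then one else 0 := by
  funext r m S
  rw [deg_apply]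
  by_cases hk : k = 0
  · subst hk
    rw [if_pos rfl]
    by_cases h : 2 * r + m.degree = 0
    · rw [if_pos h]
    · rw [if_neg h, one, if_neg]
      rintro ⟨rfl, rfl, -⟩
      exact h (by simp)
  · rw [if_neg hk]
    by_cases h : 2 * r + m.degree = k
    · rw [if_pos h, one, if_neg]; rfl
      rintro ⟨rfl, rfl, -⟩
      exact hk (by simpa using h.symm)
    · rw [if_neg h]; rfl

theorem deg_mul (k : ℕ) (a b : Fib n C) :
    deg k (mul a b) = ∑ p ∈ Finset.HasAntidiagonal.antidiagonal k, mul (deg p.1 a) (deg p.2 b) := by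
  funext r m S
  simp only [deg_apply, mul_apply, Finset.sum_apply]
  have key : ∀ x ∈ Finset.HasAntidiagonal.antidiagonal r,
      (∑ p ∈ Finset.HasAntidiagonal.antidiagonal k,
      ∑ y ∈ Finset.HasAntidiagonal.antidiagonal m, ∑ T ∈ S.powerset, sgn C T (S \ T) *
        ((if 2 * x.1 + y.1.degree = p.1 then a x.1 y.1 T else 0) *
          (if 2 * x.2 + y.2.degree = p.2 then b x.2 y.2 (S \ T) else 0))) =
      if 2 * r + m.degree = k then ∑ y ∈ Finset.HasAntidiagonal.antidiagonal m, ∑ T ∈ S.powerset,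
        sgn C T (S \ T) * (a x.1 y.1 T * b x.2 y.2 (S \ T)) else 0 := by
    intro x hx
    rw [Finset.HasAntidiagonal.mem_antidiagonal] at hx
    have hd : ∀ y ∈ Finset.HasAntidiagonal.antidiagonal m, y.1.degree + y.2.degree = m.degree := by
      intro y hy
      rw [← map_add, Finset.HasAntidiagonal.mem_antidiagonal.1 hy]
    by_cases h : 2 * r + m.degree = k
    · rw [if_pos h, Finset.sum_comm]
      refine Finset.sum_congr rfl fun y hy => ?_
      rw [Finset.sum_comm]
      refine Finset.sum_congr rfl fun T _ => ?_
      have := hd y hy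
      rw [Finset.sum_eq_single (2 * x.1 + y.1.degree, 2 * x.2 + y.2.degree)]
      · rw [if_pos rfl, if_pos rfl]
      · intro p _ hp
        by_cases h1 : 2 * x.1 + y.1.degree = p.1
        · rw [if_neg (c := 2 * x.2 + y.2.degree = p.2), mul_zero, mul_zero]
          intro h2
          exact hp (Prod.ext h1.symm h2.symm)
        · rw [if_neg h1, zero_mul, mul_zero]
      · intro hn
        exact absurd (Finset.HasAntidiagonal.mem_antidiagonal.2 (by dsimp only; omega)) hn
    · rw [if_neg h]
      refine Finset.sum_eq_zero fun p hp => Finset.sum_eq_zero fun y hy =>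
        Finset.sum_eq_zero fun T _ => ?_
      have := hd y hy
      rw [Finset.HasAntidiagonal.mem_antidiagonal] at hp
      by_cases h1 : 2 * x.1 + y.1.degree = p.1
      · rw [if_neg (c := 2 * x.2 + y.2.degree = p.2), mul_zero, mul_zero]
        omega
      · rw [if_neg h1, zero_mul, mul_zero]
  symm
  rw [Finset.sum_comm, Finset.sum_congr rfl key, Finset.sum_ite_irrel]
  simp only [Finset.sum_const_zero]

/-- A pair of fibre derivatives lowers the total degree by two, which the factor `v` restores. -/
theorem sum_biDer_deg (Λ : Matrix (Idx n) (Idx n) C) (j l : ℕ) (a b : Fib n C) :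
    ∑ p ∈ Finset.HasAntidiagonal.antidiagonal l, biDer Λ j (deg p.1 a) (deg p.2 b) =
      if 2 * j ≤ l then deg (l - 2 * j) (biDer Λ j a b) else 0 := by
  induction j generalizing l a b with
  | zero =>
    rw [if_pos (by omega), Nat.mul_zero, Nat.sub_zero, biDer_zero, deg_mul]
    rfl
  | succ j ih =>
    match l with
    | 0 => simp [biDer_succ, zDer_deg_zero]
    | 1 =>
      rw [if_neg (by omega), Finset.Nat.antidiagonal_succ, Finset.sum_cons, Finset.sum_map]
      simp [biDer_succ, zDer_deg_zero]
    | l + 2 =>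
      rw [Finset.Nat.antidiagonal_succ_succ', Finset.sum_cons, Finset.sum_cons, Finset.sum_map]
      simp only [biDer_succ, zDer_deg_zero, map_zero, LinearMap.zero_apply, smul_zero,
        Finset.sum_const_zero, zero_add, Function.Embedding.prodMap, Function.Embedding.coeFn_mk,
        Prod.map_fst, Prod.map_snd, Nat.succ_eq_add_one, ← deg_zDer, map_sum, map_smul]
      rw [Finset.sum_comm]
      have h : ∀ α β : Idx n, ∑ p ∈ Finset.HasAntidiagonal.antidiagonal l,
          Λ α β • biDer Λ j (deg p.1 (zDer α a)) (deg p.2 (zDer β b)) =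
          if 2 * (j + 1) ≤ l + 2 then
            Λ α β • deg (l + 2 - 2 * (j + 1)) (biDer Λ j (zDer α a) (zDer β b)) else 0 := by
        intro α β
        rw [← Finset.smul_sum, ih, show l + 2 - 2 * (j + 1) = l - 2 * j by omega]
        by_cases hj : 2 * j ≤ l
        · rw [if_pos hj, if_pos (by omega)]
        · rw [if_neg hj, if_neg (by omega), smul_zero]
      rw [Finset.sum_congr rfl fun α _ => Finset.sum_comm]
      simp only [h]
      simp only [Finset.sum_ite_irrel, Finset.sum_const_zero]

/-- The total degree is additive for the Wick product. -/
theorem deg_star (Λ : Matrix (Idx n) (Idx n) C) (k : ℕ) (a b : Fib n C) :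
    deg k (star Λ a b) = ∑ p ∈ Finset.HasAntidiagonal.antidiagonal k,
      star Λ (deg p.1 a) (deg p.2 b) := by
  funext r m S
  have h : ∀ j ∈ Finset.range (r + 1), (∑ p ∈ Finset.HasAntidiagonal.antidiagonal k,
      biDer Λ j (deg p.1 a) (deg p.2 b)) (r - j) m S =
      if 2 * r + m.degree = k then biDer Λ j a b (r - j) m S else 0 := by
    intro j hj
    rw [Finset.mem_range] at hj
    rw [sum_biDer_deg]
    by_cases hjk : 2 * j ≤ k
    · rw [if_pos hjk, deg_apply]
      congr 1
      simp only [eq_iff_iff]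
      omega
    · rw [if_neg hjk, if_neg (by omega)]; rfl
  have h2 : ∑ p ∈ Finset.HasAntidiagonal.antidiagonal k, star Λ (deg p.1 a) (deg p.2 b) =
      expSum (fun j => ∑ p ∈ Finset.HasAntidiagonal.antidiagonal k,
        biDer Λ j (deg p.1 a) (deg p.2 b)) := by
    simp only [star_eq]
    rw [← map_sum]
    congr 1
    funext j
    rw [Finset.sum_apply]
  rw [h2, deg_apply, star_eq, expSum_apply, expSum_apply]
  simp only [Finset.sum_apply, Pi.smul_apply] at h ⊢
  symm
  refine (Finset.sum_congr rfl fun j hj => congrArg (expCoeff j • ·) (h j hj)).trans ?_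
  split_ifs
  · rfl
  · simp only [smul_zero, Finset.sum_const_zero]

end Fib

namespace FedosovData

open Fib

variable {n : ℕ} {C : Type*} [CommRing C] [Algebra ℂ C] (D : FedosovData n C)

/-! ### The Bianchi identities -/

theorem frameD_mem_zPos {a : Fib n C} (ha : a ∈ zPos n C) : D.frameD a ∈ zPos n C :=
  Submodule.smul_of_tower_mem _ _ (sum_mem fun _ _ => wedge₂_mem_zPos _ (contr_mem_zPos _ ha))

theorem conn_mem_zPos {a : Fib n C} (ha : a ∈ zPos n C) : D.conn a ∈ zPos n C :=
  add_mem (sum_mem fun α _ => wedge_mem_zPos α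
    (sub_mem (coeffDer_mem_zPos _ ha) (lin_mem_zPos _ _))) (D.frameD_mem_zPos ha)

theorem torsionElt_mem_zPos : D.torsionElt ∈ zPos n C :=
  Submodule.smul_of_tower_mem _ _ (sum_mem fun _ _ => sum_mem fun _ _ =>
    Submodule.smul_mem _ _ (zMul_mem_zPos _ _))

theorem curvatureElt_mem_zPos : D.curvatureElt ∈ zPos n C :=
  Submodule.smul_of_tower_mem _ _ (sum_mem fun _ _ => sum_mem fun _ _ => sum_mem fun _ _ =>
    sum_mem fun _ _ => Submodule.smul_mem _ _ (zMul_mem_zPos _ _))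

theorem del_curvatureElt_mem_zPos : del D.curvatureElt ∈ zPos n C := by
  have h : ∀ (γ φ α β : Idx n),
      del (zMul γ (zMul φ (wedge α (wedge β (one : Fib n C))))) ∈ zPos n C := by
    intro γ φ α β
    rw [del_apply]
    refine sum_mem fun μ _ => wedge_mem_zPos μ ?_
    rw [zDer_zMul, zDer_zMul, ← wedge_zDer, ← wedge_zDer, zDer_one, map_zero, map_zero, map_zero,
      add_zero]
    refine add_mem ?_ (zMul_mem_zPos _ _)
    split_ifs
    · exact zMul_mem_zPos _ _
    · exact zero_mem _
  rw [curvatureElt, LinearMap.map_smul_of_tower]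
  simp only [map_sum, map_smul]
  exact Submodule.smul_of_tower_mem _ _ (sum_mem fun _ _ => sum_mem fun _ _ => sum_mem fun _ _ =>
    sum_mem fun _ _ => Submodule.smul_mem _ _ (h _ _ _ _))

theorem torsionElt_mem_forms : D.torsionElt ∈ forms n C 2 :=
  Submodule.smul_of_tower_mem _ _ (sum_mem fun _ _ => sum_mem fun _ _ =>
    Submodule.smul_mem _ _ (zMul_mem_forms _ (wedge₂_mem_forms _ one_mem_forms)))

theorem curvatureElt_mem_forms : D.curvatureElt ∈ forms n C 2 :=
  Submodule.smul_of_tower_mem _ _ (sum_mem fun _ _ => sum_mem fun _ _ => sum_mem fun _ _ =>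
    sum_mem fun _ _ => Submodule.smul_mem _ _ (zMul_mem_forms _ (zMul_mem_forms _
      (wedge_mem_forms _ (wedge_mem_forms _ one_mem_forms)))))

theorem parity_torsionElt : parity D.torsionElt = D.torsionElt := by
  rw [parity_of_mem_forms D.torsionElt_mem_forms]; simp

theorem parity_curvatureElt : parity D.curvatureElt = D.curvatureElt := by
  rw [parity_of_mem_forms D.curvatureElt_mem_forms]; simp

theorem parity_zMul_one (β : Idx n) : parity (zMul β (one : Fib n C)) = zMul β one := by
  rw [parity_of_mem_forms (zMul_mem_forms β one_mem_forms)]; simp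

/-- First Bianchi identity: `D² δ - δ D²` is also the commutator of `D` and `D δ + δ D`. -/
theorem conn_torsionElt : D.conn D.torsionElt = del D.curvatureElt := by
  rw [← sub_eq_zero]
  refine D.eq_zero_of_commute (sub_mem (D.conn_mem_zPos D.torsionElt_mem_zPos)
    D.del_curvatureElt_mem_zPos) fun β => ?_
  set b : Fib n C := zMul β one with hb
  have hp : parity b = b := parity_zMul_one β
  -- It suffices to compare commutators with the coordinates `b`. Apply `D` to the formula for
  -- `(δ D + D δ) b` and `δ` to that for `D² b`; the other two formulas are taken at
  -- `D b` and `δ b`.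
  have h1 := congrArg D.conn (D.vMul_del_conn b)
  have h2 := D.vMul_del_conn (D.conn b)
  have h3 := D.vMul_conn_conn (del b)
  have h4 := congrArg del (D.vMul_conn_conn b)
  rw [conn_vMul, map_add, map_smul, map_sub, conn_star, conn_star, parity_torsionElt, hp] at h1
  rw [LinearMap.map_smul_of_tower, map_sub, del_star, del_star, parity_curvatureElt, hp,
    del_vMul] at h4
  rw [map_add] at h1 h2
  have key : Complex.I • ((star D.Λ (D.conn D.torsionElt) b - star D.Λ b (D.conn D.torsionElt)) -
      (star D.Λ (del D.curvatureElt) b - star D.Λ b (del D.curvatureElt))) = 0 := by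
    linear_combination (norm := module) h2 - h1 + h3 - h4
  rw [smul_eq_zero_iff_right Complex.I_ne_zero] at key
  rw [map_sub, LinearMap.sub_apply, map_sub, ← sub_eq_zero, ← key]
  abel

/-- Second Bianchi identity: `D` commutes with `D²`. -/
theorem conn_curvatureElt : D.conn D.curvatureElt = 0 := by
  refine D.eq_zero_of_commute (D.conn_mem_zPos D.curvatureElt_mem_zPos) fun β => ?_
  set b : Fib n C := zMul β one with hb
  have hp : parity b = b := parity_zMul_one β
  have h1 := congrArg D.conn (D.vMul_conn_conn b)
  have h2 := D.vMul_conn_conn (D.conn b)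
  rw [conn_vMul, map_smul, map_sub, conn_star, conn_star, parity_curvatureElt, hp] at h1
  have key : Complex.I • (star D.Λ (D.conn D.curvatureElt) b - star D.Λ b (D.conn D.curvatureElt)) =
      0 := by
    linear_combination (norm := module) h1 - h2
  rw [smul_eq_zero_iff_right Complex.I_ne_zero] at key
  exact sub_eq_zero.1 key

/-! ### Fedosov's equation -/

/-- The right-hand side `T + R + D r - (i/v) r ∘ r` of the equation for `r`. -/
def source (r : Fib n C) : Fib n C :=
  D.torsionElt + D.curvatureElt + D.conn r - Complex.I • vDiv (star D.Λ r r)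

/-- The operator `-δ + D - (i/v) ad(r)` for odd `r`. -/
def fed (r a : Fib n C) : Fib n C :=
  -del a + D.conn a - Complex.I • vDiv (star D.Λ r a - star D.Λ (parity a) r)

theorem vMul_fed {r : Fib n C} (hr : parity r = -r) (a : Fib n C) :
    vMul (D.fed r a) = vMul (D.conn a - del a) -
      Complex.I • (star D.Λ r a - star D.Λ (parity a) r) := by
  rw [fed, map_sub, LinearMap.map_smul_of_tower, vMul_vDiv (star_sub_star_apply_zero _ hr a),
    neg_add_eq_sub]

/-- The square of the odd derivation `D - δ`. -/
theorem vMul_conn_sub_del (a : Fib n C) :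
    vMul (D.conn (D.conn a - del a) - del (D.conn a - del a)) =
      -Complex.I • (star D.Λ (D.torsionElt + D.curvatureElt) a -
        star D.Λ a (D.torsionElt + D.curvatureElt)) := by
  have h1 := D.vMul_conn_conn a
  have h2 := D.vMul_del_conn a
  simp only [map_sub, map_add, LinearMap.add_apply, del_del] at h1 h2 ⊢
  rw [map_zero]
  linear_combination (norm := module) h1 - h2

theorem conn_sub_del_star (a b : Fib n C) :
    D.conn (star D.Λ a b) - del (star D.Λ a b) =
      star D.Λ (D.conn a - del a) b + star D.Λ (parity a) (D.conn b - del b) := by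
  rw [conn_star, del_star, map_sub, map_sub, LinearMap.sub_apply]
  abel

theorem parity_conn_sub_del (a : Fib n C) :
    parity (D.conn a - del a) = -(D.conn (parity a) - del (parity a)) := by
  rw [map_sub, conn_parity, parity_del]; abel

/-- If `r` solves Fedosov's equation then `-δ + D - (i/v) ad(r)` is flat. -/
theorem fed_fed {r : Fib n C} (hr : parity r = -r) (h : del r = D.source r) (a : Fib n C) :
    D.fed r (D.fed r a) = 0 := by
  set w := D.torsionElt + D.curvatureElt with hw
  set A := star D.Λ r a - star D.Λ (parity a) r with hA
  -- Fedosov equation, multiplied by `v`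
  have hr2 : vMul (D.conn r - del r) + vMul w = Complex.I • star D.Λ r r := by
    have e : D.conn r - del r + w = Complex.I • vDiv (star D.Λ r r) := by
      rw [h, source, hw]; abel
    rw [← map_add, e, LinearMap.map_smul_of_tower, vMul_vDiv (star_self_apply_zero D.Λ hr)]
  -- multiplication by `v²` clears the two divisions by `v`
  apply vMul_injective
  apply vMul_injective
  rw [map_zero, map_zero, vMul_fed D hr, map_sub vMul, LinearMap.map_smul_of_tower]
  -- the contribution of `D - δ`: its square is the commutator with `w`, and it is an odd derivation
  have e1 : vMul (vMul (D.conn (D.fed r a) - del (D.fed r a))) =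
      vMul (-Complex.I • (star D.Λ w a - star D.Λ a w)) - Complex.I • vMul
        (star D.Λ (D.conn r - del r) a - star D.Λ r (D.conn a - del a) -
          (star D.Λ (D.conn (parity a) - del (parity a)) r + star D.Λ a (D.conn r - del r))) := by
    rw [map_sub vMul, ← D.conn_vMul, ← del_vMul, vMul_fed D hr, ← hA]
    have e2 : D.conn A - del A = star D.Λ (D.conn r - del r) a - star D.Λ r (D.conn a - del a) -
          (star D.Λ (D.conn (parity a) - del (parity a)) r + star D.Λ a (D.conn r - del r)) := by
      have f1 := D.conn_sub_del_star r a
      have f2 := D.conn_sub_del_star (parity a) r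
      rw [hr, map_neg, LinearMap.neg_apply] at f1
      rw [parity_parity] at f2
      rw [hA, map_sub, map_sub]
      linear_combination (norm := module) f1 - f2
    rw [← e2, ← D.vMul_conn_sub_del, map_sub D.conn, map_sub del, map_smul,
      LinearMap.map_smul_of_tower, D.conn_vMul, del_vMul]
    simp only [map_sub, smul_sub, LinearMap.map_smul_of_tower]
    abel
  -- the contributions of the commutator with `r`, split into left and right multiplication
  have e3 : vMul (star D.Λ r (D.fed r a)) =
      vMul (star D.Λ r (D.conn a - del a)) - Complex.I • star D.Λ r A := by
    rw [← star_vMul_right, vMul_fed D hr, ← hA, map_sub, LinearMap.map_smul_of_tower,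
      star_vMul_right]
  have e4 : vMul (star D.Λ (parity (D.fed r a)) r) =
      -vMul (star D.Λ (D.conn (parity a) - del (parity a)) r) -
        Complex.I • star D.Λ (star D.Λ a r - star D.Λ r (parity a)) r := by
    rw [← star_vMul_left, vMul_parity, vMul_fed D hr, ← hA, map_sub parity,
      LinearMap.map_smul_of_tower, ← vMul_parity, parity_conn_sub_del, map_neg vMul, hA,
      map_sub parity, parity_star, parity_star, hr, parity_parity, map_sub (star D.Λ),
      map_neg (star D.Λ), LinearMap.sub_apply, LinearMap.map_smul_of_tower, LinearMap.smul_apply,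
      LinearMap.neg_apply, star_vMul_left]
    congr 4
    simp only [map_neg, LinearMap.neg_apply]
    abel
  -- the equation for `r`, multiplied by `a` from the right and from the left
  have e5 : vMul (star D.Λ (D.conn r - del r) a) + vMul (star D.Λ w a) =
      Complex.I • star D.Λ (star D.Λ r r) a := by
    rw [← star_vMul_left, ← star_vMul_left, ← LinearMap.add_apply, ← map_add, hr2,
      LinearMap.map_smul_of_tower, LinearMap.smul_apply]
  have e6 : vMul (star D.Λ a (D.conn r - del r)) + vMul (star D.Λ a w) =
      Complex.I • star D.Λ a (star D.Λ r r) := by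
    rw [← star_vMul_right, ← star_vMul_right, ← map_add, hr2, LinearMap.map_smul_of_tower]
  rw [map_sub vMul (star D.Λ r _), e1, e3, e4]
  -- by associativity the terms with `r` on both sides of `a` cancel, and the terms with `r ∘ r` are
  -- those in the equation for `r`
  have e7 : star D.Λ r A = star D.Λ (star D.Λ r r) a - star D.Λ r (star D.Λ (parity a) r) := by
    rw [hA, map_sub, star_assoc]
  have e8 : star D.Λ (star D.Λ a r - star D.Λ r (parity a)) r =
      star D.Λ a (star D.Λ r r) - star D.Λ r (star D.Λ (parity a) r) := by
    rw [map_sub, LinearMap.sub_apply, star_assoc, star_assoc]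
  rw [e7, e8]
  simp only [map_sub vMul, map_add vMul, LinearMap.map_smul_of_tower]
  linear_combination (norm := module) Complex.I • e6 - Complex.I • e5

end FedosovData

namespace FedosovData

open Fib

variable {n : ℕ} {C : Type*} [CommRing C] [Algebra ℂ C] (D : FedosovData n C)

/-! ### Solution of Fedosov's equation by recursion on the total degree -/

theorem deg_conn (k : ℕ) (a : Fib n C) : deg k (D.conn a) = D.conn (deg k a) := by
  simp only [conn_apply, frameD, nabla_apply, map_add, map_sum, LinearMap.map_smul_of_tower,
    deg_wedge, deg_wedge₂, deg_contr, map_sub, deg_coeffDer, deg_lin]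

theorem deg_torsionElt (k : ℕ) : deg k D.torsionElt = if k = 1 then D.torsionElt else 0 := by
  have h : ∀ γ τ, deg k (zMul γ (wedge₂ (D.torsion τ) (one : Fib n C))) =
      if k = 1 then zMul γ (wedge₂ (D.torsion τ) one) else 0 := by
    intro γ τ
    match k with
    | 0 => rw [deg_zero_zMul]; rfl
    | 1 => rw [deg_succ_zMul, deg_wedge₂, deg_one]; rfl
    | k + 2 => rw [deg_succ_zMul, deg_wedge₂, deg_one, if_neg (by omega), if_neg (by omega),
        map_zero, map_zero]
  simp only [torsionElt, LinearMap.map_smul_of_tower, map_sum, map_smul, h]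
  split_ifs
  · rfl
  · simp only [smul_zero, Finset.sum_const_zero]

theorem deg_curvatureElt (k : ℕ) : deg k D.curvatureElt = if k = 2 then D.curvatureElt else 0 := by
  have h : ∀ γ φ α β, deg k (zMul γ (zMul φ (wedge α (wedge β (one : Fib n C))))) =
      if k = 2 then zMul γ (zMul φ (wedge α (wedge β one))) else 0 := by
    intro γ φ α β
    match k with
    | 0 => rw [deg_zero_zMul]; rfl
    | 1 => rw [deg_succ_zMul, deg_zero_zMul, map_zero]; rfl
    | 2 => rw [deg_succ_zMul, deg_succ_zMul, deg_wedge, deg_wedge, deg_one]; rfl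
    | k + 3 => rw [deg_succ_zMul, deg_succ_zMul, deg_wedge, deg_wedge, deg_one, if_neg (by omega),
        if_neg (by omega), map_zero, map_zero, map_zero, map_zero]
  simp only [curvatureElt, LinearMap.map_smul_of_tower, map_sum, map_smul, h]
  split_ifs
  · rfl
  · simp only [smul_zero, Finset.sum_const_zero]

theorem conn_mem_forms {q : ℕ} {a : Fib n C} (ha : a ∈ forms n C q) :
    D.conn a ∈ forms n C (q + 1) := by
  refine add_mem (sum_mem fun α _ => wedge_mem_forms α
    (sub_mem (coeffDer_mem_forms _ ha) (lin_mem_forms _ ha))) ?_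
  refine Submodule.smul_of_tower_mem _ _ (sum_mem fun τ _ => ?_)
  cases q with
  | zero => rw [contr_of_mem_forms_zero τ ha, map_zero]; exact zero_mem _
  | succ q => exact wedge₂_mem_forms _ (contr_mem_forms τ ha)

theorem source_mem_forms {r : Fib n C} (hr : r ∈ forms n C 1) : D.source r ∈ forms n C 2 :=
  sub_mem (add_mem (add_mem D.torsionElt_mem_forms D.curvatureElt_mem_forms) (D.conn_mem_forms hr))
    (Submodule.smul_of_tower_mem _ _ (vDiv_mem_forms (star_mem_forms D.Λ hr hr)))

theorem deg_source (k : ℕ) (a : Fib n C) : deg k (D.source a) =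
    (if k = 1 then D.torsionElt else 0) + (if k = 2 then D.curvatureElt else 0) + D.conn (deg k a) -
      Complex.I • vDiv (∑ p ∈ Finset.HasAntidiagonal.antidiagonal (k + 2),
        star D.Λ (deg p.1 a) (deg p.2 a)) := by
  rw [source, map_sub, map_add, map_add, LinearMap.map_smul_of_tower, deg_vDiv, deg_star,
    deg_torsionElt, deg_curvatureElt, deg_conn]

theorem sum_star_deg {a : Fib n C} (h0 : deg 0 a = 0) (h1 : deg 1 a = 0) (j : ℕ) (b : Fib n C)
    (h0' : deg 0 b = 0) (h1' : deg 1 b = 0) :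
    ∑ p ∈ Finset.HasAntidiagonal.antidiagonal (j + 4), star D.Λ (deg p.1 a) (deg p.2 b) =
      ∑ l ∈ Finset.range (j + 1), star D.Λ (deg (l + 2) a) (deg (j - l + 2) b) := by
  rw [Finset.Nat.antidiagonal_succ_succ', Finset.sum_cons, Finset.sum_cons, Finset.sum_map,
    Finset.Nat.antidiagonal_succ_succ', Finset.sum_cons, Finset.sum_cons, Finset.sum_map,
    ← Finset.Nat.sum_antidiagonal_eq_sum_range_succ
      (fun p q => star D.Λ (deg (p + 2) a) (deg (q + 2) b))]
  simp only [h0, h0', h1, h1', map_zero, LinearMap.zero_apply, zero_add, Function.Embedding.prodMap,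
    Function.Embedding.coeFn_mk, Prod.map, Nat.succ_eq_add_one]

theorem sum_star_deg_of_lt {a b : Fib n C} (h0 : deg 0 a = 0) (h1 : deg 1 a = 0)
    (h0' : deg 0 b = 0) (h1' : deg 1 b = 0) {k : ℕ} (hk : k < 4) :
    ∑ p ∈ Finset.HasAntidiagonal.antidiagonal k, star D.Λ (deg p.1 a) (deg p.2 b) = 0 := by
  refine Finset.sum_eq_zero fun p hp => ?_
  rw [Finset.HasAntidiagonal.mem_antidiagonal] at hp
  have h : p.1 = 0 ∨ p.1 = 1 ∨ p.2 = 0 ∨ p.2 = 1 := by omega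
  rcases h with h | h | h | h <;> simp [h, h0, h1, h0', h1']

/-- The recursion for the homogeneous components, for `F r = δ⁻¹ (T + R + D r - (i/v) r ∘ r)`. -/
theorem deg_delInv_source {a : Fib n C} (h0 : deg 0 a = 0) (h1 : deg 1 a = 0) :
    deg 0 (delInv (D.source a)) = 0 ∧ deg 1 (delInv (D.source a)) = 0 ∧
    deg 2 (delInv (D.source a)) = delInv D.torsionElt ∧
    deg 3 (delInv (D.source a)) = delInv (D.curvatureElt + D.conn (deg 2 a) -
      Complex.I • vDiv (star D.Λ (deg 2 a) (deg 2 a))) ∧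
    ∀ k, 1 ≤ k → deg (k + 3) (delInv (D.source a)) = delInv (D.conn (deg (k + 2) a) -
      Complex.I • vDiv (∑ l ∈ Finset.range (k + 1),
        star D.Λ (deg (l + 2) a) (deg (k - l + 2) a))) := by
  refine ⟨deg_zero_delInv _, ?_, ?_, ?_, fun k hk => ?_⟩
  · rw [deg_succ_delInv, deg_source, D.sum_star_deg_of_lt h0 h1 h0 h1 (by norm_num), h0]
    simp
  · rw [deg_succ_delInv, deg_source, D.sum_star_deg_of_lt h0 h1 h0 h1 (by norm_num), h1]
    simp
  · rw [deg_succ_delInv, deg_source, D.sum_star_deg h0 h1 0 a h0 h1]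
    simp
  · rw [show k + 3 = (k + 2) + 1 from rfl, deg_succ_delInv, deg_source,
      D.sum_star_deg h0 h1 k a h0 h1,
      if_neg (by omega), if_neg (by omega), zero_add, zero_add]

/-- The map `r ↦ δ⁻¹ (T + R + D r - (i/v) r ∘ r)` is contracting for the filtration by the total
degree. -/
theorem deg_delInv_source_congr {a b : Fib n C} (ha0 : deg 0 a = 0) (ha1 : deg 1 a = 0)
    (hb0 : deg 0 b = 0) (hb1 : deg 1 b = 0) {k : ℕ} (h : ∀ i ≤ k, deg i a = deg i b) :
    ∀ i ≤ k + 1, deg i (delInv (D.source a)) = deg i (delInv (D.source b)) := by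
  obtain ⟨a0, a1, a2, a3, ak⟩ := D.deg_delInv_source ha0 ha1
  obtain ⟨b0, b1, b2, b3, bk⟩ := D.deg_delInv_source hb0 hb1
  intro i hi
  match i with
  | 0 => rw [a0, b0]
  | 1 => rw [a1, b1]
  | 2 => rw [a2, b2]
  | 3 => rw [a3, b3, h 2 (by omega)]
  | i + 4 =>
    rw [show i + 4 = (i + 1) + 3 from rfl, ak _ (by omega), bk _ (by omega), h _ (by omega)]
    -- in degree `i + 4` only the components of degrees `2, …, i + 3` enter
    congr 4
    refine Finset.sum_congr rfl fun l hl => ?_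
    rw [Finset.mem_range] at hl
    rw [h _ (by omega), h _ (by omega)]

/-- The successive approximations of the solution. -/
def approx : ℕ → Fib n C
  | 0 => 0
  | j + 1 => delInv (D.source (approx j))

theorem deg_approx_zero_one (j : ℕ) : deg 0 (D.approx j) = 0 ∧ deg 1 (D.approx j) = 0 := by
  induction j with
  | zero => exact ⟨map_zero _, map_zero _⟩
  | succ j ih => exact ⟨(D.deg_delInv_source ih.1 ih.2).1, (D.deg_delInv_source ih.1 ih.2).2.1⟩

theorem approx_mem_forms (j : ℕ) : D.approx j ∈ forms n C 1 := by
  induction j with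
  | zero => exact zero_mem _
  | succ j ih => exact delInv_mem_forms (D.source_mem_forms ih)

theorem deg_approx_succ (j : ℕ) : ∀ i ≤ j + 1, deg i (D.approx (j + 1)) = deg i (D.approx j) := by
  induction j with
  | zero =>
    intro i hi
    have h0 := D.deg_approx_zero_one 0
    have h1 := D.deg_approx_zero_one 1
    obtain rfl | rfl : i = 0 ∨ i = 1 := by omega
    · rw [h0.1, h1.1]
    · rw [h0.2, h1.2]
  | succ j ih =>
    have h0 := D.deg_approx_zero_one j
    have h1 := D.deg_approx_zero_one (j + 1)
    exact D.deg_delInv_source_congr h1.1 h1.2 h0.1 h0.2 ih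

theorem deg_approx {i j : ℕ} (h : i ≤ j) : deg i (D.approx j) = deg i (D.approx i) := by
  induction j, h using Nat.le_induction with
  | base => rfl
  | succ j hj ih => rw [D.deg_approx_succ j i (by omega), ih]

/-- The solution of Fedosov's equation: its component of degree `k` is that of the `k`-th
approximation. -/
def sol : Fib n C := fun r m S => D.approx (2 * r + m.degree) r m S

theorem deg_sol (k : ℕ) : deg k D.sol = deg k (D.approx k) := by
  funext r m S
  rw [deg_apply, deg_apply]
  split_ifs with h
  · rw [sol, h]
  · rfl

theorem deg_sol_zero : deg 0 D.sol = 0 := by rw [deg_sol, (D.deg_approx_zero_one 0).1]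

theorem deg_sol_one : deg 1 D.sol = 0 := by rw [deg_sol, (D.deg_approx_zero_one 1).2]

theorem sol_mem_forms : D.sol ∈ forms n C 1 := fun r m S h => D.approx_mem_forms _ r m S h

theorem sol_eq : D.sol = delInv (D.source D.sol) := by
  refine deg_ext fun k => ?_
  have h := D.deg_approx_zero_one k
  have h2 := D.deg_delInv_source_congr D.deg_sol_zero D.deg_sol_one h.1 h.2 (k := k)
    (fun i hi => by rw [deg_sol, D.deg_approx hi]) k (by omega)
  rw [h2, deg_sol, ← D.deg_approx_succ k k (by omega)]
  rfl

/-- The characterization of the solution of Fedosov's equation. -/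
structure IsSolution (r : Fib n C) : Prop where
  mem_forms : r ∈ forms n C 1
  delInv_eq : delInv r = 0
  deg_zero : deg 0 r = 0
  deg_one : deg 1 r = 0
  del_eq : del r = D.source r

theorem apply_zero_empty_of_mem_forms {q : ℕ} {a : Fib n C} (ha : a ∈ forms n C (q + 1)) (r : ℕ) :
    a r 0 ∅ = 0 := ha _ _ _ (by simp)

variable {D} in
/-- By the Hodge identity, a solution is a fixed point of `r ↦ δ⁻¹ (T + R + D r - (i/v) r ∘ r)`. -/
theorem IsSolution.eq_delInv {r : Fib n C} (h : D.IsSolution r) : r = delInv (D.source r) := by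
  have := del_delInv r (apply_zero_empty_of_mem_forms h.mem_forms)
  rw [h.delInv_eq, map_zero, zero_add, h.del_eq] at this
  exact this.symm

variable {D} in
theorem IsSolution.unique {a b : Fib n C} (ha : D.IsSolution a) (hb : D.IsSolution b) : a = b := by
  have h : ∀ k, ∀ i ≤ k, deg i a = deg i b := by
    intro k
    induction k with
    | zero =>
      intro i hi
      obtain rfl : i = 0 := by omega
      rw [ha.deg_zero, hb.deg_zero]
    | succ k ih =>
      rw [ha.eq_delInv, hb.eq_delInv]
      exact D.deg_delInv_source_congr ha.deg_zero ha.deg_one hb.deg_zero hb.deg_one ih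
  exact deg_ext fun k => h k k le_rfl

/-- The defect of the solution satisfies a homogeneous equation, by the Bianchi identities, and is
determined by its `δ`-image; it vanishes by induction on the degree. -/
theorem del_sol : del D.sol = D.source D.sol := by
  set r := D.sol with hr
  have hp : parity r = -r := by rw [parity_of_mem_forms D.sol_mem_forms]; simp [hr]
  set w := D.torsionElt + D.curvatureElt with hw
  -- the defect of the equation
  obtain ⟨Ω, hΩ⟩ : ∃ Ω, Ω = D.source r - del r := ⟨_, rfl⟩
  have hs : r = delInv (D.source r) := D.sol_eq
  have hd : delInv r = 0 := by rw [hs, delInv_delInv]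
  have hform : Ω ∈ forms n C 2 := hΩ ▸ sub_mem (D.source_mem_forms D.sol_mem_forms)
    (del_mem_forms D.sol_mem_forms)
  -- the Hodge identity for `r` gives `δ⁻¹ δ r = r`, hence `δ⁻¹ Ω = 0` and `Ω = δ⁻¹ δ Ω`
  have h1 : delInv Ω = 0 := by
    have e := del_delInv r (apply_zero_empty_of_mem_forms D.sol_mem_forms)
    rw [hd, map_zero, zero_add] at e
    rw [hΩ, map_sub, e, ← hs, sub_self]
  have h2 : Ω = delInv (del Ω) := by
    have e := del_delInv Ω (apply_zero_empty_of_mem_forms hform)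
    rw [h1, map_zero, zero_add] at e
    exact e.symm
  have hΩ2 : vMul Ω = vMul (D.conn r - del r) + vMul w - Complex.I • star D.Λ r r := by
    have e : Ω = D.conn r - del r + w - Complex.I • vDiv (star D.Λ r r) := by
      rw [hΩ, source, hw]; abel
    rw [e, map_sub, map_add, LinearMap.map_smul_of_tower, vMul_vDiv (star_self_apply_zero D.Λ hp)]
  -- the Bianchi identities, together with the closedness of `θ`
  have hw0 : D.conn w - del w = 0 := by
    rw [hw, map_add, map_add, D.conn_torsionElt, D.conn_curvatureElt, D.del_torsionElt]; abel
  -- the homogeneous equation for the defect: the inhomogeneous terms cancel by `hw0`, and the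
  -- terms cubic in `r` by associativity
  have h3 : vMul (D.conn Ω - del Ω) = -Complex.I • (star D.Λ Ω r - star D.Λ r Ω) := by
    apply vMul_injective
    have e1 : vMul (D.conn Ω - del Ω) = D.conn (vMul Ω) - del (vMul Ω) := by
      rw [D.conn_vMul, del_vMul, map_sub]
    have e2 : D.conn (vMul Ω) - del (vMul Ω) =
        vMul (D.conn (D.conn r - del r) - del (D.conn r - del r)) -
          Complex.I • (star D.Λ (D.conn r - del r) r - star D.Λ r (D.conn r - del r)) := by
      have e3 := D.conn_sub_del_star r r
      rw [hp, map_neg, LinearMap.neg_apply, ← sub_eq_add_neg] at e3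
      have e4 : vMul (D.conn w) - vMul (del w) = 0 := by rw [← map_sub, hw0, map_zero]
      rw [← e3, hΩ2, map_sub D.conn, map_add D.conn, map_sub del, map_add del, map_smul,
        LinearMap.map_smul_of_tower, D.conn_vMul, del_vMul, D.conn_vMul, del_vMul, map_sub vMul]
      linear_combination (norm := module) e4
    have f3 := D.vMul_conn_sub_del r
    rw [← hw] at f3
    rw [e1, e2, f3]
    generalize D.conn r - del r = X at hΩ2
    have f1 : vMul (star D.Λ Ω r) = vMul (star D.Λ X r) + vMul (star D.Λ w r) -
        Complex.I • star D.Λ r (star D.Λ r r) := by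
      rw [← star_vMul_left, hΩ2, map_sub, map_add, LinearMap.sub_apply, LinearMap.add_apply,
        star_vMul_left, star_vMul_left, LinearMap.map_smul_of_tower, LinearMap.smul_apply,
        star_assoc]
    have f2 : vMul (star D.Λ r Ω) = vMul (star D.Λ r X) + vMul (star D.Λ r w) -
        Complex.I • star D.Λ r (star D.Λ r r) := by
      rw [← star_vMul_right, hΩ2, map_sub, map_add, star_vMul_right, star_vMul_right,
        LinearMap.map_smul_of_tower]
    simp only [LinearMap.map_smul_of_tower, map_sub vMul, f1, f2]
    module
  -- `δ Ω` in degree `i` involves only components of `Ω` of degree at most `i`, because `r` starts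
  -- in degree `2`; and `δ⁻¹` raises the degree by one
  have h4 : ∀ k, ∀ i < k, deg i Ω = 0 := by
    intro k
    induction k with
    | zero => intro i hi; omega
    | succ k ih =>
      intro i hi
      by_cases hik : i < k
      · exact ih i hik
      obtain rfl : i = k := by omega
      cases i with
      | zero => rw [h2, deg_zero_delInv]
      | succ i =>
        rw [h2, deg_succ_delInv]
        have e1 : vMul (del Ω) = vMul (D.conn Ω) + Complex.I • (star D.Λ Ω r - star D.Λ r Ω) := by
          rw [map_sub] at h3
          linear_combination (norm := module) -h3
        have e2 : deg (i + 2) (vMul (del Ω)) = 0 := by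
          rw [e1, map_add, LinearMap.map_smul_of_tower, map_sub, deg_vMul, deg_conn,
            ih i (by omega),
            map_zero, map_zero, deg_star, deg_star, Finset.sum_eq_zero, Finset.sum_eq_zero]
          · simp
          all_goals
            intro p hp
            rw [Finset.HasAntidiagonal.mem_antidiagonal] at hp
          · by_cases h : p.1 < 2
            · obtain h | h : p.1 = 0 ∨ p.1 = 1 := by omega
              · rw [h, hr, deg_sol_zero, map_zero, LinearMap.zero_apply]
              · rw [h, hr, deg_sol_one, map_zero, LinearMap.zero_apply]
            · rw [ih p.2 (by omega), map_zero]
          · by_cases h : p.2 < 2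
            · obtain h | h : p.2 = 0 ∨ p.2 = 1 := by omega
              · rw [h, hr, deg_sol_zero, map_zero]
              · rw [h, hr, deg_sol_one, map_zero]
            · rw [ih p.1 (by omega), map_zero, LinearMap.zero_apply]
        rw [deg_vMul] at e2
        rw [vMul_injective (e2.trans (map_zero _).symm), map_zero]
  have h5 : Ω = 0 := deg_ext fun k => by rw [h4 (k + 1) k (by omega), map_zero]
  rw [hΩ, sub_eq_zero] at h5
  exact h5.symm

theorem isSolution_sol : D.IsSolution D.sol where
  mem_forms := D.sol_mem_forms
  delInv_eq := by rw [D.sol_eq, delInv_delInv]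
  deg_zero := D.deg_sol_zero
  deg_one := D.deg_sol_one
  del_eq := D.del_sol

end FedosovData

/-! ### Minors -/

section Minor

variable {n : ℕ} {C : Type*} [CommRing C]

/-- The minor of `A` with rows `S` and columns `T`. -/
def cminor (A : Matrix (Idx n) (Idx n) C) (S T : Finset (Idx n)) : C :=
  if h : S.card = T.card then
    (A.submatrix (nth S) fun k : Fin S.card => nth T (Fin.cast h k)).det
  else 0

theorem nth_eq {S : Finset (Idx n)} {k : ℕ} (hk : S.card = k) {f : Fin k → Idx n}
    (hf : ∀ i, f i ∈ S) (hm : StrictMono fun i => finSumFinEquiv (f i)) (i : Fin k) :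
    f i = nth S (Fin.cast hk.symm i) := by
  subst hk
  have h := Finset.orderEmbOfFin_unique (s := S.map finSumFinEquiv.toEmbedding) (Finset.card_map _)
    (f := fun i => finSumFinEquiv (f i)) (fun i => by simpa using hf i) hm
  rw [nth, Equiv.eq_symm_apply]
  exact congrFun h i

theorem nth_mem (S : Finset (Idx n)) (k : Fin S.card) : nth S k ∈ S := by
  have h := Finset.orderEmbOfFin_mem (S.map finSumFinEquiv.toEmbedding) (Finset.card_map _) k
  rw [Finset.mem_map_equiv] at h
  exact h

theorem strictMono_nth (S : Finset (Idx n)) : StrictMono fun k => finSumFinEquiv (nth S k) := by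
  intro i j h
  simpa [nth] using h

theorem nth_bijOn (S : Finset (Idx n)) {β : Idx n} (h : β ∈ S) : ∃ k, nth S k = β := by
  have h2 : finSumFinEquiv β ∈ Set.range ((S.map finSumFinEquiv.toEmbedding).orderEmbOfFin
      (Finset.card_map _ : _ = S.card)) := by
    rw [Finset.range_orderEmbOfFin]
    simpa using h
  obtain ⟨k, hk⟩ := h2
  exact ⟨k, by rw [nth, hk, Equiv.symm_apply_apply]⟩

theorem cminor_eq (A : Matrix (Idx n) (Idx n) C) {S T : Finset (Idx n)} {k : ℕ}
    (hS : S.card = k) (hT : T.card = k) {f g : Fin k → Idx n}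
    (hf : ∀ i, f i ∈ S) (hfm : StrictMono fun i => finSumFinEquiv (f i))
    (hg : ∀ i, g i ∈ T) (hgm : StrictMono fun i => finSumFinEquiv (g i)) :
    cminor A S T = (A.submatrix f g).det := by
  subst hS
  rw [cminor, dif_pos hT.symm]
  congr 1
  ext i j
  rw [Matrix.submatrix_apply, Matrix.submatrix_apply, nth_eq rfl hf hfm, nth_eq hT hg hgm]
  rfl

theorem cminor_of_card_ne (A : Matrix (Idx n) (Idx n) C) {S T : Finset (Idx n)}
    (h : S.card ≠ T.card) : cminor A S T = 0 := dif_neg h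

theorem cminor_empty (A : Matrix (Idx n) (Idx n) C) : cminor A ∅ ∅ = 1 := by
  rw [cminor, dif_pos rfl]
  exact Matrix.det_isEmpty (n := Fin 0)

theorem inversions_singleton_nth (S : Finset (Idx n)) (j : Fin S.card) :
    inversions {nth S j} (S.erase (nth S j)) = j := by
  have h : (({nth S j} ×ˢ (S.erase (nth S j))).filter
      fun q : Idx n × Idx n => finSumFinEquiv q.2 < finSumFinEquiv q.1) =
      (Finset.univ.filter fun i : Fin S.card => i < j).image (fun i => (nth S j, nth S i)) := by
    ext ⟨a, b⟩
    simp only [Finset.mem_filter, Finset.mem_product, Finset.mem_singleton, Finset.mem_erase,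
      Finset.mem_image, Finset.mem_univ, true_and, Prod.mk.injEq]
    constructor
    · rintro ⟨⟨rfl, h1, h2⟩, h3⟩
      obtain ⟨i, rfl⟩ := nth_bijOn S h2
      exact ⟨i, (strictMono_nth S).lt_iff_lt.1 h3, rfl, rfl⟩
    · rintro ⟨i, h1, rfl, rfl⟩
      have h2 := (strictMono_nth S) h1
      exact ⟨⟨rfl, fun h => (ne_of_lt h2) (congrArg _ h), nth_mem S i⟩, h2⟩
  rw [inversions, h, Finset.card_image_of_injective]
  · rw [show (Finset.univ.filter fun i : Fin S.card => i < j) = Finset.Iio j by ext; simp,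
      Fin.card_Iio]
  · intro i j h
    exact (strictMono_nth S).injective (congrArg finSumFinEquiv (Prod.mk.inj h).2)

/-- Expansion of a minor along its first row. -/
theorem cminor_insert (A : Matrix (Idx n) (Idx n) C) {α : Idx n} {S T : Finset (Idx n)}
    (hα : ∀ β ∈ S, finSumFinEquiv α < finSumFinEquiv β) :
    cminor A (insert α S) T =
      ∑ β ∈ T, A α β * (sgn C {β} (T.erase β) * cminor A S (T.erase β)) := by
  have hαS : α ∉ S := fun h => lt_irrefl _ (hα α h)
  by_cases hc : S.card + 1 = T.card
  · have hSα : (insert α S).card = S.card + 1 := Finset.card_insert_of_notMem hαS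
    set g : Fin (S.card + 1) → Idx n := fun j => nth T (Fin.cast hc j) with hg
    have hgT : ∀ j, g j ∈ T := fun j => nth_mem T _
    have hgm : StrictMono fun j => finSumFinEquiv (g j) := fun i j h => strictMono_nth T h
    have hginj : Function.Injective g := fun i j h => hgm.injective (congrArg _ h)
    set f : Fin (S.card + 1) → Idx n := Fin.cons α (nth S) with hf
    have hfm : StrictMono fun i => finSumFinEquiv (f i) := by
      intro i j h
      induction i using Fin.cases with
      | zero =>
        induction j using Fin.cases with
        | zero => exact absurd h (lt_irrefl _)
        | succ j => exact hα _ (nth_mem S j)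
      | succ i =>
        induction j using Fin.cases with
        | zero => exact absurd h (Fin.not_lt_zero _)
        | succ j => exact strictMono_nth S (Fin.succ_lt_succ_iff.1 h)
    rw [cminor_eq A hSα hc.symm (f := f) (g := g) ?_ hfm hgT hgm, Matrix.det_succ_row_zero]
    · have hT : T = Finset.univ.image g := by
        symm
        apply Finset.eq_of_subset_of_card_le
        · intro β hβ
          obtain ⟨j, -, rfl⟩ := Finset.mem_image.1 hβ
          exact hgT j
        · rw [Finset.card_image_of_injective _ hginj, Finset.card_univ, Fintype.card_fin, hc]
      conv_rhs => rw [hT, Finset.sum_image fun _ _ _ _ h => hginj h, ← hT]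
      refine Finset.sum_congr rfl fun j _ => ?_
      have h1 : sgn C {g j} (T.erase (g j)) = (-1) ^ (j : ℕ) := by
        rw [sgn]
        congr 1
        exact inversions_singleton_nth T (Fin.cast hc j)
      have h2 : cminor A S (T.erase (g j)) =
          ((A.submatrix f g).submatrix Fin.succ j.succAbove).det := by
        refine cminor_eq A rfl ?_ (f := nth S) (g := fun i => g (j.succAbove i)) (nth_mem S)
          (strictMono_nth S)
            (fun i => Finset.mem_erase.2 ⟨fun h => Fin.succAbove_ne j i (hginj h), hgT _⟩)
          (fun i k h => hgm (Fin.strictMono_succAbove j h))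
        rw [Finset.card_erase_of_mem (hgT j)]
        omega
      rw [h1, h2, Matrix.submatrix_apply]
      simp only [hf, Fin.cons_zero]
      ring
    · intro i
      induction i using Fin.cases with
      | zero => exact Finset.mem_insert_self _ _
      | succ i => exact Finset.mem_insert_of_mem (nth_mem S i)
  · rw [cminor_of_card_ne, Finset.sum_eq_zero]
    · intro β hβ
      rw [cminor_of_card_ne, mul_zero, mul_zero]
      rw [Finset.card_erase_of_mem hβ]
      have := Finset.card_pos.2 ⟨β, hβ⟩
      omega
    · rwa [Finset.card_insert_of_notMem hαS]

end Minor

namespace Fib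

variable {n : ℕ} {C : Type*} [CommRing C] [Algebra ℂ C]

/-! ### Linear substitutions -/

open MvPolynomial in
/-- The linear form `A^α_β z^β`. -/
def linForm (A : Matrix (Idx n) (Idx n) C) (α : Idx n) : MvPolynomial (Idx n) C :=
  ∑ β, MvPolynomial.C (A α β) * X β

/-- The linear substitution `z^α ↦ A^α_β z^β`, `e^α ↦ A^α_β e^β` in a series. -/
def pull (A : Matrix (Idx n) (Idx n) C) : Fib n C →ₗ[C] Fib n C where
  toFun b r m S := ∑ m' ∈ Finset.finsuppAntidiag (Finset.univ : Finset (Idx n)) m.degree,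
    ∑ S' : Finset (Idx n),
      (MvPolynomial.coeff m (∏ α, linForm A α ^ m' α) * cminor A S' S) * b r m' S'
  map_add' a b := by
    funext r m S
    simp only [Pi.add_apply, mul_add, Finset.sum_add_distrib]
  map_smul' c a := by
    funext r m S
    simp only [Pi.smul_apply, smul_eq_mul, Finset.mul_sum, mul_left_comm c, RingHom.id_apply]

theorem pull_apply (A : Matrix (Idx n) (Idx n) C) (b : Fib n C) (r m S) : pull A b r m S =
    ∑ m' ∈ Finset.finsuppAntidiag (Finset.univ : Finset (Idx n)) m.degree, ∑ S' : Finset (Idx n),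
      (MvPolynomial.coeff m (∏ α, linForm A α ^ m' α) * cminor A S' S) * b r m' S' := rfl

theorem mem_finsuppAntidiag_univ {d : ℕ} {m : Idx n →₀ ℕ} :
    m ∈ Finset.finsuppAntidiag (Finset.univ : Finset (Idx n)) d ↔ m.degree = d := by
  rw [Finset.mem_finsuppAntidiag, Finsupp.degree_eq_sum]
  simp

/-- The homogeneous part of degree `d` of a series, as a polynomial. -/
def homPart (d : ℕ) (f : (Idx n →₀ ℕ) → C) : MvPolynomial (Idx n) C :=
  ∑ m ∈ Finset.finsuppAntidiag (Finset.univ : Finset (Idx n)) d, MvPolynomial.monomial m (f m)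

theorem coeff_homPart (d : ℕ) (f : (Idx n →₀ ℕ) → C) (m : Idx n →₀ ℕ) :
    (homPart d f).coeff m = if m.degree = d then f m else 0 := by
  classical
  simp only [homPart, MvPolynomial.coeff_sum, MvPolynomial.coeff_monomial]
  rw [Finset.sum_ite_eq']
  simp only [mem_finsuppAntidiag_univ]

theorem pderiv_homPart (d : ℕ) (f : (Idx n →₀ ℕ) → C) (γ : Idx n) :
    MvPolynomial.pderiv γ (homPart (d + 1) f) =
      homPart d fun m => ((m γ : C) + 1) * f (m + Finsupp.single γ 1) := by
  ext m
  rw [MvPolynomial.coeff_pderiv, coeff_homPart, coeff_homPart, degree_add_single]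
  simp only [add_left_inj]
  split_ifs
  · rw [mul_comm]
  · rw [zero_mul]

/-- The substitution of linear forms in a polynomial. -/
def polySubst (A : Matrix (Idx n) (Idx n) C) :
    MvPolynomial (Idx n) C →ₐ[C] MvPolynomial (Idx n) C :=
  MvPolynomial.aeval (linForm A)

theorem polySubst_homPart (A : Matrix (Idx n) (Idx n) C) (d : ℕ) (f : (Idx n →₀ ℕ) → C)
    (m : Idx n →₀ ℕ) : (polySubst A (homPart d f)).coeff m =
      ∑ m' ∈ Finset.finsuppAntidiag (Finset.univ : Finset (Idx n)) d,
        MvPolynomial.coeff m (∏ α, linForm A α ^ m' α) * f m' := by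
  rw [homPart, map_sum, MvPolynomial.coeff_sum]
  refine Finset.sum_congr rfl fun m' _ => ?_
  rw [polySubst, MvPolynomial.aeval_monomial, MvPolynomial.algebraMap_eq, MvPolynomial.coeff_C_mul,
    Finsupp.prod_fintype _ _ (fun _ => pow_zero _), mul_comm]

theorem pderiv_polySubst (A : Matrix (Idx n) (Idx n) C) (β : Idx n) (p : MvPolynomial (Idx n) C) :
    MvPolynomial.pderiv β (polySubst A p) =
      ∑ γ, MvPolynomial.C (A γ β) * polySubst A (MvPolynomial.pderiv γ p) := by
  induction p using MvPolynomial.induction_on with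
  | C c => simp [polySubst]
  | add p q hp hq => simp only [map_add, hp, hq, mul_add, Finset.sum_add_distrib]
  | mul_X p α hp =>
    have h1 : polySubst A (MvPolynomial.X α) = linForm A α := MvPolynomial.aeval_X _ _
    have h2 : MvPolynomial.pderiv β (linForm A α) = MvPolynomial.C (A α β) := by
      rw [linForm, map_sum, Finset.sum_eq_single β]
      · rw [MvPolynomial.pderiv_C_mul, MvPolynomial.pderiv_X_self, _root_.mul_one]
      · intro γ _ h
        rw [MvPolynomial.pderiv_C_mul, MvPolynomial.pderiv_X_of_ne h, mul_zero]
      · simp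
    have h3 : ∀ γ, MvPolynomial.C (A γ β) *
        polySubst A (MvPolynomial.pderiv γ (p * MvPolynomial.X α)) =
        MvPolynomial.C (A γ β) * polySubst A (MvPolynomial.pderiv γ p) * linForm A α +
          if γ = α then MvPolynomial.C (A γ β) * polySubst A p else 0 := by
      intro γ
      rw [Derivation.leibniz, smul_eq_mul, smul_eq_mul, map_add, map_mul, map_mul, h1]
      split_ifs with h
      · subst h
        rw [MvPolynomial.pderiv_X_self, map_one]; ring
      · rw [MvPolynomial.pderiv_X_of_ne (Ne.symm h), map_zero]; ring
    simp only [h3, Finset.sum_add_distrib, Finset.sum_ite_eq', Finset.mem_univ, if_true]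
    rw [map_mul, h1, Derivation.leibniz, h2, hp, ← Finset.sum_mul, smul_eq_mul, smul_eq_mul]
    ring

theorem pull_eq (A : Matrix (Idx n) (Idx n) C) (b : Fib n C) (r m S) : pull A b r m S =
    (polySubst A (homPart m.degree fun m' =>
      ∑ S' : Finset (Idx n), cminor A S' S * b r m' S')).coeff m := by
  rw [pull_apply, polySubst_homPart]
  simp only [Finset.mul_sum, _root_.mul_assoc]

/-- The chain rule. -/
theorem zDer_pull (A : Matrix (Idx n) (Idx n) C) (β : Idx n) (b : Fib n C) :
    zDer β (pull A b) = ∑ γ, A γ β • pull A (zDer γ b) := by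
  funext r m S
  rw [zDer_apply, pull_eq, degree_add_single, mul_comm, ← MvPolynomial.coeff_pderiv,
    pderiv_polySubst]
  simp only [pderiv_homPart, Finset.sum_apply, Pi.smul_apply, pull_eq, MvPolynomial.coeff_sum,
    MvPolynomial.coeff_C_mul, smul_eq_mul, zDer_apply, Finset.mul_sum, mul_left_comm]

theorem pull_apply_zero (A : Matrix (Idx n) (Idx n) C) (b : Fib n C) (r S) : pull A b r 0 S =
    ∑ S' : Finset (Idx n), cminor A S' S * b r 0 S' := by
  rw [pull_eq, map_zero]
  have : homPart 0 (fun m' => ∑ S' : Finset (Idx n), cminor A S' S * b r m' S') =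
      MvPolynomial.C (∑ S' : Finset (Idx n), cminor A S' S * b r 0 S') := by
    ext m
    rw [coeff_homPart, MvPolynomial.coeff_C]
    by_cases h : m = 0
    · subst h; simp
    · rw [if_neg (fun h' => h (Finsupp.degree_eq_zero_iff _ |>.1 h')), if_neg (Ne.symm h)]
  rw [this, polySubst, MvPolynomial.aeval_C, MvPolynomial.algebraMap_eq, MvPolynomial.coeff_zero_C]

end Fib

/-! ### Linear substitutions and the operations of the fibre -/

namespace Fib

variable {n : ℕ} {C : Type*} [CommRing C] [Algebra ℂ C]

/-- A family of elements without `z`-constant parts, whose fibre derivatives are combinations of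
members of the family, vanishes. -/
theorem eq_zero_of_zDer_mem_span {ι : Type*} (D : ι → Fib n C) (h0 : ∀ i r S, D i r 0 S = 0)
    (h : ∀ i β, zDer β (D i) ∈ Submodule.span C (Set.range D)) (i : ι) : D i = 0 := by
  have key : ∀ d : ℕ, ∀ x ∈ Submodule.span C (Set.range D), ∀ r m S,
      m.degree = d → x r m S = 0 := by
    intro d
    induction d with
    | zero =>
      intro x hx r m S hm
      rw [Finsupp.degree_eq_zero_iff] at hm
      subst hm
      induction hx using Submodule.span_induction with
      | mem x hx => obtain ⟨i, rfl⟩ := hx; exact h0 i r S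
      | zero => rfl
      | add x y _ _ hx hy => rw [Pi.add_apply, Pi.add_apply, Pi.add_apply, hx, hy, add_zero]
      | smul c x _ hx => rw [Pi.smul_apply, Pi.smul_apply, Pi.smul_apply, hx, smul_zero]
    | succ d ih =>
      intro x hx r m S hm
      induction hx using Submodule.span_induction with
      | mem x hx =>
        obtain ⟨i, rfl⟩ := hx
        obtain ⟨β, hβ⟩ : ∃ β, m β ≠ 0 := by
          by_contra hc
          push Not at hc
          have : m = 0 := Finsupp.ext hc
          subst this
          simp at hm
        have h1 := ih _ (h i β) r (m - Finsupp.single β 1) S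
          (by have := degree_sub_single hβ; omega)
        have h2 : m - Finsupp.single β 1 + Finsupp.single β 1 = m := by
          ext i; by_cases hi : i = β
          · subst hi; simp; omega
          · simp [hi]
        rw [zDer_apply, h2] at h1
        have h3 : (((m - Finsupp.single β 1 : Idx n →₀ ℕ) β : C) + 1) = algebraMap ℂ C (m β) := by
          rw [map_natCast, ← Nat.cast_add_one, ← DFunLike.congr_fun h2 β]
          simp
        rw [h3, ← Algebra.smul_def] at h1
        exact (smul_eq_zero_iff_right (by exact_mod_cast hβ)).1 h1
      | zero => rfl
      | add x y _ _ hx hy => rw [Pi.add_apply, Pi.add_apply, Pi.add_apply, hx, hy, add_zero]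
      | smul c x _ hx => rw [Pi.smul_apply, Pi.smul_apply, Pi.smul_apply, hx, smul_zero]
  funext r m S
  exact key _ (D i) (Submodule.subset_span ⟨i, rfl⟩) r m S rfl

variable (A : Matrix (Idx n) (Idx n) C)

/-- On elements with a single form component `e^U`, a substitution acts on the form part through the
minors of the rows `U`. -/
theorem pull_of_supported {b : Fib n C} {U : Finset (Idx n)}
    (hb : ∀ r m T, T ≠ U → b r m T = 0) (r m S) :
    pull A b r m S = cminor A U S * pull A (fun r m _ => b r m U) r m ∅ := by
  rw [pull_apply, pull_apply, Finset.mul_sum]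
  refine Finset.sum_congr rfl fun m' _ => ?_
  rw [Finset.sum_eq_single U, Finset.sum_eq_single ∅, cminor_empty]
  · ring
  · intro T _ hT
    rw [cminor_of_card_ne _ (by simpa using hT), mul_zero, zero_mul]
  · simp
  · intro T _ hT
    rw [hb _ _ _ hT, mul_zero]
  · simp

/-- The exterior multiplication by `A^α_β e^β`. -/
def wedgeRow (α : Idx n) : Fib n C →ₗ[C] Fib n C := ∑ β, A α β • wedge β

theorem wedgeRow_apply (α : Idx n) (b : Fib n C) : wedgeRow A α b = ∑ β, A α β • wedge β b := by
  simp [wedgeRow, LinearMap.sum_apply]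

theorem wedgeRow_wedgeRow (α β : Idx n) (b : Fib n C) :
    wedgeRow A α (wedgeRow A β b) = -wedgeRow A β (wedgeRow A α b) := by
  simp only [wedgeRow_apply, map_sum, map_smul, Finset.smul_sum, smul_smul]
  rw [Finset.sum_comm, ← Finset.sum_neg_distrib]
  refine Finset.sum_congr rfl fun μ _ => ?_
  rw [← Finset.sum_neg_distrib]
  refine Finset.sum_congr rfl fun ν _ => ?_
  rw [wedge_wedge, smul_neg, mul_comm]

theorem wedgeRow_self (α : Idx n) (b : Fib n C) : wedgeRow A α (wedgeRow A α b) = 0 := by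
  have h := wedgeRow_wedgeRow A α α b
  rw [eq_neg_iff_add_eq_zero, ← two_smul ℂ] at h
  exact (smul_eq_zero_iff_right two_ne_zero).1 h

theorem wedge_supported {b : Fib n C} {U : Finset (Idx n)} (hb : ∀ r m T, T ≠ U → b r m T = 0)
    {α : Idx n} (r m T) (hT : T ≠ insert α U) : wedge α b r m T = 0 := by
  rw [wedge_apply]
  split_ifs with h
  · rw [hb, mul_zero]
    intro h2
    exact hT (by rw [← h2, Finset.insert_erase h])
  · rfl

/-- If `α` precedes `U`, this is the Laplace expansion of the minors along the first row. -/
theorem pull_wedge_of_lt {b : Fib n C} {U : Finset (Idx n)} (hb : ∀ r m T, T ≠ U → b r m T = 0)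
    {α : Idx n} (hα : ∀ β ∈ U, finSumFinEquiv α < finSumFinEquiv β) :
    pull A (wedge α b) = wedgeRow A α (pull A b) := by
  have hαU : α ∉ U := fun h => lt_irrefl _ (hα α h)
  have hs : sgn C {α} U = 1 := by
    rw [sgn, inversions, Finset.filter_eq_empty_iff.2, Finset.card_empty, pow_zero]
    rintro ⟨a, b⟩ h
    rw [Finset.mem_product, Finset.mem_singleton] at h
    obtain ⟨rfl, h⟩ := h
    exact (hα _ h).le.not_gt
  funext r m S
  rw [pull_of_supported A (fun r m T hT => wedge_supported hb r m T hT), cminor_insert A hα,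
    wedgeRow_apply]
  simp only [Finset.sum_apply, Pi.smul_apply, wedge_apply, smul_eq_mul]
  rw [Finset.sum_mul, ← Finset.sum_filter_add_sum_filter_not Finset.univ (fun β => β ∈ S)]
  rw [Finset.sum_eq_zero (s := Finset.univ.filter fun β => ¬ β ∈ S), add_zero]
  · rw [Finset.filter_univ_mem]
    refine Finset.sum_congr rfl fun β hβ => ?_
    rw [if_pos hβ, pull_of_supported A hb]
    simp only [Finset.mem_insert_self, if_true, Finset.erase_insert hαU, hs, _root_.one_mul]
    ring
  · intro β hβ
    rw [if_neg (Finset.mem_filter.1 hβ).2, mul_zero]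

/-- A substitution replaces the factor `e^α` by `A^α_β e^β`. -/
theorem pull_wedge (α : Idx n) (b : Fib n C) :
    pull A (wedge α b) = ∑ β, A α β • wedge β (pull A b) := by
  rw [← wedgeRow_apply]
  -- induction on the number of factors of the form: the smallest index is split off and moved to
  -- the front, where the expansion along the first row applies
  have key : ∀ k : ℕ, ∀ (U : Finset (Idx n)) (b : Fib n C) (α : Idx n), U.card = k →
      (∀ r m T, T ≠ U → b r m T = 0) → pull A (wedge α b) = wedgeRow A α (pull A b) := by
    intro k
    induction k with
    | zero =>
      intro U b α hU hb
      rw [Finset.card_eq_zero] at hU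
      subst hU
      exact pull_wedge_of_lt A hb (by simp)
    | succ k ih =>
      intro U b α hU hb
      have hne : U.Nonempty := Finset.card_pos.1 (by omega)
      obtain ⟨μ, hμ, hmin⟩ := Finset.exists_min_image U finSumFinEquiv hne
      set U' := U.erase μ with hU'
      have hcard : U'.card = k := by rw [Finset.card_erase_of_mem hμ]; omega
      have hμ' : ∀ β ∈ U', finSumFinEquiv μ < finSumFinEquiv β := fun β hβ =>
        lt_of_le_of_ne (hmin β (Finset.mem_of_mem_erase hβ))
          fun h => (Finset.ne_of_mem_erase hβ) (finSumFinEquiv.injective h).symm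
      obtain ⟨b', hb', rfl⟩ : ∃ b' : Fib n C,
          (∀ r m T, T ≠ U' → b' r m T = 0) ∧ b = wedge μ b' := by
        refine ⟨fun r m T => if T = U' then sgn C {μ} U' * b r m U else 0,
          fun r m T hT => if_neg hT, ?_⟩
        funext r m T
        rw [wedge_apply]
        by_cases hT : T = U
        · subst hT
          rw [if_pos hμ, if_pos rfl, ← _root_.mul_assoc, sgn_mul_self, _root_.one_mul]
        · rw [hb _ _ _ hT]
          split_ifs with h1 h2
          · exact absurd (by rw [← Finset.insert_erase h1, h2, hU', Finset.insert_erase hμ]) hT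
          · rw [mul_zero]
          · rfl
      have h1 : pull A (wedge μ b') = wedgeRow A μ (pull A b') := pull_wedge_of_lt A hb' hμ'
      rcases lt_trichotomy (finSumFinEquiv α) (finSumFinEquiv μ) with h | h | h
      · refine pull_wedge_of_lt A hb fun β hβ => lt_of_lt_of_le h (hmin β hβ)
      · obtain rfl := finSumFinEquiv.injective h
        rw [wedge_self, map_zero, h1, wedgeRow_self]
      · rw [wedge_wedge, map_neg, h1, wedgeRow_wedgeRow, ← ih U' b' α hcard hb']
        congr 1
        refine pull_wedge_of_lt A (fun r m T hT => wedge_supported hb' r m T hT) fun β hβ => ?_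
        rcases Finset.mem_insert.1 hβ with rfl | hβ
        · exact h
        · exact hμ' β hβ
  have hsum : b = ∑ U : Finset (Idx n), fun r m T => if T = U then b r m T else 0 := by
    funext r m T
    simp [Finset.sum_apply]
  rw [hsum]
  simp only [map_sum]
  refine Finset.sum_congr rfl fun U _ => key _ U _ α rfl fun r m T hT => if_neg hT

theorem isZeroForm_zDer {a : Fib n C} (ha : IsZeroForm a) (α : Idx n) : IsZeroForm (zDer α a) :=
  fun r m S hS => by rw [zDer_apply, ha _ _ _ hS, mul_zero]

theorem isZeroForm_pull {a : Fib n C} (ha : IsZeroForm a) : IsZeroForm (pull A a) := by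
  intro r m S hS
  rw [pull_apply]
  refine Finset.sum_eq_zero fun m' _ => Finset.sum_eq_zero fun T _ => ?_
  by_cases hT : T = ∅
  · subst hT
    rw [cminor_of_card_ne, mul_zero, zero_mul]
    rw [Finset.card_empty]
    exact (Finset.card_ne_zero.2 (Finset.nonempty_iff_ne_empty.2 hS)).symm
  · rw [ha _ _ _ hT, mul_zero]

theorem pull_apply_zero_empty (b : Fib n C) (r) : pull A b r 0 ∅ = b r 0 ∅ := by
  rw [pull_apply_zero, Finset.sum_eq_single ∅, cminor_empty, _root_.one_mul]
  · intro T _ hT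
    rw [cminor_of_card_ne _ (by simpa using hT), zero_mul]
  · simp

/-- A substitution is multiplicative. -/
theorem pull_mul (a b : Fib n C) : pull A (mul a b) = mul (pull A a) (pull A b) := by
  -- On forms of degree zero, the differences of both sides have no constant part, and their fibre
  -- derivatives are combinations of such differences.
  have key : ∀ p : {a : Fib n C // IsZeroForm a} × {a : Fib n C // IsZeroForm a},
      pull A (mul p.1.1 p.2.1) - mul (pull A p.1.1) (pull A p.2.1) = 0 := by
    refine eq_zero_of_zDer_mem_span
      (D := fun p : {a : Fib n C // IsZeroForm a} × {a : Fib n C // IsZeroForm a} =>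
        pull A (mul p.1.1 p.2.1) - mul (pull A p.1.1) (pull A p.2.1)) ?_ ?_
    · rintro ⟨⟨a, ha⟩, ⟨b, hb⟩⟩ r S
      dsimp only
      rw [Pi.sub_apply, Pi.sub_apply, Pi.sub_apply]
      by_cases hS : S = ∅
      · subst hS
        rw [pull_apply_zero_empty, mul_zeroForm_apply ha, mul_zeroForm_apply (isZeroForm_pull A ha),
          sub_eq_zero]
        refine Finset.sum_congr rfl fun x _ => Finset.sum_congr rfl fun y hy => ?_
        rw [Finset.HasAntidiagonal.mem_antidiagonal, add_eq_zero] at hy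
        rw [hy.1, hy.2, pull_apply_zero_empty, pull_apply_zero_empty]
      · rw [isZeroForm_pull A (isZeroForm_mul ha hb) _ _ _ hS,
          isZeroForm_mul (isZeroForm_pull A ha) (isZeroForm_pull A hb) _ _ _ hS, sub_zero]
    · rintro ⟨⟨a, ha⟩, ⟨b, hb⟩⟩ β
      dsimp only
      have : zDer β (pull A (mul a b) - mul (pull A a) (pull A b)) = ∑ γ, A γ β •
          ((pull A (mul (zDer γ a) b) - mul (pull A (zDer γ a)) (pull A b)) +
            (pull A (mul a (zDer γ b)) - mul (pull A a) (pull A (zDer γ b)))) := by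
        rw [map_sub, zDer_mul, zDer_pull, zDer_pull, zDer_pull]
        simp only [zDer_mul, map_add, map_sum, map_smul, smul_add, smul_sub, LinearMap.sum_apply,
          LinearMap.smul_apply, Finset.sum_add_distrib, Finset.sum_sub_distrib]
        abel
      rw [this]
      refine sum_mem fun γ _ => Submodule.smul_mem _ _ (add_mem ?_ ?_)
      · exact Submodule.subset_span ⟨(⟨_, isZeroForm_zDer ha γ⟩, ⟨b, hb⟩), rfl⟩
      · exact Submodule.subset_span ⟨(⟨a, ha⟩, ⟨_, isZeroForm_zDer hb γ⟩), rfl⟩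
  induction a using form_induction generalizing b with
  | h0 a ha =>
    induction b using form_induction with
    | h0 b hb => exact sub_eq_zero.1 (key (⟨a, ha⟩, ⟨b, hb⟩))
    | hadd b c hb hc => simp only [map_add, hb, hc]
    | hw α b hb =>
      have h1 := mul_parity_wedge α a b
      rw [parity_of_isZeroForm ha] at h1
      rw [h1, pull_wedge, pull_wedge, hb, map_sum]
      refine Finset.sum_congr rfl fun β _ => ?_
      have h2 := mul_parity_wedge β (pull A a) (pull A b)
      rw [parity_of_isZeroForm (isZeroForm_pull A ha)] at h2
      rw [map_smul, h2]
  | hadd a c ha hc => simp only [map_add, LinearMap.add_apply, ha, hc]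
  | hw α a ha =>
    rw [mul_wedge_left, pull_wedge, pull_wedge, ha, map_sum, LinearMap.sum_apply]
    refine Finset.sum_congr rfl fun β _ => ?_
    rw [map_smul, LinearMap.smul_apply, mul_wedge_left]

theorem pull_zMul (γ : Idx n) (b : Fib n C) :
    pull A (zMul γ b) = ∑ β, A γ β • zMul β (pull A b) := by
  rw [← sub_eq_zero]
  -- the differences of both sides form a family that is closed under fibre derivatives
  refine eq_zero_of_zDer_mem_span
    (D := fun b : Fib n C => pull A (zMul γ b) - ∑ β, A γ β • zMul β (pull A b)) ?_ ?_ b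
  · intro b r S
    have h1 : pull A (zMul γ b) r 0 S = 0 := by
      rw [pull_apply_zero]
      exact Finset.sum_eq_zero fun T _ => by rw [zMul_mem_zPos γ b r T, mul_zero]
    have h2 : (∑ β, A γ β • zMul β (pull A b)) r 0 S = 0 :=
      (sum_mem fun β _ => Submodule.smul_mem (zPos n C) _ (zMul_mem_zPos β _) :
        ∑ β, A γ β • zMul β (pull A b) ∈ zPos n C) r S
    rw [Pi.sub_apply, Pi.sub_apply, Pi.sub_apply, h1, h2, sub_zero]
  · intro b ν
    have : zDer ν (pull A (zMul γ b) - ∑ β, A γ β • zMul β (pull A b)) = ∑ δ, A δ ν •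
        (pull A (zMul γ (zDer δ b)) - ∑ β, A γ β • zMul β (pull A (zDer δ b))) := by
      have h1 : ∑ δ, A δ ν • pull A (if δ = γ then b else 0) = A γ ν • pull A b := by
        rw [Finset.sum_eq_single γ]
        · simp
        · intro δ _ h; simp [h]
        · simp
      have h2 : ∑ β, A γ β • (if ν = β then pull A b else 0) = A γ ν • pull A b := by
        rw [Finset.sum_eq_single ν]
        · simp
        · intro δ _ h; simp [Ne.symm h]
        · simp
      have h3 : ∑ β, A γ β • ∑ δ, A δ ν • zMul β (pull A (zDer δ b)) =
          ∑ δ, A δ ν • ∑ β, A γ β • zMul β (pull A (zDer δ b)) := by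
        simp only [Finset.smul_sum]
        rw [Finset.sum_comm]
        exact Finset.sum_congr rfl fun δ _ => Finset.sum_congr rfl fun β _ => smul_comm _ _ _
      rw [map_sub, zDer_pull]
      simp only [zDer_zMul, map_add, smul_add, Finset.sum_add_distrib, h1, map_sum, map_smul, h2,
        zDer_pull, h3, smul_sub, Finset.sum_sub_distrib]
      abel
    rw [this]
    exact sum_mem fun δ _ => Submodule.smul_mem _ _ (Submodule.subset_span ⟨_, rfl⟩)

theorem contr_pull (β : Idx n) (b : Fib n C) :
    contr β (pull A b) = ∑ γ, A γ β • pull A (contr γ b) := by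
  induction b using form_induction with
  | h0 b hb =>
    simp only [contr_of_isZeroForm (isZeroForm_pull A hb), contr_of_isZeroForm hb, map_zero,
      smul_zero, Finset.sum_const_zero]
  | hadd b c hb hc => simp only [map_add, hb, hc, smul_add, Finset.sum_add_distrib]
  | hw α b hb =>
    have h1 : ∑ μ, A α μ • (if β = μ then pull A b else 0) = A α β • pull A b := by
      rw [Finset.sum_eq_single β]
      · simp
      · intro δ _ h; simp [Ne.symm h]
      · simp
    have h2 : ∑ γ, A γ β • pull A (if γ = α then b else 0) = A α β • pull A b := by
      rw [Finset.sum_eq_single α]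
      · simp
      · intro δ _ h; simp [h]
      · simp
    have h3 : ∑ μ, A α μ • ∑ γ, A γ β • wedge μ (pull A (contr γ b)) =
          ∑ γ, A γ β • ∑ μ, A α μ • wedge μ (pull A (contr γ b)) := by
        simp only [Finset.smul_sum]
        rw [Finset.sum_comm]
        exact Finset.sum_congr rfl fun δ _ => Finset.sum_congr rfl fun β _ => smul_comm _ _ _
    rw [pull_wedge, map_sum]
    simp only [map_smul, contr_wedge, smul_sub, Finset.sum_sub_distrib, h1, hb, map_sub, h2,
      map_sum, pull_wedge, h3]

theorem parity_pull (b : Fib n C) : parity (pull A b) = pull A (parity b) := by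
  induction b using form_induction with
  | h0 b hb => rw [parity_of_isZeroForm hb, parity_of_isZeroForm (isZeroForm_pull A hb)]
  | hadd b c hb hc => simp only [map_add, hb, hc]
  | hw α b hb => simp only [pull_wedge, parity_wedge, map_sum, map_smul, map_neg, hb, smul_neg,
      Finset.sum_neg_distrib]

theorem pull_one : pull A one = one := by
  rw [← sub_eq_zero]
  refine eq_zero_of_zDer (fun r S => ?_) fun α => ?_
  · have h1 : IsZeroForm (one : Fib n C) := fun r m S hS => by simp [one, hS]
    by_cases hS : S = ∅
    · subst hS
      rw [Pi.sub_apply, Pi.sub_apply, Pi.sub_apply, pull_apply_zero_empty, sub_self]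
    · rw [Pi.sub_apply, Pi.sub_apply, Pi.sub_apply, isZeroForm_pull A h1 _ _ _ hS, h1 _ _ _ hS,
        sub_zero]
  · rw [map_sub, zDer_pull]
    simp only [zDer_one, map_zero, smul_zero, Finset.sum_const_zero, sub_zero]

theorem isSlicewise_pull : IsSlicewise ((pull A).restrictScalars ℂ) := fun _ _ => rfl

theorem pull_vMul (b : Fib n C) : pull A (vMul b) = vMul (pull A b) := by
  funext r
  cases r with
  | zero => funext m S; rw [pull_apply]; simp
  | succ r => rfl

theorem sum_comm₄ {M : Type*} [AddCommMonoid M] (f : Idx n → Idx n → Idx n → Idx n → M) :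
    ∑ α, ∑ β, ∑ δ, ∑ γ, f α β γ δ = ∑ γ, ∑ δ, ∑ β, ∑ α, f α β γ δ := by
  rw [Finset.sum_comm]
  have h : ∀ β, ∑ α, ∑ δ, ∑ γ, f α β γ δ = ∑ δ, ∑ γ, ∑ α, f α β γ δ := fun β => by
    rw [Finset.sum_comm]
    exact Finset.sum_congr rfl fun δ _ => Finset.sum_comm
  simp only [h]
  rw [Finset.sum_comm, Finset.sum_congr rfl fun δ _ => Finset.sum_comm, Finset.sum_comm]

/-- A linear substitution intertwines the Wick products of corresponding bivectors. -/
theorem pull_star {Λ Λ' : Matrix (Idx n) (Idx n) C} (h : Λ' = A * Λ * Aᵀ) (a b : Fib n C) :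
    pull A (star Λ' a b) = star Λ (pull A a) (pull A b) := by
  have hk : ∀ k a b, pull A (biDer Λ' k a b) = biDer Λ k (pull A a) (pull A b) := by
    intro k
    induction k with
    | zero => exact pull_mul A
    | succ k ih =>
      intro a b
      have e : ∀ x y : Idx n → Fib n C, ∑ α, ∑ β, Λ α β •
          biDer Λ k (∑ γ, A γ α • x γ) (∑ δ, A δ β • y δ) =
          ∑ γ, ∑ δ, Λ' γ δ • biDer Λ k (x γ) (y δ) := by
        intro x y
        have e1 : ∀ α β, Λ α β • biDer Λ k (∑ γ, A γ α • x γ) (∑ δ, A δ β • y δ) =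
            ∑ δ, ∑ γ, (A γ α * Λ α β * A δ β) • biDer Λ k (x γ) (y δ) := by
          intro α β
          rw [map_sum (biDer Λ k _), Finset.smul_sum]
          refine Finset.sum_congr rfl fun δ _ => ?_
          rw [map_sum, LinearMap.sum_apply, Finset.smul_sum]
          refine Finset.sum_congr rfl fun γ _ => ?_
          rw [map_smul, map_smul, LinearMap.smul_apply, smul_smul, smul_smul]
          congr 1
          ring
        simp only [e1]
        rw [sum_comm₄]
        simp only [h, Matrix.mul_apply, Matrix.transpose_apply, Finset.sum_mul, Finset.sum_smul]
      rw [biDer_succ, biDer_succ]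
      simp only [zDer_pull]
      rw [e (fun γ => pull A (zDer γ a)) (fun δ => pull A (zDer δ b))]
      simp only [map_sum, map_smul, ih]
  rw [star_eq, star_eq]
  have := expSum_map (isSlicewise_pull A) (fun k => biDer Λ' k a b)
  simp only [LinearMap.restrictScalars_apply, hk] at this
  exact this

theorem pull_del (b : Fib n C) : pull A (del b) = del (pull A b) := by
  simp only [del_apply, map_sum, pull_wedge, zDer_pull, map_smul]
  rw [Finset.sum_comm]

theorem weight_pull (f : ℕ → ℂ) (b : Fib n C) : weight f (pull A b) = pull A (weight f b) := by
  funext r m S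
  rw [weight_apply, pull_apply, pull_apply, Finset.smul_sum]
  refine Finset.sum_congr rfl fun m' hm' => ?_
  rw [mem_finsuppAntidiag_univ] at hm'
  rw [Finset.smul_sum]
  refine Finset.sum_congr rfl fun T _ => ?_
  rw [weight_apply]
  by_cases hT : T.card = S.card
  · rw [hT, hm', mul_smul_comm]
  · rw [cminor_of_card_ne _ hT, mul_zero, zero_mul, zero_mul, smul_zero]

theorem pull_delInv (b : Fib n C) : pull A (delInv b) = delInv (pull A b) := by
  rw [delInv_apply, delInv_apply, ← weight_pull]
  congr 1
  simp only [delAdj_apply, map_sum, pull_zMul, contr_pull, map_smul]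
  rw [Finset.sum_comm]

theorem deg_pull (k : ℕ) (b : Fib n C) : deg k (pull A b) = pull A (deg k b) := by
  funext r m S
  rw [deg_apply, pull_apply, pull_apply]
  have h : ∀ m' ∈ Finset.finsuppAntidiag (Finset.univ : Finset (Idx n)) m.degree, ∀ T,
      deg k b r m' T = if 2 * r + m.degree = k then b r m' T else 0 := by
    intro m' hm' T
    rw [mem_finsuppAntidiag_univ] at hm'
    rw [deg_apply, hm']
  symm
  refine (Finset.sum_congr rfl fun m' hm' => Finset.sum_congr rfl fun T _ =>
    congrArg _ (h m' hm' T)).trans ?_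
  split_ifs
  · rfl
  · simp only [mul_zero, Finset.sum_const_zero]

theorem pull_mem_forms {q : ℕ} {b : Fib n C} (hb : b ∈ forms n C q) : pull A b ∈ forms n C q := by
  intro r m S hS
  rw [pull_apply]
  refine Finset.sum_eq_zero fun m' _ => Finset.sum_eq_zero fun T _ => ?_
  by_cases hT : T.card = S.card
  · rw [hb _ _ _ (hT ▸ hS), mul_zero]
  · rw [cminor_of_card_ne _ hT, mul_zero, zero_mul]

theorem pull_mem_zPos {b : Fib n C} (hb : b ∈ zPos n C) : pull A b ∈ zPos n C := by
  intro r S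
  rw [pull_apply_zero]
  exact Finset.sum_eq_zero fun T _ => by rw [hb r T, mul_zero]

/-- The derivative of a substitution with variable coefficients. -/
theorem coeffDer_pull (X : Derivation ℂ C C) (b : Fib n C) : coeffDer X (pull A b) =
    pull A (coeffDer X b) + ∑ γ, ∑ β, X (A γ β) •
      (zMul β (pull A (zDer γ b)) + wedge β (pull A (contr γ b))) := by
  induction b using form_induction with
  | h0 b hb =>
    rw [← sub_eq_zero]
    -- On forms of degree zero, the differences of both sides form a family that is closed under
    -- fibre derivatives and has no constant part.
    have h0 : ∀ b : {b : Fib n C // IsZeroForm b}, coeffDer X (pull A b.1) -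
        (pull A (coeffDer X b.1) + ∑ γ, ∑ β, X (A γ β) • zMul β (pull A (zDer γ b.1))) = 0 := by
      refine eq_zero_of_zDer_mem_span (D := fun b : {b : Fib n C // IsZeroForm b} =>
        coeffDer X (pull A b.1) -
        (pull A (coeffDer X b.1) + ∑ γ, ∑ β, X (A γ β) • zMul β (pull A (zDer γ b.1)))) ?_ ?_
      · rintro ⟨b, hb⟩ r S
        dsimp only
        have h2 : (∑ γ, ∑ β, X (A γ β) • zMul β (pull A (zDer γ b))) r 0 S = 0 :=
          (sum_mem fun γ _ => sum_mem fun β _ =>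
              Submodule.smul_mem (zPos n C) _ (zMul_mem_zPos β _) :
            ∑ γ, ∑ β, X (A γ β) • zMul β (pull A (zDer γ b)) ∈ zPos n C) r S
        have hX : IsZeroForm (coeffDer X b) := fun r m S hS => by
          rw [coeffDer_apply, hb _ _ _ hS, map_zero]
        rw [Pi.sub_apply, Pi.sub_apply, Pi.sub_apply, Pi.add_apply, Pi.add_apply, Pi.add_apply, h2,
          coeffDer_apply]
        by_cases hS : S = ∅
        · subst hS
          rw [pull_apply_zero_empty, pull_apply_zero_empty, coeffDer_apply, add_zero, sub_self]
        · rw [isZeroForm_pull A hb _ _ _ hS, isZeroForm_pull A hX _ _ _ hS, map_zero]; simp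
      · rintro ⟨b, hb⟩ ν
        dsimp only
        have : zDer ν (coeffDer X (pull A b) -
            (pull A (coeffDer X b) + ∑ γ, ∑ β, X (A γ β) • zMul β (pull A (zDer γ b)))) =
            ∑ δ, A δ ν • (coeffDer X (pull A (zDer δ b)) - (pull A (coeffDer X (zDer δ b)) +
              ∑ γ, ∑ β, X (A γ β) • zMul β (pull A (zDer γ (zDer δ b))))) := by
          have h2 : ∀ γ, ∑ β, X (A γ β) • (if ν = β then pull A (zDer γ b) else 0) =
              X (A γ ν) • pull A (zDer γ b) := by
            intro γ
            rw [Finset.sum_eq_single ν]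
            · simp
            · intro δ _ h; simp [Ne.symm h]
            · simp
          have h3 : ∑ γ, ∑ β, X (A γ β) • ∑ δ, A δ ν • zMul β (pull A (zDer δ (zDer γ b))) =
              ∑ δ, A δ ν • ∑ γ, ∑ β, X (A γ β) • zMul β (pull A (zDer γ (zDer δ b))) := by
            simp only [Finset.smul_sum]
            rw [Finset.sum_congr rfl fun γ _ => Finset.sum_comm, Finset.sum_comm]
            refine Finset.sum_congr rfl fun δ _ => Finset.sum_congr rfl fun γ _ =>
              Finset.sum_congr rfl fun β _ => ?_
            rw [smul_comm, zDer_comm]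
          rw [map_sub, map_add, ← coeffDer_zDer, zDer_pull, zDer_pull]
          simp only [map_sum, map_smul, coeffDer_smul, zDer_zMul, zDer_pull, smul_add,
            Finset.sum_add_distrib, h2, h3, smul_sub, Finset.sum_sub_distrib, coeffDer_zDer]
          abel
        rw [this]
        exact sum_mem fun δ _ => Submodule.smul_mem _ _
          (Submodule.subset_span ⟨⟨_, isZeroForm_zDer hb δ⟩, rfl⟩)
    have h1 := h0 ⟨b, hb⟩
    simp only [contr_of_isZeroForm hb, map_zero, add_zero]
    exact h1
  | hadd b c hb hc =>
    simp only [map_add, hb, hc, smul_add, Finset.sum_add_distrib]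
    abel
  | hw α b hb =>
    have h1 : ∀ β, ∑ γ, X (A γ β) • wedge β (pull A (if γ = α then b else 0)) =
        X (A α β) • wedge β (pull A b) := by
      intro β
      rw [Finset.sum_eq_single α]
      · simp
      · intro δ _ h; simp [h]
      · simp
    have e : coeffDer X (pull A (wedge α b)) = ∑ β, X (A α β) • wedge β (pull A b) +
        ∑ β, A α β • wedge β (coeffDer X (pull A b)) := by
      rw [pull_wedge, map_sum]
      simp only [coeffDer_smul, coeffDer_wedge, Finset.sum_add_distrib]
    rw [e, hb]
    simp only [contr_wedge, map_sub, ← wedge_zDer, pull_wedge, coeffDer_wedge, map_add, map_sum,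
      map_smul, smul_add, smul_sub, Finset.sum_add_distrib, Finset.sum_sub_distrib, Finset.smul_sum]
    have h2 : ∑ γ, ∑ β, X (A γ β) • wedge β (pull A (if γ = α then b else 0)) =
        ∑ β, X (A α β) • wedge β (pull A b) := by
      rw [Finset.sum_comm]
      exact Finset.sum_congr rfl fun β _ => h1 β
    have h3 : ∀ F : Idx n → Idx n → Fib n C,
        ∑ δ, ∑ γ, ∑ β, A α δ • X (A γ β) • wedge δ (zMul β (F γ β)) =
        ∑ γ, ∑ β, ∑ δ, X (A γ β) • A α δ • zMul β (wedge δ (F γ β)) := by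
      intro F
      rw [Finset.sum_comm]
      refine Finset.sum_congr rfl fun γ _ => ?_
      rw [Finset.sum_comm]
      refine Finset.sum_congr rfl fun β _ => Finset.sum_congr rfl fun δ _ => ?_
      rw [smul_comm, wedge_zMul]
    have h4 : ∀ F : Idx n → Idx n → Fib n C,
        ∑ δ, ∑ γ, ∑ β, A α δ • X (A γ β) • wedge δ (wedge β (F γ β)) =
        -∑ γ, ∑ β, ∑ δ, X (A γ β) • A α δ • wedge β (wedge δ (F γ β)) := by
      intro F
      rw [Finset.sum_comm]
      simp only [← Finset.sum_neg_distrib]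
      refine Finset.sum_congr rfl fun γ _ => ?_
      rw [Finset.sum_comm]
      refine Finset.sum_congr rfl fun β _ => Finset.sum_congr rfl fun δ _ => ?_
      rw [smul_comm, wedge_wedge, smul_neg, smul_neg]
    rw [h2, h3 fun γ _ => pull A (zDer γ b), h4 fun γ _ => pull A (contr γ b)]
    abel

end Fib

namespace Fib

variable {n : ℕ} {C C' : Type*} [CommRing C] [Algebra ℂ C] [CommRing C'] [Algebra ℂ C']
  (σ : C' →ₐ[ℂ] C)

/-! ### Change of the coefficient ring -/

/-- The action of a homomorphism of the coefficient rings. -/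
def map : Fib n C' →ₗ[ℂ] Fib n C where
  toFun a r m S := σ (a r m S)
  map_add' a b := by funext r m S; simp
  map_smul' c a := by funext r m S; simp

theorem map_apply (a : Fib n C') (r m S) : map σ a r m S = σ (a r m S) := rfl

theorem map_smul_coeff (c : C') (a : Fib n C') : map σ (c • a) = σ c • map σ a := by
  funext r m S; simp [map_apply]

theorem map_sgn (S T : Finset (Idx n)) : σ (sgn C' S T) = sgn C S T := by simp [sgn]

theorem map_wedge (α : Idx n) (a : Fib n C') : map σ (wedge α a) = wedge α (map σ a) := by
  funext r m S
  simp only [map_apply, wedge_apply]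
  split_ifs <;> simp [map_sgn]

theorem map_contr (α : Idx n) (a : Fib n C') : map σ (contr α a) = contr α (map σ a) := by
  funext r m S
  simp only [map_apply, contr_apply]
  split_ifs <;> simp [map_sgn]

theorem map_zMul (α : Idx n) (a : Fib n C') : map σ (zMul α a) = zMul α (map σ a) := by
  funext r m S
  simp only [map_apply, zMul_apply]
  split_ifs <;> simp

theorem map_zDer (α : Idx n) (a : Fib n C') : map σ (zDer α a) = zDer α (map σ a) := by
  funext r m S
  simp [map_apply, zDer_apply]

theorem map_vMul (a : Fib n C') : map σ (vMul a) = vMul (map σ a) := by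
  funext r m S
  cases r with
  | zero => simp [map_apply]
  | succ r => rfl

theorem map_vDiv (a : Fib n C') : map σ (vDiv a) = vDiv (map σ a) := rfl

theorem map_parity (a : Fib n C') : map σ (parity a) = parity (map σ a) := by
  funext r m S
  simp [map_apply, parity_apply]

theorem map_one : map σ (one : Fib n C') = one := by
  funext r m S
  simp only [map_apply, one]
  split_ifs <;> simp

theorem map_mul (a b : Fib n C') : map σ (mul a b) = mul (map σ a) (map σ b) := by
  funext r m S
  simp only [map_apply, mul_apply, _root_.map_sum, _root_.map_mul, map_sgn]

theorem map_biDer (Λ : Matrix (Idx n) (Idx n) C') (k : ℕ) (a b : Fib n C') :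
    map σ (biDer Λ k a b) = biDer (Λ.map σ) k (map σ a) (map σ b) := by
  induction k generalizing a b with
  | zero => exact map_mul σ a b
  | succ k ih => simp only [biDer_succ, _root_.map_sum, map_smul_coeff, ih, map_zDer,
      Matrix.map_apply]

theorem map_star (Λ : Matrix (Idx n) (Idx n) C') (a b : Fib n C') :
    map σ (star Λ a b) = star (Λ.map σ) (map σ a) (map σ b) := by
  funext r m S
  rw [star_eq, star_eq, map_apply, expSum_apply, expSum_apply, Finset.sum_apply, Finset.sum_apply,
    Finset.sum_apply, Finset.sum_apply, _root_.map_sum]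
  refine Finset.sum_congr rfl fun k _ => ?_
  rw [Pi.smul_apply, Pi.smul_apply, Pi.smul_apply, Pi.smul_apply, _root_.map_smul, ← map_biDer,
    map_apply]

theorem map_del (a : Fib n C') : map σ (del a) = del (map σ a) := by
  simp only [del_apply, _root_.map_sum, map_wedge, map_zDer]

theorem map_weight (f : ℕ → ℂ) (a : Fib n C') : map σ (weight f a) = weight f (map σ a) := by
  funext r m S
  rw [map_apply, weight_apply, weight_apply, _root_.map_smul, map_apply]

theorem map_delInv (a : Fib n C') : map σ (delInv a) = delInv (map σ a) := by
  simp only [delInv_apply, map_weight, delAdj_apply, _root_.map_sum, map_zMul, map_contr]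

theorem map_deg (k : ℕ) (a : Fib n C') : map σ (deg k a) = deg k (map σ a) := by
  funext r m S
  simp only [map_apply, deg_apply]
  split_ifs <;> simp

theorem map_mem_forms {q : ℕ} {a : Fib n C'} (ha : a ∈ forms n C' q) : map σ a ∈ forms n C q :=
  fun r m S h => by rw [map_apply, ha r m S h, _root_.map_zero]

theorem map_mem_zPos {a : Fib n C'} (ha : a ∈ zPos n C') : map σ a ∈ zPos n C :=
  fun r S => by rw [map_apply, ha r S, _root_.map_zero]

theorem map_cminor (A : Matrix (Idx n) (Idx n) C') (S T : Finset (Idx n)) :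
    σ (cminor A S T) = cminor (A.map σ) S T := by
  rw [cminor, cminor]
  split_ifs
  · rw [AlgHom.map_det]; rfl
  · exact _root_.map_zero σ

theorem map_pull (A : Matrix (Idx n) (Idx n) C') (a : Fib n C') :
    map σ (pull A a) = pull (A.map σ) (map σ a) := by
  funext r m S
  have h : ∀ m' : Idx n →₀ ℕ, σ (MvPolynomial.coeff m (∏ α, linForm A α ^ m' α)) =
      MvPolynomial.coeff m (∏ α, linForm (A.map σ) α ^ m' α) := by
    intro m'
    have e := MvPolynomial.coeff_map (σ : C' →+* C) (∏ α, linForm A α ^ m' α) m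
    rw [RingHom.coe_coe] at e
    rw [← e]
    congr 1
    simp [linForm, _root_.map_prod, _root_.map_sum]
  simp only [map_apply, pull_apply, _root_.map_sum, _root_.map_mul, h, map_cminor]

end Fib

section FrameChange

open Fib

/-! ### Change of frame -/

/-- A homomorphism of the coefficient rings of two Fedosov data, with the matrix
`e'^α = A^α_β e^β` that relates the coframes. -/
structure FrameChange {n : ℕ} {C C' : Type*} [CommRing C] [Algebra ℂ C] [CommRing C'] [Algebra ℂ C']
    (D' : FedosovData n C') (D : FedosovData n C) where
  σ : C' →ₐ[ℂ] C
  A : Matrix (Idx n) (Idx n) C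
  B : Matrix (Idx n) (Idx n) C
  B_mul_A : B * A = 1
  X_map : ∀ α f, D.X α (σ f) = ∑ β, A β α * σ (D'.X β f)
  Γ_map : ∀ μ, A.map (D.X μ) - A * D.Γ μ = -∑ α, A α μ • ((D'.Γ α).map σ * A)
  W_map : ∀ γ α β, D.X α (A γ β) - D.X β (A γ α) - ∑ τ, D.W τ α β * A γ τ =
    -∑ μ, ∑ ν, A μ α * A ν β * σ (D'.W γ μ ν)
  Λ_map : D'.Λ.map σ = A * D.Λ * Aᵀ

namespace FrameChange

variable {n : ℕ} {C C' : Type*} [CommRing C] [Algebra ℂ C] [CommRing C'] [Algebra ℂ C']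
  {D' : FedosovData n C'} {D : FedosovData n C} (F : FrameChange D' D)

/-- The map of sections defined by a change of frame. -/
def Φ : Fib n C' →ₗ[ℂ] Fib n C := ((Fib.pull F.A).restrictScalars ℂ).comp (Fib.map F.σ)

theorem Φ_apply (b : Fib n C') : F.Φ b = Fib.pull F.A (Fib.map F.σ b) := rfl

theorem Φ_smul (c : C') (b : Fib n C') : F.Φ (c • b) = F.σ c • F.Φ b := by
  rw [Φ_apply, map_smul_coeff, map_smul, Φ_apply]

theorem Φ_wedge (α : Idx n) (b : Fib n C') : F.Φ (wedge α b) = ∑ β, F.A α β • wedge β (F.Φ b) := by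
  rw [Φ_apply, map_wedge, pull_wedge, Φ_apply]

theorem Φ_zMul (α : Idx n) (b : Fib n C') : F.Φ (zMul α b) = ∑ β, F.A α β • zMul β (F.Φ b) := by
  rw [Φ_apply, map_zMul, pull_zMul, Φ_apply]

theorem zDer_Φ (β : Idx n) (b : Fib n C') : zDer β (F.Φ b) = ∑ γ, F.A γ β • F.Φ (zDer γ b) := by
  simp only [Φ_apply, zDer_pull, map_zDer]

theorem contr_Φ (β : Idx n) (b : Fib n C') : contr β (F.Φ b) = ∑ γ, F.A γ β • F.Φ (contr γ b) := by
  simp only [Φ_apply, contr_pull, map_contr]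

theorem Φ_parity (b : Fib n C') : F.Φ (parity b) = parity (F.Φ b) := by
  rw [Φ_apply, map_parity, ← parity_pull, Φ_apply]

theorem Φ_vMul (b : Fib n C') : F.Φ (vMul b) = vMul (F.Φ b) := by
  rw [Φ_apply, map_vMul, pull_vMul, Φ_apply]

theorem Φ_vDiv (b : Fib n C') : F.Φ (vDiv b) = vDiv (F.Φ b) := rfl

theorem Φ_star (a b : Fib n C') : F.Φ (star D'.Λ a b) = star D.Λ (F.Φ a) (F.Φ b) := by
  rw [Φ_apply, Fib.map_star, pull_star F.A F.Λ_map, Φ_apply, Φ_apply]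

theorem Φ_del (b : Fib n C') : F.Φ (del b) = del (F.Φ b) := by
  rw [Φ_apply, map_del, pull_del, Φ_apply]

theorem Φ_delInv (b : Fib n C') : F.Φ (delInv b) = delInv (F.Φ b) := by
  rw [Φ_apply, map_delInv, pull_delInv, Φ_apply]

theorem Φ_deg (k : ℕ) (b : Fib n C') : F.Φ (deg k b) = deg k (F.Φ b) := by
  rw [Φ_apply, map_deg, ← deg_pull, Φ_apply]

theorem Φ_mem_forms {q : ℕ} {b : Fib n C'} (hb : b ∈ forms n C' q) : F.Φ b ∈ forms n C q :=
  pull_mem_forms _ (map_mem_forms _ hb)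

theorem Φ_mem_zPos {b : Fib n C'} (hb : b ∈ zPos n C') : F.Φ b ∈ zPos n C :=
  pull_mem_zPos _ (map_mem_zPos _ hb)

theorem coeffDer_Φ (α : Idx n) (b : Fib n C') : coeffDer (D.X α) (F.Φ b) =
    ∑ β, F.A β α • F.Φ (coeffDer (D'.X β) b) + ∑ γ, ∑ β, D.X α (F.A γ β) •
      (zMul β (F.Φ (zDer γ b)) + wedge β (F.Φ (contr γ b))) := by
  have h : coeffDer (D.X α) (Fib.map F.σ b) =
      ∑ β, F.A β α • Fib.map F.σ (coeffDer (D'.X β) b) := by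
    funext r m S
    simp only [coeffDer_apply, map_apply, F.X_map, Finset.sum_apply, Pi.smul_apply, smul_eq_mul]
  simp only [Φ_apply, coeffDer_pull, h, map_sum, map_smul, map_zDer, map_contr]

theorem lin_Φ (μ : Idx n) (b : Fib n C') : lin (D.Γ μ) (F.Φ b) =
    ∑ δ, ∑ ν, (F.A * D.Γ μ) δ ν • zMul ν (F.Φ (zDer δ b)) := by
  simp only [lin_apply, zDer_Φ, map_sum, map_smul, Finset.smul_sum, smul_smul, Matrix.mul_apply,
    Finset.sum_smul]
  rw [Finset.sum_congr rfl fun γ _ => Finset.sum_comm, Finset.sum_comm]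
  refine Finset.sum_congr rfl fun δ _ => ?_
  rw [Finset.sum_comm]
  refine Finset.sum_congr rfl fun ν _ => Finset.sum_congr rfl fun γ _ => ?_
  rw [mul_comm]

theorem Φ_lin (α : Idx n) (b : Fib n C') : F.Φ (lin (D'.Γ α) b) =
    ∑ δ, ∑ ν, ((D'.Γ α).map F.σ * F.A) δ ν • zMul ν (F.Φ (zDer δ b)) := by
  simp only [lin_apply, map_sum, Φ_smul, Φ_zMul, Finset.smul_sum, smul_smul, Matrix.mul_apply,
    Finset.sum_smul, Matrix.map_apply]
  refine Finset.sum_congr rfl fun δ _ => ?_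
  rw [Finset.sum_comm]

/-- The transformation law of the connection absorbs the derivatives of `A` in the action on the
fibre coordinates; those in the action on the form part remain. -/
theorem Φ_nabla (μ : Idx n) (b : Fib n C') : D.nabla μ (F.Φ b) =
    ∑ α, F.A α μ • F.Φ (D'.nabla α b) +
      ∑ γ, ∑ β, D.X μ (F.A γ β) • wedge β (F.Φ (contr γ b)) := by
  have h : ∑ γ, ∑ β, D.X μ (F.A γ β) • zMul β (F.Φ (zDer γ b)) - lin (D.Γ μ) (F.Φ b) =
      -∑ α, F.A α μ • F.Φ (lin (D'.Γ α) b) := by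
    have e : ∀ γ β, D.X μ (F.A γ β) - (F.A * D.Γ μ) γ β =
        -∑ α, F.A α μ * ((D'.Γ α).map F.σ * F.A) γ β := by
      intro γ β
      have := congrFun (congrFun (F.Γ_map μ) γ) β
      simpa only [Matrix.sub_apply, Matrix.map_apply, Matrix.neg_apply, Matrix.sum_apply,
        Matrix.smul_apply, smul_eq_mul] using this
    rw [lin_Φ]
    simp only [← Finset.sum_sub_distrib, ← sub_smul, e, Φ_lin, neg_smul, Finset.sum_neg_distrib,
      Finset.smul_sum, smul_smul, Finset.sum_smul]
    rw [Finset.sum_congr rfl fun γ _ => Finset.sum_comm, Finset.sum_comm]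
  simp only [FedosovData.nabla_apply, coeffDer_Φ, map_sub, smul_sub, Finset.sum_sub_distrib,
    smul_add, Finset.sum_add_distrib]
  rw [sub_eq_add_neg _ (∑ α, F.A α μ • F.Φ (lin (D'.Γ α) b)), ← h]
  abel

/-- The exterior derivative of the coframe transforms with the term that compensates the one
in `Φ_nabla`. -/
theorem Φ_frameD (b : Fib n C') : F.Φ (D'.frameD b) = D.frameD (F.Φ b) +
    ∑ μ, ∑ γ, ∑ β, D.X μ (F.A γ β) • wedge μ (wedge β (F.Φ (contr γ b))) := by
  have h1 : ∀ (G : Idx n → Idx n → C') (b : Fib n C'), F.Φ (wedge₂ G b) =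
      wedge₂ (fun α β => ∑ μ, ∑ ν, F.A μ α * F.A ν β * F.σ (G μ ν)) (F.Φ b) := by
    intro G b
    simp only [wedge₂_apply, map_sum, Φ_smul, Φ_wedge, map_smul, Finset.smul_sum, smul_smul,
      Finset.sum_smul]
    rw [sum_comm₄]
    rw [Finset.sum_comm]
    refine Finset.sum_congr rfl fun α _ => Finset.sum_congr rfl fun β _ => ?_
    rw [Finset.sum_comm]
    refine Finset.sum_congr rfl fun μ _ => Finset.sum_congr rfl fun ν _ => ?_
    congr 1; ring
  have h2 : ∀ γ, (fun α β => ∑ μ, ∑ ν, F.A μ α * F.A ν β * F.σ (D'.W γ μ ν)) =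
      fun α β => ∑ τ, D.W τ α β * F.A γ τ - (D.X α (F.A γ β) - D.X β (F.A γ α)) := by
    intro γ
    funext α β
    have := F.W_map γ α β
    linear_combination this
  have h3 : D.frameD (F.Φ b) = -(1 / 2 : ℂ) • ∑ γ, wedge₂ (fun α β => ∑ τ, D.W τ α β * F.A γ τ)
      (F.Φ (contr γ b)) := by
    simp only [FedosovData.frameD, contr_Φ, map_sum, map_smul]
    congr 1
    rw [Finset.sum_comm]
    refine Finset.sum_congr rfl fun γ _ => ?_
    simp only [wedge₂_apply, Finset.smul_sum, smul_smul, Finset.sum_smul]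
    rw [Finset.sum_comm]
    refine Finset.sum_congr rfl fun α _ => ?_
    rw [Finset.sum_comm]
    refine Finset.sum_congr rfl fun β _ => Finset.sum_congr rfl fun τ _ => ?_
    rw [mul_comm]
  have h4 : ∀ γ x, wedge₂ (fun α β => ∑ τ, D.W τ α β * F.A γ τ -
      (D.X α (F.A γ β) - D.X β (F.A γ α))) x = wedge₂ (fun α β => ∑ τ, D.W τ α β * F.A γ τ) x -
      (2 : ℂ) • ∑ α, ∑ β, D.X α (F.A γ β) • wedge α (wedge β x) := by
    intro γ x
    have e : ∑ α, ∑ β, D.X β (F.A γ α) • wedge α (wedge β x) =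
        -∑ α, ∑ β, D.X α (F.A γ β) • wedge α (wedge β x) := by
      rw [Finset.sum_comm]
      simp only [← Finset.sum_neg_distrib]
      refine Finset.sum_congr rfl fun α _ => Finset.sum_congr rfl fun β _ => ?_
      rw [wedge_wedge, smul_neg]
    simp only [wedge₂_apply, sub_smul, Finset.sum_sub_distrib, e]
    rw [two_smul]
    abel
  rw [h3, FedosovData.frameD, LinearMap.map_smul, map_sum]
  simp only [h1, h2, h4, Finset.sum_sub_distrib, smul_sub, ← Finset.smul_sum, smul_smul]
  rw [Finset.sum_comm (f := fun μ γ => ∑ β, D.X μ (F.A γ β) • wedge μ (wedge β (F.Φ (contr γ b))))]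
  rw [show (-(1 / 2) * 2 : ℂ) = -1 by ring, neg_one_smul, sub_neg_eq_add]

/-- A change of frame intertwines the connections: the inhomogeneous terms of `Φ_nabla` and
`Φ_frameD` cancel. -/
theorem Φ_conn (b : Fib n C') : F.Φ (D'.conn b) = D.conn (F.Φ b) := by
  rw [FedosovData.conn_apply, FedosovData.conn_apply, map_add, map_sum, Φ_frameD]
  simp only [Φ_wedge, Φ_nabla, map_add, map_sum, map_smul, Finset.sum_add_distrib]
  rw [Finset.sum_comm]
  abel

theorem Φ_one : F.Φ one = one := by rw [Φ_apply, Fib.map_one, pull_one]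

/-- An element that commutes with the images of the fibre coordinates vanishes. -/
theorem eq_zero_of_commute {x : Fib n C} (h0 : x ∈ zPos n C)
    (h : ∀ b, parity b = b → star D.Λ x (F.Φ b) = star D.Λ (F.Φ b) x) : x = 0 := by
  refine D.eq_zero_of_commute h0 fun β => ?_
  have hz : zMul β (one : Fib n C) = ∑ γ, F.B β γ • F.Φ (zMul γ one) := by
    simp only [Φ_zMul, Φ_one, Finset.smul_sum, smul_smul]
    rw [Finset.sum_comm]
    simp only [← Finset.sum_smul]
    have : ∀ δ, ∑ γ, F.B β γ * F.A γ δ = if β = δ then 1 else 0 := by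
      intro δ
      rw [← Matrix.mul_apply, F.B_mul_A, Matrix.one_apply]
    simp only [this, ite_smul, one_smul, zero_smul, Finset.sum_ite_eq, Finset.mem_univ, if_true]
  rw [hz]
  simp only [map_sum, map_smul, LinearMap.sum_apply, LinearMap.smul_apply,
    h _ (FedosovData.parity_zMul_one _)]

/-- The torsion element is determined by its commutators, and these are expressed by `δ` and `D`. -/
theorem Φ_torsionElt : F.Φ D'.torsionElt = D.torsionElt := by
  rw [← sub_eq_zero]
  refine F.eq_zero_of_commute (sub_mem (F.Φ_mem_zPos D'.torsionElt_mem_zPos)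
    D.torsionElt_mem_zPos) fun b _ => ?_
  have h1 := congrArg F.Φ (D'.vMul_del_conn b)
  have h2 := D.vMul_del_conn (F.Φ b)
  rw [Φ_vMul, map_add, Φ_del, Φ_conn, Φ_conn, Φ_del, map_smul, map_sub, Φ_star, Φ_star, h2,
    ← sub_eq_zero, ← smul_sub, smul_eq_zero_iff_right Complex.I_ne_zero] at h1
  rw [map_sub, LinearMap.sub_apply, map_sub, ← sub_eq_zero, ← neg_eq_zero, ← h1]
  abel

/-- The curvature element is determined by its commutators, and these are expressed by `D²`. -/
theorem Φ_curvatureElt : F.Φ D'.curvatureElt = D.curvatureElt := by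
  rw [← sub_eq_zero]
  refine F.eq_zero_of_commute (sub_mem (F.Φ_mem_zPos D'.curvatureElt_mem_zPos)
    D.curvatureElt_mem_zPos) fun b _ => ?_
  have h1 := congrArg F.Φ (D'.vMul_conn_conn b)
  have h2 := D.vMul_conn_conn (F.Φ b)
  rw [Φ_vMul, Φ_conn, Φ_conn, map_smul, map_sub, Φ_star, Φ_star, h2,
    ← sub_eq_zero, ← smul_sub, smul_eq_zero_iff_right (neg_ne_zero.2 Complex.I_ne_zero)] at h1
  rw [map_sub, LinearMap.sub_apply, map_sub, ← sub_eq_zero, ← neg_eq_zero, ← h1]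
  abel

/-- By uniqueness, a change of frame preserves the solution of Fedosov's equation. -/
theorem Φ_sol : F.Φ D'.sol = D.sol := by
  have h := D'.isSolution_sol
  refine FedosovData.IsSolution.unique ⟨F.Φ_mem_forms h.mem_forms, ?_, ?_, ?_, ?_⟩ D.isSolution_sol
  · rw [← Φ_delInv, h.delInv_eq, map_zero]
  · rw [← Φ_deg, h.deg_zero, map_zero]
  · rw [← Φ_deg, h.deg_one, map_zero]
  · rw [← Φ_del, h.del_eq, FedosovData.source, FedosovData.source, map_sub, map_add, map_add,
      Φ_torsionElt, Φ_curvatureElt, Φ_conn, map_smul, Φ_vDiv, Φ_star]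

theorem Φ_fed (r a : Fib n C') : F.Φ (D'.fed r a) = D.fed (F.Φ r) (F.Φ a) := by
  rw [FedosovData.fed, FedosovData.fed, map_sub, map_add, map_neg, Φ_del, Φ_conn, map_smul, Φ_vDiv,
    map_sub, Φ_star, Φ_star, Φ_parity]

end FrameChange

end FrameChange

/-! ### Lagrange geometry over a ring with derivations -/

/-- The algebraic skeleton of a coordinate domain with a regular generating function: commuting
derivations `∂_α` of a ring `C` of functions, coordinates `u^β` with `∂_α u^β = δ_α^β`, a
generating function `ℓ`, and an inverse `K` of its vertical Hessian. -/
structure LagrangeData (n : ℕ) (C : Type*) [CommRing C] [Algebra ℂ C] where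
  d : Idx n → Derivation ℂ C C
  d_comm : ∀ α β f, d α (d β f) = d β (d α f)
  u : Idx n → C
  d_u : ∀ α β, d α (u β) = if α = β then 1 else 0
  ℓ : C
  K : Matrix (Fin n) (Fin n) C
  K_mul : K * Matrix.of (fun i j => (1 / 2 : ℂ) • d (Sum.inr i) (d (Sum.inr j) ℓ)) = 1

namespace LagrangeData

variable {n : ℕ} {C : Type*} [CommRing C] [Algebra ℂ C] (M : LagrangeData n C)

/-- The momenta `p_i = (1/2) ∂ℓ/∂y^i`. -/
def p (i : Fin n) : C := (1 / 2 : ℂ) • M.d (Sum.inr i) M.ℓ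

/-- The vertical Hessian `h_ij = (1/2) ∂²ℓ/∂y^i∂y^j`. -/
def H : Matrix (Fin n) (Fin n) C :=
  Matrix.of fun i j => (1 / 2 : ℂ) • M.d (Sum.inr i) (M.d (Sum.inr j) M.ℓ)

theorem H_apply (i j : Fin n) :
    M.H i j = (1 / 2 : ℂ) • M.d (Sum.inr i) (M.d (Sum.inr j) M.ℓ) := rfl

theorem H_eq (i j : Fin n) : M.H i j = M.d (Sum.inr i) (M.p j) := by
  rw [p, Derivation.map_smul, H_apply]

theorem H_symm (i j : Fin n) : M.H i j = M.H j i := by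
  rw [H_apply, H_apply, M.d_comm]

theorem H_transpose : M.Hᵀ = M.H := by
  ext i j; exact M.H_symm j i

theorem K_mul_H : M.K * M.H = 1 := M.K_mul

theorem H_mul_K : M.H * M.K = 1 := mul_eq_one_comm.mp M.K_mul_H

theorem K_transpose : M.Kᵀ = M.K := by
  have h : M.Kᵀ * M.H = 1 := by
    rw [← M.H_transpose, ← Matrix.transpose_mul, M.H_mul_K, Matrix.transpose_one]
  calc M.Kᵀ = M.Kᵀ * (M.H * M.K) := by rw [M.H_mul_K, mul_one]
    _ = M.K := by rw [← mul_assoc, h, one_mul]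

/-- The semispray coefficients. -/
def G (a : Fin n) : C := (1 / 4 : ℂ) • ∑ b, M.K a b *
  ((∑ k, M.d (Sum.inr b) (M.d (Sum.inl k) M.ℓ) * M.u (Sum.inr k)) - M.d (Sum.inl b) M.ℓ)

/-- The canonical N-connection. -/
def N (a i : Fin n) : C := M.d (Sum.inr i) (M.G a)

/-- The N-adapted frame. -/
def X : Idx n → Derivation ℂ C C
  | Sum.inl i => M.d (Sum.inl i) - ∑ a, M.N a i • M.d (Sum.inr a)
  | Sum.inr a => M.d (Sum.inr a)

theorem X_inl (i : Fin n) (f : C) :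
    M.X (Sum.inl i) f = M.d (Sum.inl i) f - ∑ a, M.N a i * M.d (Sum.inr a) f := by
  have h : (∑ a, M.N a i • M.d (Sum.inr a)) f = ∑ a, M.N a i * M.d (Sum.inr a) f := by
    have := congrFun (map_sum Derivation.coeFnAddMonoidHom
      (fun a => M.N a i • M.d (Sum.inr a)) Finset.univ) f
    rw [Finset.sum_apply] at this
    exact this
  rw [X, Derivation.sub_apply, h]

theorem X_inr (a : Fin n) : M.X (Sum.inr a) = M.d (Sum.inr a) := rfl

/-- Contraction of the defining relation of `G` with `h_ab`. -/
theorem four_H_mul_G (a : Fin n) : (4 : ℂ) • ∑ b, M.H a b * M.G b =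
    (∑ k, M.d (Sum.inr a) (M.d (Sum.inl k) M.ℓ) * M.u (Sum.inr k)) - M.d (Sum.inl a) M.ℓ := by
  let E : Fin n → C := fun b =>
    (∑ k, M.d (Sum.inr b) (M.d (Sum.inl k) M.ℓ) * M.u (Sum.inr k)) - M.d (Sum.inl b) M.ℓ
  have hG : ∀ b, M.G b = (1 / 4 : ℂ) • (M.K *ᵥ E) b := fun b => rfl
  have h1 : ∑ b, M.H a b * M.G b = (1 / 4 : ℂ) • (M.H *ᵥ (M.K *ᵥ E)) a := by
    simp only [hG, mul_smul_comm, ← Finset.smul_sum]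
    rfl
  rw [h1, Matrix.mulVec_mulVec, M.H_mul_K, Matrix.one_mulVec, smul_smul]
  rw [show (4 : ℂ) * (1 / 4) = 1 by norm_num, one_smul]

/-- The momenta have symmetric horizontal derivatives: the horizontal distribution is
isotropic for `d(p_i dx^i)`. This property reflects the choice of the semispray `G`. -/
theorem X_p_symm (i k : Fin n) : M.X (Sum.inl k) (M.p i) = M.X (Sum.inl i) (M.p k) := by
  -- the derivative of the relation that defines the semispray along `∂/∂y^i`
  have key : ∀ a i : Fin n, (4 : ℂ) • ∑ b, M.H a b * M.N b i =
      (2 : ℂ) • ∑ k, M.d (Sum.inl k) (M.H a i) * M.u (Sum.inr k) +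
      (2 : ℂ) • M.d (Sum.inl i) (M.p a) - (2 : ℂ) • M.d (Sum.inl a) (M.p i)
      - (4 : ℂ) • ∑ b, M.G b * M.d (Sum.inr i) (M.d (Sum.inr a) (M.p b)) := by
    intro a i
    have h := congrArg (M.d (Sum.inr i)) (M.four_H_mul_G a)
    simp only [map_sub, map_sum, Derivation.map_smul, Derivation.leibniz, smul_eq_mul, M.d_u,
      Finset.sum_add_distrib, smul_add, Sum.inr.injEq, mul_ite, mul_one, mul_zero,
      Finset.sum_ite_eq, Finset.mem_univ, if_true] at h
    have e1 : ∀ k, M.d (Sum.inr i) (M.d (Sum.inr a) (M.d (Sum.inl k) M.ℓ)) =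
        (2 : ℂ) • M.d (Sum.inl k) (M.H a i) := by
      intro k
      rw [H_apply, Derivation.map_smul, smul_smul, M.d_comm (Sum.inr a) (Sum.inl k),
        M.d_comm (Sum.inr i) (Sum.inl k), M.d_comm (Sum.inr i) (Sum.inr a)]
      norm_num
    have e2 : ∀ a k, M.d (Sum.inr a) (M.d (Sum.inl k) M.ℓ) = (2 : ℂ) • M.d (Sum.inl k) (M.p a) := by
      intro a k
      rw [p, Derivation.map_smul, smul_smul, M.d_comm (Sum.inr a) (Sum.inl k)]
      norm_num
    simp only [e1] at h
    simp only [e2, mul_smul_comm, ← Finset.smul_sum] at h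
    simp only [H_eq] at h ⊢
    have e3 : ∀ k, M.d (Sum.inl k) (M.d (Sum.inr a) (M.p i)) * M.u (Sum.inr k) =
      M.u (Sum.inr k) * M.d (Sum.inl k) (M.d (Sum.inr a) (M.p i)) := fun k => mul_comm _ _
    simp only [e3]
    simp only [N]
    linear_combination (exp := 1) h
  -- in the part antisymmetric in `i, k` the third derivatives of `ℓ` drop out
  have h1 := key i k
  have h2 := key k i
  have e1 : M.H k i = M.H i k := M.H_symm k i
  have e2 : ∀ b, M.d (Sum.inr i) (M.d (Sum.inr k) (M.p b)) =
    M.d (Sum.inr k) (M.d (Sum.inr i) (M.p b)) := fun b => M.d_comm _ _ _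
  simp only [e1, e2] at h2
  have h3 : (4 : ℂ) • (∑ b, M.H i b * M.N b k - ∑ b, M.H k b * M.N b i -
      (M.d (Sum.inl k) (M.p i) - M.d (Sum.inl i) (M.p k))) = 0 := by
    rw [smul_sub, smul_sub, h1, h2]
    module
  have h4 : ∑ b, M.H i b * M.N b k - ∑ b, M.H k b * M.N b i -
      (M.d (Sum.inl k) (M.p i) - M.d (Sum.inl i) (M.p k)) = 0 := by
    have := congrArg (fun x => (1 / 4 : ℂ) • x) h3
    rwa [smul_zero, smul_smul, show (1 / 4 : ℂ) * 4 = 1 by norm_num, one_smul] at this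
  have e4 : ∀ i k, ∑ b, M.N b k * M.d (Sum.inr b) (M.p i) = ∑ b, M.H i b * M.N b k := by
    intro i k
    refine Finset.sum_congr rfl fun b _ => ?_
    rw [← H_eq, M.H_symm, mul_comm]
  rw [X_inl, X_inl, e4, e4]
  linear_combination -h4

/-- The anholonomy coefficients `[e_α, e_β] = W^τ_{αβ} e_τ`. -/
def W : Idx n → Idx n → Idx n → C
  | Sum.inl _, _, _ => 0
  | Sum.inr a, Sum.inl i, Sum.inl j => M.X (Sum.inl j) (M.N a i) - M.X (Sum.inl i) (M.N a j)
  | Sum.inr a, Sum.inl i, Sum.inr b => M.d (Sum.inr b) (M.N a i)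
  | Sum.inr a, Sum.inr b, Sum.inl i => -M.d (Sum.inr b) (M.N a i)
  | Sum.inr _, Sum.inr _, Sum.inr _ => 0

theorem W_antisymm (τ α β : Idx n) : M.W τ α β = -M.W τ β α := by
  rcases τ with τ | τ <;> rcases α with α | α <;> rcases β with β | β <;> simp [W]

theorem commutator (α β : Idx n) (f : C) :
    M.X α (M.X β f) - M.X β (M.X α f) = ∑ τ, M.W τ α β * M.X τ f := by
  have key : ∀ i (b : Fin n) (f : C), M.X (Sum.inl i) (M.d (Sum.inr b) f) -
      M.d (Sum.inr b) (M.X (Sum.inl i) f) = ∑ a, M.d (Sum.inr b) (M.N a i) * M.d (Sum.inr a) f := by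
    intro i b f
    simp only [X_inl, map_sub, map_sum, Derivation.leibniz, smul_eq_mul, Finset.sum_add_distrib,
      M.d_comm (Sum.inr b)]
    simp only [mul_comm]
    abel
  have key2 : ∀ i (g : Derivation ℂ C C) (f : C), M.X (Sum.inl i) (g f) =
    M.d (Sum.inl i) (g f) - ∑ a, M.N a i * M.d (Sum.inr a) (g f) := fun i g f => M.X_inl i _
  rw [Fintype.sum_sum_type]
  simp only [W, zero_mul, Finset.sum_const_zero, zero_add]
  rcases α with i | a <;> rcases β with j | b
  · have e : ∀ i j, M.X (Sum.inl i) (M.X (Sum.inl j) f) = M.X (Sum.inl i) (M.d (Sum.inl j) f) -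
        ∑ a, (M.N a j * M.X (Sum.inl i) (M.d (Sum.inr a) f) +
          M.d (Sum.inr a) f * M.X (Sum.inl i) (M.N a j)) := by
      intro i j
      rw [M.X_inl j, map_sub, map_sum]
      simp only [Derivation.leibniz, smul_eq_mul]
    have e2 : ∀ i j, M.X (Sum.inl i) (M.d (Sum.inl j) f) = M.d (Sum.inl i) (M.d (Sum.inl j) f) -
        ∑ a, M.N a i * M.d (Sum.inr a) (M.d (Sum.inl j) f) := fun i j => M.X_inl i _
    have e3 : ∀ i j, ∑ a, M.N a j * M.X (Sum.inl i) (M.d (Sum.inr a) f) =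
        ∑ a, M.N a j * M.d (Sum.inl i) (M.d (Sum.inr a) f) -
        ∑ a, ∑ b, M.N a j * (M.N b i * M.d (Sum.inr b) (M.d (Sum.inr a) f)) := by
      intro i j
      simp only [X_inl, mul_sub, Finset.sum_sub_distrib, Finset.mul_sum]
    have e4 : ∑ a, ∑ b, M.N a i * (M.N b j * M.d (Sum.inr b) (M.d (Sum.inr a) f)) =
        ∑ a, ∑ b, M.N a j * (M.N b i * M.d (Sum.inr b) (M.d (Sum.inr a) f)) := by
      rw [Finset.sum_comm]
      refine Finset.sum_congr rfl fun a _ => Finset.sum_congr rfl fun b _ => ?_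
      rw [M.d_comm]; ring
    simp only [e, e2, Finset.sum_add_distrib, e3, X_inr]
    rw [e4, M.d_comm (Sum.inl i) (Sum.inl j)]
    simp only [M.d_comm (Sum.inl _) (Sum.inr _), sub_mul, Finset.sum_sub_distrib,
      mul_comm (M.d (Sum.inr _) f)]
    ring
  · exact key i b f
  · rw [← neg_sub]
    simp only [X_inr, key, neg_mul, Finset.sum_neg_distrib]
  · simp only [X_inr, zero_mul, Finset.sum_const_zero, M.d_comm (Sum.inr a), sub_self]

/-- Linear independence of the frame. -/
theorem eq_zero_of_sum_X (c : Idx n → C) (h : ∀ f, ∑ τ, c τ * M.X τ f = 0) : c = 0 := by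
  -- test on the coordinates `x^i`, which are annihilated by the vertical frame vectors
  have h1 : ∀ i, c (Sum.inl i) = 0 := by
    intro i
    have := h (M.u (Sum.inl i))
    simpa [X_inl, X_inr, M.d_u] using this
  funext τ
  rcases τ with i | a
  · exact h1 i
  · have := h (M.u (Sum.inr a))
    simpa [h1, X_inr, M.d_u] using this

/-- The Jacobi identity for the structure functions of the frame, from that of derivations and the
linear independence of the frame. -/
theorem jacobi (σ α μ ν : Idx n) : (M.X α (M.W σ μ ν) + ∑ τ, M.W τ μ ν * M.W σ α τ) +
    (M.X μ (M.W σ ν α) + ∑ τ, M.W τ ν α * M.W σ μ τ) +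
    (M.X ν (M.W σ α μ) + ∑ τ, M.W τ α μ * M.W σ ν τ) = 0 := by
  revert σ
  suffices h : (fun σ => (M.X α (M.W σ μ ν) + ∑ τ, M.W τ μ ν * M.W σ α τ) +
      (M.X μ (M.W σ ν α) + ∑ τ, M.W τ ν α * M.W σ μ τ) +
      (M.X ν (M.W σ α μ) + ∑ τ, M.W τ α μ * M.W σ ν τ)) = 0 from fun σ => congrFun h σ
  apply M.eq_zero_of_sum_X
  intro f
  -- the coefficient sum below is the double commutator `[e_α, [e_μ, e_ν]] f`
  have key : ∀ α μ ν, ∑ σ, (M.X α (M.W σ μ ν) + ∑ τ, M.W τ μ ν * M.W σ α τ) * M.X σ f =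
      M.X α (M.X μ (M.X ν f) - M.X ν (M.X μ f)) -
        (M.X μ (M.X ν (M.X α f)) - M.X ν (M.X μ (M.X α f))) := by
    intro α μ ν
    rw [M.commutator μ ν (M.X α f), M.commutator μ ν f, map_sum, ← Finset.sum_sub_distrib]
    have e1 : ∀ τ, M.X α (M.W τ μ ν * M.X τ f) - M.W τ μ ν * M.X τ (M.X α f) =
        M.X α (M.W τ μ ν) * M.X τ f + ∑ σ, M.W τ μ ν * M.W σ α τ * M.X σ f := by
      intro τ
      rw [Derivation.leibniz, smul_eq_mul, smul_eq_mul]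
      simp only [mul_assoc, ← Finset.mul_sum]
      rw [← M.commutator α τ f]
      ring
    simp only [e1, add_mul, Finset.sum_add_distrib, Finset.sum_mul]
    rw [Finset.sum_comm]
  simp only [add_mul, Finset.sum_add_distrib] at key ⊢
  linear_combination key α μ ν + key μ ν α + key ν α μ +
    map_sub (M.X α) (M.X μ (M.X ν f)) (M.X ν (M.X μ f))
    + map_sub (M.X μ) (M.X ν (M.X α f)) (M.X α (M.X ν f))
    + map_sub (M.X ν) (M.X α (M.X μ f)) (M.X μ (M.X α f))

/-- The symplectic form `θ_{αβ} = g(J e_α, e_β)`. -/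
def θ : Matrix (Idx n) (Idx n) C := Matrix.fromBlocks 0 (-M.H) M.H 0

/-- The one-form `p_i e^i`. -/
def P : Idx n → C := Sum.elim M.p 0

theorem θ_apply (α β : Idx n) : M.θ α β = M.X α (M.P β) - M.X β (M.P α) := by
  rcases α with i | i <;> rcases β with j | j
  · simp [θ, P, M.X_p_symm j i]
  · simp [θ, P, X_inr, ← H_eq, M.H_symm i j]
  · simp [θ, P, X_inr, H_eq]
  · simp [θ, P]

theorem W_mul_X_P (α β γ τ : Idx n) : M.W τ α β * M.X γ (M.P τ) = 0 := by
  rcases τ with i | i <;> simp [W, P]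

/-- The form `θ` is the exterior derivative of `p_i e^i = (1/2) ∂ℓ/∂y^i dx^i`, hence closed. -/
theorem θ_closed (α β γ : Idx n) :
    M.X α (M.θ β γ) + M.X β (M.θ γ α) + M.X γ (M.θ α β) =
    ∑ τ, (M.W τ α β * M.θ τ γ + M.W τ β γ * M.θ τ α + M.W τ γ α * M.θ τ β) := by
  simp only [θ_apply, mul_sub, W_mul_X_P, sub_zero, Finset.sum_add_distrib, ← M.commutator, map_sub]
  ring

/-- Twice the lowered Christoffel symbols of `h_ij` for a family of derivations, as a matrix
with rows `m` and columns `j`, where `k` is the direction of differentiation. -/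
def christ (H : Matrix (Fin n) (Fin n) C) (Z : Fin n → Derivation ℂ C C) (k : Fin n) :
    Matrix (Fin n) (Fin n) C :=
  Matrix.of fun m j => Z k (H j m) + Z j (H m k) - Z m (H j k)

/-- The blocks of the normal d-connection, `(1/2) h^{im} (e_k h_jm + e_j h_mk - e_m h_jk)`. -/
def Γb : Idx n → Matrix (Fin n) (Fin n) C
  | Sum.inl k => (1 / 2 : ℂ) • (M.K * christ M.H (fun i => M.X (Sum.inl i)) k)
  | Sum.inr k => (1 / 2 : ℂ) • (M.K * christ M.H (fun i => M.X (Sum.inr i)) k)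

/-- The normal d-connection. -/
def Γ (α : Idx n) : Matrix (Idx n) (Idx n) C := Matrix.fromBlocks (M.Γb α) 0 0 (M.Γb α)

/-- The Wick tensor `Λ^{αβ} = θ^{αβ} - i g^{αβ}`. -/
def Λ : Matrix (Idx n) (Idx n) C :=
  Matrix.fromBlocks (-Complex.I • M.K) (-M.K) M.K (-Complex.I • M.K)

theorem map_one_der (Z : Derivation ℂ C C) {m : Type*} [DecidableEq m] :
    (1 : Matrix m m C).map Z = 0 := by
  ext i j
  rw [Matrix.map_apply, Matrix.one_apply]
  split_ifs <;> simp

theorem christ_add_transpose (H : Matrix (Fin n) (Fin n) C) (hH : Hᵀ = H)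
    (Z : Fin n → Derivation ℂ C C) (k : Fin n) :
    christ H Z k + (christ H Z k)ᵀ = (2 : ℂ) • H.map (Z k) := by
  have h : ∀ i j, H i j = H j i := fun i j => congrFun (congrFun hH j) i
  ext i j
  simp only [christ, Matrix.add_apply, Matrix.transpose_apply, Matrix.of_apply, Matrix.smul_apply,
    Matrix.map_apply, two_smul]
  rw [h j i]
  ring

theorem H_mul_Γb (α : Idx n) : (2 : ℂ) • (M.H * M.Γb α) =
    match α with
    | Sum.inl k => christ M.H (fun i => M.X (Sum.inl i)) k
    | Sum.inr k => christ M.H (fun i => M.X (Sum.inr i)) k := by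
  rcases α with k | k <;>
  · simp only [Γb, Matrix.mul_smul, ← mul_assoc, M.H_mul_K, one_mul, smul_smul]
    norm_num

theorem H_mul_Γb_add (α : Idx n) : M.H * M.Γb α + (M.Γb α)ᵀ * M.H = M.H.map (M.X α) := by
  have h : (2 : ℂ) • (M.H * M.Γb α) + ((2 : ℂ) • (M.H * M.Γb α))ᵀ = (2 : ℂ) • M.H.map (M.X α) := by
    rw [H_mul_Γb]
    rcases α with k | k
    · exact christ_add_transpose _ M.H_transpose _ k
    · exact christ_add_transpose _ M.H_transpose _ k
  rw [Matrix.transpose_smul, Matrix.transpose_mul, M.H_transpose, ← smul_add] at h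
  have := congrArg (fun x => (1 / 2 : ℂ) • x) h
  simpa only [smul_smul, one_div, inv_mul_cancel₀ (two_ne_zero' ℂ), one_smul] using this

/-- The normal d-connection is metric. -/
theorem K_parallel (α : Idx n) :
    M.K.map (M.X α) + M.Γb α * M.K + M.K * (M.Γb α)ᵀ = 0 := by
  have h1 : M.K.map (M.X α) * M.H + M.K * M.H.map (M.X α) = 0 := by
    rw [← FedosovData.map_mul_derivation, M.K_mul_H, map_one_der]
  have h2 : M.K.map (M.X α) = -(M.K * M.H.map (M.X α) * M.K) := by
    have := congrArg (· * M.K) h1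
    simp only [add_mul, mul_assoc, M.H_mul_K, mul_one, zero_mul] at this
    rw [mul_assoc]
    exact eq_neg_of_add_eq_zero_left this
  rw [h2, ← H_mul_Γb_add]
  have e1 : M.K * (M.H * M.Γb α) = M.Γb α := by rw [← mul_assoc, M.K_mul_H, one_mul]
  have e2 : (M.Γb α)ᵀ * M.H * M.K = (M.Γb α)ᵀ := by rw [mul_assoc, M.H_mul_K, mul_one]
  rw [mul_add, add_mul, e1, mul_assoc, e2]
  abel

theorem Λ_parallel (α : Idx n) :
    M.Λ.map (M.X α) + M.Γ α * M.Λ + M.Λ * (M.Γ α)ᵀ = 0 := by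
  have h := M.K_parallel α
  have e : ∀ c : ℂ, (c • M.K).map (M.X α) + M.Γb α * (c • M.K) + (c • M.K) * (M.Γb α)ᵀ = 0 := by
    intro c
    have e1 : (c • M.K).map (M.X α) = c • M.K.map (M.X α) := by
      ext i j; simp
    rw [e1, Matrix.mul_smul, Matrix.smul_mul, ← smul_add, ← smul_add, h, smul_zero]
  have e' := e (-1)
  rw [neg_one_smul] at e'
  rw [Λ, Γ, Matrix.fromBlocks_map, Matrix.fromBlocks_transpose, Matrix.fromBlocks_multiply,
    Matrix.fromBlocks_multiply, Matrix.fromBlocks_add, Matrix.fromBlocks_add]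
  simp only [Matrix.zero_mul, Matrix.mul_zero, Matrix.transpose_zero, add_zero, zero_add, e, e', h]
  exact Matrix.fromBlocks_zero

/-- The antisymmetric part of `Λ` is `θ^{αβ}`, which is inverse to `θ_{αβ}` up to sign. -/
theorem Λ_θ : (M.Λ - M.Λᵀ) * M.θ = (-2 : C) • (1 : Matrix (Idx n) (Idx n) C) := by
  rw [Λ, θ, Matrix.fromBlocks_transpose, Matrix.transpose_smul, Matrix.transpose_neg,
    M.K_transpose, sub_eq_add_neg, Matrix.fromBlocks_neg, Matrix.fromBlocks_add,
    Matrix.fromBlocks_multiply]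
  simp only [add_neg_cancel, Matrix.zero_mul, Matrix.mul_zero, add_zero, zero_add, add_mul, neg_mul,
    mul_neg, M.K_mul_H, neg_neg]
  rw [← Matrix.fromBlocks_one, Matrix.fromBlocks_smul]
  congr 1
  · rw [neg_smul, two_smul, neg_add]
  · simp
  · simp
  · rw [neg_smul, two_smul, neg_add]

/-- The Fedosov data of a Lagrange geometry. -/
def fedosov : FedosovData n C where
  X := M.X
  W := M.W
  Γ := M.Γ
  Λ := M.Λ
  θ := M.θ
  commutator := M.commutator
  W_antisymm := M.W_antisymm
  jacobi := M.jacobi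
  Λ_parallel := M.Λ_parallel
  Λ_θ := M.Λ_θ
  θ_closed := M.θ_closed

end LagrangeData

/-! ### Change of Lagrange coordinates -/

/-- A homomorphism `σ` of function rings that intertwines the frames of two Lagrange geometries
up to a block matrix with equal blocks `B`, and relates their metrics. -/
structure LagrangeChange {n : ℕ} {C C' : Type*} [CommRing C] [Algebra ℂ C] [CommRing C']
    [Algebra ℂ C'] (M' : LagrangeData n C') (M : LagrangeData n C) where
  σ : C' →ₐ[ℂ] C
  B : Matrix (Fin n) (Fin n) C
  Binv : Matrix (Fin n) (Fin n) C
  Binv_mul_B : Binv * B = 1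
  X_inl_map : ∀ i f, M.X (Sum.inl i) (σ f) = ∑ k, B k i * σ (M'.X (Sum.inl k) f)
  X_inr_map : ∀ i f, M.X (Sum.inr i) (σ f) = ∑ k, B k i * σ (M'.X (Sum.inr k) f)
  H_map : M.H = Bᵀ * M'.H.map σ * B

namespace LagrangeChange

variable {n : ℕ} {C C' : Type*} [CommRing C] [Algebra ℂ C] [CommRing C'] [Algebra ℂ C']

section

variable (σ : C' →ₐ[ℂ] C) (B : Matrix (Fin n) (Fin n) C) (H' : Matrix (Fin n) (Fin n) C')
  (Z : Fin n → Derivation ℂ C C) (Z' : Fin n → Derivation ℂ C' C')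

/-- The derivative of the congruence transform `Bᵀ H' B` along the frame. -/
theorem der_congruence (hH : H'ᵀ = H') (hZ : ∀ i f, Z i (σ f) = ∑ k, B k i * σ (Z' k f))
    (k i j : Fin n) :
    Z k ((Bᵀ * H'.map σ * B) i j) =
      ∑ c, ∑ a, ∑ b, B c k * B a i * B b j * σ (Z' c (H' a b)) +
      (∑ a, ∑ b, Z k (B a i) * σ (H' a b) * B b j +
          ∑ a, ∑ b, Z k (B a j) * σ (H' a b) * B b i) := by
  have h : ∀ a b, σ (H' a b) = σ (H' b a) := fun a b =>
    congrArg σ (congrFun (congrFun hH b) a)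
  have e : (Bᵀ * H'.map σ * B) i j = ∑ a, ∑ b, B a i * σ (H' a b) * B b j := by
    simp only [Matrix.mul_apply, Matrix.transpose_apply, Matrix.map_apply, Finset.sum_mul]
    rw [Finset.sum_comm]
  have e2 : ∑ c, ∑ a, ∑ b, B c k * B a i * B b j * σ (Z' c (H' a b)) =
      ∑ a, ∑ b, ∑ c, B c k * B a i * B b j * σ (Z' c (H' a b)) := by
    rw [Finset.sum_comm]
    exact Finset.sum_congr rfl fun a _ => Finset.sum_comm
  have e3 : ∑ a, ∑ b, Z k (B a j) * σ (H' a b) * B b i =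
      ∑ a, ∑ b, B a i * σ (H' a b) * Z k (B b j) := by
    rw [Finset.sum_comm]
    refine Finset.sum_congr rfl fun a _ => Finset.sum_congr rfl fun b _ => ?_
    rw [h]; ring
  rw [e, e2, e3]
  simp only [map_sum, ← Finset.sum_add_distrib]
  refine Finset.sum_congr rfl fun a _ => Finset.sum_congr rfl fun b _ => ?_
  simp only [Derivation.leibniz, smul_eq_mul, hZ, Finset.mul_sum, mul_add]
  rw [Finset.sum_congr rfl fun c _ => show B b j * (B a i * (B c k * σ (Z' c (H' a b)))) =
    B c k * B a i * B b j * σ (Z' c (H' a b)) by ring]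
  ring

/-- The transformation law of the Christoffel symbols, for a matrix `B` of first derivatives, whose
own derivatives are symmetric. -/
theorem christ_congruence (hH : H'ᵀ = H') (hZ : ∀ i f, Z i (σ f) = ∑ k, B k i * σ (Z' k f))
    (hB : ∀ k a i, Z k (B a i) = Z i (B a k)) (k : Fin n) :
    LagrangeData.christ (Bᵀ * H'.map σ * B) Z k =
      ∑ c, B c k • (Bᵀ * (LagrangeData.christ H' Z' c).map σ * B) +
        (2 : ℂ) • (Bᵀ * H'.map σ * B.map (Z k)) := by
  have h : ∀ a b, σ (H' a b) = σ (H' b a) := fun a b =>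
    congrArg σ (congrFun (congrFun hH b) a)
  ext m j
  have hB' : ∀ k i j, ∑ a, ∑ b, Z k (B a i) * σ (H' a b) * B b j =
      ∑ a, ∑ b, Z i (B a k) * σ (H' a b) * B b j := fun k i j =>
    Finset.sum_congr rfl fun a _ => Finset.sum_congr rfl fun b _ => by rw [hB]
  have q1 : ∑ c, ∑ a, ∑ b, B c k * B a j * B b m * σ (Z' c (H' a b)) =
      ∑ c, ∑ a, ∑ b, B c k * (B a m * σ (Z' c (H' b a)) * B b j) := by
    refine Finset.sum_congr rfl fun c _ => ?_
    rw [Finset.sum_comm]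
    refine Finset.sum_congr rfl fun a _ => Finset.sum_congr rfl fun b _ => ?_
    ring
  have q2 : ∑ c, ∑ a, ∑ b, B c j * B a m * B b k * σ (Z' c (H' a b)) =
      ∑ c, ∑ a, ∑ b, B c k * (B a m * σ (Z' b (H' a c)) * B b j) := by
    rw [Finset.sum_comm, Finset.sum_congr rfl fun a _ => Finset.sum_comm, Finset.sum_comm]
    refine Finset.sum_congr rfl fun c _ => Finset.sum_congr rfl fun a _ =>
      Finset.sum_congr rfl fun b _ => ?_
    ring
  have q3 : ∑ c, ∑ a, ∑ b, B c m * B a j * B b k * σ (Z' c (H' a b)) =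
      ∑ c, ∑ a, ∑ b, B c k * (B a m * σ (Z' a (H' b c)) * B b j) := by
    rw [Finset.sum_congr rfl fun a _ => Finset.sum_comm, Finset.sum_comm]
    refine Finset.sum_congr rfl fun c _ => Finset.sum_congr rfl fun a _ =>
      Finset.sum_congr rfl fun b _ => ?_
    ring
  have r1 : (∑ c, B c k • (Bᵀ * (LagrangeData.christ H' Z' c).map σ * B)) m j =
      ∑ c, ∑ a, ∑ b, B c k * (B a m * σ (Z' c (H' b a)) * B b j) +
      ∑ c, ∑ a, ∑ b, B c k * (B a m * σ (Z' b (H' a c)) * B b j) -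
      ∑ c, ∑ a, ∑ b, B c k * (B a m * σ (Z' a (H' b c)) * B b j) := by
    rw [Matrix.sum_apply, ← Finset.sum_add_distrib, ← Finset.sum_sub_distrib]
    refine Finset.sum_congr rfl fun c _ => ?_
    simp only [Matrix.smul_apply, smul_eq_mul, Matrix.mul_apply, Matrix.transpose_apply,
      Matrix.map_apply, LagrangeData.christ, Matrix.of_apply, Finset.sum_mul, Finset.mul_sum]
    rw [Finset.sum_comm, ← Finset.sum_add_distrib, ← Finset.sum_sub_distrib]
    refine Finset.sum_congr rfl fun a _ => ?_
    rw [← Finset.sum_add_distrib, ← Finset.sum_sub_distrib]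
    refine Finset.sum_congr rfl fun b _ => ?_
    rw [map_sub, map_add]
    ring
  have r2 : (Bᵀ * H'.map σ * B.map (Z k)) m j = ∑ a, ∑ b, Z k (B a j) * σ (H' a b) * B b m := by
    simp only [Matrix.mul_apply, Matrix.transpose_apply, Matrix.map_apply, Finset.sum_mul]
    refine Finset.sum_congr rfl fun a _ => Finset.sum_congr rfl fun b _ => ?_
    rw [h]; ring
  rw [Matrix.add_apply, r1, Matrix.smul_apply, r2]
  rw [LagrangeData.christ, Matrix.of_apply, der_congruence σ B H' Z Z' hH hZ,
    der_congruence σ B H' Z Z' hH hZ, der_congruence σ B H' Z Z' hH hZ, q1, q2, q3,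
    hB' j m k, hB' j k m, hB' m k j, two_smul]
  ring

end

variable {M' : LagrangeData n C'} {M : LagrangeData n C} (F : LagrangeChange M' M)

/-- The matrix of the change of coframe. -/
def A : Matrix (Idx n) (Idx n) C := Matrix.fromBlocks F.B 0 0 F.B

theorem X_map (α : Idx n) (f : C') : M.X α (F.σ f) = ∑ β, F.A β α * F.σ (M'.X β f) := by
  rcases α with i | i
  · rw [F.X_inl_map, Fintype.sum_sum_type]
    simp [A]
  · rw [F.X_inr_map, Fintype.sum_sum_type]
    simp [A]

theorem X_inl_u (i j : Fin n) : M.X (Sum.inl i) (F.σ (M'.u (Sum.inl j))) = F.B j i := by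
  rw [F.X_inl_map]
  have : ∀ k, M'.X (Sum.inl k) (M'.u (Sum.inl j)) = if k = j then 1 else 0 := by
    intro k
    simp [LagrangeData.X_inl, M'.d_u]
  simp only [this]
  simp

theorem X_inr_u (i j : Fin n) : M.X (Sum.inr i) (F.σ (M'.u (Sum.inl j))) = 0 := by
  rw [F.X_inr_map]
  simp [LagrangeData.X_inr, M'.d_u]

/-- Second derivatives of the functions `x'^j` are symmetric, since commutators of the frame are
vertical and the `x'^j` are constant in the vertical directions. -/
theorem commutator_u (α β : Idx n) (j : Fin n) :
    M.X α (M.X β (F.σ (M'.u (Sum.inl j)))) = M.X β (M.X α (F.σ (M'.u (Sum.inl j)))) := by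
  rw [← sub_eq_zero, M.commutator]
  refine Finset.sum_eq_zero fun τ _ => ?_
  rcases τ with i | i
  · simp [LagrangeData.W]
  · rw [X_inr_u, mul_zero]

theorem X_inl_B (k i j : Fin n) : M.X (Sum.inl k) (F.B j i) = M.X (Sum.inl i) (F.B j k) := by
  rw [← X_inl_u, ← X_inl_u, commutator_u]

theorem X_inr_B (k i j : Fin n) : M.X (Sum.inr k) (F.B j i) = 0 := by
  rw [← X_inl_u, commutator_u, X_inr_u, map_zero]

theorem K_map : M'.K.map F.σ = F.B * M.K * F.Bᵀ := by
  have h1 : M'.K.map F.σ * M'.H.map F.σ = 1 := by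
    have := congrArg (fun A => A.map F.σ) M'.K_mul_H
    simpa using this
  have h2 : F.Bᵀ * M'.H.map F.σ * (F.B * M.K) = 1 := by
    rw [← mul_assoc, ← F.H_map, M.H_mul_K]
  have h3 : F.B * M.K * F.Bᵀ * M'.H.map F.σ = 1 := by
    rw [mul_eq_one_comm] at h2
    simpa only [mul_assoc] using h2
  calc M'.K.map F.σ = F.B * M.K * F.Bᵀ * M'.H.map F.σ * M'.K.map F.σ := by rw [h3, one_mul]
    _ = _ := by rw [mul_assoc, mul_eq_one_comm.mp h1, mul_one]

theorem Λ_map : M'.Λ.map F.σ = F.A * M.Λ * F.Aᵀ := by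
  have e : ∀ c : ℂ, (c • M'.K).map F.σ = F.B * (c • M.K) * F.Bᵀ := by
    intro c
    rw [Matrix.mul_smul, Matrix.smul_mul, ← K_map]
    ext i j; simp
  have e' := e (-1)
  rw [neg_one_smul, neg_one_smul] at e'
  rw [LagrangeData.Λ, LagrangeData.Λ, A, Matrix.fromBlocks_map, Matrix.fromBlocks_transpose,
    Matrix.fromBlocks_multiply, Matrix.fromBlocks_multiply]
  simp only [Matrix.zero_mul, Matrix.mul_zero, Matrix.transpose_zero, add_zero, zero_add, e, e',
    K_map]

theorem Γb_map_aux (Z : Fin n → Derivation ℂ C C) (Z' : Fin n → Derivation ℂ C' C')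
    (hZ : ∀ i f, Z i (F.σ f) = ∑ k, F.B k i * F.σ (Z' k f))
    (hB : ∀ k a i, Z k (F.B a i) = Z i (F.B a k)) (k : Fin n) :
    F.B.map (Z k) - F.B * ((1 / 2 : ℂ) • (M.K * LagrangeData.christ M.H Z k)) =
      -∑ c, F.B c k • ((((1 / 2 : ℂ) • (M'.K * LagrangeData.christ M'.H Z' c)).map F.σ) * F.B) := by
  have h1 : F.B * (M.K * LagrangeData.christ M.H Z k) =
      ∑ c, F.B c k • (M'.K.map F.σ * (LagrangeData.christ M'.H Z' c).map F.σ * F.B) +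
        (2 : ℂ) • F.B.map (Z k) := by
    have hKH : M'.K.map F.σ * M'.H.map F.σ = 1 := by
      have := congrArg (fun A => A.map F.σ) M'.K_mul_H
      simpa using this
    have e : ∀ Y : Matrix (Fin n) (Fin n) C, F.B * (M.K * (F.Bᵀ * Y)) = M'.K.map F.σ * Y := by
      intro Y
      rw [K_map]; simp only [mul_assoc]
    rw [F.H_map, christ_congruence F.σ F.B M'.H Z Z' M'.H_transpose hZ hB k, mul_add, mul_add]
    simp only [Matrix.mul_sum, Matrix.mul_smul, mul_assoc, e]
    rw [← mul_assoc (M'.K.map F.σ), hKH, one_mul]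
  have h2 : ∀ c, (((1 / 2 : ℂ) • (M'.K * LagrangeData.christ M'.H Z' c)).map F.σ) =
      (1 / 2 : ℂ) • (M'.K.map F.σ * (LagrangeData.christ M'.H Z' c).map F.σ) := by
    intro c
    ext i j
    simp [Matrix.mul_apply]
  rw [Matrix.mul_smul, h1]
  simp only [h2, Matrix.smul_mul, smul_comm (_ : C) (1 / 2 : ℂ), ← Finset.smul_sum]
  rw [smul_add, smul_smul, show (1 / 2 : ℂ) * 2 = 1 by norm_num, one_smul]
  abel

/-- The transformation law of the normal d-connection. -/
theorem Γ_map (μ : Idx n) :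
    F.A.map (M.X μ) - F.A * M.Γ μ = -∑ α, F.A α μ • ((M'.Γ α).map F.σ * F.A) := by
  have key : F.B.map (M.X μ) - F.B * M.Γb μ = -∑ α, F.A α μ • ((M'.Γb α).map F.σ * F.B) := by
    rcases μ with k | k
    · have := F.Γb_map_aux (fun i => M.X (Sum.inl i)) (fun i => M'.X (Sum.inl i))
        F.X_inl_map (fun k a i => F.X_inl_B k i a) k
      rw [Fintype.sum_sum_type]
      simpa [A, LagrangeData.Γb] using this
    · have := F.Γb_map_aux (fun i => M.X (Sum.inr i)) (fun i => M'.X (Sum.inr i))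
        F.X_inr_map (fun k a i => by simp only [X_inr_B]) k
      rw [Fintype.sum_sum_type]
      simpa [A, LagrangeData.Γb] using this
  have h1 : F.A.map (M.X μ) - F.A * M.Γ μ = Matrix.fromBlocks (F.B.map (M.X μ) - F.B * M.Γb μ) 0 0
      (F.B.map (M.X μ) - F.B * M.Γb μ) := by
    rw [A, LagrangeData.Γ, Matrix.fromBlocks_map, Matrix.fromBlocks_multiply, sub_eq_add_neg,
      Matrix.fromBlocks_neg, Matrix.fromBlocks_add]
    have : (0 : Matrix (Fin n) (Fin n) C).map (M.X μ) = 0 := by ext i j; simp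
    simp [this, sub_eq_add_neg]
  have h2 : ∀ α, (M'.Γ α).map F.σ * F.A = Matrix.fromBlocks ((M'.Γb α).map F.σ * F.B) 0 0
      ((M'.Γb α).map F.σ * F.B) := by
    intro α
    rw [A, LagrangeData.Γ, Matrix.fromBlocks_map, Matrix.fromBlocks_multiply]
    have : (0 : Matrix (Fin n) (Fin n) C').map F.σ = 0 := by ext i j; simp
    simp [this]
  rw [h1, key]
  simp only [h2]
  have key3 : ∀ (c : Idx n → C) (Y : Idx n → Matrix (Fin n) (Fin n) C),
      Matrix.fromBlocks (-∑ α, c α • Y α) 0 0 (-∑ α, c α • Y α) =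
      -∑ α, c α • Matrix.fromBlocks (Y α) 0 0 (Y α) := by
    intro c Y
    ext i j
    rcases i with i | i <;> rcases j with j | j <;>
      simp [Matrix.sum_apply, -Fintype.sum_sum_type]
  exact key3 _ _

/-- The Maurer-Cartan equation for the change of coframe, from the commutators of the frames and the
linear independence of `e'_γ`. -/
theorem W_map (γ α β : Idx n) :
    M.X α (F.A γ β) - M.X β (F.A γ α) - ∑ τ, M.W τ α β * F.A γ τ =
      -∑ μ, ∑ ν, F.A μ α * F.A ν β * F.σ (M'.W γ μ ν) := by
  -- linear independence of the image of the frame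
  have indep : ∀ c : Idx n → C, (∀ f, ∑ γ, c γ * F.σ (M'.X γ f) = 0) → c = 0 := by
    intro c h
    have h1 : ∀ i, c (Sum.inl i) = 0 := by
      intro i
      have := h (M'.u (Sum.inl i))
      simpa [LagrangeData.X_inl, LagrangeData.X_inr, M'.d_u, apply_ite F.σ] using this
    funext τ
    rcases τ with i | a
    · exact h1 i
    · have := h (M'.u (Sum.inr a))
      simpa [h1, LagrangeData.X_inr, M'.d_u, apply_ite F.σ] using this
  revert γ
  suffices h : (fun γ => M.X α (F.A γ β) - M.X β (F.A γ α) - ∑ τ, M.W τ α β * F.A γ τ +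
      ∑ μ, ∑ ν, F.A μ α * F.A ν β * F.σ (M'.W γ μ ν)) = 0 from
    fun γ => eq_neg_of_add_eq_zero_left (congrFun h γ)
  apply indep
  intro f
  -- second derivatives of `f ∘ φ` in terms of those of `f`
  have e1 : ∀ α β, M.X α (M.X β (F.σ f)) = ∑ γ, M.X α (F.A γ β) * F.σ (M'.X γ f) +
      ∑ μ, ∑ ν, F.A μ α * F.A ν β * F.σ (M'.X μ (M'.X ν f)) := by
    intro α β
    rw [X_map, map_sum]
    simp only [Derivation.leibniz, smul_eq_mul, X_map, Finset.sum_add_distrib, Finset.mul_sum]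
    rw [add_comm, Finset.sum_comm]
    congr 1
    · exact Finset.sum_congr rfl fun _ _ => mul_comm _ _
    · refine Finset.sum_congr rfl fun _ _ => Finset.sum_congr rfl fun _ _ => ?_
      ring
  have e2 : ∑ μ, ∑ ν, F.A μ β * F.A ν α * F.σ (M'.X μ (M'.X ν f)) =
      ∑ μ, ∑ ν, F.A μ α * F.A ν β * F.σ (M'.X ν (M'.X μ f)) := by
    rw [Finset.sum_comm]
    refine Finset.sum_congr rfl fun _ _ => Finset.sum_congr rfl fun _ _ => ?_
    ring
  have e3 : ∑ μ, ∑ ν, F.A μ α * F.A ν β * F.σ (M'.X μ (M'.X ν f)) -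
      ∑ μ, ∑ ν, F.A μ α * F.A ν β * F.σ (M'.X ν (M'.X μ f)) =
      ∑ γ, ∑ μ, ∑ ν, F.A μ α * F.A ν β * F.σ (M'.W γ μ ν) * F.σ (M'.X γ f) := by
    refine Eq.trans ?_ (Finset.sum_comm.trans (Finset.sum_congr rfl fun _ _ =>
      Finset.sum_comm)).symm
    simp only [← Finset.sum_sub_distrib, ← mul_sub, ← map_sub, M'.commutator, map_sum, map_mul,
      Finset.mul_sum, mul_assoc]
  have e4 : ∑ τ, M.W τ α β * M.X τ (F.σ f) =
      ∑ γ, ∑ τ, M.W τ α β * F.A γ τ * F.σ (M'.X γ f) := by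
    rw [Finset.sum_comm]
    simp only [X_map, Finset.mul_sum, mul_assoc]
  have h := M.commutator α β (F.σ f)
  rw [e1, e1, e2, e4] at h
  simp only [add_mul, sub_mul, Finset.sum_add_distrib, Finset.sum_sub_distrib, Finset.sum_mul]
  rw [← e3]
  linear_combination h

/-- The change of frame of the associated Fedosov data. -/
def frameChange : FrameChange M'.fedosov M.fedosov where
  σ := F.σ
  A := F.A
  B := Matrix.fromBlocks F.Binv 0 0 F.Binv
  B_mul_A := by simp [A, Matrix.fromBlocks_multiply, F.Binv_mul_B]
  X_map := F.X_map
  Γ_map := F.Γ_map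
  W_map := F.W_map
  Λ_map := F.Λ_map

end LagrangeChange

open TopologicalSpace (Opens)

/-! ### Rings of smooth functions -/

section SmoothRing

variable {n : ℕ}

/-- Extension of a function on `O` by zero. -/
def extendZero (O : Opens (Coord n)) (f : O → ℂ) (u : Coord n) : ℂ :=
  open Classical in if h : u ∈ O then f ⟨u, h⟩ else 0

theorem extendZero_of_mem {O : Opens (Coord n)} (f : O → ℂ) {u : Coord n} (hu : u ∈ O) :
    extendZero O f u = f ⟨u, hu⟩ := dif_pos hu

/-- The ring of smooth complex-valued functions on an open set of `ℝ^{2n}`. -/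
def smoothRing (O : Opens (Coord n)) : Subalgebra ℂ (O → ℂ) where
  carrier := {f | ContDiffOn ℝ ∞ (extendZero O f) O}
  mul_mem' {f g} hf hg := (ContDiffOn.mul hf hg).congr fun u hu => by
    simp [extendZero_of_mem _ (show u ∈ O from hu)]
  add_mem' {f g} hf hg := (ContDiffOn.add hf hg).congr fun u hu => by
    simp [extendZero_of_mem _ (show u ∈ O from hu)]
  algebraMap_mem' c := (contDiffOn_const (c := c)).congr fun u hu => by
    simp [extendZero_of_mem _ (show u ∈ O from hu)]

namespace smoothRing

variable {O : Opens (Coord n)}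

/-- An element of the ring as a function on `ℝ^{2n}`, zero outside of `O`. -/
def fn (f : smoothRing O) : Coord n → ℂ := extendZero O f.1

theorem contDiffOn_fn (f : smoothRing O) : ContDiffOn ℝ ∞ (fn f) O := f.2

/-- Evaluation at a point. -/
def ev {u : Coord n} (hu : u ∈ O) : smoothRing O →ₐ[ℂ] ℂ :=
  (Pi.evalAlgHom ℂ (fun _ : O => ℂ) ⟨u, hu⟩).comp (smoothRing O).val

theorem fn_eq_ev (f : smoothRing O) {u : Coord n} (hu : u ∈ O) : fn f u = ev hu f :=
  extendZero_of_mem f.1 hu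

theorem ext_ev {f g : smoothRing O} (h : ∀ (u : Coord n) (hu : u ∈ O), ev hu f = ev hu g) :
    f = g :=
  Subtype.ext (funext fun u => h u.1 u.2)

/-- The element defined by a smooth function. -/
def mk (F : Coord n → ℂ) (hF : ContDiffOn ℝ ∞ F O) : smoothRing O :=
  ⟨fun u => F u.1, hF.congr fun _ hu => extendZero_of_mem _ hu⟩

@[simp] theorem ev_mk (F : Coord n → ℂ) (hF : ContDiffOn ℝ ∞ F O) {u : Coord n} (hu : u ∈ O) :
    ev hu (mk F hF) = F u := rfl

theorem differentiableAt_fn (f : smoothRing O) {u : Coord n} (hu : u ∈ O) :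
    DifferentiableAt ℝ (fn f) u :=
  ((contDiffOn_fn f).contDiffAt (O.2.mem_nhds hu)).differentiableAt (by simp)

theorem eventuallyEq_fn {f : smoothRing O} {F : Coord n → ℂ}
    (h : ∀ (u : Coord n) (hu : u ∈ O), ev hu f = F u) {u : Coord n} (hu : u ∈ O) :
    fn f =ᶠ[nhds u] F :=
  Filter.eventually_of_mem (O.2.mem_nhds hu) fun w hw => (fn_eq_ev f hw).trans (h w hw)

theorem fderiv_fn {f : smoothRing O} {F : Coord n → ℂ}
    (h : ∀ (u : Coord n) (hu : u ∈ O), ev hu f = F u) {u : Coord n} (hu : u ∈ O) :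
    fderiv ℝ (fn f) u = fderiv ℝ F u :=
  (eventuallyEq_fn h hu).fderiv_eq

theorem contDiffOn_of_ev {f : smoothRing O} {F : Coord n → ℂ}
    (h : ∀ (u : Coord n) (hu : u ∈ O), ev hu f = F u) : ContDiffOn ℝ ∞ F O :=
  (contDiffOn_fn f).congr fun u hu => ((fn_eq_ev f hu).trans (h u hu)).symm

theorem contDiffOn_pd_fn (f : smoothRing O) (α : Idx n) :
    ContDiffOn ℝ ∞ (fun u => pd α (fn f) u) O :=
  ((contDiffOn_fn f).fderiv_of_isOpen O.2 (m := ∞) (by simp)).clm_apply contDiffOn_const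

/-- The derivation `∂/∂u^α`. -/
def pdDer (O : Opens (Coord n)) (α : Idx n) : Derivation ℂ (smoothRing O) (smoothRing O) :=
  Derivation.mk'
    { toFun f := mk (fun u => pd α (fn f) u) (contDiffOn_pd_fn f α)
      map_add' f g := by
        refine ext_ev fun u hu => ?_
        rw [map_add, ev_mk, ev_mk, ev_mk, pd, fderiv_fn (F := fn f + fn g) _ hu,
          fderiv_add (differentiableAt_fn f hu) (differentiableAt_fn g hu)]
        · rfl
        · intro u hu
          rw [map_add, Pi.add_apply, fn_eq_ev _ hu, fn_eq_ev _ hu]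
      map_smul' c f := by
        refine ext_ev fun u hu => ?_
        rw [RingHom.id_apply, map_smul, ev_mk, ev_mk, pd, fderiv_fn (F := c • fn f) _ hu,
          fderiv_const_smul (differentiableAt_fn f hu)]
        · rfl
        · intro u hu
          rw [map_smul, Pi.smul_apply, fn_eq_ev _ hu] }
    fun f g => by
      refine ext_ev fun u hu => ?_
      rw [LinearMap.coe_mk, AddHom.coe_mk, map_add, smul_eq_mul, smul_eq_mul, map_mul, map_mul,
        ev_mk, ev_mk, ev_mk, pd, fderiv_fn (F := fn f * fn g) _ hu,
        fderiv_mul (differentiableAt_fn f hu) (differentiableAt_fn g hu)]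
      · simp [pd, fn_eq_ev _ hu]
      · intro u hu
        rw [map_mul, Pi.mul_apply, fn_eq_ev _ hu, fn_eq_ev _ hu]

theorem ev_pdDer (α : Idx n) (f : smoothRing O) {u : Coord n} (hu : u ∈ O) :
    ev hu (pdDer O α f) = pd α (fn f) u := rfl

theorem pdDer_comm (α β : Idx n) (f : smoothRing O) :
    pdDer O α (pdDer O β f) = pdDer O β (pdDer O α f) := by
  have key : ∀ α β : Idx n, ∀ (u : Coord n) (hu : u ∈ O), ev hu (pdDer O α (pdDer O β f)) =
      fderiv ℝ (fderiv ℝ (fn f)) u (Pi.single α 1) (Pi.single β 1) := by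
    intro α β u hu
    have hd : DifferentiableAt ℝ (fderiv ℝ (fn f)) u :=
      (((contDiffOn_fn f).fderiv_of_isOpen O.2 (m := ∞) (by simp)).contDiffAt
        (O.2.mem_nhds hu)).differentiableAt (by simp)
    rw [ev_pdDer, pd, fderiv_fn (F := fun w => fderiv ℝ (fn f) w (Pi.single β 1)) _ hu,
      fderiv_clm_apply hd (differentiableAt_const _)]
    · simp
    · intro w hw; rfl
  refine ext_ev fun u hu => ?_
  rw [key, key]
  exact (((contDiffOn_fn f).contDiffAt (O.2.mem_nhds hu)).isSymmSndFDerivAt (by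
    simp only [minSmoothness_of_isRCLikeNormedField]; exact WithTop.coe_le_coe.mpr le_top)) _ _

/-- A function of the ring is the real-valued function `F` on `O`. -/
def Rep (f : smoothRing O) (F : Coord n → ℝ) : Prop :=
  ∀ (u : Coord n) (hu : u ∈ O), ev hu f = (F u : ℂ)

namespace Rep

variable {f g : smoothRing O} {F G : Coord n → ℝ}

theorem contDiffOn (h : Rep f F) : ContDiffOn ℝ ∞ F O := by
  have h1 : ContDiffOn ℝ ∞ (fun u => Complex.reCLM (fn f u)) O :=
    Complex.reCLM.contDiff.comp_contDiffOn (contDiffOn_fn f)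
  exact h1.congr fun u hu => by rw [fn_eq_ev f hu, h u hu]; simp

theorem differentiableAt (h : Rep f F) {u : Coord n} (hu : u ∈ O) : DifferentiableAt ℝ F u :=
  (h.contDiffOn.contDiffAt (O.2.mem_nhds hu)).differentiableAt (by simp)

theorem fderiv_apply (h : Rep f F) {u : Coord n} (hu : u ∈ O) (w : Coord n) :
    fderiv ℝ (fn f) u w = (fderiv ℝ F u w : ℂ) := by
  have e : (fun w => (F w : ℂ)) = Complex.ofRealCLM ∘ F := rfl
  rw [fderiv_fn h hu, e,
    (Complex.ofRealCLM.hasFDerivAt.comp u (h.differentiableAt hu).hasFDerivAt).fderiv]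
  rfl

theorem pd (h : Rep f F) (α : Idx n) : Rep (pdDer O α f) (pd α F) := fun u hu => by
  rw [ev_pdDer, LagrangeFedosov.pd, h.fderiv_apply hu]; rfl

theorem add (hf : Rep f F) (hg : Rep g G) : Rep (f + g) (fun u => F u + G u) := fun u hu => by
  rw [map_add, hf, hg]; simp

theorem sub (hf : Rep f F) (hg : Rep g G) : Rep (f - g) (fun u => F u - G u) := fun u hu => by
  rw [map_sub, hf, hg]; simp

theorem mul (hf : Rep f F) (hg : Rep g G) : Rep (f * g) (fun u => F u * G u) := fun u hu => by
  rw [map_mul, hf, hg]; simp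

theorem zero : Rep (0 : smoothRing O) (fun _ => 0) := fun u hu => by simp

theorem smul (c : ℝ) (hf : Rep f F) : Rep ((c : ℂ) • f) (fun u => c * F u) := fun u hu => by
  rw [map_smul, hf]; simp

theorem sum {ι : Type*} (s : Finset ι) {f : ι → smoothRing O} {F : ι → Coord n → ℝ}
    (h : ∀ i, Rep (f i) (F i)) : Rep (∑ i ∈ s, f i) (fun u => ∑ i ∈ s, F i u) := fun u hu => by
  rw [map_sum, Complex.ofReal_sum]
  exact Finset.sum_congr rfl fun i _ => h i u hu

end Rep

/-- The element defined by a smooth real-valued function. -/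
def ofReal (F : Coord n → ℝ) (hF : ContDiffOn ℝ ∞ F O) : smoothRing O :=
  mk (fun u => (F u : ℂ)) (Complex.ofRealCLM.contDiff.comp_contDiffOn hF)

theorem rep_ofReal (F : Coord n → ℝ) (hF : ContDiffOn ℝ ∞ F O) : Rep (ofReal F hF) F :=
  fun _ _ => rfl

theorem isUnit_of_ne_zero (f : smoothRing O) (h : ∀ (u : Coord n) (hu : u ∈ O), ev hu f ≠ 0) :
    IsUnit f := by
  refine IsUnit.of_mul_eq_one (mk (fun u => (fn f u)⁻¹) ((contDiffOn_fn f).inv fun u hu => ?_)) ?_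
  · rw [fn_eq_ev f hu]; exact h u hu
  · refine ext_ev fun u hu => ?_
    rw [map_mul, ev_mk, fn_eq_ev f hu, map_one, mul_inv_cancel₀ (h u hu)]

/-- Restriction of functions along a smooth map between open sets. -/
def comap {O O' : Opens (Coord n)} (φ : Coord n → Coord n) (hφ : ContDiffOn ℝ ∞ φ O)
    (h : ∀ u ∈ O, φ u ∈ O') : smoothRing O' →ₐ[ℂ] smoothRing O where
  toFun f := mk (fun u => fn f (φ u)) ((contDiffOn_fn f).comp hφ h)
  map_one' := ext_ev fun u hu => by rw [ev_mk, fn_eq_ev _ (h u hu), map_one, map_one]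
  map_mul' f g := ext_ev fun u hu => by
    rw [ev_mk, fn_eq_ev _ (h u hu), map_mul, map_mul, ev_mk, ev_mk, fn_eq_ev _ (h u hu),
      fn_eq_ev _ (h u hu)]
  map_zero' := ext_ev fun u hu => by rw [ev_mk, fn_eq_ev _ (h u hu), map_zero, map_zero]
  map_add' f g := ext_ev fun u hu => by
    rw [ev_mk, fn_eq_ev _ (h u hu), map_add, map_add, ev_mk, ev_mk, fn_eq_ev _ (h u hu),
      fn_eq_ev _ (h u hu)]
  commutes' c := ext_ev fun u hu => by
    rw [ev_mk, fn_eq_ev _ (h u hu), AlgHom.commutes, AlgHom.commutes]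

theorem ev_comap {O O' : Opens (Coord n)} (φ : Coord n → Coord n) (hφ : ContDiffOn ℝ ∞ φ O)
    (h : ∀ u ∈ O, φ u ∈ O') (f : smoothRing O') {u : Coord n} (hu : u ∈ O) :
    ev hu (comap φ hφ h f) = ev (h u hu) f := fn_eq_ev f (h u hu)

end smoothRing

end SmoothRing

open smoothRing

/-! ### The Lagrange geometry of a generating function -/

section Lagr

variable {n : ℕ} {O : Opens (Coord n)} {L : Coord n → ℝ}

theorem rep_hess {f : smoothRing O} (hf : Rep f L) (i j : Fin n) :
    Rep ((1 / 2 : ℂ) • pdDer O (Sum.inr i) (pdDer O (Sum.inr j) f)) (fun u => hess L u i j) := by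
  have := ((hf.pd (Sum.inr j)).pd (Sum.inr i)).smul (1 / 2)
  push_cast at this
  exact this

/-- The Lagrange data of a regular generating function. -/
def lagr (O : Opens (Coord n)) (L : Coord n → ℝ) (hL : ContDiffOn ℝ ∞ L O)
    (hreg : ∀ u ∈ O, (hess L u).det ≠ 0) : LagrangeData n (smoothRing O) where
  d := pdDer O
  d_comm := pdDer_comm
  u α := ofReal (fun u => u α) ((contDiff_apply ℝ ℝ α).contDiffOn)
  d_u α β := by
    refine ext_ev fun u hu => ?_
    rw [((rep_ofReal (fun u : Coord n => u β) (contDiff_apply ℝ ℝ β).contDiffOn).pd α) u hu, pd,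
      show (fun u : Coord n => u β) = ContinuousLinearMap.proj (R := ℝ) β from rfl,
      ContinuousLinearMap.fderiv]
    by_cases h : α = β
    · subst h; simp
    · simp [h]
  ℓ := ofReal L hL
  K := (Matrix.of fun i j =>
    (1 / 2 : ℂ) • pdDer O (Sum.inr i) (pdDer O (Sum.inr j) (ofReal L hL)))⁻¹
  K_mul := by
    refine Matrix.nonsing_inv_mul _ (isUnit_of_ne_zero _ fun u hu => ?_)
    rw [AlgHom.map_det]
    have : (ev hu).mapMatrix (Matrix.of fun i j =>
        (1 / 2 : ℂ) • pdDer O (Sum.inr i) (pdDer O (Sum.inr j) (ofReal L hL))) =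
        (hess L u).map Complex.ofRealHom := by
      ext i j
      exact rep_hess (rep_ofReal L hL) i j u hu
    rw [this, ← RingHom.mapMatrix_apply, ← RingHom.map_det]
    simpa using hreg u hu

variable (hL : ContDiffOn ℝ ∞ L O) (hreg : ∀ u ∈ O, (hess L u).det ≠ 0)

theorem rep_H (i j : Fin n) : Rep ((lagr O L hL hreg).H i j) (fun u => hess L u i j) :=
  rep_hess (rep_ofReal L hL) i j

theorem map_H {u : Coord n} (hu : u ∈ O) :
    (lagr O L hL hreg).H.map (ev hu) = (hess L u).map Complex.ofRealHom := by
  ext i j; exact rep_H hL hreg i j u hu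

theorem rep_K (i j : Fin n) : Rep ((lagr O L hL hreg).K i j) (fun u => (hess L u)⁻¹ i j) := by
  intro u hu
  have h1 : (lagr O L hL hreg).K.map (ev hu) * (hess L u).map Complex.ofRealHom = 1 := by
    rw [← map_H hL hreg hu]
    have := congrArg (fun A => A.map (ev hu)) (lagr O L hL hreg).K_mul_H
    simpa using this
  have h2 : (hess L u).map Complex.ofRealHom * ((hess L u)⁻¹).map Complex.ofRealHom = 1 := by
    rw [← Matrix.map_mul, Matrix.mul_nonsing_inv _ (hreg u hu).isUnit]
    simp
  have h3 : (lagr O L hL hreg).K.map (ev hu) = ((hess L u)⁻¹).map Complex.ofRealHom := by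
    rw [← mul_one ((lagr O L hL hreg).K.map (ev hu)), ← h2, ← mul_assoc, h1, one_mul]
  exact congrFun (congrFun h3 i) j

theorem rep_G (a : Fin n) : Rep ((lagr O L hL hreg).G a) (spray L a) := by
  have hl := rep_ofReal L hL
  have := (Rep.sum Finset.univ fun b => (rep_K hL hreg a b).mul
    ((Rep.sum Finset.univ fun k => ((hl.pd (Sum.inl k)).pd (Sum.inr b)).mul
      (rep_ofReal (fun u => u (Sum.inr k)) (contDiff_apply ℝ ℝ (Sum.inr k)).contDiffOn)).sub
        (hl.pd (Sum.inl b)))).smul (1 / 4)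
  push_cast at this
  exact this

theorem rep_N (a i : Fin n) : Rep ((lagr O L hL hreg).N a i) (ncon L a i) :=
  (rep_G hL hreg a).pd (Sum.inr i)

theorem ev_X (α : Idx n) (f : smoothRing O) {u : Coord n} (hu : u ∈ O) :
    ev hu ((lagr O L hL hreg).X α f) = fderiv ℝ (fn f) u (frame L α u) := by
  rcases α with i | a
  · rw [LagrangeData.X_inl, frame, map_sub, map_sum, map_sub, map_sum]
    congr 1
    refine Finset.sum_congr rfl fun a _ => ?_
    rw [map_mul, rep_N hL hreg a i u hu, map_smul, Complex.real_smul]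
    rfl
  · rfl

theorem rep_X {f : smoothRing O} {F : Coord n → ℝ} (h : Rep f F) (α : Idx n) :
    Rep ((lagr O L hL hreg).X α f) (fd L α F) := fun u hu => by
  rw [ev_X, h.fderiv_apply hu]; rfl

theorem hasFDerivAt_frame_inl (hL : ContDiffOn ℝ ∞ L O)
    (hreg : ∀ u ∈ O, (hess L u).det ≠ 0) (i : Fin n) {u : Coord n} (hu : u ∈ O) :
    HasFDerivAt (frame L (Sum.inl i))
      (-∑ a, (fderiv ℝ (ncon L a i) u).smulRight (Pi.single (Sum.inr a) 1 : Coord n)) u := by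
  have h : HasFDerivAt (fun u => ∑ a, ncon L a i u • (Pi.single (Sum.inr a) 1 : Coord n))
      (∑ a, (fderiv ℝ (ncon L a i) u).smulRight (Pi.single (Sum.inr a) 1 : Coord n)) u :=
    HasFDerivAt.fun_sum fun a _ =>
      ((rep_N hL hreg a i).differentiableAt hu).hasFDerivAt.smul_const _
  exact h.const_sub _

/-- The structure functions coincide with the components of the Lie brackets of the frame. -/
theorem rep_W (τ α β : Idx n) : Rep ((lagr O L hL hreg).W τ α β) (anhol L τ α β) := by
  intro u hu
  have e1 : ∀ i w, fderiv ℝ (frame L (Sum.inl i)) u w =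
      -∑ a, fderiv ℝ (ncon L a i) u w • (Pi.single (Sum.inr a) 1 : Coord n) := by
    intro i w
    rw [(hasFDerivAt_frame_inl hL hreg i hu).fderiv]
    simp
  have e2 : ∀ a w, fderiv ℝ (frame L (Sum.inr a)) u w = 0 := by
    intro a w
    have : frame L (Sum.inr a) = fun _ => Pi.single (Sum.inr a) 1 := rfl
    rw [this, fderiv_fun_const]; rfl
  have e3 : ∀ i w j, fderiv ℝ (frame L (Sum.inl i)) u w (Sum.inl j) = 0 := by
    intro i w j
    rw [e1]; simp [Finset.sum_apply]
  have e4 : ∀ i w a, fderiv ℝ (frame L (Sum.inl i)) u w (Sum.inr a) =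
      -fderiv ℝ (ncon L a i) u w := by
    intro i w a
    rw [e1]; simp [Finset.sum_apply, Pi.single_apply]
  have e5 : ∀ a, frame L (Sum.inr a) u = Pi.single (Sum.inr a) 1 := fun a => rfl
  rw [anhol, VectorField.lieBracket]
  rcases τ with k | a <;> rcases α with i | b <;> rcases β with j | c
  · simp [LagrangeData.W, coframe, e3]
  · simp [LagrangeData.W, coframe, e3, e2]
  · simp [LagrangeData.W, coframe, e3, e2]
  · simp [LagrangeData.W, coframe, e2]
  · rw [LagrangeData.W, map_sub, rep_X hL hreg (rep_N hL hreg a i) _ u hu,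
      rep_X hL hreg (rep_N hL hreg a j) _ u hu]
    simp only [coframe, Pi.sub_apply, e3, e4, fd]
    push_cast
    simp
    ring
  · have h := ((rep_N hL hreg a i).pd (Sum.inr c)) u hu
    change ev hu (pdDer O (Sum.inr c) _) = _
    rw [h]
    simp [coframe, e3, e4, e2, e5, pd]
  · have h := ((rep_N hL hreg a j).pd (Sum.inr b)) u hu
    change ev hu (-pdDer O (Sum.inr b) _) = _
    rw [map_neg, h]
    simp [coframe, e3, e4, e2, e5, pd]
  · simp [LagrangeData.W, coframe, e2]

theorem rep_christ (s : Fin n → Idx n) (i j k : Fin n) :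
    Rep (((1 / 2 : ℂ) • ((lagr O L hL hreg).K * LagrangeData.christ (lagr O L hL hreg).H
        (fun i => (lagr O L hL hreg).X (s i)) k)) i j)
      (fun u => (1 / 2) * ∑ m, (hess L u)⁻¹ i m *
        (fd L (s k) (fun w => hess L w j m) u + fd L (s j) (fun w => hess L w m k) u
          - fd L (s m) (fun w => hess L w j k) u)) := by
  have := (Rep.sum Finset.univ fun m => (rep_K hL hreg i m).mul
    (((rep_X hL hreg (rep_H hL hreg j m) (s k)).add
      (rep_X hL hreg (rep_H hL hreg m k) (s j))).sub
        (rep_X hL hreg (rep_H hL hreg j k) (s m)))).smul (1 / 2)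
  push_cast at this
  exact this

theorem rep_Γ (τ β α : Idx n) : Rep ((lagr O L hL hreg).Γ α τ β) (gam L τ β α) := by
  rcases τ with i | i <;> rcases β with j | j <;> rcases α with k | k
  · exact rep_christ hL hreg Sum.inl i j k
  · exact rep_christ hL hreg Sum.inr i j k
  · exact Rep.zero
  · exact Rep.zero
  · exact Rep.zero
  · exact Rep.zero
  · exact rep_christ hL hreg Sum.inl i j k
  · exact rep_christ hL hreg Sum.inr i j k

theorem jMat_transpose : (jMat n)ᵀ = Matrix.fromBlocks 0 (-1) 1 0 := by
  rw [jMat, Matrix.fromBlocks_transpose]; simp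

theorem thetaLow_eq (u : Coord n) :
    thetaLow L u = Matrix.fromBlocks 0 (-hess L u) (hess L u) 0 := by
  rw [thetaLow, jMat_transpose, gMat, Matrix.fromBlocks_multiply]; simp

theorem rep_θ (α β : Idx n) : Rep ((lagr O L hL hreg).θ α β) (fun u => thetaLow L u α β) := by
  intro u hu
  change _ = ((thetaLow L u α β : ℝ) : ℂ)
  rw [thetaLow_eq]
  rcases α with i | i <;> rcases β with j | j
  · simp [LagrangeData.θ]
  · simp [LagrangeData.θ, rep_H hL hreg i j u hu]
  · simp [LagrangeData.θ, rep_H hL hreg i j u hu]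
  · simp [LagrangeData.θ]

theorem gMat_inv (hreg : ∀ u ∈ O, (hess L u).det ≠ 0) {u : Coord n} (hu : u ∈ O) :
    (gMat L u)⁻¹ = Matrix.fromBlocks (hess L u)⁻¹ 0 0 (hess L u)⁻¹ := by
  refine Matrix.inv_eq_left_inv ?_
  rw [gMat, Matrix.fromBlocks_multiply]
  simp [Matrix.nonsing_inv_mul _ (hreg u hu).isUnit]

theorem hess_transpose (hL : ContDiffOn ℝ ∞ L O)
    (hreg : ∀ u ∈ O, (hess L u).det ≠ 0) {u : Coord n} (hu : u ∈ O) : (hess L u)ᵀ = hess L u := by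
  ext i j
  have := congrArg (ev hu) ((lagr O L hL hreg).H_symm j i)
  rw [rep_H hL hreg _ _ u hu, rep_H hL hreg _ _ u hu] at this
  exact_mod_cast this

theorem thetaUp_eq (hL : ContDiffOn ℝ ∞ L O)
    (hreg : ∀ u ∈ O, (hess L u).det ≠ 0) {u : Coord n} (hu : u ∈ O) :
    thetaUp L u = Matrix.fromBlocks 0 (-(hess L u)⁻¹) (hess L u)⁻¹ 0 := by
  rw [thetaUp, gMat_inv hreg hu, thetaLow_eq, Matrix.fromBlocks_transpose,
    Matrix.fromBlocks_multiply, Matrix.fromBlocks_multiply, Matrix.transpose_nonsing_inv,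
    hess_transpose hL hreg hu]
  simp [Matrix.nonsing_inv_mul _ (hreg u hu).isUnit]

theorem map_Λ {u : Coord n} (hu : u ∈ O) : (lagr O L hL hreg).Λ.map (ev hu) = lam L u := by
  ext α β
  rw [lam, Matrix.of_apply, thetaUp_eq hL hreg hu, gMat_inv hreg hu]
  rcases α with i | i <;> rcases β with j | j <;>
    simp [LagrangeData.Λ, rep_K hL hreg i j u hu]

theorem rep_torsion (τ α β : Idx n) :
    Rep ((lagr O L hL hreg).fedosov.torsion τ α β) (tors L τ α β) :=
  ((rep_Γ hL hreg τ α β).sub (rep_Γ hL hreg τ β α)).sub (rep_W hL hreg τ β α)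

theorem rep_curvature (τ φ α β : Idx n) :
    Rep ((lagr O L hL hreg).fedosov.curvature β α τ φ) (curv L τ φ α β) := by
  intro u hu
  have h1 := rep_X hL hreg (rep_Γ hL hreg τ φ α) β u hu
  have h2 := rep_X hL hreg (rep_Γ hL hreg τ φ β) α u hu
  have e : (lagr O L hL hreg).fedosov.curvature β α τ φ =
      (lagr O L hL hreg).X β ((lagr O L hL hreg).Γ α τ φ) -
      (lagr O L hL hreg).X α ((lagr O L hL hreg).Γ β τ φ) +
      ∑ μ, ((lagr O L hL hreg).Γ α μ φ * (lagr O L hL hreg).Γ β τ μ -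
        (lagr O L hL hreg).Γ β μ φ * (lagr O L hL hreg).Γ α τ μ) -
      ∑ μ, (lagr O L hL hreg).W μ β α * (lagr O L hL hreg).Γ μ τ φ := by
    simp only [FedosovData.curvature, Matrix.sub_apply, Matrix.add_apply, Matrix.map_apply,
      Matrix.mul_apply, Matrix.sum_apply, Matrix.smul_apply, smul_eq_mul, LagrangeData.fedosov,
      Finset.sum_sub_distrib, mul_comm ((lagr O L hL hreg).Γ α _ φ),
      mul_comm ((lagr O L hL hreg).Γ β _ φ)]
    ring
  rw [e]
  exact (((rep_X hL hreg (rep_Γ hL hreg τ φ α) β).sub (rep_X hL hreg (rep_Γ hL hreg τ φ β) α)).add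
    (Rep.sum Finset.univ fun μ => ((rep_Γ hL hreg μ φ α).mul (rep_Γ hL hreg τ μ β)).sub
      ((rep_Γ hL hreg μ φ β).mul (rep_Γ hL hreg τ μ α)))).sub
    (Rep.sum Finset.univ fun μ => (rep_W hL hreg μ β α).mul (rep_Γ hL hreg τ φ μ)) u hu

end Lagr

/-! ### The fibre over a point -/

section Fibre

variable {n : ℕ}

theorem extMul_eq (α : Idx n) (a : Fiber n) : extMul α a = Fib.wedge α a := rfl

theorem intProd_eq (α : Idx n) (a : Fiber n) : intProd α a = Fib.contr α a := rfl

theorem zmul_eq (α : Idx n) (a : Fiber n) : zmul α a = Fib.zMul α a := rfl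

theorem zd_eq (α : Idx n) (a : Fiber n) : zd α a = Fib.zDer α a := rfl

theorem wOne_eq : wOne n = Fib.one := rfl

theorem vdiv_eq (a : Fiber n) : vdiv a = Fib.vDiv a := rfl

theorem degTot_eq (k : ℕ) (a : Fiber n) : degTot k a = Fib.deg k a := rfl

theorem delta_eq (a : Fiber n) : delta a = Fib.del a := by rw [Fib.del_apply]; rfl

theorem deltaInv_eq (a : Fiber n) : deltaInv a = Fib.delInv a := by
  funext r m S
  rw [Fib.delInv_apply, Fib.weight_apply, Fib.delAdj_apply, deltaInv]
  split_ifs with h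
  · rw [h]; simp
  · rw [smul_eq_mul, div_eq_inv_mul]; rfl

theorem wickTerm_eq (Λ : Matrix (Idx n) (Idx n) ℂ) (k : ℕ) (a b : Fiber n) :
    wickTerm Λ k a b = Fib.biDer Λ k a b := by
  induction k generalizing a b with
  | zero => rfl
  | succ k ih => rw [Fib.biDer_succ, wickTerm]; simp only [ih, zd_eq]

theorem wick_eq (Λ : Matrix (Idx n) (Idx n) ℂ) (a b : Fiber n) : wick Λ a b = Fib.star Λ a b := by
  funext r m S
  rw [Fib.star_eq, Fib.expSum_apply, Finset.sum_apply, Finset.sum_apply, wick]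
  refine Finset.sum_congr rfl fun k _ => ?_
  rw [wickTerm_eq]; rfl

theorem degA_eq_self_iff (q : ℕ) (a : Fiber n) : degA q a = a ↔ a ∈ Fib.forms n ℂ q := by
  constructor
  · intro h r m S hS
    rw [← h, degA, if_neg hS]
  · intro h
    funext r m S
    rw [degA]
    split_ifs with hS
    · rfl
    · exact (h r m S hS).symm

theorem sum_degA (a : Fiber n) : ∑ q ∈ Finset.range (2 * n + 1), degA q a = a := by
  funext r m S
  simp only [Finset.sum_apply, degA]
  rw [Finset.sum_ite_eq, if_pos]
  have : S.card ≤ Fintype.card (Idx n) := S.card_le_univ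
  rw [Fintype.card_sum, Fintype.card_fin] at this
  exact Finset.mem_range.mpr (by omega)

/-- The graded commutator with an element of form degree one, written with the parity involution. -/
theorem adWick_eq (Λ : Matrix (Idx n) (Idx n) ℂ) {r : Fiber n} (hr : r ∈ Fib.forms n ℂ 1)
    (a : Fiber n) : adWick Λ r a = Fib.star Λ r a - Fib.star Λ (Fib.parity a) r := by
  have h : ∀ p q, (-1 : ℂ) ^ (p * q) • wick Λ (degA q a) (degA p r) =
      Fib.star Λ (degA q (Fib.parity a)) (degA p r) := by
    intro p q
    rw [wick_eq]
    by_cases hp : p = 1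
    · rw [hp, one_mul, ← LinearMap.smul_apply, ← map_smul]
      congr 2
      funext r m S
      simp only [Pi.smul_apply, degA, Fib.parity_apply, smul_eq_mul]
      split_ifs with hS
      · rw [hS]
      · rw [mul_zero]
    · have : degA p r = 0 := by
        funext k m S
        rw [degA]
        split_ifs with hS
        · exact hr k m S (by omega)
        · rfl
      rw [this, map_zero, map_zero, smul_zero]
  rw [adWick]
  have hl : ∀ b, ∑ p ∈ Finset.range (2 * n + 1), Fib.star Λ (degA p r) b = Fib.star Λ r b := by
    intro b
    conv_rhs => rw [← sum_degA r, map_sum, LinearMap.sum_apply]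
  have hl' : ∀ b, ∑ q ∈ Finset.range (2 * n + 1), Fib.star Λ (degA q (Fib.parity a)) b =
      Fib.star Λ (Fib.parity a) b := by
    intro b
    conv_rhs => rw [← sum_degA (Fib.parity a), map_sum, LinearMap.sum_apply]
  have hr' : ∀ (x b : Fiber n), ∑ q ∈ Finset.range (2 * n + 1), Fib.star Λ x (degA q b) =
      Fib.star Λ x b := by
    intro x b
    rw [← map_sum, sum_degA]
  simp only [h, Finset.sum_sub_distrib]
  simp only [wick_eq, hr', hl, hl']

theorem minor_eq (A : Matrix (Idx n) (Idx n) ℝ) (S T : Finset (Idx n)) :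
    ((minor A S T : ℝ) : ℂ) = cminor (A.map Complex.ofRealHom) S T := by
  rw [minor, cminor]
  split_ifs
  · rw [← Complex.ofRealHom_eq_coe, RingHom.map_det]; rfl
  · simp

/-- The substitution of the fibre in the statement is the algebraic one. -/
theorem pull_eq (A : Matrix (Idx n) (Idx n) ℝ) (b : Fiber n) :
    pull A b = Fib.pull (A.map Complex.ofRealHom) b := by
  funext r m S
  rw [Fib.pull_apply, pull]
  refine Finset.sum_congr rfl fun m' _ => Finset.sum_congr rfl fun S' _ => ?_
  rw [Complex.ofReal_mul, minor_eq]
  congr 2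
  have e := MvPolynomial.coeff_map Complex.ofRealHom
    (∏ α, (∑ β, MvPolynomial.C (A α β) * MvPolynomial.X β) ^ m' α) m
  rw [Complex.ofRealHom_eq_coe] at e
  rw [← e]
  congr 1
  simp only [map_prod, map_pow, map_sum, map_mul, MvPolynomial.map_C, MvPolynomial.map_X,
    Fib.linForm, Matrix.map_apply]

end Fibre

theorem LagrangeData.fedosov_X {n : ℕ} {C : Type*} [CommRing C] [Algebra ℂ C]
    (M : LagrangeData n C) : M.fedosov.X = M.X := rfl

theorem LagrangeData.fedosov_Γ {n : ℕ} {C : Type*} [CommRing C] [Algebra ℂ C]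
    (M : LagrangeData n C) : M.fedosov.Γ = M.Γ := rfl

namespace FedosovData

variable {n : ℕ} {C C' : Type*} [CommRing C] [Algebra ℂ C] [CommRing C'] [Algebra ℂ C']
  (D : FedosovData n C') (σ : C' →ₐ[ℂ] C)

theorem map_conn (x : Fib n C') : Fib.map σ (D.conn x) =
    ∑ α, Fib.wedge α (Fib.map σ (Fib.coeffDer (D.X α) x) - Fib.map σ (Fib.lin (D.Γ α) x)) -
      (1 / 2 : ℂ) • ∑ τ, ∑ α, ∑ β,
        σ (D.W τ α β) • Fib.wedge α (Fib.wedge β (Fib.contr τ (Fib.map σ x))) := by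
  rw [conn_apply, frameD, sub_eq_add_neg, ← neg_smul]
  simp only [map_add, map_sum, Fib.map_wedge, nabla_apply, map_sub, map_smul,
    Fib.wedge₂_apply, Fib.map_smul_coeff, Fib.map_contr]

theorem map_torsionElt : Fib.map σ D.torsionElt = ∑ γ, ∑ τ, ∑ α, ∑ β,
    ((1 / 2 : ℂ) • (σ (D.θ γ τ) * σ (D.torsion τ α β))) •
      Fib.zMul γ (Fib.wedge α (Fib.wedge β Fib.one)) := by
  rw [torsionElt]
  simp only [map_smul, map_sum, Fib.map_smul_coeff, Fib.map_zMul, Fib.wedge₂_apply, Fib.map_wedge,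
    Fib.map_one, Finset.smul_sum, smul_smul, smul_assoc, map_mul]

theorem map_curvatureElt : Fib.map σ D.curvatureElt = ∑ γ, ∑ φ, ∑ τ, ∑ α, ∑ β,
    ((1 / 4 : ℂ) • (σ (D.θ γ τ) * σ (D.curvature β α τ φ))) •
      Fib.zMul γ (Fib.zMul φ (Fib.wedge α (Fib.wedge β Fib.one))) := by
  have e : ∀ F : Idx n → Idx n → Idx n → Idx n → Idx n → Fib n C,
      ∑ α, ∑ β, ∑ γ, ∑ φ, ∑ τ, F α β γ φ τ = ∑ γ, ∑ φ, ∑ τ, ∑ α, ∑ β, F α β γ φ τ := by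
    intro F
    have e1 : ∀ α, ∑ β, ∑ γ, ∑ φ, ∑ τ, F α β γ φ τ = ∑ γ, ∑ φ, ∑ τ, ∑ β, F α β γ φ τ := by
      intro α
      rw [Finset.sum_comm]
      refine Finset.sum_congr rfl fun γ _ => ?_
      rw [Finset.sum_comm]
      refine Finset.sum_congr rfl fun φ _ => ?_
      rw [Finset.sum_comm]
    simp only [e1]
    rw [Finset.sum_comm]
    refine Finset.sum_congr rfl fun γ _ => ?_
    rw [Finset.sum_comm]
    refine Finset.sum_congr rfl fun φ _ => ?_
    rw [Finset.sum_comm]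
  rw [curvatureElt]
  simp only [map_smul, map_sum, Fib.map_smul_coeff, Fib.map_zMul, Fib.map_wedge, Fib.map_one,
    Matrix.mul_apply, map_mul, Finset.sum_smul, Finset.smul_sum]
  rw [e]
  simp only [smul_assoc]

end FedosovData

/-! ### Sections over an open set -/

section Sections

variable {n : ℕ} {O : Opens (Coord n)} {L : Coord n → ℝ}

/-- A local section as an element of the fibre over the ring of smooth functions. -/
def toFib (O : Opens (Coord n)) (a : LocSec n) (ha : SmoothOn a O) : Fib n (smoothRing O) :=
  fun r m S => mk (fun u => a u r m S) (ha r m S)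

/-- An element of the fibre over the ring of smooth functions represents a local section. -/
def RepSec (x : Fib n (smoothRing O)) (a : LocSec n) : Prop :=
  ∀ (u : Coord n) (hu : u ∈ O), Fib.map (ev hu) x = a u

theorem repSec_toFib (a : LocSec n) (ha : SmoothOn a O) : RepSec (toFib O a ha) a :=
  fun _ _ => rfl

theorem RepSec.smoothOn {x : Fib n (smoothRing O)} {a : LocSec n} (h : RepSec x a) :
    SmoothOn a O := fun r m S =>
  contDiffOn_of_ev (f := x r m S) fun u hu => by rw [← h u hu]; rfl

theorem ext_map_ev {x y : Fib n (smoothRing O)}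
    (h : ∀ (u : Coord n) (hu : u ∈ O), Fib.map (ev hu) x = Fib.map (ev hu) y) : x = y := by
  funext r m S
  exact ext_ev fun u hu => congrFun (congrFun (congrFun (h u hu) r) m) S

variable (hL : ContDiffOn ℝ ∞ L O) (hreg : ∀ u ∈ O, (hess L u).det ≠ 0)

theorem rep_fedosov_W (τ α β : Idx n) :
    Rep ((lagr O L hL hreg).fedosov.W τ α β) (anhol L τ α β) := rep_W hL hreg τ α β

theorem RepSec.conn {x : Fib n (smoothRing O)} {a : LocSec n} (h : RepSec x a) :
    RepSec ((lagr O L hL hreg).fedosov.conn x) (dConn L a) := by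
  intro u hu
  have h1 : ∀ α, Fib.map (ev hu) (Fib.coeffDer ((lagr O L hL hreg).X α) x) =
      fun r m S => fd L α (fun w => a w r m S) u := by
    intro α
    funext r m S
    rw [Fib.map_apply, Fib.coeffDer_apply, ev_X, fd,
      fderiv_fn (F := fun w => a w r m S) (fun w hw => by rw [← h w hw]; rfl) hu]
  have h2 : ∀ α, Fib.map (ev hu) (Fib.lin ((lagr O L hL hreg).Γ α) x) =
      ∑ β, ∑ γ, (gam L γ β α u : ℂ) • zmul β (zd γ (a u)) := by
    intro α
    rw [Fib.lin_apply, Finset.sum_comm]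
    simp only [map_sum, Fib.map_smul_coeff, rep_Γ hL hreg _ _ _ u hu, Fib.map_zMul, Fib.map_zDer,
      h u hu, zmul_eq, zd_eq]
  rw [FedosovData.map_conn, dConn]
  refine congrArg₂ (· - ·) (Finset.sum_congr rfl fun α _ => ?_) (congrArg _
    (Finset.sum_congr rfl fun τ _ => Finset.sum_congr rfl fun α _ =>
      Finset.sum_congr rfl fun β _ => ?_))
  · rw [extMul_eq, ← h1, ← h2, LagrangeData.fedosov_X, LagrangeData.fedosov_Γ]
  · rw [h u hu, rep_fedosov_W hL hreg τ α β u hu, extMul_eq, extMul_eq, intProd_eq]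

theorem rep_fedosov_θ (α β : Idx n) :
    Rep ((lagr O L hL hreg).fedosov.θ α β) (fun u => thetaLow L u α β) := rep_θ hL hreg α β

theorem repSec_torsionElt : RepSec (lagr O L hL hreg).fedosov.torsionElt (torsElt L) := by
  intro u hu
  rw [FedosovData.map_torsionElt, torsElt]
  refine Finset.sum_congr rfl fun γ _ => Finset.sum_congr rfl fun τ _ => Finset.sum_congr rfl
    fun α _ => Finset.sum_congr rfl fun β _ => ?_
  rw [rep_torsion hL hreg τ α β u hu, rep_fedosov_θ hL hreg γ τ u hu, zmul_eq, extMul_eq,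
    extMul_eq, wOne_eq]
  push_cast
  rw [smul_eq_mul, mul_assoc]

theorem repSec_curvatureElt : RepSec (lagr O L hL hreg).fedosov.curvatureElt (curvElt L) := by
  intro u hu
  rw [FedosovData.map_curvatureElt, curvElt]
  refine Finset.sum_congr rfl fun γ _ => Finset.sum_congr rfl fun φ _ => Finset.sum_congr rfl
    fun τ _ => Finset.sum_congr rfl fun α _ => Finset.sum_congr rfl fun β _ => ?_
  rw [rep_curvature hL hreg τ φ α β u hu, rep_fedosov_θ hL hreg γ τ u hu, zmul_eq, zmul_eq,
    extMul_eq, extMul_eq, wOne_eq]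
  push_cast
  rw [smul_eq_mul, mul_assoc]

theorem map_star_ev {u : Coord n} (hu : u ∈ O) (x y : Fib n (smoothRing O)) :
    Fib.map (ev hu) (Fib.star (lagr O L hL hreg).fedosov.Λ x y) =
      wick (lam L u) (Fib.map (ev hu) x) (Fib.map (ev hu) y) := by
  rw [Fib.map_star, wick_eq, ← map_Λ hL hreg hu]; rfl

theorem RepSec.deg {x : Fib n (smoothRing O)} {a : LocSec n} (h : RepSec x a) (k : ℕ) :
    RepSec (Fib.deg k x) (fun u => degTot k (a u)) := fun u hu => by
  rw [Fib.map_deg, h u hu]; rfl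

theorem RepSec.fed {x y : Fib n (smoothRing O)} {r a : LocSec n} (hx : RepSec x r)
    (hf : x ∈ Fib.forms n _ 1) (hy : RepSec y a) :
    RepSec ((lagr O L hL hreg).fedosov.fed x y) (fedosovD L r a) := by
  intro u hu
  have hr : r u ∈ Fib.forms n ℂ 1 := hx u hu ▸ Fib.map_mem_forms _ hf
  rw [FedosovData.fed, fedosovD, map_sub, map_add, map_neg, map_smul, Fib.map_del,
    RepSec.conn hL hreg hy u hu, Fib.map_vDiv, map_sub, map_star_ev, map_star_ev, Fib.map_parity,
    hx u hu, hy u hu, adWick_eq _ hr, delta_eq, vdiv_eq, wick_eq, wick_eq]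

end Sections

/-! ### Transition maps -/

namespace Fib

variable {n : ℕ} {C : Type*} [CommRing C] [Algebra ℂ C]

theorem cminor_one (S T : Finset (Idx n)) :
    cminor (1 : Matrix (Idx n) (Idx n) C) S T = if S = T then 1 else 0 := by
  split_ifs with h
  · subst h
    rw [cminor, dif_pos rfl]
    simp only [Fin.cast_eq_self]
    rw [show (fun k : Fin S.card => nth S k) = nth S from rfl,
      Matrix.submatrix_one _
        (fun _ _ h => (strictMono_nth S).injective (congrArg finSumFinEquiv h)), Matrix.det_one]
  · rw [cminor]
    split_ifs with hc
    · -- an element of `S` that is not in `T` gives a zero row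
      have : ∃ s ∈ S, s ∉ T := by
        by_contra hcon
        push Not at hcon
        exact h (Finset.eq_of_subset_of_card_le hcon hc.ge)
      obtain ⟨s, hs, hsT⟩ := this
      obtain ⟨k, rfl⟩ := nth_bijOn S hs
      refine Matrix.det_eq_zero_of_row_eq_zero k fun j => ?_
      rw [Matrix.submatrix_apply, Matrix.one_apply_ne]
      intro he
      exact hsT (he ▸ nth_mem _ _)
    · rfl

theorem pull_identity (b : Fib n C) : pull (1 : Matrix (Idx n) (Idx n) C) b = b := by
  funext r m S
  rw [pull_apply]
  have h : ∀ m' : Idx n →₀ ℕ, ∏ α, linForm (1 : Matrix (Idx n) (Idx n) C) α ^ m' α =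
      MvPolynomial.monomial m' 1 := by
    intro m'
    have e : ∀ α, linForm (1 : Matrix (Idx n) (Idx n) C) α = MvPolynomial.X α := by
      intro α
      rw [linForm, Finset.sum_eq_single α]
      · simp
      · intro β _ hβ; rw [Matrix.one_apply_ne hβ.symm]; simp
      · simp
    simp only [e]
    rw [MvPolynomial.monomial_eq, Finsupp.prod_fintype _ _ (fun _ => pow_zero _)]
    simp
  simp only [h, cminor_one, MvPolynomial.coeff_monomial]
  rw [Finset.sum_eq_single m, Finset.sum_eq_single S]
  · simp
  · intro S' _ hS'; rw [if_neg hS', mul_zero, zero_mul]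
  · simp
  · intro m' _ hm'
    refine Finset.sum_eq_zero fun S' _ => ?_
    rw [if_neg hm', zero_mul, zero_mul]
  · intro hm
    exact absurd (mem_finsuppAntidiag_univ.mpr rfl) hm

end Fib

section Transition

variable {n : ℕ}

theorem coframe_add (L : Coord n → ℝ) (u v w : Coord n) :
    coframe L u (v + w) = coframe L u v + coframe L u w := by
  funext α
  rcases α with i | a
  · rfl
  · simp only [coframe, Pi.add_apply, mul_add, Finset.sum_add_distrib]; ring

theorem coframe_smul (L : Coord n → ℝ) (u : Coord n) (c : ℝ) (v : Coord n) :
    coframe L u (c • v) = c • coframe L u v := by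
  funext α
  rcases α with i | a
  · rfl
  · simp only [coframe, Pi.smul_apply, smul_eq_mul, mul_add, Finset.mul_sum, mul_left_comm c]

/-- The coframe at a point as a linear map. -/
def coframeₗ (L : Coord n → ℝ) (u : Coord n) : Coord n →ₗ[ℝ] (Idx n → ℝ) where
  toFun := coframe L u
  map_add' := coframe_add L u
  map_smul' := coframe_smul L u

theorem coframe_frame (L : Coord n → ℝ) (u : Coord n) (α : Idx n) :
    coframe L u (frame L α u) = Pi.single α 1 := by
  funext β
  rcases α with i | a <;> rcases β with j | b
  · simp [coframe, frame, Finset.sum_apply, Pi.single_apply]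
  · simp [coframe, frame, Finset.sum_apply, Pi.single_apply]
  · simp [coframe, frame]
  · simp [coframe, frame, Pi.single_apply]

theorem sum_coframe_smul_frame (L : Coord n → ℝ) (u v : Coord n) :
    ∑ α, coframe L u v α • frame L α u = v := by
  funext β
  rw [Fintype.sum_sum_type]
  rcases β with j | b
  · simp [coframe, frame, Finset.sum_apply, Pi.single_apply]
  · simp [coframe, frame, Finset.sum_apply, Pi.single_apply]
    rw [add_comm, add_assoc]
    simp [mul_comm]

/-- The matrix that relates the coframes `e'^α = A^α_β e^β` of two generating functions along a
map `φ`. -/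
def transMatrix (L L' : Coord n → ℝ) (φ : Coord n → Coord n) (u : Coord n) :
    Matrix (Idx n) (Idx n) ℝ :=
  Matrix.of fun β α => coframe L' (φ u) (fderiv ℝ φ u (frame L α u)) β

variable {L L' : Coord n → ℝ} {φ : Coord n → Coord n}

theorem transMatrix_mulVec (u v : Coord n) :
    transMatrix L L' φ u *ᵥ coframe L u v = coframe L' (φ u) (fderiv ℝ φ u v) := by
  have h : coframe L' (φ u) (fderiv ℝ φ u v) =
      ((coframeₗ L' (φ u)).comp (fderiv ℝ φ u).toLinearMap)
        (∑ α, coframe L u v α • frame L α u) := by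
    rw [sum_coframe_smul_frame]; rfl
  rw [h, map_sum]
  funext β
  rw [Finset.sum_apply]
  change ∑ α, transMatrix L L' φ u β α * coframe L u v α = _
  refine Finset.sum_congr rfl fun α _ => ?_
  rw [map_smul, Pi.smul_apply, smul_eq_mul, mul_comm]
  rfl

theorem fderiv_frame (u : Coord n) (α : Idx n) :
    fderiv ℝ φ u (frame L α u) = ∑ β, transMatrix L L' φ u β α • frame L' β (φ u) :=
  (sum_coframe_smul_frame L' (φ u) _).symm

theorem eq_transMatrix_of_mulVec {u : Coord n} {A : Matrix (Idx n) (Idx n) ℝ}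
    (h : ∀ v, coframe L' (φ u) (fderiv ℝ φ u v) = A *ᵥ coframe L u v) :
    A = transMatrix L L' φ u := by
  ext β α
  have := congrFun (h (frame L α u)) β
  rw [coframe_frame, Matrix.mulVec_single_one] at this
  exact this.symm

variable {O O' : Opens (Coord n)}

section

variable (hL : ContDiffOn ℝ ∞ L O) (hreg : ∀ u ∈ O, (hess L u).det ≠ 0)
  (hL' : ContDiffOn ℝ ∞ L' O') (hreg' : ∀ u ∈ O', (hess L' u).det ≠ 0)
  (hφ : ContDiffOn ℝ ∞ φ O) (hO : ∀ u ∈ O, φ u ∈ O')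

theorem ev_X_comap (α : Idx n) (f : smoothRing O') {u : Coord n} (hu : u ∈ O) :
    ev hu ((lagr O L hL hreg).X α (comap φ hφ hO f)) = ∑ β, (transMatrix L L' φ u β α : ℂ) *
      ev hu (comap φ hφ hO ((lagr O' L' hL' hreg').X β f)) := by
  have hd : DifferentiableAt ℝ φ u :=
    (hφ.contDiffAt (O.2.mem_nhds hu)).differentiableAt (by simp)
  rw [ev_X, fderiv_fn (F := fn f ∘ φ) (fun w hw => by
    rw [ev_comap, Function.comp_apply, fn_eq_ev f (hO w hw)]) hu,
    fderiv_comp u (differentiableAt_fn f (hO u hu)) hd, ContinuousLinearMap.comp_apply,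
    fderiv_frame (L' := L'), map_sum]
  refine Finset.sum_congr rfl fun β _ => ?_
  rw [map_smul, ev_comap, ev_X, Complex.real_smul]

/-- The block `B^j_i = e_i(x'^j)` of the matrix of a transition map. -/
def transBlock : Matrix (Fin n) (Fin n) (smoothRing O) :=
  Matrix.of fun j i => (lagr O L hL hreg).X (Sum.inl i)
    (comap φ hφ hO ((lagr O' L' hL' hreg').u (Sum.inl j)))

theorem ev_transBlock (j i : Fin n) {u : Coord n} (hu : u ∈ O) :
    ev hu (transBlock hL hreg hL' hreg' hφ hO j i) =
      (transMatrix L L' φ u (Sum.inl j) (Sum.inl i) : ℂ) := by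
  rw [transBlock, Matrix.of_apply, ev_X_comap hL hreg hL' hreg' hφ hO,
    Finset.sum_eq_single (Sum.inl j)]
  · have : (lagr O' L' hL' hreg').X (Sum.inl j) ((lagr O' L' hL' hreg').u (Sum.inl j)) = 1 := by
      simp [LagrangeData.X_inl, LagrangeData.d_u]
    rw [this, map_one, map_one, mul_one]
  · intro β _ hβ
    have : (lagr O' L' hL' hreg').X β ((lagr O' L' hL' hreg').u (Sum.inl j)) = 0 := by
      rcases β with k | k
      · have hk : k ≠ j := fun h => hβ (by rw [h])
        simp [LagrangeData.X_inl, LagrangeData.d_u, hk]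
      · simp [LagrangeData.X_inr, LagrangeData.d_u]
    rw [this, map_zero, map_zero, mul_zero]
  · simp

theorem H_eq_transBlock
    (htr : ∀ u ∈ O, ∃ b : Matrix (Fin n) (Fin n) ℝ,
      transMatrix L L' φ u = Matrix.fromBlocks b 0 0 b ∧
      hess L u = bᵀ * hess L' (φ u) * b) :
    (lagr O L hL hreg).H = (transBlock hL hreg hL' hreg' hφ hO)ᵀ *
      (lagr O' L' hL' hreg').H.map (comap φ hφ hO) * transBlock hL hreg hL' hreg' hφ hO := by
  refine Matrix.ext fun i j => ext_ev fun u hu => ?_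
  obtain ⟨b, h1, h2⟩ := htr u hu
  rw [rep_H hL hreg i j u hu]
  change ((hess L u i j : ℝ) : ℂ) = _
  rw [h2]
  simp only [Matrix.mul_apply, Matrix.transpose_apply, Matrix.map_apply, map_sum, map_mul,
    ev_transBlock, ev_comap, rep_H hL' hreg' _ _ _ (hO u hu), h1, Matrix.fromBlocks_apply₁₁]
  push_cast
  rfl

/-- The change of Lagrange data along a transition map. -/
def lagrChange
    (htr : ∀ u ∈ O, ∃ b : Matrix (Fin n) (Fin n) ℝ,
      transMatrix L L' φ u = Matrix.fromBlocks b 0 0 b ∧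
      hess L u = bᵀ * hess L' (φ u) * b) :
    LagrangeChange (lagr O' L' hL' hreg') (lagr O L hL hreg) where
  σ := comap φ hφ hO
  B := transBlock hL hreg hL' hreg' hφ hO
  Binv := (lagr O L hL hreg).K * ((transBlock hL hreg hL' hreg' hφ hO)ᵀ *
    (lagr O' L' hL' hreg').H.map (comap φ hφ hO))
  Binv_mul_B := by
    rw [mul_assoc, ← H_eq_transBlock hL hreg hL' hreg' hφ hO htr, LagrangeData.K_mul_H]
  X_inl_map i f := ext_ev fun u hu => by
    obtain ⟨b, h1, -⟩ := htr u hu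
    rw [ev_X_comap hL hreg hL' hreg', map_sum, Fintype.sum_sum_type]
    simp only [map_mul, ev_transBlock, h1, Matrix.fromBlocks_apply₁₁,
      Matrix.fromBlocks_apply₂₁, Matrix.zero_apply, Complex.ofReal_zero, zero_mul,
      Finset.sum_const_zero, add_zero]
  X_inr_map i f := ext_ev fun u hu => by
    obtain ⟨b, h1, -⟩ := htr u hu
    rw [ev_X_comap hL hreg hL' hreg', map_sum, Fintype.sum_sum_type]
    simp only [map_mul, ev_transBlock, h1, Matrix.fromBlocks_apply₁₁,
      Matrix.fromBlocks_apply₁₂, Matrix.fromBlocks_apply₂₂, Matrix.zero_apply,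
      Complex.ofReal_zero, zero_mul, Finset.sum_const_zero, zero_add]
  H_map := H_eq_transBlock hL hreg hL' hreg' hφ hO htr

theorem map_ev_Φ_lagrChange
    (htr : ∀ u ∈ O, ∃ b : Matrix (Fin n) (Fin n) ℝ,
      transMatrix L L' φ u = Matrix.fromBlocks b 0 0 b ∧
      hess L u = bᵀ * hess L' (φ u) * b) (x : Fib n (smoothRing O')) {u : Coord n} (hu : u ∈ O) :
    Fib.map (ev hu) ((lagrChange hL hreg hL' hreg' hφ hO htr).frameChange.Φ x) =
      pull (transMatrix L L' φ u) (Fib.map (ev (hO u hu)) x) := by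
  have hA : (lagrChange hL hreg hL' hreg' hφ hO htr).A.map (ev hu) =
      (transMatrix L L' φ u).map Complex.ofRealHom := by
    obtain ⟨b, h1, -⟩ := htr u hu
    have hB : (transBlock hL hreg hL' hreg' hφ hO).map (ev hu) = b.map Complex.ofRealHom := by
      ext i j
      rw [Matrix.map_apply, ev_transBlock, h1]
      rfl
    have h0 : (0 : Matrix (Fin n) (Fin n) (smoothRing O)).map (ev hu) = 0 :=
      Matrix.map_zero _ (map_zero _)
    have h0' : (0 : Matrix (Fin n) (Fin n) ℝ).map Complex.ofRealHom = 0 :=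
      Matrix.map_zero _ (map_zero _)
    rw [LagrangeChange.A, Matrix.fromBlocks_map, h1, Matrix.fromBlocks_map, h0, h0']
    rw [show (lagrChange hL hreg hL' hreg' hφ hO htr).B = transBlock hL hreg hL' hreg' hφ hO
      from rfl, hB]
  rw [FrameChange.Φ_apply, Fib.map_pull, pull_eq,
    show (lagrChange hL hreg hL' hreg' hφ hO htr).frameChange.A =
      (lagrChange hL hreg hL' hreg' hφ hO htr).A from rfl, hA]
  congr 1
  funext r m S
  exact ev_comap φ hφ hO (x r m S) hu

end

theorem transMatrix_id (L : Coord n → ℝ) (u : Coord n) : transMatrix L L id u = 1 := by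
  refine (eq_transMatrix_of_mulVec fun v => ?_).symm
  rw [Matrix.one_mulVec, fderiv_id]
  rfl

/-- The restriction of Lagrange data to a smaller open set. -/
def lagrRestrict (hL : ContDiffOn ℝ ∞ L O) (hreg : ∀ u ∈ O, (hess L u).det ≠ 0)
    (hL' : ContDiffOn ℝ ∞ L O') (hreg' : ∀ u ∈ O', (hess L u).det ≠ 0) (hO : ∀ u ∈ O, u ∈ O') :
    LagrangeChange (lagr O' L hL' hreg') (lagr O L hL hreg) :=
  lagrChange hL hreg hL' hreg' (φ := id) contDiffOn_id hO fun u _ =>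
    ⟨1, by rw [transMatrix_id, Matrix.fromBlocks_one], by simp⟩

theorem map_ev_Φ_lagrRestrict (hL : ContDiffOn ℝ ∞ L O) (hreg : ∀ u ∈ O, (hess L u).det ≠ 0)
    (hL' : ContDiffOn ℝ ∞ L O') (hreg' : ∀ u ∈ O', (hess L u).det ≠ 0) (hO : ∀ u ∈ O, u ∈ O')
    (x : Fib n (smoothRing O')) {u : Coord n} (hu : u ∈ O) :
    Fib.map (ev hu) ((lagrRestrict hL hreg hL' hreg' hO).frameChange.Φ x) =
      Fib.map (ev (hO u hu)) x := by
  rw [lagrRestrict, map_ev_Φ_lagrChange, transMatrix_id, pull_eq,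
    Matrix.map_one _ (map_zero _) (map_one _),
    Fib.pull_identity]

end Transition

/-! ### Charts -/

/-- A linear map that respects the two splittings, the complex structures and the metrics is a
block matrix with two equal blocks. -/
theorem exists_block {n : ℕ} {A : Matrix (Idx n) (Idx n) ℝ} {H H' : Matrix (Fin n) (Fin n) ℝ}
    (hver : ∀ c : Idx n → ℝ, (∀ i, c (Sum.inl i) = 0) → ∀ i, (A *ᵥ c) (Sum.inl i) = 0)
    (hhor : ∀ c : Idx n → ℝ, (∀ i, c (Sum.inr i) = 0) → ∀ i, (A *ᵥ c) (Sum.inr i) = 0)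
    (hJ : ∀ c, A *ᵥ (jMat n *ᵥ c) = jMat n *ᵥ (A *ᵥ c))
    (hg : ∀ c d : Idx n → ℝ, ∑ α, ∑ β, Matrix.fromBlocks H 0 0 H α β * (c α * d β) =
      ∑ α, ∑ β, Matrix.fromBlocks H' 0 0 H' α β * ((A *ᵥ c) α * (A *ᵥ d) β)) :
    ∃ b : Matrix (Fin n) (Fin n) ℝ, A = Matrix.fromBlocks b 0 0 b ∧ H = bᵀ * H' * b := by
  have h12 : A.toBlocks₁₂ = 0 := by
    ext i j
    have := hver (Pi.single (Sum.inr j) 1) (fun i => by simp) i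
    rwa [Matrix.mulVec_single_one] at this
  have h21 : A.toBlocks₂₁ = 0 := by
    ext i j
    have := hhor (Pi.single (Sum.inl j) 1) (fun i => by simp) i
    rwa [Matrix.mulVec_single_one] at this
  have hA : A = Matrix.fromBlocks A.toBlocks₁₁ 0 0 A.toBlocks₂₂ := by
    conv_lhs => rw [← Matrix.fromBlocks_toBlocks A, h12, h21]
  have hAJ : A * jMat n = jMat n * A := by
    refine Matrix.ext_of_mulVec_single fun i => ?_
    rw [← Matrix.mulVec_mulVec, hJ, Matrix.mulVec_mulVec]
  have hb : A.toBlocks₂₂ = A.toBlocks₁₁ := by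
    rw [hA, jMat, Matrix.fromBlocks_multiply, Matrix.fromBlocks_multiply] at hAJ
    have := (Matrix.fromBlocks_inj.mp hAJ).2.1
    simpa using this.symm
  refine ⟨A.toBlocks₁₁, by rw [← hb, ← hb.symm]; rw [hb] at hA; exact hA, ?_⟩
  rw [hb] at hA
  obtain ⟨b, hbdef⟩ : ∃ b, b = A.toBlocks₁₁ := ⟨_, rfl⟩
  rw [← hbdef] at hA ⊢
  ext i j
  have h := hg (Pi.single (Sum.inl i) 1) (Pi.single (Sum.inl j) 1)
  simp only [Matrix.mulVec_single_one, hA, Fintype.sum_sum_type] at h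
  simp [Pi.single_apply] at h
  rw [h]
  simp only [Matrix.mul_apply, Matrix.transpose_apply, Finset.sum_mul]
  rw [Finset.sum_comm]
  refine Finset.sum_congr rfl fun k _ => Finset.sum_congr rfl fun l _ => ?_
  ring

section Chart

variable {n : ℕ} {V : Type*} [TopologicalSpace V] [ChartedSpace (Coord n) V]

/-- The coordinate change between two charts. -/
def coordChange (e e' : OpenPartialHomeomorph V (Coord n)) : Coord n → Coord n :=
  fun u => e' (e.symm u)

/-- The image of the intersection of two chart domains in the first chart. -/
def overlap (e e' : OpenPartialHomeomorph V (Coord n)) : Opens (Coord n) :=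
  ⟨(e.symm.trans e').source, (e.symm.trans e').open_source⟩

/-- The image of a chart domain. -/
def chartImage (e : OpenPartialHomeomorph V (Coord n)) : Opens (Coord n) :=
  ⟨e.target, e.open_target⟩

theorem mem_overlap {e e' : OpenPartialHomeomorph V (Coord n)} {u : Coord n} :
    u ∈ overlap e e' ↔ u ∈ e.target ∧ e.symm u ∈ e'.source := Iff.rfl

theorem overlap_le (e e' : OpenPartialHomeomorph V (Coord n)) :
    ∀ u ∈ overlap e e', u ∈ chartImage e :=
  fun _ hu => (mem_overlap.mp hu).1

theorem coordChange_mem (e e' : OpenPartialHomeomorph V (Coord n)) :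
    ∀ u ∈ overlap e e', coordChange e e' u ∈ chartImage e' :=
  fun _ hu => e'.map_source (mem_overlap.mp hu).2

variable [IsManifold 𝓘(ℝ, Coord n) ∞ V] {e e' : OpenPartialHomeomorph V (Coord n)}
  (he : e ∈ IsManifold.maximalAtlas 𝓘(ℝ, Coord n) ∞ V)
  (he' : e' ∈ IsManifold.maximalAtlas 𝓘(ℝ, Coord n) ∞ V)

theorem mdifferentiable_of_mem_maximalAtlas
    (he : e ∈ IsManifold.maximalAtlas 𝓘(ℝ, Coord n) ∞ V) :
    e.MDifferentiable 𝓘(ℝ, Coord n) 𝓘(ℝ, Coord n) :=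
  ⟨(contMDiffOn_of_mem_maximalAtlas he).mdifferentiableOn (by simp),
    (contMDiffOn_symm_of_mem_maximalAtlas he).mdifferentiableOn (by simp)⟩

theorem contDiffOn_coordChange (he : e ∈ IsManifold.maximalAtlas 𝓘(ℝ, Coord n) ∞ V)
    (he' : e' ∈ IsManifold.maximalAtlas 𝓘(ℝ, Coord n) ∞ V) :
    ContDiffOn ℝ ∞ (coordChange e e') (overlap e e') := by
  rw [← contMDiffOn_iff_contDiffOn]
  exact (contMDiffOn_of_mem_maximalAtlas he').comp
    ((contMDiffOn_symm_of_mem_maximalAtlas he).mono fun u hu => (mem_overlap.mp hu).1)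
    fun u hu => (mem_overlap.mp hu).2

theorem mfderiv_chart_eq (he : e ∈ IsManifold.maximalAtlas 𝓘(ℝ, Coord n) ∞ V)
    (he' : e' ∈ IsManifold.maximalAtlas 𝓘(ℝ, Coord n) ∞ V) {p : V} (hp : p ∈ e.source)
    (hp' : p ∈ e'.source) (Y : TangentSpace 𝓘(ℝ, Coord n) p) :
    (mfderiv 𝓘(ℝ, Coord n) 𝓘(ℝ, Coord n) e' p Y : Coord n) =
      fderiv ℝ (coordChange e e') (e p) (mfderiv 𝓘(ℝ, Coord n) 𝓘(ℝ, Coord n) e p Y : Coord n) := by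
  have hmem : e p ∈ overlap e e' := mem_overlap.mpr ⟨e.map_source hp, by rwa [e.left_inv hp]⟩
  have h1 : (e' : V → Coord n) =ᶠ[nhds p] coordChange e e' ∘ e :=
    Filter.eventually_of_mem (e.open_source.mem_nhds hp) fun q hq => by
      rw [Function.comp_apply, coordChange, e.left_inv hq]
  have hd : DifferentiableAt ℝ (coordChange e e') (e p) :=
    ((contDiffOn_coordChange he he').contDiffAt
      ((overlap e e').2.mem_nhds hmem)).differentiableAt (by simp)
  have h2 := mfderiv_comp p hd.mdifferentiableAt
    ((mdifferentiable_of_mem_maximalAtlas he).mdifferentiableAt hp)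
  have h3 := h1.mfderiv_eq (I := 𝓘(ℝ, Coord n)) (I' := 𝓘(ℝ, Coord n))
  rw [h2, mfderiv_eq_fderiv] at h3
  exact congrArg (fun T : Coord n →L[ℝ] Coord n => T Y) h3

theorem surjective_mfderiv_chart (he : e ∈ IsManifold.maximalAtlas 𝓘(ℝ, Coord n) ∞ V) {p : V}
    (hp : p ∈ e.source) (w : Coord n) : ∃ Y : TangentSpace 𝓘(ℝ, Coord n) p,
      (mfderiv 𝓘(ℝ, Coord n) 𝓘(ℝ, Coord n) e p Y : Coord n) = w :=
  (mdifferentiable_of_mem_maximalAtlas he).mfderiv_surjective hp w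

end Chart

namespace LagrangeVariables

variable {n : ℕ} {V : Type*} [TopologicalSpace V] [ChartedSpace (Coord n) V]
  [IsManifold 𝓘(ℝ, Coord n) ∞ V] {g : PseudoRiemMetric n V} (X : LagrangeVariables g)

theorem transMatrix_mulVec_chartCoframe (e e' : X.charts) {p : V} (hp : p ∈ e.1.source)
    (hp' : p ∈ e'.1.source) (Y : TangentSpace 𝓘(ℝ, Coord n) p) :
    transMatrix (X.L e) (X.L e') (coordChange e.1 e'.1) (e.1 p) *ᵥ chartCoframe e.1 (X.L e) p Y =
      chartCoframe e'.1 (X.L e') p Y := by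
  have h1 := mfderiv_chart_eq (X.charts_subset e.2) (X.charts_subset e'.2) hp hp' Y
  have h2 : coordChange e.1 e'.1 (e.1 p) = e'.1 p := by rw [coordChange, e.1.left_inv hp]
  exact (transMatrix_mulVec _ _).trans (congrArg₂ (coframe (X.L e')) h2 h1.symm)

theorem surjective_chartCoframe (e : X.charts) {p : V} (hp : p ∈ e.1.source) (c : Idx n → ℝ) :
    ∃ Y, chartCoframe e.1 (X.L e) p Y = c := by
  obtain ⟨Y, hY⟩ := surjective_mfderiv_chart (X.charts_subset e.2) hp
    (∑ α, c α • frame (X.L e) α (e.1 p))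
  refine ⟨Y, ?_⟩
  rw [chartCoframe, hY]
  change coframeₗ (X.L e) (e.1 p) _ = c
  rw [map_sum]
  funext β
  rw [Finset.sum_apply]
  have h : ∀ α, coframeₗ (X.L e) (e.1 p) (frame (X.L e) α (e.1 p)) = Pi.single α 1 :=
    fun α => coframe_frame _ _ α
  simp only [map_smul, h, Pi.smul_apply, Pi.single_apply, smul_eq_mul, mul_ite, mul_one, mul_zero]
  simp only [Finset.sum_ite_eq, Finset.mem_univ, if_true]

/-- The transition maps of adapted charts are block matrices that relate the Hessians. -/
theorem exists_block_transMatrix (e e' : X.charts) : ∀ u ∈ overlap e.1 e'.1,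
    ∃ b : Matrix (Fin n) (Fin n) ℝ,
      transMatrix (X.L e) (X.L e') (coordChange e.1 e'.1) u = Matrix.fromBlocks b 0 0 b ∧
      hess (X.L e) u = bᵀ * hess (X.L e') (coordChange e.1 e'.1 u) * b := by
  intro u hu
  obtain ⟨hut, hp'⟩ := mem_overlap.mp hu
  obtain ⟨p, hpdef⟩ : ∃ p, p = e.1.symm u := ⟨_, rfl⟩
  have hp : p ∈ e.1.source := hpdef ▸ e.1.map_target hut
  rw [← hpdef] at hp'
  have hu' : u = e.1 p := by rw [hpdef, e.1.right_inv hut]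
  subst hu'
  have hφ : coordChange e.1 e'.1 (e.1 p) = e'.1 p := by rw [coordChange, e.1.left_inv hp]
  have htr := X.transMatrix_mulVec_chartCoframe e e' hp hp'
  have hsurj := X.surjective_chartCoframe e hp
  rw [hφ]
  refine exists_block ?_ ?_ ?_ ?_
  · intro c hc
    obtain ⟨Y, rfl⟩ := hsurj c
    rw [htr]
    exact (X.ver_eq e' p hp' Y).mp ((X.ver_eq e p hp Y).mpr hc)
  · intro c hc
    obtain ⟨Y, rfl⟩ := hsurj c
    rw [htr]
    exact (X.hor_eq e' p hp' Y).mp ((X.hor_eq e p hp Y).mpr hc)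
  · intro c
    obtain ⟨Y, rfl⟩ := hsurj c
    rw [htr, ← X.J_eq e p hp, htr, X.J_eq e' p hp']
  · intro c d
    obtain ⟨Y, rfl⟩ := hsurj c
    obtain ⟨Z, rfl⟩ := hsurj d
    rw [htr, htr]
    exact (X.metric_eq e p hp Y Z).symm.trans (X.metric_eq e' p hp' Y Z)

theorem eq_transMatrix (e e' : X.charts) {p : V} (hp : p ∈ e.1.source) (hp' : p ∈ e'.1.source)
    {A : Matrix (Idx n) (Idx n) ℝ}
    (hA : ∀ Y, chartCoframe e'.1 (X.L e') p Y = A *ᵥ chartCoframe e.1 (X.L e) p Y) :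
    A = transMatrix (X.L e) (X.L e') (coordChange e.1 e'.1) (e.1 p) := by
  refine Matrix.ext_of_mulVec_single fun i => ?_
  obtain ⟨Y, hY⟩ := X.surjective_chartCoframe e hp (Pi.single i 1)
  rw [← hY, ← hA, X.transMatrix_mulVec_chartCoframe e e' hp hp']

end LagrangeVariables

/-! ### Fedosov's equation on a manifold -/

namespace FedosovData

variable {n : ℕ} {C C' : Type*} [CommRing C] [Algebra ℂ C] [CommRing C'] [Algebra ℂ C']
  (D : FedosovData n C') (σ : C' →ₐ[ℂ] C)

theorem parity_sol : Fib.parity D.sol = -D.sol := by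
  rw [Fib.parity_of_mem_forms D.sol_mem_forms]; simp

theorem map_deg_sol :
    Fib.map σ (Fib.deg 0 D.sol) = 0 ∧ Fib.map σ (Fib.deg 1 D.sol) = 0 ∧
    Fib.map σ (Fib.deg 2 D.sol) = Fib.delInv (Fib.map σ D.torsionElt) ∧
    Fib.map σ (Fib.deg 3 D.sol) = Fib.delInv (Fib.map σ D.curvatureElt
      + Fib.map σ (D.conn (Fib.deg 2 D.sol)) - Complex.I • Fib.vDiv (Fib.star (D.Λ.map σ)
        (Fib.map σ (Fib.deg 2 D.sol)) (Fib.map σ (Fib.deg 2 D.sol)))) ∧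
    ∀ k, 1 ≤ k → Fib.map σ (Fib.deg (k + 3) D.sol) = Fib.delInv (
      Fib.map σ (D.conn (Fib.deg (k + 2) D.sol)) - Complex.I • Fib.vDiv (∑ l ∈ Finset.range (k + 1),
        Fib.star (D.Λ.map σ) (Fib.map σ (Fib.deg (l + 2) D.sol))
          (Fib.map σ (Fib.deg (k - l + 2) D.sol)))) := by
  obtain ⟨h0, h1, h2, h3, hk⟩ := D.deg_delInv_source D.deg_sol_zero D.deg_sol_one
  rw [← D.sol_eq] at h0 h1 h2 h3
  refine ⟨?_, ?_, ?_, ?_, fun k hk1 => ?_⟩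
  · rw [h0, map_zero]
  · rw [h1, map_zero]
  · rw [h2, Fib.map_delInv]
  · rw [h3, Fib.map_delInv, map_sub, map_add, map_smul, Fib.map_vDiv, Fib.map_star]
  · have hk' := hk k hk1
    rw [← D.sol_eq] at hk'
    rw [hk', Fib.map_delInv, map_sub, map_smul, Fib.map_vDiv, map_sum]
    simp only [Fib.map_star]

end FedosovData

section Local

variable {n : ℕ} {O : Opens (Coord n)} {L : Coord n → ℝ}
  (hL : ContDiffOn ℝ ∞ L O) (hreg : ∀ u ∈ O, (hess L u).det ≠ 0)

theorem RepSec.source {x : Fib n (smoothRing O)} {r : LocSec n} (h : RepSec x r) :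
    RepSec ((lagr O L hL hreg).fedosov.source x) (fun u => torsElt L u + curvElt L u + dConn L r u
      - Complex.I • vdiv (wick (lam L u) (r u) (r u))) := by
  intro u hu
  rw [FedosovData.source, map_sub, map_add, map_add, map_smul, Fib.map_vDiv, map_star_ev,
    repSec_torsionElt hL hreg u hu, repSec_curvatureElt hL hreg u hu, h.conn hL hreg u hu, h u hu]
  rfl

/-- Solutions of Fedosov's equation over the ring of smooth functions are the smooth pointwise
solutions. -/
theorem RepSec.isSolution_iff {x : Fib n (smoothRing O)} {r : LocSec n} (h : RepSec x r) :
    (lagr O L hL hreg).fedosov.IsSolution x ↔ ∀ u ∈ O,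
      degA 1 (r u) = r u ∧ deltaInv (r u) = 0 ∧ degTot 0 (r u) = 0 ∧ degTot 1 (r u) = 0 ∧
      delta (r u) = torsElt L u + curvElt L u + dConn L r u
        - Complex.I • vdiv (wick (lam L u) (r u) (r u)) := by
  constructor
  · intro hs u hu
    refine ⟨?_, ?_, ?_, ?_, ?_⟩
    · rw [degA_eq_self_iff, ← h u hu]
      exact Fib.map_mem_forms _ hs.mem_forms
    · rw [deltaInv_eq, ← h u hu, ← Fib.map_delInv, hs.delInv_eq, map_zero]
    · rw [degTot_eq, ← h u hu, ← Fib.map_deg, hs.deg_zero, map_zero]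
    · rw [degTot_eq, ← h u hu, ← Fib.map_deg, hs.deg_one, map_zero]
    · have h1 := h.source hL hreg u hu
      rw [← hs.del_eq, Fib.map_del, h u hu, ← delta_eq] at h1
      exact h1
  · intro hs
    refine ⟨?_, ?_, ?_, ?_, ?_⟩
    · intro k m S hS
      refine ext_ev fun u hu => ?_
      have h1 := (degA_eq_self_iff 1 (r u)).mp (hs u hu).1 k m S hS
      rw [← h u hu] at h1
      rw [map_zero]
      exact h1
    · refine ext_map_ev fun u hu => ?_
      rw [Fib.map_delInv, h u hu, ← deltaInv_eq, (hs u hu).2.1, map_zero]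
    · refine ext_map_ev fun u hu => ?_
      rw [Fib.map_deg, h u hu, ← degTot_eq, (hs u hu).2.2.1, map_zero]
    · refine ext_map_ev fun u hu => ?_
      rw [Fib.map_deg, h u hu, ← degTot_eq, (hs u hu).2.2.2.1, map_zero]
    · refine ext_map_ev fun u hu => ?_
      rw [Fib.map_del, h u hu, ← delta_eq, (hs u hu).2.2.2.2, h.source hL hreg u hu]

end Local

namespace LagrangeVariables

variable {n : ℕ} {V : Type*} [TopologicalSpace V] [ChartedSpace (Coord n) V]
  [IsManifold 𝓘(ℝ, Coord n) ∞ V] {g : PseudoRiemMetric n V} (X : LagrangeVariables g)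

/-- The Lagrange data of a chart, over an open subset of its image. -/
def data (e : X.charts) (O : Opens (Coord n)) (hO : ∀ u ∈ O, u ∈ chartImage e.1) :
    LagrangeData n (smoothRing O) :=
  lagr O (X.L e) ((X.smooth e).mono hO) fun u hu => X.regular e u (hO u hu)

/-- Restriction to an open subset of the image of a chart. -/
def restrict (e : X.charts) (O : Opens (Coord n)) (hO : ∀ u ∈ O, u ∈ chartImage e.1) :
    FrameChange (X.data e (chartImage e.1) fun _ h => h).fedosov (X.data e O hO).fedosov :=
  (lagrRestrict _ _ _ _ hO).frameChange

/-- The change of coframe between two charts. -/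
def frameChange (e e' : X.charts) : FrameChange (X.data e' (chartImage e'.1) fun _ h => h).fedosov
    (X.data e (overlap e.1 e'.1) (overlap_le e.1 e'.1)).fedosov :=
  (lagrChange _ _ _ _ (contDiffOn_coordChange (X.charts_subset e.2) (X.charts_subset e'.2))
    (coordChange_mem e.1 e'.1) (X.exists_block_transMatrix e e')).frameChange

theorem map_ev_restrict (e : X.charts) (O : Opens (Coord n)) (hO : ∀ u ∈ O, u ∈ chartImage e.1)
    (x : Fib n (smoothRing (chartImage e.1))) {u : Coord n} (hu : u ∈ O) :
    Fib.map (ev hu) ((X.restrict e O hO).Φ x) = Fib.map (ev (hO u hu)) x :=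
  map_ev_Φ_lagrRestrict _ _ _ _ _ _ _

theorem map_ev_frameChange (e e' : X.charts)
    (x : Fib n (smoothRing (chartImage e'.1))) {u : Coord n} (hu : u ∈ overlap e.1 e'.1) :
    Fib.map (ev hu) ((X.frameChange e e').Φ x) =
      pull (transMatrix (X.L e) (X.L e') (coordChange e.1 e'.1) u)
        (Fib.map (ev (coordChange_mem e.1 e'.1 u hu)) x) :=
  map_ev_Φ_lagrChange _ _ _ _ _ _ _ _ _

/-- Local sections define a global section if and only if they agree on overlaps after a change
of coframe. -/
theorem isSection_iff {a : X.charts → LocSec n}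
    {x : ∀ e : X.charts, Fib n (smoothRing (chartImage e.1))} (h : ∀ e, RepSec (x e) (a e)) :
    X.IsSection a ↔ ∀ e e' : X.charts,
      (X.restrict e _ (overlap_le e.1 e'.1)).Φ (x e) = (X.frameChange e e').Φ (x e') := by
  constructor
  · intro ha e e'
    refine ext_map_ev fun u hu => ?_
    obtain ⟨hut, hp'⟩ := mem_overlap.mp hu
    have hp := e.1.map_target hut
    have h1 := ha.2 e e' (e.1.symm u) ⟨hp, hp'⟩ _
      (fun Y => (X.transMatrix_mulVec_chartCoframe e e' hp hp' Y).symm)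
    rw [e.1.right_inv hut] at h1
    rw [map_ev_restrict, map_ev_frameChange, h e, h e', h1]
    rfl
  · intro hx
    refine ⟨fun e => (h e).smoothOn, fun e e' p hp A hA => ?_⟩
    have hu : e.1 p ∈ overlap e.1 e'.1 :=
      mem_overlap.mpr ⟨e.1.map_source hp.1, by rw [e.1.left_inv hp.1]; exact hp.2⟩
    have h1 := congrArg (Fib.map (ev hu)) (hx e e')
    rw [map_ev_restrict, map_ev_frameChange, h e, h e', ← X.eq_transMatrix e e' hp.1 hp.2 hA,
      coordChange,
      e.1.left_inv hp.1] at h1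
    exact h1

/-- The solution of Fedosov's equation over the image of a chart. -/
def localSol (e : X.charts) : Fib n (smoothRing (chartImage e.1)) :=
  (X.data e (chartImage e.1) fun _ h => h).fedosov.sol

/-- The global solution of Fedosov's equation. -/
def fedosovElement (e : X.charts) : LocSec n := fun u =>
  open Classical in if h : u ∈ chartImage e.1 then Fib.map (ev h) (X.localSol e) else 0

theorem repSec_localSol (e : X.charts) : RepSec (X.localSol e) (X.fedosovElement e) :=
  fun u hu => by rw [fedosovElement, dif_pos hu]

/-- The local solutions agree on overlaps, as each of them goes to the unique solution there. -/
theorem isFedosovElement_fedosovElement : X.IsFedosovElement X.fedosovElement := by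
  refine ⟨(X.isSection_iff X.repSec_localSol).mpr fun e e' => ?_, fun e => ?_⟩
  · rw [localSol, localSol, FrameChange.Φ_sol, FrameChange.Φ_sol]
  · exact ((X.repSec_localSol e).isSolution_iff _ _).mp
      (X.data e (chartImage e.1) fun _ h => h).fedosov.isSolution_sol

theorem IsFedosovElement.eq_fedosovElement {X : LagrangeVariables g} {r : X.charts → LocSec n}
    (hr : X.IsFedosovElement r) (e : X.charts) :
    ∀ u ∈ e.1.target, r e u = X.fedosovElement e u := by
  intro u hu
  have h1 := repSec_toFib (O := chartImage e.1) (r e) (hr.1.1 e)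
  have h2 : toFib (chartImage e.1) (r e) (hr.1.1 e) = X.localSol e :=
    FedosovData.IsSolution.unique ((h1.isSolution_iff (X.smooth e) (X.regular e)).mpr (hr.2 e))
      (X.data e (chartImage e.1) fun _ h => h).fedosov.isSolution_sol
  rw [← h1 u hu, h2, X.repSec_localSol e u hu]

theorem deg_fedosovElement (e : X.charts) : ∀ u ∈ e.1.target,
    degTot 0 (X.fedosovElement e u) = 0 ∧ degTot 1 (X.fedosovElement e u) = 0 ∧
    degTot 2 (X.fedosovElement e u) = deltaInv (torsElt (X.L e) u) ∧
    degTot 3 (X.fedosovElement e u) = deltaInv (curvElt (X.L e) u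
      + dConn (X.L e) (fun w => degTot 2 (X.fedosovElement e w)) u
      - Complex.I • vdiv (wick (lam (X.L e) u) (degTot 2 (X.fedosovElement e u))
          (degTot 2 (X.fedosovElement e u)))) ∧
    ∀ k : ℕ, 1 ≤ k → degTot (k + 3) (X.fedosovElement e u) = deltaInv (
      dConn (X.L e) (fun w => degTot (k + 2) (X.fedosovElement e w)) u
      - Complex.I • vdiv (∑ l ∈ Finset.range (k + 1),
          wick (lam (X.L e) u) (degTot (l + 2) (X.fedosovElement e u))
            (degTot (k - l + 2) (X.fedosovElement e u)))) := by
  intro u hu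
  have hu' : u ∈ chartImage e.1 := hu
  have hr := X.repSec_localSol e
  obtain ⟨D, hD⟩ : ∃ D, D = (X.data e (chartImage e.1) fun _ h => h).fedosov := ⟨_, rfl⟩
  have hdeg : ∀ k, Fib.map (ev hu') (Fib.deg k D.sol) = degTot k (X.fedosovElement e u) := by
    subst hD
    exact fun k => hr.deg k u hu'
  have hconn : ∀ k, Fib.map (ev hu') (D.conn (Fib.deg k D.sol)) =
      dConn (X.L e) (fun w => degTot k (X.fedosovElement e w)) u := by
    subst hD
    exact fun k => (hr.deg k).conn _ _ u hu'
  have hΛ : D.Λ.map (ev hu') = lam (X.L e) u := by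
    subst hD
    exact map_Λ _ _ hu'
  have htors : Fib.map (ev hu') D.torsionElt = torsElt (X.L e) u := by
    subst hD
    exact repSec_torsionElt _ _ u hu'
  have hcurv : Fib.map (ev hu') D.curvatureElt = curvElt (X.L e) u := by
    subst hD
    exact repSec_curvatureElt _ _ u hu'
  obtain ⟨h0, h1, h2, h3, hk⟩ := D.map_deg_sol (ev hu')
  rw [hdeg] at h0 h1
  rw [hdeg, htors] at h2
  rw [hdeg, hdeg, hconn, hcurv, hΛ] at h3
  simp only [hdeg, hconn, hΛ] at hk
  simp only [deltaInv_eq, wick_eq, vdiv_eq]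
  exact ⟨h0, h1, h2, h3, hk⟩

theorem isSection_fedosovD {a : X.charts → LocSec n} (ha : X.IsSection a) :
    X.IsSection fun e => fedosovD (X.L e) (X.fedosovElement e) (a e) := by
  have h1 : ∀ e : X.charts, RepSec (toFib (chartImage e.1) (a e) (ha.1 e)) (a e) := fun e =>
    repSec_toFib _ _
  have h2 := (X.isSection_iff h1).mp ha
  refine (X.isSection_iff fun e => (X.repSec_localSol e).fed (X.smooth e) (X.regular e)
    (FedosovData.sol_mem_forms _) (h1 e)).mpr fun e e' => ?_
  have h3 := (X.restrict e _ (overlap_le e.1 e'.1)).Φ_fed (X.localSol e)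
    (toFib (chartImage e.1) (a e) (ha.1 e))
  have h4 := (X.frameChange e e').Φ_fed (X.localSol e') (toFib (chartImage e'.1) (a e') (ha.1 e'))
  rw [h2 e e', localSol, FrameChange.Φ_sol] at h3
  rw [localSol, FrameChange.Φ_sol] at h4
  exact h3.trans h4.symm

/-- Flatness over an open subset of a chart, from flatness over its ring of smooth functions. -/
theorem fedosovD_fedosovD (e : X.charts) {U : Set (Coord n)} (hU : IsOpen U)
    (hUe : U ⊆ e.1.target) {a : LocSec n} (ha : SmoothOn a U) : ∀ u ∈ U,
    fedosovD (X.L e) (X.fedosovElement e) (fedosovD (X.L e) (X.fedosovElement e) a) u = 0 := by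
  intro u hu
  obtain ⟨O, hOdef⟩ : ∃ O : Opens (Coord n), O = ⟨U, hU⟩ := ⟨_, rfl⟩
  have hO : ∀ u ∈ O, u ∈ chartImage e.1 := by subst hOdef; exact hUe
  have huO : u ∈ O := by subst hOdef; exact hu
  have haO : SmoothOn a O := by subst hOdef; exact ha
  obtain ⟨D, hD⟩ : ∃ D, D = (X.data e O hO).fedosov := ⟨_, rfl⟩
  have hr : RepSec D.sol (X.fedosovElement e) := fun w hw => by
    have h1 := (X.restrict e O hO).Φ_sol
    rw [hD, ← h1, map_ev_restrict]
    exact X.repSec_localSol e w (hO w hw)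
  have h1 : RepSec (D.fed D.sol (toFib O a haO)) (fedosovD (X.L e) (X.fedosovElement e) a) := by
    subst hD
    exact hr.fed _ _ (FedosovData.sol_mem_forms _) (repSec_toFib a haO)
  have h2 : RepSec (D.fed D.sol (D.fed D.sol (toFib O a haO)))
      (fedosovD (X.L e) (X.fedosovElement e) (fedosovD (X.L e) (X.fedosovElement e) a)) := by
    subst hD
    exact hr.fed _ _ (FedosovData.sol_mem_forms _) h1
  rw [← h2 u huO, D.fed_fed D.parity_sol D.del_sol, map_zero]

end LagrangeVariables

end LagrangeFedosov

end

theorem mainTheorem7 (n : ℕ) (V : Type*) [TopologicalSpace V] [ChartedSpace (Coord n) V]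
    [IsManifold 𝓘(ℝ, Coord n) ∞ V] (g : PseudoRiemMetric n V) (X : LagrangeVariables g) :
    ∃ r : X.charts → LocSec n,
      X.IsFedosovElement r ∧
      (∀ r' : X.charts → LocSec n, X.IsFedosovElement r' →
        ∀ e : X.charts, ∀ u ∈ e.1.target, r' e u = r e u) ∧
      (∀ e : X.charts, ∀ u ∈ e.1.target,
        degTot 0 (r e u) = 0 ∧ degTot 1 (r e u) = 0 ∧
        degTot 2 (r e u) = deltaInv (torsElt (X.L e) u) ∧
        degTot 3 (r e u) = deltaInv (curvElt (X.L e) u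
          + dConn (X.L e) (fun w => degTot 2 (r e w)) u
          - Complex.I • vdiv (wick (lam (X.L e) u) (degTot 2 (r e u)) (degTot 2 (r e u)))) ∧
        ∀ k : ℕ, 1 ≤ k → degTot (k + 3) (r e u) = deltaInv (
          dConn (X.L e) (fun w => degTot (k + 2) (r e w)) u
          - Complex.I • vdiv (∑ l ∈ Finset.range (k + 1),
              wick (lam (X.L e) u) (degTot (l + 2) (r e u)) (degTot (k - l + 2) (r e u))))) ∧
      (∀ a : X.charts → LocSec n, X.IsSection a →
        X.IsSection fun e => fedosovD (X.L e) (r e) (a e)) ∧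
      (∀ (e : X.charts) (U : Set (Coord n)), IsOpen U → U ⊆ e.1.target →
        ∀ a : LocSec n, SmoothOn a U → ∀ u ∈ U,
          fedosovD (X.L e) (r e) (fedosovD (X.L e) (r e) a) u = 0) :=
  ⟨X.fedosovElement, X.isFedosovElement_fedosovElement, fun _ hr => hr.eq_fedosovElement,
    X.deg_fedosovElement, fun _ => X.isSection_fedosovD,
    fun e _ hU hUe _ ha => X.fedosovD_fedosovD e hU hUe ha⟩
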